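/- **Setting.** Let $n\ge 1$ and let $\Omega\subset\mathbb R^n$ be a bounded Lipschitz domain. Let $A$ be a measurable, symmetric matrix field on $\Omega$ with $\alpha|\xi|^2\le \xi\cdot A(x)\xi\le\beta|\xi|^2$ for a.e. $x\in\Omega$ and all $\xi\in\mathbb R^n$, where $0<\alpha$ (no continuity of $A$ and no elliptic regularity is assumed). Put $a(u,v)=\int_\Omega A\nabla u\cdot\nabla v$, $|u|_a^2=a(u,u)$, $\|\cdot\|_0=\|\cdot\|_{L^2(\Omega)}$, and let $H^{-1}(\Omega)$ be the dual of $H^1(\Omega)$. Let $V_H$ be a real Hilbert space with inner product $(\cdot,\cdot)_Y$ and let $L_H:H^1(\Omega)\to V_H$ be linear with $$C_B^{-1}\|L_Hu\|_Y^2\le\|u\|_0^2+|u|_a^2,\qquad \|u\|_0^2\le\|L_Hu\|_Y^2+C_a|u|_a^2\qquad\text{for all }u\in H^1(\Omega),$$ for some $C_B>0$, $C_a\ge 0$. We say that $L_H$ is $L^2$-stable with constant $C_S>0$ if $\|L_Hu\|_Y^2\le C_S\|u\|_0^2$ for all $u\in H^1(\Omega)$. Let $\mathcal T_h$ be a conforming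 (face-to-face) triangulation of $\Omega$ into simplices, or into parallelepipeds, with mesh size $h$ (the largest cell diameter), such that for some $\kappa>0$ each cell $K$ contains a ball of radius at least $\operatorname{diam}(K)/\kappa$ (shape regularity) and satisfies $h\le\kappa\operatorname{diam}(K)$ (quasi-uniformity). Let $V_h\subset H^1(\Omega)$ be the conforming finite element space of degree $r\ge1$ on $\mathcal T_h$: the functions in $H^1(\Omega)$ which on each cell are polynomials of total degree at most $r$ (simplices), respectively affine images of polynomials of degree at most $r$ in each variable on the unit cube (parallelepipeds). Let $T>0$, $f\in L^2(0,T;H^{-1}(\Omega))$, $g\in L^2(0,T;H^{-1/2}(\partial\Omega))$, $\nu_0\in L^2(\Omega)$, and let $\nu\in L^2(0,T;H^1(\Omega))\cap H^1(0,T;H^{-1}(\Omega))$ (taken as a continuous function $[0,T]\to L^2(\Omega)$) satisfy $\nu(0)=\nu_0$ and, for a.e. $t\in(0,T)$, $$\langle\partial_t\nu,v\rangle+a(\nu,v)=\langle f,v\rangle+\langle g,v\rangle_\partial\qquad\text{for all }v\in H^1(\Omega).$$ For $\mu>0$ let $u_h\in H^1(0,T;V_h)$ solve the nudged scheme $u_h(0)=0$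 and, for a.e. $t\in(0,T)$, $$(\partial_tu_h,v_h)+a(u_h,v_h)+\mu(L_Hu_h-L_H\nu,L_Hv_h)_Y=\langle f,v_h\rangle+\langle g,v_h\rangle_\partial\qquad\text{for all }v_h\in V_h.$$ **Proposition 3.2.** Let $0\le s\le r$ and assume $\nu\in L^\infty(0,T;H^{1+s}(\Omega))$. Put $\gamma=\tfrac12\min(\mu,1/C_a)$ (with $1/0=\infty$). Then for every $\mu>0$ and every $t\in[0,T]$ $$\|u_h(t)-\nu(t)\|_0\le C\Big(e^{-\gamma t}\|\nu_0\|_0+h^s(1+\mu C_\mu)^{1/2}\|\nu\|_{L^2(0,T;H^{1+s}(\Omega))}+h^{1+s}\|\nu(t)\|_{H^{1+s}(\Omega)}\Big)$$ (the last norm being $\infty$ if $\nu(t)\notin H^{1+s}(\Omega)$) in each of the following two cases: 1. $C_\mu=1$, with a constant $C>0$ that depends only on $\Omega$, the kind of cells, $r$, $s$, $\kappa$, $\beta$ and $C_B$; 2. $C_\mu=h^2$, if $L_H$ is $L^2$-stable with constant $C_S$, with a constant $C>0$ that depends only on the same quantities and on $C_S$. In particular $C$ does not depend on $h$, $\mu$,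 $C_a$, $T$, $t$, $f$, $g$, $\nu$ or, beyond the constants listed, on $A$, $V_H$, $L_H$ and $\mathcal T_h$. -/

import Mathlib

open MeasureTheory Set Metric
open scoped ENNReal ContDiff InnerProductSpace

namespace Nudging

noncomputable section

/-- The Euclidean space `ℝⁿ`. -/
abbrev E (n : ℕ) : Type := EuclideanSpace ℝ (Fin n)

/-! ### Domains -/

/-- Bounded Lipschitz domain: open, connected, nonempty, bounded, and near each boundary point
`Ω` is, in suitable orthonormal coordinates (with vertical unit vector `e`), the set lying
strictly above the graph of a Lipschitz function `ψ` of the horizontal variables. -/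
structure IsBoundedLipschitzDomain {n : ℕ} (Ω : Set (E n)) : Prop where
  isOpen : IsOpen Ω
  isConnected : IsConnected Ω
  isBounded : Bornology.IsBounded Ω
  lipschitz_boundary : ∀ x ∈ frontier Ω, ∃ e : E n, ‖e‖ = 1 ∧
    ∃ (K : NNReal) (ψ : E n → ℝ), LipschitzWith K ψ ∧
    ∃ ρ : ℝ, 0 < ρ ∧ ∀ y ∈ ball x ρ, y ∈ Ω ↔ ψ (y - ⟪e, y⟫_ℝ • e) < ⟪e, y⟫_ℝ

/-! ### Sobolev spaces -/

/-- Test functions: `φ ∈ C_c^∞(Ω)`. -/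
def IsTest {n : ℕ} (Ω : Set (E n)) (φ : E n → ℝ) : Prop :=
  ContDiff ℝ ∞ φ ∧ HasCompactSupport φ ∧ tsupport φ ⊆ Ω

/-- The classical partial derivative `∂_{i₁} ⋯ ∂_{i_k} φ`. -/
def partialDeriv {n k : ℕ} (i : Fin k → Fin n) (φ : E n → ℝ) (x : E n) : ℝ :=
  iteratedFDeriv ℝ k φ x (fun j => EuclideanSpace.single (i j) (1 : ℝ))

/-- `L²(Ω)`. -/
abbrev L2 {n : ℕ} (Ω : Set (E n)) : Type := Lp ℝ 2 (volume.restrict Ω)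

/-- `L²(Ω; ℝⁿ)`. -/
abbrev L2Vec {n : ℕ} (Ω : Set (E n)) : Type := Lp (E n) 2 (volume.restrict Ω)

/-- `g` is the weak derivative `∂_{i₁} ⋯ ∂_{i_k} u` on `Ω`
(used below for square-integrable `u` and `g` only). -/
def IsWeakPartial {n k : ℕ} (Ω : Set (E n)) (i : Fin k → Fin n) (u g : E n → ℝ) : Prop :=
  ∀ φ : E n → ℝ, IsTest Ω φ →
    ∫ x in Ω, u x * partialDeriv i φ x = (-1 : ℝ) ^ k * ∫ x in Ω, g x * φ x

lemma partialDeriv_memLp {n k : ℕ} {Ω : Set (E n)} (i : Fin k → Fin n) {φ : E n → ℝ}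
    (hφ : IsTest Ω φ) : MemLp (partialDeriv i φ) 2 (volume.restrict Ω) := by
  have hc : Continuous (iteratedFDeriv ℝ k φ) :=
    hφ.1.continuous_iteratedFDeriv (by exact_mod_cast le_top)
  have h1 : Continuous (partialDeriv i φ) := by
    unfold partialDeriv
    fun_prop
  refine (h1.memLp_of_hasCompactSupport ?_).restrict Ω
  refine (hφ.2.1.iteratedFDeriv (𝕜 := ℝ) k).mono' ?_
  intro x hx
  refine subset_tsupport _ ?_
  intro h0
  exact hx (by simp [partialDeriv, h0])

lemma test_memLp {n : ℕ} {Ω : Set (E n)} {φ : E n → ℝ} (hφ : IsTest Ω φ) :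
    MemLp φ 2 (volume.restrict Ω) :=
  (hφ.1.continuous.memLp_of_hasCompactSupport hφ.2.1).restrict Ω

lemma IsWeakPartial.congr {n k : ℕ} {Ω : Set (E n)} {i : Fin k → Fin n} {u u' g g' : E n → ℝ}
    (h : IsWeakPartial Ω i u g) (hu : u' =ᵐ[volume.restrict Ω] u)
    (hg : g' =ᵐ[volume.restrict Ω] g) : IsWeakPartial Ω i u' g' := by
  intro φ hφ
  have e1 : ∫ x in Ω, u' x * partialDeriv i φ x = ∫ x in Ω, u x * partialDeriv i φ x :=
    integral_congr_ae (by filter_upwards [hu] with x hx; rw [hx])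
  have e2 : ∫ x in Ω, g' x * φ x = ∫ x in Ω, g x * φ x :=
    integral_congr_ae (by filter_upwards [hg] with x hx; rw [hx])
  rw [e1, e2, h φ hφ]

lemma IsWeakPartial.add {n k : ℕ} {Ω : Set (E n)} {i : Fin k → Fin n} {u u' g g' : E n → ℝ}
    (h : IsWeakPartial Ω i u g) (h' : IsWeakPartial Ω i u' g')
    (hu : MemLp u 2 (volume.restrict Ω)) (hu' : MemLp u' 2 (volume.restrict Ω))
    (hg : MemLp g 2 (volume.restrict Ω)) (hg' : MemLp g' 2 (volume.restrict Ω)) :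
    IsWeakPartial Ω i (fun x => u x + u' x) (fun x => g x + g' x) := by
  intro φ hφ
  have p := partialDeriv_memLp i hφ
  have q := test_memLp hφ
  have i1 : Integrable (fun x => u x * partialDeriv i φ x) (volume.restrict Ω) :=
    hu.integrable_mul p
  have i2 : Integrable (fun x => u' x * partialDeriv i φ x) (volume.restrict Ω) :=
    hu'.integrable_mul p
  have i3 : Integrable (fun x => g x * φ x) (volume.restrict Ω) := hg.integrable_mul q
  have i4 : Integrable (fun x => g' x * φ x) (volume.restrict Ω) := hg'.integrable_mul q
  simp only [add_mul]
  rw [integral_add i1 i2, integral_add i3 i4, h φ hφ, h' φ hφ, mul_add]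

lemma IsWeakPartial.smul {n k : ℕ} {Ω : Set (E n)} {i : Fin k → Fin n} {u g : E n → ℝ}
    (c : ℝ) (h : IsWeakPartial Ω i u g) :
    IsWeakPartial Ω i (fun x => c * u x) (fun x => c * g x) := by
  intro φ hφ
  simp only [mul_assoc]
  rw [integral_const_mul, integral_const_mul, h φ hφ]
  ring

lemma memLp_coord {n : ℕ} {Ω : Set (E n)} (G : L2Vec Ω) (j : Fin n) :
    MemLp (fun x => G x j) 2 (volume.restrict Ω) :=
  (Lp.memLp G).continuousLinearMap_comp (EuclideanSpace.proj j : E n →L[ℝ] ℝ)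

/-- The Sobolev space `H¹(Ω)`: pairs `(u, ∇u)` of a function `u ∈ L²(Ω)` and its weak gradient
`∇u ∈ L²(Ω; ℝⁿ)` (which is determined by `u`), with the norm `(‖u‖² + ‖∇u‖²)^{1/2}`. -/
def H1 {n : ℕ} (Ω : Set (E n)) : Submodule ℝ (WithLp 2 (L2 Ω × L2Vec Ω)) where
  carrier := {w | ∀ j : Fin n, IsWeakPartial Ω (fun _ : Fin 1 => j) w.fst (fun x => w.snd x j)}
  zero_mem' := by
    intro j
    have h : IsWeakPartial Ω (fun _ : Fin 1 => j) (fun _ => 0) (fun _ => 0) := by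
      intro φ _
      simp
    refine h.congr (Lp.coeFn_zero ℝ 2 (volume.restrict Ω)) ?_
    filter_upwards [Lp.coeFn_zero (E n) 2 (volume.restrict Ω)] with x hx
    change ((0 : L2Vec Ω) : E n → E n) x j = 0
    rw [hx]
    rfl
  add_mem' := by
    intro v w hv hw j
    refine ((hv j).add (hw j) (Lp.memLp _) (Lp.memLp _) (memLp_coord _ j)
      (memLp_coord _ j)).congr (Lp.coeFn_add v.fst w.fst) ?_
    filter_upwards [Lp.coeFn_add v.snd w.snd] with x hx
    change ((v.snd + w.snd : L2Vec Ω) : E n → E n) x j = _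
    rw [hx]
    rfl
  smul_mem' := by
    intro c w hw j
    refine ((hw j).smul c).congr (Lp.coeFn_smul c w.fst) ?_
    filter_upwards [Lp.coeFn_smul c w.snd] with x hx
    change ((c • w.snd : L2Vec Ω) : E n → E n) x j = _
    rw [hx]
    rfl

/-- The inclusion `H¹(Ω) → L²(Ω)`. -/
def toL2 {n : ℕ} {Ω : Set (E n)} : H1 Ω →L[ℝ] L2 Ω :=
  (WithLp.fstL 2 ℝ (L2 Ω) (L2Vec Ω)).comp (H1 Ω).subtypeL

/-- The weak gradient of a function in `H¹(Ω)`. -/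
def grad {n : ℕ} {Ω : Set (E n)} (w : H1 Ω) : L2Vec Ω := w.1.snd

/-- `H¹₀(Ω)`: the closure of `C_c^∞(Ω)` in `H¹(Ω)`, i.e. the kernel of the trace map on a
bounded Lipschitz domain. -/
def H10 {n : ℕ} (Ω : Set (E n)) : Submodule ℝ (H1 Ω) :=
  (Submodule.span ℝ
    {w : H1 Ω | ∃ φ, IsTest Ω φ ∧ toL2 w =ᵐ[volume.restrict Ω] φ}).topologicalClosure

/-- `H^{-1}(Ω)`, the dual of `H¹(Ω)` (natural for Neumann conditions). -/
abbrev HNegOne {n : ℕ} (Ω : Set (E n)) : Type := H1 Ω →L[ℝ] ℝ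

/-- The trace space `H^{1/2}(∂Ω)`, i.e. the range of the trace map with the quotient norm:
`H¹(Ω)` modulo the functions of zero trace. -/
def HHalf {n : ℕ} (Ω : Set (E n)) : Type := H1 Ω ⧸ H10 Ω

instance {n : ℕ} (Ω : Set (E n)) : IsClosed (H10 Ω : Set (H1 Ω)) :=
  Submodule.isClosed_topologicalClosure _

instance {n : ℕ} (Ω : Set (E n)) : NormedAddCommGroup (HHalf Ω) :=
  Submodule.Quotient.normedAddCommGroup (H10 Ω)

instance {n : ℕ} (Ω : Set (E n)) : NormedSpace ℝ (HHalf Ω) :=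
  Submodule.Quotient.normedSpace (H10 Ω) ℝ

/-- `H^{-1/2}(∂Ω)`, the dual of `H^{1/2}(∂Ω)`. -/
abbrev HNegHalf {n : ℕ} (Ω : Set (E n)) : Type := HHalf Ω →L[ℝ] ℝ

/-- The trace of an `H¹(Ω)` function on `∂Ω`. -/
def trace {n : ℕ} {Ω : Set (E n)} (v : H1 Ω) : HHalf Ω := (H10 Ω).mkQ v

/-- The embedding `L²(Ω) → H^{-1}(Ω)`, `u ↦ (v ↦ (u, v))`. -/
def toHNegOne {n : ℕ} {Ω : Set (E n)} (u : L2 Ω) : HNegOne Ω := (innerSL ℝ u).comp toL2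

/-- The squared Gagliardo (Sobolev–Slobodeckij) seminorm
`∫_Ω ∫_Ω |g(x) - g(y)|² / |x - y|^{n + 2θ} dx dy`. -/
def gagliardoSq {n : ℕ} (Ω : Set (E n)) (θ : ℝ) (g : E n → ℝ) : ℝ≥0∞ :=
  ∫⁻ x in Ω, ∫⁻ y in Ω, ‖g x - g y‖ₑ ^ 2 / edist x y ^ ((n : ℝ) + 2 * θ)

/-- The norm of `H^p(Ω)` for real `p ≥ 0`, with value `∞` if `u ∉ H^p(Ω)`: with `m = ⌊p⌋` and
`θ = p - m`, the square of the norm is the sum of the squared `L²` norms of all weak derivatives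
of order `≤ m` and, if `θ > 0`, the squared Gagliardo seminorms of order `θ` of those of order
`m`. The infimum runs over the families of weak derivatives of `u` in `L²(Ω)`; there is at most
one of them in each order up to `m`, and the infimum over the empty set is `∞`. -/
def sobolevNorm {n : ℕ} (Ω : Set (E n)) (p : ℝ) (u : L2 Ω) : ℝ≥0∞ :=
  ⨅ (D : (k : ℕ) → (Fin k → Fin n) → L2 Ω)
    (_ : ∀ k ≤ ⌊p⌋₊, ∀ i : Fin k → Fin n, IsWeakPartial Ω i u (D k i)),
    ((∑ k ∈ Finset.range (⌊p⌋₊ + 1), ∑ i : Fin k → Fin n, ‖D k i‖ₑ ^ 2) +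
      (if p = ⌊p⌋₊ then 0
        else ∑ i : Fin ⌊p⌋₊ → Fin n, gagliardoSq Ω (p - ⌊p⌋₊) (D ⌊p⌋₊ i))) ^ (1 / 2 : ℝ)

/-! ### Conductivity and the bilinear form -/

/-- Symmetric, measurable, uniformly elliptic and bounded coefficients:
`α|ξ|² ≤ ξ·A(x)ξ ≤ β|ξ|²` for a.e. `x ∈ Ω`. -/
structure IsConductivity {n : ℕ} (Ω : Set (E n)) (α β : ℝ)
    (A : E n → Matrix (Fin n) (Fin n) ℝ) : Prop where
  measurable : ∀ i j, AEMeasurable (fun x => A x i j) (volume.restrict Ω)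
  symm : ∀ᵐ x ∂(volume.restrict Ω), (A x).IsSymm
  pos : 0 < α
  lower : ∀ᵐ x ∂(volume.restrict Ω), ∀ ξ : E n, α * ‖ξ‖ ^ 2 ≤ ∑ i, ∑ j, A x i j * ξ j * ξ i
  upper : ∀ᵐ x ∂(volume.restrict Ω), ∀ ξ : E n, ∑ i, ∑ j, A x i j * ξ j * ξ i ≤ β * ‖ξ‖ ^ 2

/-- `a(u, v) = (A ∇u, ∇v)`. -/
def aForm {n : ℕ} {Ω : Set (E n)} (A : E n → Matrix (Fin n) (Fin n) ℝ) (u v : H1 Ω) : ℝ :=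
  ∫ x in Ω, ∑ i, ∑ j, A x i j * grad u x j * grad v x i

/-! ### Triangulations and finite element spaces -/

/-- The two usual kinds of cells: simplices and parallelepipeds. -/
inductive CellKind
  | simplex
  | box

/-- The reference cell: the unit simplex or the unit cube. -/
def refCell (n : ℕ) : CellKind → Set (E n)
  | .simplex => {x | (∀ i, 0 ≤ x i) ∧ ∑ i, x i ≤ 1}
  | .box => {x | ∀ i, 0 ≤ x i ∧ x i ≤ 1}

/-- The reference polynomials: `P_r` (total degree at most `r`) on the simplex, and `Q_r`
(degree at most `r` in each variable) on the cube. -/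
def refPoly (n r : ℕ) : CellKind → Submodule ℝ (MvPolynomial (Fin n) ℝ)
  | .simplex => MvPolynomial.restrictTotalDegree (Fin n) ℝ r
  | .box => MvPolynomial.restrictDegree (Fin n) ℝ r

/-- The cell `F(K̂)`. -/
def cell {n : ℕ} (kind : CellKind) (F : E n ≃ᵃ[ℝ] E n) : Set (E n) := F '' refCell n kind

/-- A (conforming, face-to-face) triangulation of `Ω`: finitely many cells `F(K̂)`, given by
invertible affine maps `F`, which cover `closure Ω`, and any two of which intersect in a
(possibly empty) common face. -/
structure Triangulation {n : ℕ} (Ω : Set (E n)) (kind : CellKind) where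
  maps : Finset (E n ≃ᵃ[ℝ] E n)
  cover : ⋃ F ∈ maps, cell kind F = closure Ω
  conforming : ∀ F ∈ maps, ∀ G ∈ maps,
    IsExposed ℝ (cell kind F) (cell kind F ∩ cell kind G)

/-- The mesh size `h`: the largest diameter of a cell. -/
def Triangulation.h {n : ℕ} {Ω : Set (E n)} {kind : CellKind} (𝒯 : Triangulation Ω kind) : ℝ :=
  sSup ((fun F => diam (cell kind F)) '' (𝒯.maps : Set (E n ≃ᵃ[ℝ] E n)))

/-- Mesh quality: `𝒯` is shape-regular (each cell contains a ball of radius at least `1/κ` times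
its diameter) and quasi-uniform (the mesh size is at most `κ` times the diameter of each cell). -/
structure Triangulation.Quality {n : ℕ} {Ω : Set (E n)} {kind : CellKind}
    (𝒯 : Triangulation Ω kind) (κ : ℝ) : Prop where
  pos : 0 < κ
  shape_regular : ∀ F ∈ 𝒯.maps, ∃ c, closedBall c (diam (cell kind F) / κ) ⊆ cell kind F
  quasi_uniform : ∀ F ∈ 𝒯.maps, 𝒯.h ≤ κ * diam (cell kind F)

/-- The conforming finite element space `V_h ⊂ H¹(Ω)` of degree `r`: the functions in `H¹(Ω)`
whose restriction to each cell is an (affinely mapped) reference polynomial. -/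
def feSpace {n : ℕ} {Ω : Set (E n)} {kind : CellKind} (𝒯 : Triangulation Ω kind) (r : ℕ) :
    Submodule ℝ (H1 Ω) where
  carrier := {w | ∀ F ∈ 𝒯.maps, ∃ p ∈ refPoly n r kind,
    ∀ᵐ x ∂((volume.restrict Ω).restrict (cell kind F)),
      toL2 w x = MvPolynomial.eval (fun i => F.symm x i) p}
  zero_mem' := by
    intro F _
    refine ⟨0, zero_mem _, ?_⟩
    have h := ae_restrict_of_ae (s := cell kind F) (Lp.coeFn_zero ℝ 2 (volume.restrict Ω))
    filter_upwards [h] with x hx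
    rw [map_zero, map_zero, hx]
    rfl
  add_mem' := by
    intro v w hv hw F hF
    obtain ⟨p, hp, hvp⟩ := hv F hF
    obtain ⟨q, hq, hwq⟩ := hw F hF
    refine ⟨p + q, add_mem hp hq, ?_⟩
    have h := ae_restrict_of_ae (s := cell kind F) (Lp.coeFn_add (toL2 v) (toL2 w))
    filter_upwards [h, hvp, hwq] with x hx h1 h2
    rw [map_add, map_add, hx, Pi.add_apply, h1, h2]
  smul_mem' := by
    intro c w hw F hF
    obtain ⟨p, hp, hwp⟩ := hw F hF
    refine ⟨c • p, Submodule.smul_mem _ c hp, ?_⟩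
    have h := ae_restrict_of_ae (s := cell kind F) (Lp.coeFn_smul c (toL2 w))
    filter_upwards [h, hwp] with x hx h1
    rw [map_smul, hx, Pi.smul_apply, h1, MvPolynomial.smul_eval, smul_eq_mul]

/-! ### Time-dependent functions -/

/-- `w ∈ L²(0, T; X)`. -/
def IsL2Time {X : Type*} [NormedAddCommGroup X] (T : ℝ) (w : ℝ → X) : Prop :=
  MemLp w 2 (volume.restrict (Ioo 0 T))

/-- `w ∈ H¹(0, T; X)` with weak time derivative `w' ∈ L²(0, T; X)`. -/
structure IsH1Time {X : Type*} [NormedAddCommGroup X] [NormedSpace ℝ X] (T : ℝ)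
    (w w' : ℝ → X) : Prop where
  memLp : IsL2Time T w
  memLp_deriv : IsL2Time T w'
  weak_deriv : ∀ φ : ℝ → ℝ, ContDiff ℝ ∞ φ → HasCompactSupport φ → tsupport φ ⊆ Ioo 0 T →
    ∫ t in Ioo 0 T, deriv φ t • w t = -∫ t in Ioo 0 T, φ t • w' t

/-- `(∫₀ᵀ ‖w(t)‖²_{H^p(Ω)} dt)^{1/2}`. -/
def l2SobolevNorm {n : ℕ} {Ω : Set (E n)} (T p : ℝ) (w : ℝ → L2 Ω) : ℝ≥0∞ :=
  (∫⁻ t in Ioo 0 T, sobolevNorm Ω p (w t) ^ 2) ^ (1 / 2 : ℝ)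

/-- `w ∈ L^∞(0, T; H^p(Ω))`. -/
def IsLinftySobolev {n : ℕ} {Ω : Set (E n)} (T p : ℝ) (w : ℝ → L2 Ω) : Prop :=
  essSup (fun t => sobolevNorm Ω p (w t)) (volume.restrict (Ioo 0 T)) < ⊤

/-- `ν ∈ L²(0, T; H¹(Ω)) ∩ H¹(0, T; H^{-1}(Ω))` is the weak solution of the heat equation
`⟨∂ₜν, v⟩ + a(ν, v) = ⟨f, v⟩ + ⟨g, v⟩_∂` for all `v ∈ H¹(Ω)`, with `ν(0) = ν₀`.
Here `ν : ℝ → L²(Ω)` is the representative that is continuous on `[0, T]` with values in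
`L²(Ω)`, and `νs : ℝ → H¹(Ω)` is the same function with values in `H¹(Ω)`, which is meaningful
for a.e. `t`. -/
structure IsExactSolution {n : ℕ} {Ω : Set (E n)} (A : E n → Matrix (Fin n) (Fin n) ℝ) (T : ℝ)
    (f : ℝ → HNegOne Ω) (g : ℝ → HNegHalf Ω) (ν₀ : L2 Ω)
    (ν : ℝ → L2 Ω) (νs : ℝ → H1 Ω) : Prop where
  continuousOn : ContinuousOn ν (Icc 0 T)
  ae_eq : ∀ᵐ t ∂(volume.restrict (Ioo 0 T)), toL2 (νs t) = ν t
  memLp : IsL2Time T νs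
  initial : ν 0 = ν₀
  equation : ∃ ν' : ℝ → HNegOne Ω, IsH1Time T (fun t => toHNegOne (ν t)) ν' ∧
    ∀ᵐ t ∂(volume.restrict (Ioo 0 T)), ∀ v : H1 Ω,
      ν' t v + aForm A (νs t) v = f t v + g t (trace v)

/-- `u_h ∈ H¹(0, T; V_h)` (continuous representative) is the solution of the semi-discrete nudged
scheme `(∂ₜu_h, v) + a(u_h, v) + μ (L u_h - ν_H, L v)_Y = ⟨f, v⟩ + ⟨g, v⟩_∂` for all `v ∈ V_h`,
with `u_h(0) = 0`, where `νH` are the observations. -/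
structure IsNudgedSolution {n : ℕ} {Ω : Set (E n)} {Y : Type*} [NormedAddCommGroup Y]
    [InnerProductSpace ℝ Y] (A : E n → Matrix (Fin n) (Fin n) ℝ) (T : ℝ)
    (f : ℝ → HNegOne Ω) (g : ℝ → HNegHalf Ω) (L : H1 Ω →ₗ[ℝ] Y) (μ : ℝ) (νH : ℝ → Y)
    (Vh : Submodule ℝ (H1 Ω)) (uh : ℝ → Vh) : Prop where
  continuousOn : ContinuousOn uh (Icc 0 T)
  initial : uh 0 = 0
  equation : ∃ uh' : ℝ → Vh, IsH1Time T uh uh' ∧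
    ∀ᵐ t ∂(volume.restrict (Ioo 0 T)), ∀ v : Vh,
      ⟪toL2 (uh' t : H1 Ω), toL2 (v : H1 Ω)⟫_ℝ + aForm A (uh t : H1 Ω) (v : H1 Ω)
        + μ * ⟪L (uh t : H1 Ω) - νH t, L (v : H1 Ω)⟫_ℝ
      = f t (v : H1 Ω) + g t (trace (v : H1 Ω))

/-! ### Observation operators -/

/-- Continuity of the observation operator: `C_B⁻¹ ‖L u‖²_Y ≤ ‖u‖²_0 + a(u, u)`. -/
def IsContinuousObs {n : ℕ} {Ω : Set (E n)} {Y : Type*} [NormedAddCommGroup Y]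
    [InnerProductSpace ℝ Y] (A : E n → Matrix (Fin n) (Fin n) ℝ) (L : H1 Ω →ₗ[ℝ] Y)
    (CB : ℝ) : Prop :=
  0 < CB ∧ ∀ u : H1 Ω, CB⁻¹ * ‖L u‖ ^ 2 ≤ ‖toL2 u‖ ^ 2 + aForm A u u

/-- Observability: `‖u‖²_0 ≤ ‖L u‖²_Y + C_a |u|²_a`. -/
def IsObservable {n : ℕ} {Ω : Set (E n)} {Y : Type*} [NormedAddCommGroup Y]
    [InnerProductSpace ℝ Y] (A : E n → Matrix (Fin n) (Fin n) ℝ) (L : H1 Ω →ₗ[ℝ] Y)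
    (Ca : ℝ) : Prop :=
  0 ≤ Ca ∧ ∀ u : H1 Ω, ‖toL2 u‖ ^ 2 ≤ ‖L u‖ ^ 2 + Ca * aForm A u u

/-- Stability in `L²(Ω)`: `‖L u‖²_Y ≤ C_S ‖u‖²_0`. -/
def IsL2Stable {n : ℕ} {Ω : Set (E n)} {Y : Type*} [NormedAddCommGroup Y]
    [InnerProductSpace ℝ Y] (L : H1 Ω →ₗ[ℝ] Y) (CS : ℝ) : Prop :=
  0 < CS ∧ ∀ u : H1 Ω, ‖L u‖ ^ 2 ≤ CS * ‖toL2 u‖ ^ 2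

/-- `γ = min(μ, 1/C_a)/2`, where `1/0 = ∞`. -/
def decayRate (μ Ca : ℝ) : ℝ := if Ca = 0 then μ / 2 else min μ (1 / Ca) / 2

/-- The error estimate
`‖u - ν(t)‖₀ ≤ C (e^{-γt} ‖ν₀‖₀ + h^s (1 + μ C_μ)^{1/2} ‖ν‖_{L²(0,T;H^{1+s})}
  + h^{1+s} ‖ν(t)‖_{H^{1+s}})` at a time `t`, with values in `[0, ∞]`. -/
def ErrorEstimate {n : ℕ} {Ω : Set (E n)} (C Cμ h s μ γ T : ℝ) (ν₀ : L2 Ω) (ν : ℝ → L2 Ω)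
    (u : L2 Ω) (t : ℝ) : Prop :=
  ‖u - ν t‖ₑ ≤ ENNReal.ofReal C *
    (ENNReal.ofReal (Real.exp (-γ * t) * ‖ν₀‖)
      + ENNReal.ofReal (h ^ s * Real.sqrt (1 + μ * Cμ)) * l2SobolevNorm T (1 + s) ν
      + ENNReal.ofReal (h ^ (1 + s)) * sobolevNorm Ω (1 + s) (ν t))

end

end Nudging

/-! # Error estimate for the nudged finite element approximation of the heat equation

Let `P` be the `L²(Ω)` projection onto the finite element space and write the error as
`u_h - ν = θ - (ν - P ν)` with `θ = u_h - P ν`. Testing the difference of the two equations with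
`θ`, the time derivative of `ν - P ν` drops out by orthogonality, which leaves

`d/dt ‖θ‖² + a(θ, θ) + μ ‖L θ‖² ≤ a(w, w) + μ ‖L w‖²`, where `w = ν - P ν`.

By observability the form on the left is at least `2γ ‖θ‖²`, so Gronwall's inequality
(`energy_estimate`) bounds `‖θ(t)‖` by `e^{-γt} ‖ν₀‖` and the projection errors of `ν` in `L²` and
in `H¹`. No regularity of `A` is needed, since `P` is not the elliptic projection. The time
derivatives exist only weakly; the argument is carried out for the coordinates of `θ` in an
`L²`-orthonormal basis, which are absolutely continuous by the lemma of du Bois-Reymond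
(`eq_add_integral_of_weak_deriv`, `gronwall`).

What remains is the estimate `‖w‖ ≤ C h^{1+s} ‖ν‖_{H^{1+s}}`, `‖∇w‖ ≤ C h^s ‖ν‖_{H^{1+s}}`
(`exists_projection_error`). It follows from the existence of some finite element function with
these errors and from an inverse inequality. That function is a quasi-interpolant
(`exists_interpolant`): each nodal value is the mean of `ν` against a dual function over one cell
containing the node. It lies in `H¹(Ω)` because Lagrange interpolants agree on common faces
(`FacetSystem.lagrange_conforming`, `Triangulation.exists_H1`), reproduces polynomials of degree at
most `r`, and is locally bounded in `L²`. Hence the error on a cell is controlled by the distance of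
`ν` to the polynomials on a neighbourhood of the cell. In a Lipschitz domain such a neighbourhood is
contained in a patch which is star-shaped with respect to a ball of radius `h`
(`IsBoundedLipschitzDomain.exists_patch`); on patches the distance is bounded by iterating the
Poincaré inequality (`poincare_double`, `bramble_hilbert`), for fractional orders too, where the
last step is a direct comparison with the Gagliardo seminorm. By a volume count the patches overlap
boundedly (`Triangulation.exists_overlap`), so that the local estimates can be summed.
-/

namespace Nudging

noncomputable section

/-! ### Faces and facet coordinates of the reference cells -/

/-- A nonempty exposed face of the reference cell. -/
def IsRefFace {n : ℕ} (kind : CellKind) (f : Set (E n)) : Prop :=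
  f.Nonempty ∧ ∃ l : E n →L[ℝ] ℝ,
    f = {x | x ∈ refCell n kind ∧ ∀ y ∈ refCell n kind, l y ≤ l x}

/-- `a` takes different values on `f`. -/
def NonconstOn {n : ℕ} (f : Set (E n)) (a : E n →ᵃ[ℝ] ℝ) : Prop := ∃ x ∈ f, ∃ y ∈ f, a x ≠ a y

/-- The facet coordinates of a reference cell (barycentric coordinates on the simplex, the
functions `xᵢ` and `1 - xᵢ` on the cube). The cell is described by the inequalities `lam a ≥ 0`,
and on each face the nonconstant coordinates are the normalised generators of the extreme rays of
the cone of nonnegative affine functions (`generate` and `extreme`), so that they do not depend on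
the parametrisation of the face. -/
structure FacetSystem (n : ℕ) (kind : CellKind) (ι : Type) [Fintype ι] where
  lam : ι → E n →ᵃ[ℝ] ℝ
  poly : ι → MvPolynomial (Fin n) ℝ
  eval_poly : ∀ a (x : E n), MvPolynomial.eval x (poly a) = lam a x
  mem_iff : ∀ x, x ∈ refCell n kind ↔ ∀ a, 0 ≤ lam a x
  coord : ∀ i, ∃ a, ∀ x : E n, lam a x = x i
  le_one : ∀ x ∈ refCell n kind, ∀ a, lam a x ≤ 1
  separate : ∀ x y : E n, x ≠ y → ∃ a, lam a x < lam a y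
  mem_face : ∀ f, IsRefFace kind f → ∀ x ∈ refCell n kind,
    (∀ a, (∀ y ∈ f, lam a y = 0) → lam a x = 0) → x ∈ f
  const_face : ∀ f, IsRefFace kind f → ∀ a, ¬ NonconstOn f (lam a) →
    (∀ x ∈ f, lam a x = 0) ∨ (∀ x ∈ f, lam a x = 1)
  generate : ∀ f, IsRefFace kind f → ∀ ℓ : E n →ᵃ[ℝ] ℝ, (∀ x ∈ f, 0 ≤ ℓ x) →
    ∃ c : ℝ, 0 ≤ c ∧ ∃ m : ι → ℝ, (∀ a, 0 ≤ m a) ∧ ∀ x ∈ f, ℓ x = c + ∑ a, m a * lam a x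
  extreme : ∀ f, IsRefFace kind f → ∀ a, NonconstOn f (lam a) → ∀ ℓ : E n →ᵃ[ℝ] ℝ,
    (∀ x ∈ f, 0 ≤ ℓ x) → (∀ x ∈ f, ℓ x ≤ lam a x) → ∃ k : ℝ, ∀ x ∈ f, ℓ x = k * lam a x
  attain : ∀ f, IsRefFace kind f → ∀ a, NonconstOn f (lam a) → ∃ x ∈ f, lam a x = 1
  inj : ∀ f, IsRefFace kind f → ∀ a b, NonconstOn f (lam a) → NonconstOn f (lam b) →
    (∀ x ∈ f, lam a x = lam b x) → a = b

/-- The coordinate functional `x ↦ xᵢ` as an affine map. -/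
def coordAff {n : ℕ} (i : Fin n) : E n →ᵃ[ℝ] ℝ :=
  ((EuclideanSpace.proj i : E n →L[ℝ] ℝ) : E n →ₗ[ℝ] ℝ).toAffineMap

lemma sum_single_coord {n : ℕ} (x : E n) :
    ∑ i, x i • EuclideanSpace.single i (1 : ℝ) = x := by
  ext j
  simp [Finset.sum_apply, Pi.single_apply]

lemma linear_expand {n : ℕ} (l : E n →ₗ[ℝ] ℝ) (x : E n) :
    l x = ∑ i, x i * l (EuclideanSpace.single i (1 : ℝ)) := by
  conv_lhs => rw [← sum_single_coord x]
  simp [map_sum]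

lemma affine_expand {n : ℕ} (l : E n →ᵃ[ℝ] ℝ) (x : E n) :
    l x = l 0 + ∑ i, x i * l.linear (EuclideanSpace.single i (1 : ℝ)) := by
  rw [← linear_expand]
  have := congrFun (AffineMap.decomp l) x
  simp only [Pi.add_apply] at this
  linarith

lemma affine_sub {n : ℕ} (l : E n →ᵃ[ℝ] ℝ) (x y : E n) :
    l x - l y = ∑ i, (x i - y i) * l.linear (EuclideanSpace.single i (1 : ℝ)) := by
  rw [affine_expand l x, affine_expand l y]
  simp only [sub_mul, Finset.sum_sub_distrib]
  ring

/-! ### The simplex -/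

/-- Barycentric coordinates of the unit simplex; `none` belongs to the vertex `0`. -/
def simplexLam {n : ℕ} : Option (Fin n) → E n →ᵃ[ℝ] ℝ
  | none => AffineMap.const ℝ (E n) 1 - ∑ i, coordAff i
  | some i => coordAff i

/-- The vertices of the unit simplex. -/
def simplexVertex {n : ℕ} : Option (Fin n) → E n
  | none => 0
  | some i => EuclideanSpace.single i 1

lemma simplexLam_none {n : ℕ} (x : E n) : simplexLam none x = 1 - ∑ i, x i := by
  have h : (∑ i : Fin n, coordAff i) x = ∑ i, x i := by
    have : ∀ s : Finset (Fin n), (∑ i ∈ s, coordAff i) x = ∑ i ∈ s, x i := by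
      classical
      intro s
      induction s using Finset.induction_on with
      | empty => simp
      | insert a s ha ih => rw [Finset.sum_insert ha, Finset.sum_insert ha, ← ih]; rfl
    exact this _
  simp only [simplexLam]
  change (1 : ℝ) - (∑ i : Fin n, coordAff i) x = _
  rw [h]

@[simp] lemma simplexLam_some {n : ℕ} (i : Fin n) (x : E n) : simplexLam (some i) x = x i := rfl

lemma simplexLam_vertex {n : ℕ} (a b : Option (Fin n)) :
    simplexLam a (simplexVertex b) = if a = b then 1 else 0 := by
  cases a with
  | none =>
    rw [simplexLam_none]
    cases b with
    | none => simp [simplexVertex]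
    | some j => simp [simplexVertex]
  | some i =>
    cases b with
    | none => simp [simplexVertex]
    | some j => simp [simplexVertex]

lemma simplexLam_sum {n : ℕ} (x : E n) : ∑ a, simplexLam a x = 1 := by
  rw [Fintype.sum_option, simplexLam_none]
  simp

lemma simplex_expand {n : ℕ} (l : E n →ᵃ[ℝ] ℝ) (x : E n) :
    l x = ∑ a, l (simplexVertex a) * simplexLam a x := by
  have h : ∀ i, l (EuclideanSpace.single i (1 : ℝ))
      = l 0 + l.linear (EuclideanSpace.single i (1 : ℝ)) := by
    intro i
    have := congrFun (AffineMap.decomp l) (EuclideanSpace.single i (1 : ℝ))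
    simp only [Pi.add_apply] at this
    linarith
  rw [Fintype.sum_option, simplexLam_none, affine_expand l x]
  simp only [simplexVertex, simplexLam_some, h, add_mul, Finset.sum_add_distrib, ← Finset.mul_sum]
  have : ∀ i, l.linear (EuclideanSpace.single i (1 : ℝ)) * x i
      = x i * l.linear (EuclideanSpace.single i (1 : ℝ)) := fun i => mul_comm _ _
  simp only [this]
  ring

lemma simplex_mem_iff {n : ℕ} (x : E n) :
    x ∈ refCell n .simplex ↔ ∀ a, 0 ≤ simplexLam a x := by
  constructor
  · rintro ⟨h1, h2⟩ a
    cases a with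
    | none => rw [simplexLam_none]; linarith
    | some i => exact h1 i
  · intro h
    refine ⟨fun i => h (some i), ?_⟩
    have := h none
    rw [simplexLam_none] at this
    linarith

lemma simplexVertex_mem {n : ℕ} (a : Option (Fin n)) :
    simplexVertex a ∈ refCell n .simplex := by
  rw [simplex_mem_iff]
  intro b
  rw [simplexLam_vertex]
  split_ifs <;> norm_num

/-- A face of the simplex is spanned by the vertices that it contains. -/
lemma simplex_face {n : ℕ} {f : Set (E n)} (hf : IsRefFace .simplex f) (x : E n)
    (hx : x ∈ refCell n .simplex) :
    x ∈ f ↔ ∀ a, simplexLam a x ≠ 0 → simplexVertex a ∈ f := by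
  obtain ⟨⟨x₀, hx₀⟩, l, rfl⟩ := hf
  set M := l x₀ with hM
  have hmax : ∀ y ∈ refCell n .simplex, l y ≤ M := hx₀.2
  have hmem : ∀ y ∈ refCell n .simplex,
      (y ∈ {x | x ∈ refCell n .simplex ∧ ∀ y ∈ refCell n .simplex, l y ≤ l x} ↔ l y = M) := by
    intro y hy
    constructor
    · intro h
      exact le_antisymm (hmax y hy) (h.2 x₀ hx₀.1)
    · intro h
      exact ⟨hy, fun z hz => h ▸ hmax z hz⟩
  have hsum : M - l x = ∑ a, (M - l (simplexVertex a)) * simplexLam a x := by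
    have h1 := simplex_expand (l : E n →ₗ[ℝ] ℝ).toAffineMap x
    simp only [sub_mul, Finset.sum_sub_distrib, ← Finset.mul_sum, simplexLam_sum]
    have h2 : l x = ∑ a, l (simplexVertex a) * simplexLam a x := h1
    rw [← h2]
    ring
  have hnn : ∀ a ∈ Finset.univ, 0 ≤ (M - l (simplexVertex a)) * simplexLam a x := fun a _ =>
    mul_nonneg (sub_nonneg.2 (hmax _ (simplexVertex_mem a))) ((simplex_mem_iff x).1 hx a)
  rw [hmem x hx]
  constructor
  · intro h a ha
    rw [hmem _ (simplexVertex_mem a)]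
    rw [h, sub_self, eq_comm, Finset.sum_eq_zero_iff_of_nonneg hnn] at hsum
    rcases mul_eq_zero.1 (hsum a (Finset.mem_univ _)) with h | h
    · linarith
    · exact absurd h ha
  · intro h
    have : ∑ a, (M - l (simplexVertex a)) * simplexLam a x = 0 := by
      refine Finset.sum_eq_zero fun a _ => ?_
      by_cases ha : simplexLam a x = 0
      · rw [ha, mul_zero]
      · have := (hmem _ (simplexVertex_mem a)).1 (h a ha)
        rw [this, sub_self, zero_mul]
    linarith

lemma IsRefFace.subset {n : ℕ} {kind : CellKind} {f : Set (E n)} (hf : IsRefFace kind f) :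
    f ⊆ refCell n kind := by
  obtain ⟨_, l, rfl⟩ := hf
  exact fun x hx => hx.1

lemma simplex_nonconst {n : ℕ} {f : Set (E n)} (hf : IsRefFace .simplex f) {a : Option (Fin n)}
    (ha : NonconstOn f (simplexLam a)) : simplexVertex a ∈ f := by
  obtain ⟨x, hx, y, hy, hxy⟩ := ha
  by_cases h : simplexLam a x = 0
  · exact (simplex_face hf y (hf.subset hy)).1 hy a (fun h' => hxy (h.trans h'.symm))
  · exact (simplex_face hf x (hf.subset hx)).1 hx a h

/-- The facet coordinates of the simplex. -/
def simplexSystem (n : ℕ) : FacetSystem n .simplex (Option (Fin n)) where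
  lam := simplexLam
  poly := fun a => match a with
    | none => 1 - ∑ i, MvPolynomial.X i
    | some i => MvPolynomial.X i
  eval_poly := by
    intro a x
    cases a with
    | none => rw [simplexLam_none]; simp [map_sum]
    | some i => simp
  mem_iff := simplex_mem_iff
  coord := fun i => ⟨some i, fun _ => rfl⟩
  le_one := by
    intro x hx a
    rw [← simplexLam_sum x]
    exact Finset.single_le_sum (f := fun a => simplexLam a x)
      (fun b _ => (simplex_mem_iff x).1 hx b) (Finset.mem_univ a)
  separate := by
    intro x y hxy
    by_contra! h
    refine hxy ?_
    have h2 : ∀ a, simplexLam a x = simplexLam a y := by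
      intro a
      have := (Finset.sum_eq_sum_iff_of_le (s := Finset.univ) (fun a _ => h a)).1
        ((simplexLam_sum y).trans (simplexLam_sum x).symm)
      exact (this a (Finset.mem_univ _)).symm
    ext i
    exact h2 (some i)
  mem_face := by
    intro f hf x hx h
    rw [simplex_face hf x hx]
    intro a ha
    by_contra hv
    refine ha (h a fun y hy => ?_)
    by_contra h0
    exact hv ((simplex_face hf y (hf.subset hy)).1 hy a h0)
  const_face := by
    intro f hf a ha
    simp only [NonconstOn, not_exists, not_and, not_not] at ha
    by_cases h : ∀ x ∈ f, simplexLam a x = 0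
    · exact Or.inl h
    · right
      push Not at h
      obtain ⟨x, hx, hxa⟩ := h
      have hv := (simplex_face hf x (hf.subset hx)).1 hx a hxa
      intro y hy
      rw [ha y hy _ hv, simplexLam_vertex, if_pos rfl]
  generate := by
    classical
    intro f hf ℓ hℓ
    refine ⟨0, le_rfl, fun a => if simplexVertex a ∈ f then ℓ (simplexVertex a) else 0, ?_, ?_⟩
    · intro a
      dsimp only
      split_ifs with h
      · exact hℓ _ h
      · exact le_rfl
    · intro x hx
      rw [zero_add, simplex_expand ℓ x]
      refine Finset.sum_congr rfl fun a _ => ?_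
      dsimp only
      split_ifs with h
      · rfl
      · have : simplexLam a x = 0 := by
          by_contra h0
          exact h ((simplex_face hf x (hf.subset hx)).1 hx a h0)
        rw [this, mul_zero, mul_zero]
  extreme := by
    intro f hf a ha ℓ h0 h1
    have hv := simplex_nonconst hf ha
    refine ⟨ℓ (simplexVertex a), fun x hx => ?_⟩
    rw [simplex_expand ℓ x]
    refine Finset.sum_eq_single a (fun b _ hb => ?_) (fun h => absurd (Finset.mem_univ a) h)
    by_cases hbf : simplexVertex b ∈ f
    · have h2 := h1 _ hbf
      rw [simplexLam_vertex, if_neg (Ne.symm hb)] at h2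
      rw [le_antisymm h2 (h0 _ hbf), zero_mul]
    · have : simplexLam b x = 0 := by
        by_contra h0
        exact hbf ((simplex_face hf x (hf.subset hx)).1 hx b h0)
      rw [this, mul_zero]
  attain := by
    intro f hf a ha
    exact ⟨_, simplex_nonconst hf ha, by rw [simplexLam_vertex, if_pos rfl]⟩
  inj := by
    intro f hf a b ha _ h
    have := h _ (simplex_nonconst hf ha)
    rw [simplexLam_vertex, simplexLam_vertex, if_pos rfl] at this
    by_contra hab
    rw [if_neg (Ne.symm hab)] at this
    exact one_ne_zero this

/-! ### The cube -/

/-- The functions `xᵢ` and `1 - xᵢ`. -/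
def boxLam {n : ℕ} (a : Fin n × Bool) : E n →ᵃ[ℝ] ℝ :=
  if a.2 then coordAff a.1 else AffineMap.const ℝ (E n) 1 - coordAff a.1

@[simp] lemma boxLam_true {n : ℕ} (i : Fin n) (x : E n) : boxLam (i, true) x = x i := rfl

@[simp] lemma boxLam_false {n : ℕ} (i : Fin n) (x : E n) : boxLam (i, false) x = 1 - x i := rfl

/-- `x` with the `i`-th coordinate replaced by `t`. -/
def updateCoord {n : ℕ} (x : E n) (i : Fin n) (t : ℝ) : E n :=
  WithLp.toLp 2 (Function.update (x : Fin n → ℝ) i t)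

@[simp] lemma updateCoord_apply {n : ℕ} (x : E n) (i j : Fin n) (t : ℝ) :
    updateCoord x i t j = if j = i then t else x j := by
  simp [updateCoord, Function.update_apply]

/-- A face of the cube is given by fixing some of the coordinates to `0` or `1`. -/
lemma box_face {n : ℕ} {f : Set (E n)} (hf : IsRefFace .box f) :
    ∃ Z O : Set (Fin n), Disjoint Z O ∧
      ∀ x, x ∈ f ↔ x ∈ refCell n .box ∧ (∀ i ∈ Z, x i = 0) ∧ (∀ i ∈ O, x i = 1) := by
  obtain ⟨⟨x₀, hx₀⟩, l, rfl⟩ := hf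
  let c : Fin n → ℝ := fun i => l (EuclideanSpace.single i (1 : ℝ))
  have hl : ∀ x, l x = ∑ i, x i * c i := fun x => linear_expand (l : E n →ₗ[ℝ] ℝ) x
  have hupd : ∀ x : E n, ∀ i t, l (updateCoord x i t) - l x = (t - x i) * c i := by
    intro x i t
    rw [hl, hl, ← Finset.sum_sub_distrib, Finset.sum_eq_single i]
    · simp; ring
    · intro j _ hj; simp [hj]
    · simp
  have hmemu : ∀ x ∈ refCell n .box, ∀ i, ∀ t, 0 ≤ t → t ≤ 1 →
      updateCoord x i t ∈ refCell n .box := by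
    intro x hx i t h0 h1 j
    rw [updateCoord_apply]
    split_ifs
    · exact ⟨h0, h1⟩
    · exact hx j
  have hfix : ∀ x, x ∈ {x | x ∈ refCell n .box ∧ ∀ y ∈ refCell n .box, l y ≤ l x} →
      (∀ i, c i < 0 → x i = 0) ∧ (∀ i, 0 < c i → x i = 1) := by
    rintro x ⟨hx, hmax⟩
    constructor
    · intro i hi
      have h1 := hmax _ (hmemu x hx i 0 le_rfl zero_le_one)
      have h2 := hupd x i 0
      have h3 := (hx i).1
      nlinarith
    · intro i hi
      have h1 := hmax _ (hmemu x hx i 1 zero_le_one le_rfl)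
      have h2 := hupd x i 1
      have h3 := (hx i).2
      nlinarith
  refine ⟨{i | c i < 0}, {i | 0 < c i}, ?_, fun x => ?_⟩
  · rw [Set.disjoint_left]
    intro i h1 h2
    exact lt_asymm (show c i < 0 from h1) h2
  · constructor
    · intro hx
      exact ⟨hx.1, hfix x hx⟩
    · rintro ⟨hx, h0, h1⟩
      refine ⟨hx, fun y hy => ?_⟩
      rw [hl, hl]
      refine Finset.sum_le_sum fun i _ => ?_
      rcases lt_trichotomy (c i) 0 with h | h | h
      · rw [h0 i h]; nlinarith [(hy i).1]
      · rw [h]; simp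
      · rw [h1 i h]; nlinarith [(hy i).2]

/-- Moving a free coordinate within `[0, 1]` stays on the face. -/
lemma box_update_mem {n : ℕ} {f : Set (E n)} {Z O : Set (Fin n)}
    (hZO : ∀ x, x ∈ f ↔ x ∈ refCell n .box ∧ (∀ i ∈ Z, x i = 0) ∧ (∀ i ∈ O, x i = 1))
    {i : Fin n} (hi : i ∉ Z) (hi' : i ∉ O) {x : E n} (hx : x ∈ f) {t : ℝ} (h0 : 0 ≤ t)
    (h1 : t ≤ 1) : updateCoord x i t ∈ f := by
  rw [hZO] at hx ⊢
  refine ⟨fun j => ?_, fun j hj => ?_, fun j hj => ?_⟩ <;> rw [updateCoord_apply]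
  · split_ifs
    · exact ⟨h0, h1⟩
    · exact hx.1 j
  · rw [if_neg (fun h : j = i => hi (h ▸ hj))]; exact hx.2.1 j hj
  · rw [if_neg (fun h : j = i => hi' (h ▸ hj))]; exact hx.2.2 j hj

/-- The coordinate underlying a nonconstant facet coordinate is free. -/
lemma box_nonconst {n : ℕ} {f : Set (E n)} (hf : IsRefFace .box f) {a : Fin n × Bool}
    (ha : NonconstOn f (boxLam a)) {x : E n} (hx : x ∈ f) {t : ℝ} (h0 : 0 ≤ t) (h1 : t ≤ 1) :
    updateCoord x a.1 t ∈ f := by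
  obtain ⟨i, b⟩ := a
  obtain ⟨Z, O, hd, hZO⟩ := box_face hf
  obtain ⟨x₁, hx₁, x₂, hx₂, hne⟩ := ha
  have hne' : x₁ i ≠ x₂ i := by
    intro h
    apply hne
    cases b
    · rw [boxLam_false, boxLam_false, h]
    · exact h
  exact box_update_mem hZO
    (fun h => hne' ((((hZO x₁).1 hx₁).2.1 i h).trans (((hZO x₂).1 hx₂).2.1 i h).symm))
    (fun h => hne' ((((hZO x₁).1 hx₁).2.2 i h).trans (((hZO x₂).1 hx₂).2.2 i h).symm)) hx h0 h1

/-- The facet coordinates of the cube. -/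
def boxSystem (n : ℕ) : FacetSystem n .box (Fin n × Bool) where
  lam := boxLam
  poly := fun a => if a.2 then MvPolynomial.X a.1 else 1 - MvPolynomial.X a.1
  eval_poly := by
    rintro ⟨i, b⟩ x
    cases b <;> simp
  mem_iff := by
    intro x
    constructor
    · rintro h ⟨i, b⟩
      cases b
      · rw [boxLam_false]; linarith [(h i).2]
      · exact (h i).1
    · intro h i
      have h1 := h (i, true)
      have h2 := h (i, false)
      rw [boxLam_true] at h1
      rw [boxLam_false] at h2
      exact ⟨h1, by linarith⟩
  coord := fun i => ⟨(i, true), fun _ => rfl⟩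
  le_one := by
    rintro x h ⟨i, b⟩
    cases b
    · rw [boxLam_false]; linarith [(h i).1]
    · exact (h i).2
  separate := by
    intro x y hxy
    by_contra! h
    refine hxy ?_
    ext i
    have h1 := h (i, true)
    have h2 := h (i, false)
    rw [boxLam_true, boxLam_true] at h1
    rw [boxLam_false, boxLam_false] at h2
    linarith
  mem_face := by
    intro f hf x hx h
    obtain ⟨Z, O, -, hZO⟩ := box_face hf
    rw [hZO]
    refine ⟨hx, fun i hi => h (i, true) fun y hy => ((hZO y).1 hy).2.1 i hi, fun i hi => ?_⟩
    have := h (i, false) fun y hy => by rw [boxLam_false, ((hZO y).1 hy).2.2 i hi, sub_self]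
    rw [boxLam_false] at this
    linarith
  const_face := by
    rintro f hf ⟨i, b⟩ ha
    obtain ⟨Z, O, hd, hZO⟩ := box_face hf
    by_cases hi : i ∈ Z
    · have : ∀ x ∈ f, x i = 0 := fun x hx => ((hZO x).1 hx).2.1 i hi
      cases b
      · right; intro x hx; rw [boxLam_false, this x hx, sub_zero]
      · left; exact this
    by_cases hi' : i ∈ O
    · have : ∀ x ∈ f, x i = 1 := fun x hx => ((hZO x).1 hx).2.2 i hi'
      cases b
      · left; intro x hx; rw [boxLam_false, this x hx, sub_self]
      · right; exact this
    exfalso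
    obtain ⟨x, hx⟩ := hf.1
    have hmem : ∀ t, 0 ≤ t → t ≤ 1 → updateCoord x i t ∈ f := fun t =>
      box_update_mem hZO hi hi' hx
    refine ha ⟨_, hmem 0 le_rfl zero_le_one, _, hmem 1 zero_le_one le_rfl, ?_⟩
    cases b <;> simp
  generate := by
    classical
    intro f hf ℓ hℓ
    obtain ⟨Z, O, hd, hZO⟩ := box_face hf
    obtain ⟨x₀, hx₀⟩ := hf.1
    let d : Fin n → ℝ := fun i => ℓ.linear (EuclideanSpace.single i (1 : ℝ))
    -- the minimiser of `ℓ` on the face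
    let y : E n := WithLp.toLp 2 fun i =>
      if i ∈ Z then 0 else if i ∈ O then 1 else if 0 ≤ d i then 0 else 1
    have hyi : ∀ i, y i = if i ∈ Z then 0 else if i ∈ O then 1 else if 0 ≤ d i then 0 else 1 :=
      fun _ => rfl
    have hy : y ∈ f := by
      rw [hZO]
      refine ⟨fun j => ?_, fun j hj => ?_, fun j hj => ?_⟩ <;> rw [hyi]
      · split_ifs <;> norm_num
      · rw [if_pos hj]
      · rw [if_neg (fun h => Set.disjoint_left.1 hd h hj), if_pos hj]
    refine ⟨ℓ y, hℓ y hy, fun a => if a.1 ∈ Z ∪ O then 0 else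
      if a.2 then max (d a.1) 0 else max (-d a.1) 0, ?_, ?_⟩
    · intro a
      dsimp only
      split_ifs
      · exact le_rfl
      · exact le_max_right _ _
      · exact le_max_right _ _
    · intro x hx
      have h1 := affine_sub ℓ x y
      rw [Fintype.sum_prod_type]
      have h2 : ∀ i, ∑ b : Bool, (if i ∈ Z ∪ O then 0 else
          if b then max (d i) 0 else max (-d i) 0) * boxLam (i, b) x = (x i - y i) * d i := by
        intro i
        rw [Fintype.sum_bool, boxLam_true, boxLam_false, hyi]
        have hxf := (hZO x).1 hx
        by_cases hi : i ∈ Z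
        · simp [hi, hxf.2.1 i hi]
        by_cases hi' : i ∈ O
        · simp [hi', hi, hxf.2.2 i hi']
        by_cases hd : 0 ≤ d i
        · simp [hi, hi', hd, mul_comm]
        · have : d i ≤ 0 := le_of_lt (not_le.1 hd)
          simp [hi, hi', hd, this]; ring
      simp only [h2]
      linarith
  extreme := by
    rintro f hf ⟨i, b⟩ ha ℓ h0 h1
    have hmem : ∀ x ∈ f, ∀ t, 0 ≤ t → t ≤ 1 → updateCoord x i t ∈ f :=
      fun x hx t => box_nonconst hf ha hx
    have hdiff : ∀ x : E n, ∀ t, ℓ x - ℓ (updateCoord x i t)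
        = (x i - t) * ℓ.linear (EuclideanSpace.single i (1 : ℝ)) := by
      intro x t
      rw [affine_sub, Finset.sum_eq_single i]
      · simp
      · intro j _ hj; simp [hj]
      · simp
    cases b
    · refine ⟨-ℓ.linear (EuclideanSpace.single i (1 : ℝ)), fun x hx => ?_⟩
      have hm := hmem x hx 1 zero_le_one le_rfl
      have h2 := h1 _ hm
      have h3 := h0 _ hm
      have h4 := hdiff x 1
      simp only [boxLam_false, updateCoord_apply, if_true] at h2 ⊢
      linarith
    · refine ⟨ℓ.linear (EuclideanSpace.single i (1 : ℝ)), fun x hx => ?_⟩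
      have hm := hmem x hx 0 le_rfl zero_le_one
      have h2 := h1 _ hm
      have h3 := h0 _ hm
      have h4 := hdiff x 0
      simp only [boxLam_true, updateCoord_apply, if_true] at h2 ⊢
      linarith
  attain := by
    rintro f hf ⟨i, b⟩ ha
    have hmem : ∀ x ∈ f, ∀ t, 0 ≤ t → t ≤ 1 → updateCoord x i t ∈ f :=
      fun x hx t => box_nonconst hf ha hx
    cases b
    · exact ⟨_, hmem _ hf.1.some_mem 0 le_rfl zero_le_one, by simp⟩
    · exact ⟨_, hmem _ hf.1.some_mem 1 zero_le_one le_rfl, by simp⟩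
  inj := by
    rintro f hf ⟨i, b⟩ ⟨j, b'⟩ ha _ h
    have hmem : ∀ x ∈ f, ∀ t, 0 ≤ t → t ≤ 1 → updateCoord x i t ∈ f :=
      fun x hx t => box_nonconst hf ha hx
    have e0 := h _ (hmem _ hf.1.some_mem 0 le_rfl zero_le_one)
    have e1 := h _ (hmem _ hf.1.some_mem 1 zero_le_one le_rfl)
    by_cases hij : j = i
    · subst hij
      cases b <;> cases b' <;> simp at e0 e1 ⊢
    · cases b <;> cases b' <;> simp [hij] at e0 e1 ⊢ <;> linarith

/-! ### Lagrange elements -/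

/-- `t ↦ binom(t, k)`, as a product. -/
def fallingBinom (k : ℕ) (t : ℝ) : ℝ := ∏ j ∈ Finset.range k, 1 / ((k : ℝ) - j) * (t - j)

lemma fallingBinom_zero (t : ℝ) : fallingBinom 0 t = 1 := by simp [fallingBinom]

lemma fallingBinom_self (k : ℕ) : fallingBinom k k = 1 := by
  refine Finset.prod_eq_one fun j hj => ?_
  have : (j : ℝ) < k := by exact_mod_cast Finset.mem_range.1 hj
  field_simp [(sub_pos.2 this).ne']

lemma fallingBinom_lt {k m : ℕ} (h : m < k) : fallingBinom k m = 0 := by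
  refine Finset.prod_eq_zero (Finset.mem_range.2 h) ?_
  simp

namespace FacetSystem

variable {n : ℕ} {kind : CellKind} {ι : Type} [Fintype ι] (S : FacetSystem n kind ι) (r : ℕ)

/-- The nodes of the Lagrange element of degree `r`: the points with facet coordinates in
`(1/r) ℕ`. -/
def nodes : Set (E n) := {x | ∀ a, ∃ k : ℕ, (r : ℝ) * S.lam a x = k}

/-- The integer facet coordinates of a node. -/
def idx (x : E n) (a : ι) : ℕ := ⌊(r : ℝ) * S.lam a x⌋₊

/-- The Lagrange basis function of the node `z`. -/
def lagPoly (z : E n) : MvPolynomial (Fin n) ℝ :=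
  ∏ a, ∏ j ∈ Finset.range (S.idx r z a),
    MvPolynomial.C (1 / ((S.idx r z a : ℝ) - j)) *
      (MvPolynomial.C (r : ℝ) * S.poly a - MvPolynomial.C (j : ℝ))

lemma eval_lagPoly (z x : E n) : MvPolynomial.eval x (S.lagPoly r z)
    = ∏ a, fallingBinom (S.idx r z a) (r * S.lam a x) := by
  simp [lagPoly, fallingBinom, S.eval_poly]

variable {r}

lemma idx_cast {z : E n} (hz : z ∈ S.nodes r) (a : ι) : (S.idx r z a : ℝ) = r * S.lam a z := by
  obtain ⟨k, hk⟩ := hz a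
  simp [idx, hk]

lemma nodes_subset (hr : 1 ≤ r) : S.nodes r ⊆ refCell n kind := by
  intro x hx
  rw [S.mem_iff]
  intro a
  obtain ⟨k, hk⟩ := hx a
  have hr' : (0 : ℝ) < r := by exact_mod_cast hr
  by_contra h
  have : (r : ℝ) * S.lam a x < 0 := mul_neg_of_pos_of_neg hr' (not_le.1 h)
  have h2 : (0 : ℝ) ≤ k := Nat.cast_nonneg k
  linarith

lemma nodes_finite (hr : 1 ≤ r) : (S.nodes r).Finite := by
  have hr' : (0 : ℝ) < r := by exact_mod_cast hr
  have h1 : Set.Finite (Set.pi (Set.univ : Set (Fin n))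
      (fun _ => (fun k : ℕ => (k : ℝ) / r) '' Set.Iic r)) :=
    Set.Finite.pi fun _ => (Set.finite_Iic r).image _
  refine (h1.image (fun y => (WithLp.toLp 2 y : E n))).subset fun x hx => ?_
  refine ⟨x, fun i _ => ?_, rfl⟩
  obtain ⟨a, ha⟩ := S.coord i
  obtain ⟨k, hk⟩ := hx a
  have h2 := S.le_one x (S.nodes_subset hr hx) a
  refine ⟨k, ?_, ?_⟩
  · have : (k : ℝ) ≤ r := by rw [← hk]; nlinarith
    exact_mod_cast this
  · dsimp only
    rw [← hk, ← ha]
    field_simp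

lemma eval_lagPoly_self {z : E n} (hz : z ∈ S.nodes r) :
    MvPolynomial.eval z (S.lagPoly r z) = 1 := by
  rw [eval_lagPoly]
  refine Finset.prod_eq_one fun a _ => ?_
  rw [← S.idx_cast hz, fallingBinom_self]

lemma eval_lagPoly_ne (hr : 1 ≤ r) {z x : E n} (hz : z ∈ S.nodes r) (hx : x ∈ S.nodes r)
    (hne : x ≠ z) : MvPolynomial.eval x (S.lagPoly r z) = 0 := by
  have hr' : (0 : ℝ) < r := by exact_mod_cast hr
  obtain ⟨a, ha⟩ := S.separate x z hne
  rw [eval_lagPoly]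
  refine Finset.prod_eq_zero (Finset.mem_univ a) ?_
  rw [← S.idx_cast hx]
  refine fallingBinom_lt ?_
  have : (S.idx r x a : ℝ) < S.idx r z a := by
    rw [S.idx_cast hx, S.idx_cast hz]
    exact mul_lt_mul_of_pos_left ha hr'
  exact_mod_cast this

end FacetSystem

/-! ### Agreement of the Lagrange interpolants on common faces -/

lemma isRefFace_preimage {n : ℕ} {kind : CellKind} (F : E n ≃ᵃ[ℝ] E n) {Φ : Set (E n)}
    (hΦ : IsExposed ℝ (cell kind F) Φ) (hne : Φ.Nonempty) :
    IsRefFace kind (F ⁻¹' Φ) := by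
  obtain ⟨l, hl⟩ := hΦ hne
  obtain ⟨x, hx⟩ := hne
  refine ⟨⟨F.symm x, by simpa using hx⟩, ?_⟩
  refine ⟨l.comp (LinearMap.toContinuousLinearMap (F.linear : E n →ₗ[ℝ] E n)), ?_⟩
  have hdiff : ∀ y z : E n, l (F y) ≤ l (F z) ↔ l (F.linear y) ≤ l (F.linear z) := by
    intro y z
    have h1 : F y = F.linear y + F 0 := congrFun (AffineMap.decomp (F : E n →ᵃ[ℝ] E n)) y
    have h2 : F z = F.linear z + F 0 := congrFun (AffineMap.decomp (F : E n →ᵃ[ℝ] E n)) z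
    rw [h1, h2, map_add, map_add]
    exact add_le_add_iff_right _
  ext z
  rw [Set.mem_preimage, hl]
  constructor
  · rintro ⟨⟨z', hz', hzz⟩, h⟩
    have : z' = z := F.injective hzz
    subst this
    exact ⟨hz', fun y hy => (hdiff _ _).1 (h (F y) ⟨y, hy, rfl⟩)⟩
  · rintro ⟨hz, h⟩
    refine ⟨⟨z, hz, rfl⟩, ?_⟩
    rintro _ ⟨y, hy, rfl⟩
    exact (hdiff _ _).2 (h y hy)

namespace FacetSystem

variable {n : ℕ} {kind : CellKind} {ι : Type} [Fintype ι] (S : FacetSystem n kind ι) {r : ℕ}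

/-- The facet coordinates of the cell `F(K̂)`, as affine functions. -/
def cellLam (F : E n ≃ᵃ[ℝ] E n) (a : ι) : E n →ᵃ[ℝ] ℝ :=
  (S.lam a).comp (F.symm : E n →ᵃ[ℝ] E n)

lemma cellLam_apply (F : E n ≃ᵃ[ℝ] E n) (a : ι) (x : E n) :
    S.cellLam F a x = S.lam a (F.symm x) := rfl

lemma nonconst_iff (F : E n ≃ᵃ[ℝ] E n) (Φ : Set (E n)) (a : ι) :
    NonconstOn (F ⁻¹' Φ) (S.lam a) ↔ NonconstOn Φ (S.cellLam F a) := by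
  constructor
  · rintro ⟨x, hx, y, hy, h⟩
    exact ⟨F x, hx, F y, hy, by simpa [cellLam_apply] using h⟩
  · rintro ⟨x, hx, y, hy, h⟩
    exact ⟨F.symm x, by simpa using hx, F.symm y, by simpa using hy, h⟩

/-- The nonconstant facet coordinates on a common face do not depend on the cell. -/
lemma exists_matching (F G : E n ≃ᵃ[ℝ] E n) {Φ : Set (E n)}
    (hF : IsExposed ℝ (cell kind F) Φ) (hG : IsExposed ℝ (cell kind G) Φ) (hne : Φ.Nonempty)
    (b : ι) (hb : NonconstOn Φ (S.cellLam G b)) :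
    ∃ a, NonconstOn Φ (S.cellLam F a) ∧ ∀ x ∈ Φ, S.cellLam F a x = S.cellLam G b x := by
  have fF := isRefFace_preimage F hF hne
  have fG := isRefFace_preimage G hG hne
  have hposF : ∀ a, ∀ x ∈ Φ, 0 ≤ S.cellLam F a x := fun a x hx =>
    (S.mem_iff _).1 (fF.subset (show F.symm x ∈ F ⁻¹' Φ by simpa using hx)) a
  have hposG : ∀ a, ∀ x ∈ Φ, 0 ≤ S.cellLam G a x := fun a x hx =>
    (S.mem_iff _).1 (fG.subset (show G.symm x ∈ G ⁻¹' Φ by simpa using hx)) a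
  -- `λ_b` of `G` is a nonnegative combination of the coordinates of `F`
  obtain ⟨c, hc, m, hm, hsum⟩ := S.generate _ fF
    ((S.cellLam G b).comp (F : E n →ᵃ[ℝ] E n)) (fun x hx => hposG b _ hx)
  have hsum' : ∀ x ∈ Φ, S.cellLam G b x = c + ∑ a, m a * S.cellLam F a x := by
    intro x hx
    have := hsum (F.symm x) (by simpa using hx)
    simpa [cellLam_apply] using this
  -- by extremality each term is a multiple of `λ_b`
  have hext : ∀ ℓ : E n →ᵃ[ℝ] ℝ, (∀ x ∈ Φ, 0 ≤ ℓ x) → (∀ x ∈ Φ, ℓ x ≤ S.cellLam G b x) →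
      ∃ k : ℝ, ∀ x ∈ Φ, ℓ x = k * S.cellLam G b x := by
    intro ℓ h0 h1
    obtain ⟨k, hk⟩ := S.extreme _ fG b ((S.nonconst_iff G Φ b).2 hb)
      (ℓ.comp (G : E n →ᵃ[ℝ] E n)) (fun x hx => h0 _ hx)
      (fun x hx => by simpa [cellLam_apply] using h1 _ hx)
    refine ⟨k, fun x hx => ?_⟩
    have := hk (G.symm x) (by simpa using hx)
    simpa [cellLam_apply] using this
  have hc0 : c = 0 := by
    obtain ⟨k, hk⟩ := hext (AffineMap.const ℝ (E n) c) (fun _ _ => hc) (fun x hx => by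
      rw [hsum' x hx]
      exact le_add_of_nonneg_right
        (Finset.sum_nonneg fun a _ => mul_nonneg (hm a) (hposF a x hx)))
    obtain ⟨x, hx, y, hy, hxy⟩ := hb
    have h1 : c = k * S.cellLam G b x := hk x hx
    have h2 : c = k * S.cellLam G b y := hk y hy
    have h3 : k * (S.cellLam G b x - S.cellLam G b y) = 0 := by linarith
    rcases mul_eq_zero.1 h3 with h | h
    · rw [h1, h, zero_mul]
    · exact absurd (sub_eq_zero.1 h) hxy
  have hterm : ∀ a, ∃ k : ℝ, ∀ x ∈ Φ, m a * S.cellLam F a x = k * S.cellLam G b x := by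
    intro a
    refine hext (m a • S.cellLam F a) (fun x hx => mul_nonneg (hm a) (hposF a x hx))
      (fun x hx => ?_)
    rw [hsum' x hx, hc0, zero_add]
    exact Finset.single_le_sum (f := fun a => m a * S.cellLam F a x)
      (fun a _ => mul_nonneg (hm a) (hposF a x hx)) (Finset.mem_univ a)
  choose k hk using hterm
  -- at the maximum of `λ_b`, some term does not vanish
  obtain ⟨y, hy, hy1⟩ := S.attain _ fG b ((S.nonconst_iff G Φ b).2 hb)
  have hGy : S.cellLam G b (G y) = 1 := by simpa [cellLam_apply] using hy1
  have hsumy := hsum' _ hy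
  rw [hGy, hc0, zero_add] at hsumy
  have : ∃ a, m a * S.cellLam F a (G y) ≠ 0 := by
    by_contra! h
    rw [Finset.sum_eq_zero fun a _ => h a] at hsumy
    exact one_ne_zero hsumy
  obtain ⟨a, ha⟩ := this
  have hka : k a ≠ 0 := by
    intro h
    rw [hk a _ hy, h, zero_mul] at ha
    exact ha rfl
  have hma : m a ≠ 0 := fun h => ha (by rw [h, zero_mul])
  have hna : NonconstOn Φ (S.cellLam F a) := by
    obtain ⟨x, hx, z, hz, hxz⟩ := hb
    refine ⟨x, hx, z, hz, fun h => hxz ?_⟩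
    have h1 := hk a x hx
    have h2 := hk a z hz
    rw [h, h2] at h1
    exact (mul_left_cancel₀ hka h1).symm
  refine ⟨a, hna, ?_⟩
  -- both functions have maximum `1`
  obtain ⟨w, hw, hw1⟩ := S.attain _ fF a ((S.nonconst_iff F Φ a).2 hna)
  have hFw : S.cellLam F a (F w) = 1 := by simpa [cellLam_apply] using hw1
  have hle : S.cellLam G b (F w) ≤ 1 :=
    S.le_one _ (fG.subset (show G.symm (F w) ∈ G ⁻¹' Φ by simpa using hw)) b
  have hle' : S.cellLam F a (G y) ≤ 1 :=
    S.le_one _ (fF.subset (show F.symm (G y) ∈ F ⁻¹' Φ by simpa using hy)) a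
  have e1 := hk a _ hw
  have e2 := hk a _ hy
  rw [hFw, mul_one] at e1
  rw [hGy, mul_one] at e2
  have hmk : m a = k a := by
    have hmpos := lt_of_le_of_ne (hm a) (Ne.symm hma)
    have h0 := hposG b _ hw
    have h3 : 0 ≤ k a := by rw [← e2]; exact mul_nonneg hmpos.le (hposF a _ hy)
    nlinarith
  intro x hx
  have := hk a x hx
  rw [hmk] at this
  exact mul_left_cancel₀ hka this

/-- Whether a point of a common face is a node does not depend on the cell. -/
lemma node_of_node (F G : E n ≃ᵃ[ℝ] E n) {Φ : Set (E n)}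
    (hF : IsExposed ℝ (cell kind F) Φ) (hG : IsExposed ℝ (cell kind G) Φ)
    {z : E n} (hz : z ∈ Φ) (hzF : F.symm z ∈ S.nodes r) : G.symm z ∈ S.nodes r := by
  intro b
  by_cases hb : NonconstOn Φ (S.cellLam G b)
  · obtain ⟨a, -, ha⟩ := S.exists_matching F G hF hG ⟨z, hz⟩ b hb
    obtain ⟨k, hk⟩ := hzF a
    exact ⟨k, by rw [← hk, ← cellLam_apply, ← cellLam_apply, ha z hz]⟩
  · rcases S.const_face _ (isRefFace_preimage G hG ⟨z, hz⟩) b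
      (fun h => hb ((S.nonconst_iff G Φ b).1 h)) with h | h
    · exact ⟨0, by rw [h (G.symm z) (by simpa using hz)]; simp⟩
    · exact ⟨r, by rw [h (G.symm z) (by simpa using hz)]; simp⟩

open Classical in
/-- On a face containing the node, only the nonconstant facet coordinates matter. -/
lemma lagPoly_on_face (F : E n ≃ᵃ[ℝ] E n) {Φ : Set (E n)}
    (hF : IsExposed ℝ (cell kind F) Φ) {z x : E n} (hz : z ∈ Φ) (hx : x ∈ Φ)
    (hzF : F.symm z ∈ S.nodes r) :
    MvPolynomial.eval (F.symm x) (S.lagPoly r (F.symm z))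
      = ∏ a ∈ Finset.univ.filter (fun a => NonconstOn Φ (S.cellLam F a)),
        fallingBinom ⌊r * S.cellLam F a z⌋₊ (r * S.cellLam F a x) := by
  rw [eval_lagPoly, ← Finset.prod_filter_mul_prod_filter_not Finset.univ
    (fun a => NonconstOn Φ (S.cellLam F a))]
  conv_rhs => rw [← mul_one (∏ a ∈ _, _)]
  refine congrArg₂ _ rfl (Finset.prod_eq_one fun a ha => ?_)
  rw [Finset.mem_filter] at ha
  have hi := S.idx_cast hzF a
  rcases S.const_face _ (isRefFace_preimage F hF ⟨z, hz⟩) a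
      (fun h => ha.2 ((S.nonconst_iff F Φ a).1 h)) with h | h
  · rw [h (F.symm z) (by simpa using hz), mul_zero] at hi
    have : S.idx r (F.symm z) a = 0 := by exact_mod_cast hi
    rw [this, fallingBinom_zero]
  · rw [h (F.symm z) (by simpa using hz), mul_one] at hi
    have : S.idx r (F.symm z) a = r := by exact_mod_cast hi
    rw [this, h (F.symm x) (by simpa using hx), mul_one, fallingBinom_self]

/-- On a face not containing the node, the basis function vanishes. -/
lemma lagPoly_off_face (hr : 1 ≤ r) (F : E n ≃ᵃ[ℝ] E n) {Φ : Set (E n)}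
    (hF : IsExposed ℝ (cell kind F) Φ) {z x : E n} (hz : F z ∉ Φ) (hx : x ∈ Φ)
    (hzF : z ∈ S.nodes r) : MvPolynomial.eval (F.symm x) (S.lagPoly r z) = 0 := by
  have hr' : (0 : ℝ) < r := by exact_mod_cast hr
  have hface := isRefFace_preimage F hF ⟨x, hx⟩
  have : ∃ a, (∀ y ∈ F ⁻¹' Φ, S.lam a y = 0) ∧ S.lam a z ≠ 0 := by
    by_contra! h
    exact hz (S.mem_face _ hface z (S.nodes_subset hr hzF) h)
  obtain ⟨a, h0, ha⟩ := this
  rw [eval_lagPoly]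
  refine Finset.prod_eq_zero (Finset.mem_univ a) ?_
  rw [h0 (F.symm x) (by simpa using hx), mul_zero]
  have hpos : 0 < S.idx r z a := by
    rw [Nat.pos_iff_ne_zero]
    intro h
    have := S.idx_cast hzF a
    rw [h, Nat.cast_zero] at this
    rcases mul_eq_zero.1 this.symm with h | h
    · exact hr'.ne' h
    · exact ha h
  have := fallingBinom_lt hpos
  simpa using this

/-- Lagrange interpolants with the same nodal values agree on common faces: only the nodes on the
face contribute, and the factors of their basis functions correspond to each other. -/
lemma lagrange_conforming (hr : 1 ≤ r) (F G : E n ≃ᵃ[ℝ] E n)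
    (hF : IsExposed ℝ (cell kind F) (cell kind F ∩ cell kind G))
    (hG : IsExposed ℝ (cell kind G) (cell kind F ∩ cell kind G)) (c : E n → ℝ) (x : E n)
    (hx : x ∈ cell kind F ∩ cell kind G) :
    ∑ z ∈ (S.nodes_finite hr).toFinset, c (F z) * MvPolynomial.eval (F.symm x) (S.lagPoly r z)
      = ∑ z ∈ (S.nodes_finite hr).toFinset,
        c (G z) * MvPolynomial.eval (G.symm x) (S.lagPoly r z) := by
  classical
  set Φ := cell kind F ∩ cell kind G with hΦ
  have key : ∀ H : E n ≃ᵃ[ℝ] E n, IsExposed ℝ (cell kind H) Φ →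
      ∑ z ∈ (S.nodes_finite hr).toFinset, c (H z) * MvPolynomial.eval (H.symm x) (S.lagPoly r z)
      = ∑ z ∈ (S.nodes_finite hr).toFinset.filter (fun z => H z ∈ Φ),
        c (H z) * MvPolynomial.eval (H.symm x) (S.lagPoly r z) := by
    intro H hH
    symm
    refine Finset.sum_filter_of_ne fun z hz hne => ?_
    by_contra hz'
    refine hne ?_
    rw [S.lagPoly_off_face hr H hH hz' hx ((Set.Finite.mem_toFinset _).1 hz), mul_zero]
  rw [key F hF, key G hG]
  refine Finset.sum_bij' (fun z _ => G.symm (F z)) (fun z _ => F.symm (G z)) ?_ ?_ ?_ ?_ ?_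
  · intro z hz
    simp only [Finset.mem_filter, Set.Finite.mem_toFinset, AffineEquiv.apply_symm_apply] at hz ⊢
    exact ⟨S.node_of_node F G hF hG hz.2 (by simpa using hz.1), hz.2⟩
  · intro z hz
    simp only [Finset.mem_filter, Set.Finite.mem_toFinset, AffineEquiv.apply_symm_apply] at hz ⊢
    exact ⟨S.node_of_node G F hG hF hz.2 (by simpa using hz.1), hz.2⟩
  · intro z _; simp
  · intro z _; simp
  · intro z hz
    simp only [Finset.mem_filter, Set.Finite.mem_toFinset] at hz
    have e1 := S.lagPoly_on_face F hF hz.2 hx (by simpa using hz.1)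
    have e2 := S.lagPoly_on_face G hG hz.2 hx
      (S.node_of_node F G hF hG hz.2 (by simpa using hz.1))
    rw [AffineEquiv.symm_apply_apply] at e1
    rw [AffineEquiv.apply_symm_apply, e1, e2]
    congr 1
    have hm : ∀ b, NonconstOn Φ (S.cellLam G b) → ∃ a, NonconstOn Φ (S.cellLam F a) ∧
      ∀ x ∈ Φ, S.cellLam F a x = S.cellLam G b x := S.exists_matching F G hF hG ⟨x, hx⟩
    have hm' : ∀ b, NonconstOn Φ (S.cellLam F b) → ∃ a, NonconstOn Φ (S.cellLam G a) ∧
      ∀ x ∈ Φ, S.cellLam G a x = S.cellLam F b x := S.exists_matching G F hG hF ⟨x, hx⟩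
    have hinj : ∀ a b, NonconstOn Φ (S.cellLam G a) → NonconstOn Φ (S.cellLam G b) →
        (∀ y ∈ Φ, S.cellLam G a y = S.cellLam G b y) → a = b := by
      intro a b ha hb h
      refine S.inj _ (isRefFace_preimage G hG ⟨x, hx⟩) a b ((S.nonconst_iff G Φ a).2 ha)
        ((S.nonconst_iff G Φ b).2 hb) fun y hy => ?_
      simpa [cellLam_apply] using h _ hy
    have hinj' : ∀ a b, NonconstOn Φ (S.cellLam F a) → NonconstOn Φ (S.cellLam F b) →
        (∀ y ∈ Φ, S.cellLam F a y = S.cellLam F b y) → a = b := by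
      intro a b ha hb h
      refine S.inj _ (isRefFace_preimage F hF ⟨x, hx⟩) a b ((S.nonconst_iff F Φ a).2 ha)
        ((S.nonconst_iff F Φ b).2 hb) fun y hy => ?_
      simpa [cellLam_apply] using h _ hy
    choose! σ hσ hσ' using hm'
    refine Finset.prod_bij (fun a _ => σ a) ?_ ?_ ?_ ?_
    · intro a ha
      simp only [Finset.mem_filter, Finset.mem_univ, true_and] at ha ⊢
      exact hσ a ha
    · intro a ha b hb hab
      simp only [Finset.mem_filter, Finset.mem_univ, true_and] at ha hb
      exact hinj' a b ha hb fun y hy => by rw [← hσ' a ha y hy, ← hσ' b hb y hy, hab]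
    · intro b hb
      simp only [Finset.mem_filter, Finset.mem_univ, true_and] at hb
      obtain ⟨a, ha, hab⟩ := hm b hb
      refine ⟨a, by simpa using ha, ?_⟩
      exact hinj _ _ (hσ a ha) hb fun y hy => by rw [hσ' a ha y hy, hab y hy]
    · intro a ha
      simp only [Finset.mem_filter, Finset.mem_univ, true_and] at ha
      rw [hσ' a ha x hx, hσ' a ha _ hz.2]

end FacetSystem

/-! ### Unisolvence -/

/-- Polynomials of total degree at most `r` are reference polynomials for both kinds of cells. -/
lemma restrictTotalDegree_le_refPoly (n r : ℕ) (kind : CellKind) :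
    MvPolynomial.restrictTotalDegree (Fin n) ℝ r ≤ refPoly n r kind := by
  cases kind with
  | simplex => exact le_rfl
  | box =>
    intro p hp
    rw [MvPolynomial.mem_restrictTotalDegree] at hp
    change p ∈ MvPolynomial.restrictDegree (Fin n) ℝ r
    rw [MvPolynomial.mem_restrictDegree]
    intro s hs i
    have h1 := MvPolynomial.le_totalDegree hs
    have h2 : s i ≤ s.sum fun _ e => e := by
      by_cases h : s i = 0
      · rw [h]; exact Nat.zero_le _
      · exact Finset.single_le_sum (f := fun i => s i) (fun _ _ => Nat.zero_le _)
          (Finsupp.mem_support_iff.2 h)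
    omega

/-- Unisolvence on the simplex, by the combinatorial Nullstellensatz: the lattice of nodes contains
a product grid for each monomial of top degree. -/
lemma simplex_unisolvent {n r : ℕ} (hr : 1 ≤ r) {p : MvPolynomial (Fin n) ℝ}
    (hp : p ∈ refPoly n r .simplex)
    (h : ∀ z ∈ (simplexSystem n).nodes r, MvPolynomial.eval z p = 0) : p = 0 := by
  have hr' : (0 : ℝ) < r := by exact_mod_cast hr
  replace hp : p.totalDegree ≤ r := (MvPolynomial.mem_restrictTotalDegree _ _ _).1 hp
  by_contra hne
  -- a monomial of top degree
  obtain ⟨t, ht, htd⟩ : ∃ t ∈ p.support, p.totalDegree = t.degree := by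
    obtain ⟨t, ht, h⟩ := Finset.exists_mem_eq_sup p.support
      (MvPolynomial.support_nonempty.2 hne) (fun s => s.sum fun _ e => e)
    exact ⟨t, ht, h⟩
  obtain ⟨s, hs, hs'⟩ := MvPolynomial.combinatorial_nullstellensatz_exists_eval_nonzero p t
    (MvPolynomial.mem_support_iff.1 ht) htd
    (fun i => (Finset.range (t i + 1)).image (fun k : ℕ => (k : ℝ) / r)) (fun i => by
      rw [Finset.card_image_of_injective, Finset.card_range]
      · omega
      · intro a b hab
        have := (div_left_inj' hr'.ne').1 hab
        exact_mod_cast this)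
  have hk : ∀ i, ∃ k : ℕ, k ≤ t i ∧ (k : ℝ) / r = s i := by
    intro i
    obtain ⟨k, hk, hks⟩ := Finset.mem_image.1 (hs i)
    exact ⟨k, by have := Finset.mem_range.1 hk; omega, hks⟩
  choose k hkt hks using hk
  refine hs' (h (WithLp.toLp 2 s) ?_)
  have hsum : ∑ i, k i ≤ r := by
    calc ∑ i, k i ≤ ∑ i, t i := Finset.sum_le_sum fun i _ => hkt i
      _ = t.degree := (Finsupp.degree_eq_sum t).symm
      _ ≤ r := htd ▸ hp
  intro a
  cases a with
  | none =>
    refine ⟨r - ∑ i, k i, ?_⟩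
    change (r : ℝ) * simplexLam none _ = _
    rw [simplexLam_none, Nat.cast_sub hsum, Nat.cast_sum, mul_sub, mul_one, Finset.mul_sum]
    congr 1
    refine Finset.sum_congr rfl fun i _ => ?_
    change (r : ℝ) * s i = _
    rw [← hks]; field_simp
  | some i =>
    refine ⟨k i, ?_⟩
    change (r : ℝ) * s i = _
    rw [← hks]; field_simp

lemma box_unisolvent {n r : ℕ} (hr : 1 ≤ r) {p : MvPolynomial (Fin n) ℝ}
    (hp : p ∈ refPoly n r .box)
    (h : ∀ z ∈ (boxSystem n).nodes r, MvPolynomial.eval z p = 0) : p = 0 := by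
  have hr' : (0 : ℝ) < r := by exact_mod_cast hr
  replace hp : ∀ s ∈ p.support, ∀ i, s i ≤ r := (MvPolynomial.mem_restrictDegree _ _ _).1 hp
  refine MvPolynomial.eq_zero_of_eval_zero_at_prod_finset p
    (fun _ => (Finset.range (r + 1)).image (fun k : ℕ => (k : ℝ) / r)) (fun i => ?_) ?_
  · rw [Finset.card_image_of_injective, Finset.card_range]
    · rw [Nat.lt_succ_iff, MvPolynomial.degreeOf_le_iff]
      exact fun s hs => hp s hs i
    · intro a b hab
      have := (div_left_inj' hr'.ne').1 hab
      exact_mod_cast this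
  · intro s hs
    refine h (WithLp.toLp 2 s) ?_
    rintro ⟨i, b⟩
    obtain ⟨k, hk, hks⟩ := Finset.mem_image.1 (hs i)
    have hk' : k ≤ r := by have := Finset.mem_range.1 hk; omega
    cases b with
    | true =>
      refine ⟨k, ?_⟩
      change (r : ℝ) * s i = _
      rw [← hks]; field_simp
    | false =>
      refine ⟨r - k, ?_⟩
      change (r : ℝ) * (1 - s i) = _
      rw [← hks, Nat.cast_sub hk']; field_simp

/-- The degrees of the factors add up to `r`, since the barycentric coordinates add up to one. -/
lemma simplex_lagPoly_mem {n r : ℕ} {z : E n} (hz : z ∈ (simplexSystem n).nodes r) :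
    (simplexSystem n).lagPoly r z ∈ refPoly n r .simplex := by
  change _ ∈ MvPolynomial.restrictTotalDegree (Fin n) ℝ r
  rw [MvPolynomial.mem_restrictTotalDegree]
  have hpoly : ∀ a, ((simplexSystem n).poly a).totalDegree ≤ 1 := by
    intro a
    cases a with
    | none =>
      change (1 - ∑ i, MvPolynomial.X i : MvPolynomial (Fin n) ℝ).totalDegree ≤ 1
      refine (MvPolynomial.totalDegree_sub _ _).trans (max_le (by simp) ?_)
      exact MvPolynomial.totalDegree_finsetSum_le fun i _ => (MvPolynomial.totalDegree_X i).le
    | some i => exact (MvPolynomial.totalDegree_X i).le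
  have hfac : ∀ a (c d e : ℝ), (MvPolynomial.C c * (MvPolynomial.C d * (simplexSystem n).poly a
      - MvPolynomial.C e)).totalDegree ≤ 1 := by
    intro a c d e
    refine (MvPolynomial.totalDegree_mul _ _).trans ?_
    rw [MvPolynomial.totalDegree_C, zero_add]
    refine (MvPolynomial.totalDegree_sub _ _).trans (max_le ?_ (by simp))
    refine (MvPolynomial.totalDegree_mul _ _).trans ?_
    rw [MvPolynomial.totalDegree_C, zero_add]
    exact hpoly a
  have hidx : ∑ a, (simplexSystem n).idx r z a = r := by
    have h : ((∑ a, (simplexSystem n).idx r z a : ℕ) : ℝ) = r := by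
      rw [Nat.cast_sum]
      simp only [(simplexSystem n).idx_cast hz, ← Finset.mul_sum]
      change (r : ℝ) * ∑ a, simplexLam a z = r
      rw [simplexLam_sum, mul_one]
    exact_mod_cast h
  refine (MvPolynomial.totalDegree_finsetProd _ _).trans ?_
  calc _ ≤ ∑ a, (simplexSystem n).idx r z a := by
        refine Finset.sum_le_sum fun a _ => (MvPolynomial.totalDegree_finsetProd _ _).trans ?_
        refine (Finset.sum_le_card_nsmul _ _ 1 fun j _ => hfac a _ _ _).trans ?_
        simp
    _ = r := hidx

lemma box_lagPoly_mem {n r : ℕ} {z : E n} (hz : z ∈ (boxSystem n).nodes r) :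
    (boxSystem n).lagPoly r z ∈ refPoly n r .box := by
  classical
  change _ ∈ MvPolynomial.restrictDegree (Fin n) ℝ r
  rw [MvPolynomial.mem_restrictDegree]
  intro s hs i
  refine le_trans ?_ (show MvPolynomial.degreeOf i ((boxSystem n).lagPoly r z) ≤ r from ?_)
  · exact MvPolynomial.degreeOf_le_iff.1 le_rfl s hs
  have hX : ∀ j, MvPolynomial.degreeOf i (MvPolynomial.X j : MvPolynomial (Fin n) ℝ)
      ≤ if j = i then 1 else 0 := by
    intro j
    rw [MvPolynomial.degreeOf_X]
    split_ifs with h1 h2 h2 <;> simp_all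
  have hpoly : ∀ a, MvPolynomial.degreeOf i ((boxSystem n).poly a)
      ≤ if a.1 = i then 1 else 0 := by
    rintro ⟨j, b⟩
    cases b with
    | true => exact hX j
    | false =>
      change MvPolynomial.degreeOf i (1 - MvPolynomial.X j : MvPolynomial (Fin n) ℝ) ≤ _
      refine (MvPolynomial.degreeOf_sub_le _ _ _).trans (max_le ?_ (hX j))
      rw [← MvPolynomial.C_1, MvPolynomial.degreeOf_C]; exact Nat.zero_le _
  have hfac : ∀ a (c d e : ℝ), MvPolynomial.degreeOf i (MvPolynomial.C c *
      (MvPolynomial.C d * (boxSystem n).poly a - MvPolynomial.C e))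
      ≤ if a.1 = i then 1 else 0 := by
    intro a c d e
    refine (MvPolynomial.degreeOf_C_mul_le _ _ _).trans ?_
    refine (MvPolynomial.degreeOf_sub_le _ _ _).trans (max_le ?_ ?_)
    · exact (MvPolynomial.degreeOf_C_mul_le _ _ _).trans (hpoly a)
    · rw [MvPolynomial.degreeOf_C]; exact Nat.zero_le _
  have hidx : ∑ b : Bool, (boxSystem n).idx r z (i, b) = r := by
    have h : ((∑ b : Bool, (boxSystem n).idx r z (i, b) : ℕ) : ℝ) = r := by
      rw [Nat.cast_sum]
      simp only [(boxSystem n).idx_cast hz, ← Finset.mul_sum]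
      change (r : ℝ) * ∑ b, boxLam (i, b) z = r
      rw [Fintype.sum_bool, boxLam_true, boxLam_false]
      ring
    exact_mod_cast h
  refine (MvPolynomial.degreeOf_prod_le _ _ _).trans ?_
  calc _ ≤ ∑ a : Fin n × Bool, (if a.1 = i then (boxSystem n).idx r z a else 0) := by
        refine Finset.sum_le_sum fun a _ => (MvPolynomial.degreeOf_prod_le _ _ _).trans ?_
        refine (Finset.sum_le_card_nsmul _ _ _ fun j _ => hfac a _ _ _).trans ?_
        split_ifs <;> simp
    _ = r := by
        rw [Fintype.sum_prod_type, Finset.sum_eq_single i]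
        · simpa using hidx
        · intro j _ hj; simp [hj]
        · simp

/-- The Lagrange element of degree `r`, with nodes `N` and basis functions `Lag`. -/
theorem exists_lagrange (n : ℕ) (kind : CellKind) {r : ℕ} (hr : 1 ≤ r) :
    ∃ (N : Finset (E n)) (Lag : E n → MvPolynomial (Fin n) ℝ),
      (∀ z ∈ N, z ∈ refCell n kind) ∧ (∀ z ∈ N, Lag z ∈ refPoly n r kind) ∧
      (∀ p ∈ refPoly n r kind, p = ∑ z ∈ N, MvPolynomial.C (MvPolynomial.eval z p) * Lag z) ∧
      ∀ F G : E n ≃ᵃ[ℝ] E n,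
        IsExposed ℝ (cell kind F) (cell kind F ∩ cell kind G) →
        IsExposed ℝ (cell kind G) (cell kind F ∩ cell kind G) →
        ∀ (c : E n → ℝ), ∀ x ∈ cell kind F ∩ cell kind G,
          ∑ z ∈ N, c (F z) * MvPolynomial.eval (F.symm x) (Lag z)
            = ∑ z ∈ N, c (G z) * MvPolynomial.eval (G.symm x) (Lag z) := by
  have main : ∀ {ι : Type} [Fintype ι] (S : FacetSystem n kind ι),
      (∀ z ∈ S.nodes r, S.lagPoly r z ∈ refPoly n r kind) →
      (∀ p ∈ refPoly n r kind, (∀ z ∈ S.nodes r, MvPolynomial.eval z p = 0) → p = 0) →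
      ∀ p ∈ refPoly n r kind, p = ∑ z ∈ (S.nodes_finite hr).toFinset,
        MvPolynomial.C (MvPolynomial.eval z p) * S.lagPoly r z := by
    intro ι _ S h1 h2 p hp
    rw [← sub_eq_zero]
    refine h2 _ (sub_mem hp (sum_mem fun z hz => ?_)) fun z hz => ?_
    · rw [← MvPolynomial.smul_eq_C_mul]
      exact Submodule.smul_mem _ _ (h1 z ((Set.Finite.mem_toFinset _).1 hz))
    · rw [map_sub, map_sum, Finset.sum_eq_single z]
      · simp [S.eval_lagPoly_self hz]
      · intro w hw hwz
        rw [map_mul, S.eval_lagPoly_ne hr ((Set.Finite.mem_toFinset _).1 hw) hz hwz.symm, mul_zero]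
      · intro h
        exact absurd ((Set.Finite.mem_toFinset _).2 hz) h
  cases kind with
  | simplex =>
    refine ⟨((simplexSystem n).nodes_finite hr).toFinset, (simplexSystem n).lagPoly r,
      fun z hz => (simplexSystem n).nodes_subset hr ((Set.Finite.mem_toFinset _).1 hz),
      fun z hz => simplex_lagPoly_mem ((Set.Finite.mem_toFinset _).1 hz),
      main _ (fun z hz => simplex_lagPoly_mem hz) (fun p hp h => simplex_unisolvent hr hp h),
      (simplexSystem n).lagrange_conforming hr⟩
  | box =>
    refine ⟨((boxSystem n).nodes_finite hr).toFinset, (boxSystem n).lagPoly r,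
      fun z hz => (boxSystem n).nodes_subset hr ((Set.Finite.mem_toFinset _).1 hz),
      fun z hz => box_lagPoly_mem ((Set.Finite.mem_toFinset _).1 hz),
      main _ (fun z hz => box_lagPoly_mem hz) (fun p hp h => box_unisolvent hr hp h),
      (boxSystem n).lagrange_conforming hr⟩

/-! ### Cauchy–Schwarz and Young inequalities for lower integrals -/

lemma lintegral_mul_sq_le {α : Type*} [MeasurableSpace α] (μ : Measure α) {f g : α → ℝ≥0∞}
    (hf : AEMeasurable f μ) (hg : AEMeasurable g μ) :
    (∫⁻ a, f a * g a ∂μ) ^ 2 ≤ (∫⁻ a, f a ^ 2 ∂μ) * ∫⁻ a, g a ^ 2 ∂μ := by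
  have h := ENNReal.lintegral_mul_le_Lp_mul_Lq μ Real.HolderConjugate.two_two hf hg
  simp only [Pi.mul_apply, ENNReal.rpow_two] at h
  calc (∫⁻ a, f a * g a ∂μ) ^ 2
      ≤ ((∫⁻ a, f a ^ 2 ∂μ) ^ (1 / 2 : ℝ) * (∫⁻ a, g a ^ 2 ∂μ) ^ (1 / 2 : ℝ)) ^ 2 := by gcongr
    _ = _ := by
      rw [mul_pow, ← ENNReal.rpow_two, ← ENNReal.rpow_two, ← ENNReal.rpow_mul,
        ← ENNReal.rpow_mul]
      norm_num

lemma lintegral_sq_le {α : Type*} [MeasurableSpace α] (μ : Measure α) {f : α → ℝ≥0∞}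
    (hf : AEMeasurable f μ) : (∫⁻ a, f a ∂μ) ^ 2 ≤ μ univ * ∫⁻ a, f a ^ 2 ∂μ := by
  have h := lintegral_mul_sq_le μ (f := fun _ => 1) (g := f) aemeasurable_const hf
  simpa using h

/-- The mean deviates from a constant by at most the quadratic mean. -/
lemma sub_average_sq_le {n : ℕ} {B : Set (E n)} (hB0 : volume B ≠ 0) (hB : volume B ≠ ⊤)
    {f : E n → ℝ} (hf : MemLp f 2 (volume.restrict B)) (c : ℝ) :
    volume B * ‖c - ⨍ b in B, f b‖ₑ ^ 2 ≤ ∫⁻ b in B, ‖c - f b‖ₑ ^ 2 := by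
  have : IsFiniteMeasure (volume.restrict B) := ⟨by simpa using hB.lt_top⟩
  have hfi : Integrable f (volume.restrict B) := hf.integrable (by norm_num)
  have hreal : (volume.real B) ≠ 0 := (ENNReal.toReal_pos hB0 hB).ne'
  have h1 : ∫ b in B, (c - f b) = volume.real B * (c - ⨍ b in B, f b) := by
    rw [integral_sub (integrable_const c) hfi, setAverage_eq]
    simp only [integral_const, smul_eq_mul, measureReal_restrict_apply_univ]
    field_simp
  have h2 : ‖∫ b in B, (c - f b)‖ₑ ≤ ∫⁻ b in B, ‖c - f b‖ₑ := enorm_integral_le_lintegral_enorm _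
  have h3 : ‖∫ b in B, (c - f b)‖ₑ = volume B * ‖c - ⨍ b in B, f b‖ₑ := by
    rw [h1, enorm_mul]
    congr 1
    rw [Real.enorm_of_nonneg measureReal_nonneg]
    exact ENNReal.ofReal_toReal hB
  have h4 := lintegral_sq_le (volume.restrict B) (f := fun b => ‖c - f b‖ₑ)
    ((aestronglyMeasurable_const.sub hf.1).enorm)
  rw [Measure.restrict_apply_univ] at h4
  have h5 : volume B * (volume B * ‖c - ⨍ b in B, f b‖ₑ ^ 2)
      ≤ volume B * ∫⁻ b in B, ‖c - f b‖ₑ ^ 2 := by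
    refine le_trans (le_of_eq ?_) ((pow_le_pow_left' (h3 ▸ h2) 2).trans h4)
    ring
  exact (ENNReal.mul_le_mul_iff_right hB0 hB).1 h5

/-- Young's inequality `‖ρ ⋆ g‖₂ ≤ ‖g‖₂` for a bump function `ρ` of integral one. -/
lemma lintegral_convolution_sq_le {n : ℕ} (φ : ContDiffBump (0 : E n)) {g : E n → ℝ}
    (hg : AEStronglyMeasurable g volume) :
    ∫⁻ x, ‖(convolution (φ.normed volume) g (ContinuousLinearMap.lsmul ℝ ℝ) volume) x‖ₑ ^ 2
      ≤ ∫⁻ x, ‖g x‖ₑ ^ 2 := by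
  set ρ : E n → ℝ := φ.normed volume with hρ
  have hρc : Continuous ρ := φ.continuous_normed
  have hρ0 : ∀ x, 0 ≤ ρ x := φ.nonneg_normed
  have hρ1 : ∫⁻ t, ENNReal.ofReal (ρ t) = 1 := by
    rw [← ofReal_integral_eq_lintegral_ofReal φ.integrable_normed
      (Filter.Eventually.of_forall hρ0), φ.integral_normed, ENNReal.ofReal_one]
  have hgm : ∀ x, AEMeasurable (fun t => ‖g (x - t)‖ₑ) volume := by
    intro x
    have : AEStronglyMeasurable (fun t => g (x - t)) volume :=
      hg.comp_quasiMeasurePreserving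
        (Measure.measurePreserving_sub_left volume x).quasiMeasurePreserving
    exact this.enorm
  have hρm : Measurable fun t => ENNReal.ofReal (ρ t) := hρc.measurable.ennreal_ofReal
  have hpt : ∀ x, ‖(convolution ρ g (ContinuousLinearMap.lsmul ℝ ℝ) volume) x‖ₑ ^ 2
      ≤ ∫⁻ t, ENNReal.ofReal (ρ t) * ‖g (x - t)‖ₑ ^ 2 := by
    intro x
    have h1 : ‖(convolution ρ g (ContinuousLinearMap.lsmul ℝ ℝ) volume) x‖ₑ
        ≤ ∫⁻ t, ENNReal.ofReal (ρ t) ^ (1 / 2 : ℝ) *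
            (ENNReal.ofReal (ρ t) ^ (1 / 2 : ℝ) * ‖g (x - t)‖ₑ) := by
      rw [convolution_def]
      refine (enorm_integral_le_lintegral_enorm _).trans (le_of_eq (lintegral_congr fun t => ?_))
      rw [← mul_assoc, ← ENNReal.rpow_add_of_nonneg _ _ (by norm_num) (by norm_num)]
      norm_num
      rw [Real.enorm_of_nonneg (hρ0 t)]
    have h2 := lintegral_mul_sq_le volume
      (f := fun t => ENNReal.ofReal (ρ t) ^ (1 / 2 : ℝ))
      (g := fun t => ENNReal.ofReal (ρ t) ^ (1 / 2 : ℝ) * ‖g (x - t)‖ₑ)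
      (hρm.pow_const _).aemeasurable ((hρm.pow_const _).aemeasurable.mul (hgm x))
    refine (pow_le_pow_left' h1 2).trans (h2.trans (le_of_eq ?_))
    have h3 : ∀ y : ℝ≥0∞, (y ^ (1 / 2 : ℝ)) ^ 2 = y := by
      intro y
      rw [← ENNReal.rpow_two, ← ENNReal.rpow_mul]
      norm_num
    simp only [mul_pow, h3, hρ1, one_mul]
  have hprod : AEMeasurable (Function.uncurry fun (x t : E n) =>
      ENNReal.ofReal (ρ t) * ‖g (x - t)‖ₑ ^ 2) (volume.prod volume) := by
    have h1 : AEStronglyMeasurable (fun p : E n × E n => g (p.1 - p.2)) (volume.prod volume) :=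
      hg.comp_quasiMeasurePreserving (quasiMeasurePreserving_sub volume volume)
    exact (hρm.comp measurable_snd).aemeasurable.mul (h1.enorm.pow_const _)
  calc _ ≤ ∫⁻ x, ∫⁻ t, ENNReal.ofReal (ρ t) * ‖g (x - t)‖ₑ ^ 2 := lintegral_mono hpt
    _ = ∫⁻ t, ∫⁻ x, ENNReal.ofReal (ρ t) * ‖g (x - t)‖ₑ ^ 2 := lintegral_lintegral_swap hprod
    _ = ∫⁻ t, ENNReal.ofReal (ρ t) * ∫⁻ x, ‖g x‖ₑ ^ 2 := by
      refine lintegral_congr fun t => ?_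
      rw [lintegral_const_mul' _ _ ENNReal.ofReal_ne_top,
        lintegral_sub_right_eq_self (fun x => ‖g x‖ₑ ^ 2)]
    _ = ∫⁻ x, ‖g x‖ₑ ^ 2 := by
      rw [lintegral_mul_const _ hρm, hρ1, one_mul]

/-! ### Weak gradients and mollification -/

/-- `g` is the weak gradient of `w` on `D`. -/
def IsWeakGrad {n : ℕ} (D : Set (E n)) (w : E n → ℝ) (g : Fin n → E n → ℝ) : Prop :=
  ∀ j, ∀ φ : E n → ℝ, IsTest D φ →
    ∫ x in D, w x * fderiv ℝ φ x (EuclideanSpace.single j (1 : ℝ)) = -∫ x in D, g j x * φ x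

lemma partialDeriv_one {n : ℕ} (j : Fin n) (φ : E n → ℝ) (x : E n) :
    partialDeriv (fun _ : Fin 1 => j) φ x = fderiv ℝ φ x (EuclideanSpace.single j (1 : ℝ)) := by
  simp [partialDeriv, iteratedFDeriv_one_apply]

lemma isWeakPartial_one_iff {n : ℕ} {D : Set (E n)} {j : Fin n} {w g : E n → ℝ} :
    IsWeakPartial D (fun _ : Fin 1 => j) w g ↔ ∀ φ : E n → ℝ, IsTest D φ →
    ∫ x in D, w x * fderiv ℝ φ x (EuclideanSpace.single j (1 : ℝ)) = -∫ x in D, g x * φ x := by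
  simp [IsWeakPartial, partialDeriv_one]

lemma memLp_indicator {n : ℕ} {D : Set (E n)} (hD : MeasurableSet D) {w : E n → ℝ}
    (hw : MemLp w 2 (volume.restrict D)) : MemLp (D.indicator w) 2 volume :=
  (memLp_indicator_iff_restrict hD).2 hw

/-- Mollification commutes with weak derivatives away from the boundary. -/
lemma fderiv_mollify {n : ℕ} {D : Set (E n)} (hD : IsOpen D) {w : E n → ℝ}
    {g : Fin n → E n → ℝ} (hw : MemLp w 2 (volume.restrict D)) (h : IsWeakGrad D w g)
    (φ : ContDiffBump (0 : E n)) {x : E n} (hx : closedBall x φ.rOut ⊆ D) (j : Fin n) :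
    fderiv ℝ (convolution (φ.normed volume) (D.indicator w) (ContinuousLinearMap.lsmul ℝ ℝ)
      volume) x (EuclideanSpace.single j (1 : ℝ))
    = convolution (φ.normed volume) (D.indicator (g j)) (ContinuousLinearMap.lsmul ℝ ℝ)
      volume x := by
  set ρ : E n → ℝ := φ.normed volume with hρ
  have hρs : ContDiff ℝ ∞ ρ := φ.contDiff_normed
  have hρc : HasCompactSupport ρ := φ.hasCompactSupport_normed
  have hwl : LocallyIntegrable (D.indicator w) volume :=
    (memLp_indicator hD.measurableSet hw).locallyIntegrable (by norm_num)
  have hd := HasCompactSupport.hasFDerivAt_convolution_left (𝕜 := ℝ) (μ := (volume : Measure (E n)))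
    (ContinuousLinearMap.lsmul ℝ ℝ) hρc (hρs.of_le (by exact_mod_cast le_top)) hwl x
  have hdc : Continuous (fderiv ℝ ρ) := hρs.continuous_fderiv (by simp)
  have hint : ConvolutionExistsAt (fderiv ℝ ρ) (D.indicator w) x
      (ContinuousLinearMap.precompL (E n) (ContinuousLinearMap.lsmul ℝ ℝ)) volume :=
    HasCompactSupport.convolutionExists_left _ (hρc.fderiv ℝ) hdc hwl x
  rw [hd.fderiv, convolution_def, ContinuousLinearMap.integral_apply hint]
  -- the test function `y ↦ ρ (x - y)`
  let ψ : E n → ℝ := fun y => ρ (x - y)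
  have hψ : IsTest D ψ := by
    refine ⟨hρs.comp (contDiff_const.sub contDiff_id), ?_, ?_⟩
    · exact hρc.comp_homeomorph (Homeomorph.subLeft x)
    · refine subset_trans ?_ hx
      refine closure_minimal (fun y hy => ?_) isClosed_closedBall
      have h1 : x - y ∈ Function.support ρ := hy
      rw [hρ, φ.support_normed_eq, mem_ball_zero_iff] at h1
      rw [mem_closedBall', dist_eq_norm]
      exact h1.le
  have hψd : ∀ y v, fderiv ℝ ψ y v = -fderiv ℝ ρ (x - y) v := by
    intro y v
    have h1 : HasFDerivAt (fun y : E n => x - y) (-ContinuousLinearMap.id ℝ (E n)) y :=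
      (hasFDerivAt_id y).const_sub x
    have h2 := ((hρs.differentiable (by simp)) (x - y)).hasFDerivAt.comp y h1
    have h3 : fderiv ℝ ψ y = _ := h2.fderiv
    rw [h3]
    simp
  have e1 : ∫ t, ((ContinuousLinearMap.precompL (E n) (ContinuousLinearMap.lsmul ℝ ℝ))
      (fderiv ℝ ρ t) (D.indicator w (x - t))) (EuclideanSpace.single j (1 : ℝ))
      = ∫ y, fderiv ℝ ρ (x - y) (EuclideanSpace.single j (1 : ℝ)) * D.indicator w y := by
    rw [← integral_sub_left_eq_self _ volume x]
    refine integral_congr_ae (Filter.Eventually.of_forall fun t => ?_)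
    simp [ContinuousLinearMap.precompL_apply]
  have e2 : ∫ y, fderiv ℝ ρ (x - y) (EuclideanSpace.single j (1 : ℝ)) * D.indicator w y
      = -∫ y in D, w y * fderiv ℝ ψ y (EuclideanSpace.single j (1 : ℝ)) := by
    rw [← integral_neg, ← integral_indicator hD.measurableSet]
    refine integral_congr_ae (Filter.Eventually.of_forall fun y => ?_)
    by_cases hy : y ∈ D
    · simp [hy, hψd, mul_comm]
    · simp [hy]
  rw [e1, e2, h j ψ hψ, neg_neg, convolution_def, ← integral_indicator hD.measurableSet,
    ← integral_sub_left_eq_self _ volume x]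
  refine integral_congr_ae (Filter.Eventually.of_forall fun t => ?_)
  by_cases hy : x - t ∈ D
  · simp [hy, ψ, mul_comm]
  · simp [hy]

/-! ### Integrals along segments -/

lemma lintegral_comp_affine {n : ℕ} (G : E n → ℝ≥0∞) (hG : Measurable G) {c : ℝ} (hc : c ≠ 0)
    (v : E n) : ∫⁻ b, G (c • b + v) = ENNReal.ofReal |(c ^ n)⁻¹| * ∫⁻ y, G y := by
  have h1 : ∫⁻ b, G (c • b + v) = ∫⁻ y, G (y + v) ∂(Measure.map (c • ·) (volume : Measure (E n))) :=
    (lintegral_map (hG.comp (measurable_id.add_const v)) (measurable_const_smul c)).symm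
  rw [h1, Measure.map_addHaar_smul _ hc, lintegral_smul_measure, lintegral_add_right_eq_self]
  simp

/-- Averaging a nonnegative function over the segments between two bounded sets. -/
lemma lintegral_segments_le {n : ℕ} {X B : Set (E n)} {V : ℝ≥0∞}
    (hXV : volume X ≤ V) (hBV : volume B ≤ V) (G : E n → ℝ≥0∞) (hG : Measurable G) :
    ∫⁻ x in X, ∫⁻ b in B, ∫⁻ t in Ioc (0 : ℝ) 1, G (b + t • (x - b))
      ≤ 2 ^ n * V * ∫⁻ y, G y := by
  have hm : Measurable fun p : (E n × E n) × ℝ => G (p.1.2 + p.2 • (p.1.1 - p.1.2)) :=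
    hG.comp (by fun_prop)
  have hhalf : ∀ t : ℝ, 1 / 2 ≤ t → t ≤ 1 → ENNReal.ofReal |(t ^ n)⁻¹| ≤ 2 ^ n := by
    intro t h0 h1
    have ht : 0 < t := by linarith
    rw [abs_of_nonneg (by positivity), ← inv_pow, ENNReal.ofReal_pow (by positivity)]
    gcongr
    rw [show (2 : ℝ≥0∞) = ENNReal.ofReal 2 by norm_num]
    refine ENNReal.ofReal_le_ofReal ?_
    rw [inv_le_comm₀ ht (by norm_num)]
    linarith
  have key : ∀ t ∈ Ioc (0 : ℝ) 1, ∫⁻ x in X, ∫⁻ b in B, G (b + t • (x - b))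
      ≤ 2 ^ n * V * ∫⁻ y, G y := by
    intro t ht
    by_cases h : t ≤ 1 / 2
    · calc _ ≤ ∫⁻ x in X, 2 ^ n * ∫⁻ y, G y := by
            refine lintegral_mono fun x => (setLIntegral_le_lintegral _ _).trans ?_
            have e : ∀ b : E n, b + t • (x - b) = (1 - t) • b + t • x := by
              intro b; module
            simp only [e]
            rw [lintegral_comp_affine G hG (by linarith)]
            gcongr
            exact hhalf _ (by linarith) (by linarith [ht.1])
        _ = 2 ^ n * volume X * ∫⁻ y, G y := by
            rw [setLIntegral_const]; ring
        _ ≤ _ := by gcongr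
    · have hsw : AEMeasurable (Function.uncurry fun (x b : E n) => G (b + t • (x - b)))
          ((volume.restrict X).prod (volume.restrict B)) :=
        (hG.comp (by fun_prop : Measurable fun p : E n × E n =>
          p.2 + t • (p.1 - p.2))).aemeasurable
      rw [lintegral_lintegral_swap hsw]
      calc _ ≤ ∫⁻ b in B, 2 ^ n * ∫⁻ y, G y := by
            refine lintegral_mono fun b => (setLIntegral_le_lintegral _ _).trans ?_
            have e : ∀ x : E n, b + t • (x - b) = t • x + (1 - t) • b := by
              intro x; module
            simp only [e]
            rw [lintegral_comp_affine G hG (by linarith)]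
            gcongr
            exact hhalf _ (by linarith) ht.2
        _ = 2 ^ n * volume B * ∫⁻ y, G y := by
            rw [setLIntegral_const]; ring
        _ ≤ _ := by gcongr
  -- integrate in `t` last
  have h1 : ∀ x, ∫⁻ b in B, ∫⁻ t in Ioc (0 : ℝ) 1, G (b + t • (x - b))
      = ∫⁻ t in Ioc (0 : ℝ) 1, ∫⁻ b in B, G (b + t • (x - b)) := by
    intro x
    refine lintegral_lintegral_swap (hG.comp ?_).aemeasurable
    fun_prop
  simp only [h1]
  rw [lintegral_lintegral_swap]
  · calc _ ≤ ∫⁻ t in Ioc (0 : ℝ) 1, 2 ^ n * V * ∫⁻ y, G y :=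
          setLIntegral_mono' measurableSet_Ioc key
      _ = _ := by rw [setLIntegral_const]; simp
  · have : Measurable (fun q : (E n × ℝ) × E n => G (q.2 + q.1.2 • (q.1.1 - q.2))) :=
      hG.comp (by fun_prop)
    exact (Measurable.lintegral_prod_right (ν := volume.restrict B) this).aemeasurable

lemma fderiv_apply_sq_le {n : ℕ} (l : E n →L[ℝ] ℝ) (v : E n) :
    ‖l v‖ₑ ^ 2 ≤ ‖v‖ₑ ^ 2 * ∑ j, ‖l (EuclideanSpace.single j (1 : ℝ))‖ₑ ^ 2 := by
  have h : (l v) ^ 2 ≤ ‖v‖ ^ 2 * ∑ j, (l (EuclideanSpace.single j (1 : ℝ))) ^ 2 := by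
    rw [show l v = _ from linear_expand (l : E n →ₗ[ℝ] ℝ) v, EuclideanSpace.norm_sq_eq]
    simp only [Real.norm_eq_abs, sq_abs]
    exact Finset.sum_mul_sq_le_sq_mul_sq _ _ _
  have e : ∀ r : ℝ, ‖r‖ₑ ^ 2 = ENNReal.ofReal (r ^ 2) := by
    intro r
    rw [← sq_abs, ENNReal.ofReal_pow (abs_nonneg r), ← Real.norm_eq_abs, ofReal_norm]
  simp only [e]
  rw [← ENNReal.ofReal_sum_of_nonneg (fun _ _ => sq_nonneg _), ← ofReal_norm v,
    ← ENNReal.ofReal_pow (norm_nonneg v), ← ENNReal.ofReal_mul (by positivity)]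
  exact ENNReal.ofReal_le_ofReal h

/-- The mean value inequality in quadratic mean. -/
lemma sub_sq_le_lintegral_segment {n : ℕ} {W : E n → ℝ} (hW : ContDiff ℝ 1 W) (x b : E n) :
    ‖W x - W b‖ₑ ^ 2 ≤ ‖x - b‖ₑ ^ 2 * ∫⁻ t in Ioc (0 : ℝ) 1,
      ∑ j, ‖fderiv ℝ W (b + t • (x - b)) (EuclideanSpace.single j (1 : ℝ))‖ₑ ^ 2 := by
  have hc : Continuous (fderiv ℝ W) := hW.continuous_fderiv (by simp)
  have hder : ∀ t : ℝ, HasDerivAt (fun t : ℝ => W (b + t • (x - b)))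
      (fderiv ℝ W (b + t • (x - b)) (x - b)) t := by
    intro t
    have h1 : HasDerivAt (fun t : ℝ => b + t • (x - b)) (x - b) t := by
      simpa using ((hasDerivAt_id t).smul_const (x - b)).const_add b
    exact ((hW.differentiable (by simp)) _).hasFDerivAt.comp_hasDerivAt t h1
  have hcont : Continuous fun t : ℝ => fderiv ℝ W (b + t • (x - b)) (x - b) :=
    (hc.comp (by fun_prop)).clm_apply continuous_const
  have hftc := intervalIntegral.integral_eq_sub_of_hasDerivAt (a := 0) (b := 1)
    (fun t _ => hder t) (hcont.intervalIntegrable 0 1)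
  simp only [one_smul, zero_smul, add_zero, add_sub_cancel] at hftc
  rw [← hftc, intervalIntegral.integral_of_le zero_le_one]
  have h1 := pow_le_pow_left' (enorm_integral_le_lintegral_enorm (μ := volume.restrict (Ioc 0 1))
    (fun t : ℝ => fderiv ℝ W (b + t • (x - b)) (x - b))) 2
  refine h1.trans ((lintegral_sq_le _ hcont.enorm.measurable.aemeasurable).trans ?_)
  rw [Measure.restrict_apply_univ, Real.volume_Ioc]
  simp only [sub_zero, ENNReal.ofReal_one, one_mul]
  rw [← lintegral_const_mul' _ _ (by simp)]
  exact lintegral_mono fun t => fderiv_apply_sq_le _ _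

/-! ### The Poincaré inequality on sets which are star-shaped with respect to a ball -/

/-- The Poincaré inequality in the form of a double integral: for smooth functions it follows by
integrating along segments, and the general case by mollification and Fatou's lemma. -/
theorem poincare_double {n : ℕ} {D : Set (E n)} (hD : IsOpen D) {b₀ : E n} {ρ R : ℝ}
    (hstar : ∀ x ∈ D, ∀ b ∈ closedBall b₀ ρ, segment ℝ b x ⊆ D) (hDR : D ⊆ ball b₀ R)
    {w : E n → ℝ} {g : Fin n → E n → ℝ} (hw : MemLp w 2 (volume.restrict D))
    (hg : ∀ j, MemLp (g j) 2 (volume.restrict D)) (h : IsWeakGrad D w g) :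
    ∫⁻ x in D, ∫⁻ b in closedBall b₀ ρ, ‖w x - w b‖ₑ ^ 2
      ≤ ENNReal.ofReal ((2 * R) ^ 2) * (2 ^ n * volume (ball b₀ R)) *
        ∑ j, ∫⁻ x in D, ‖g j x‖ₑ ^ 2 := by
  set B := closedBall b₀ ρ with hB
  rcases D.eq_empty_or_nonempty with rfl | ⟨x₀, hx₀⟩
  · simp
  have hBD : B ⊆ D := fun b hb => hstar x₀ hx₀ b hb (left_mem_segment ℝ b x₀)
  -- mollifiers
  let φ : ℕ → ContDiffBump (0 : E n) := fun k =>
    ⟨1 / (2 * ((k : ℝ) + 2)), 1 / ((k : ℝ) + 2), by positivity, by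
      apply one_div_lt_one_div_of_lt <;> linarith [(Nat.cast_nonneg k : (0 : ℝ) ≤ k)]⟩
  let W : ℕ → E n → ℝ := fun k => convolution ((φ k).normed volume) (D.indicator w)
    (ContinuousLinearMap.lsmul ℝ ℝ) volume
  let Gk : ℕ → Fin n → E n → ℝ := fun k j => convolution ((φ k).normed volume)
    (D.indicator (g j)) (ContinuousLinearMap.lsmul ℝ ℝ) volume
  have hwl : ∀ {u : E n → ℝ}, MemLp u 2 (volume.restrict D) →
      LocallyIntegrable (D.indicator u) volume := fun hu =>
    (memLp_indicator hD.measurableSet hu).locallyIntegrable (by norm_num)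
  have hWs : ∀ k, ContDiff ℝ 1 (W k) := fun k =>
    HasCompactSupport.contDiff_convolution_left (n := 1) _ (φ k).hasCompactSupport_normed
      (φ k).contDiff_normed (hwl hw)
  have hGs : ∀ k j, Continuous (Gk k j) := fun k j =>
    (HasCompactSupport.contDiff_convolution_left (n := 1) (𝕜 := ℝ) _
      (φ k).hasCompactSupport_normed (φ k).contDiff_normed (hwl (hg j))).continuous
  have hlim : ∀ᵐ x : E n,
      Filter.Tendsto (fun k => W k x) Filter.atTop (nhds (D.indicator w x)) := by
    refine ContDiffBump.ae_convolution_tendsto_right_of_locallyIntegrable (K := 2) ?_ ?_ (hwl hw)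
    · change Filter.Tendsto (fun k : ℕ => 1 / ((k : ℝ) + 2)) Filter.atTop (nhds 0)
      have := (tendsto_one_div_add_atTop_nhds_zero_nat (𝕜 := ℝ)).comp
        (Filter.tendsto_add_atTop_nat 1)
      refine this.congr fun k => ?_
      simp only [Function.comp]
      push_cast
      ring
    · refine Filter.Eventually.of_forall fun k => ?_
      change 1 / ((k : ℝ) + 2) ≤ 2 * (1 / (2 * ((k : ℝ) + 2)))
      have : (0 : ℝ) < (k : ℝ) + 2 := by positivity
      field_simp
      exact le_rfl
  -- the points all of whose segments to `B` have distance at least `1 / (k + 1)` to the boundary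
  let S : ℕ → Set (E n) := fun k => {x | ∀ t ∈ Icc (0 : ℝ) 1, ∀ b ∈ B,
    ENNReal.ofReal (1 / ((k : ℝ) + 1)) ≤ infEDist (b + t • (x - b)) Dᶜ}
  have hSm : ∀ k, MeasurableSet (S k) := by
    intro k
    refine IsClosed.measurableSet ?_
    simp only [S, Set.ofPred_forall]
    refine isClosed_iInter fun t => isClosed_iInter fun _ => isClosed_iInter fun b =>
      isClosed_iInter fun _ => ?_
    exact isClosed_le continuous_const (continuous_infEDist.comp (by fun_prop))
  have hSev : ∀ x ∈ D, ∀ᶠ k in Filter.atTop, x ∈ S k := by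
    intro x hx
    let C : Set (E n) := (fun p : ℝ × E n => p.2 + p.1 • (x - p.2)) '' (Icc (0 : ℝ) 1 ×ˢ B)
    have hC : IsCompact C :=
      (isCompact_Icc.prod (isCompact_closedBall b₀ ρ)).image (by fun_prop)
    have hCD : C ⊆ D := by
      rintro _ ⟨⟨t, b⟩, ⟨ht, hb⟩, rfl⟩
      refine hstar x hx b hb ?_
      rw [segment_eq_image']
      exact ⟨t, ht, rfl⟩
    obtain ⟨δ, hδ, hδD⟩ := hC.exists_thickening_subset_open hD hCD
    have : ∀ᶠ k : ℕ in Filter.atTop, 1 / ((k : ℝ) + 1) < δ :=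
      (tendsto_one_div_add_atTop_nhds_zero_nat (𝕜 := ℝ)).eventually (gt_mem_nhds hδ)
    filter_upwards [this] with k hk t ht b hb
    rw [le_infEDist]
    intro z hz
    by_contra hlt
    rw [not_le] at hlt
    refine hz (hδD ?_)
    rw [mem_thickening_iff]
    refine ⟨_, ⟨(t, b), ⟨ht, hb⟩, rfl⟩, ?_⟩
    rw [edist_dist, ENNReal.ofReal_lt_ofReal_iff (by positivity)] at hlt
    rw [dist_comm]
    exact hlt.trans hk
  have hSball : ∀ k, ∀ x ∈ S k, ∀ b ∈ B, ∀ t ∈ Icc (0 : ℝ) 1,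
      closedBall (b + t • (x - b)) (φ k).rOut ⊆ D := by
    intro k x hx b hb t ht z hz
    by_contra hzD
    have h1 := (hx t ht b hb).trans (infEDist_le_edist_of_mem (show z ∈ Dᶜ from hzD))
    rw [edist_dist, ENNReal.ofReal_le_ofReal_iff dist_nonneg, dist_comm] at h1
    have h2 : dist z (b + t • (x - b)) ≤ 1 / ((k : ℝ) + 2) := hz
    have h3 : 1 / ((k : ℝ) + 2) < 1 / ((k : ℝ) + 1) := by
      apply one_div_lt_one_div_of_lt <;> linarith [(Nat.cast_nonneg k : (0 : ℝ) ≤ k)]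
    linarith
  set M : ℝ≥0∞ := ENNReal.ofReal ((2 * R) ^ 2) * (2 ^ n * volume (ball b₀ R)) *
        ∑ j, ∫⁻ x in D, ‖g j x‖ₑ ^ 2 with hM
  let μ2 := (volume.restrict D).prod (volume.restrict B)
  let f : ℕ → E n × E n → ℝ≥0∞ := fun k p => (S k).indicator 1 p.1 * ‖W k p.1 - W k p.2‖ₑ ^ 2
  have hfm : ∀ k, Measurable (f k) := by
    intro k
    have h1 : Measurable fun p : E n × E n => (S k).indicator (1 : E n → ℝ≥0∞) p.1 :=
      (measurable_one.indicator (hSm k)).comp measurable_fst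
    have h2 : Continuous fun p : E n × E n => W k p.1 - W k p.2 :=
      ((hWs k).continuous.comp continuous_fst).sub ((hWs k).continuous.comp continuous_snd)
    exact h1.mul (h2.enorm.measurable.pow_const 2)
  have hfk : ∀ k, ∫⁻ p, f k p ∂μ2 ≤ M := by
    intro k
    let Gs : E n → ℝ≥0∞ := fun y => ∑ j, ‖Gk k j y‖ₑ ^ 2
    have hGm : Measurable Gs :=
      Finset.measurable_sum _ fun j _ => (hGs k j).enorm.measurable.pow_const 2
    have hGi : ∫⁻ y, Gs y ≤ ∑ j, ∫⁻ x in D, ‖g j x‖ₑ ^ 2 := by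
      rw [lintegral_finsetSum _ fun j _ => (hGs k j).enorm.measurable.pow_const 2]
      refine Finset.sum_le_sum fun j _ => ?_
      refine (lintegral_convolution_sq_le (φ k) (memLp_indicator hD.measurableSet (hg j)).1).trans
        (le_of_eq ?_)
      rw [← lintegral_indicator hD.measurableSet]
      refine lintegral_congr fun x => ?_
      by_cases hx : x ∈ D <;> simp [hx]
    rw [lintegral_prod _ (hfm k).aemeasurable]
    calc _ ≤ ∫⁻ x in D, ∫⁻ b in B, ENNReal.ofReal ((2 * R) ^ 2) *
          ∫⁻ t in Ioc (0 : ℝ) 1, Gs (b + t • (x - b)) := by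
          refine setLIntegral_mono' hD.measurableSet fun x hx => ?_
          refine setLIntegral_mono' (s := B) isClosed_closedBall.measurableSet fun b hb => ?_
          by_cases hxS : x ∈ S k
          · simp only [f, hxS, indicator_of_mem, Pi.one_apply, one_mul]
            refine (sub_sq_le_lintegral_segment (hWs k) x b).trans (mul_le_mul' ?_ ?_)
            · have hxb : ‖x - b‖ ≤ 2 * R := by
                have h1 := mem_ball.1 (hDR hx)
                have h2 := mem_ball.1 (hDR (hBD hb))
                rw [← dist_eq_norm]
                linarith [dist_triangle_right x b b₀]
              rw [← ofReal_norm, ← ENNReal.ofReal_pow (norm_nonneg _)]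
              exact ENNReal.ofReal_le_ofReal (pow_le_pow_left₀ (norm_nonneg _) hxb 2)
            · refine setLIntegral_mono' (s := Ioc (0 : ℝ) 1) measurableSet_Ioc
                fun t ht => le_of_eq ?_
              refine Finset.sum_congr rfl fun j _ => ?_
              rw [fderiv_mollify hD hw h (φ k) (hSball k x hxS b hb t ⟨ht.1.le, ht.2⟩) j]
          · simp [f, hxS]
      _ = ENNReal.ofReal ((2 * R) ^ 2) * ∫⁻ x in D, ∫⁻ b in B,
          ∫⁻ t in Ioc (0 : ℝ) 1, Gs (b + t • (x - b)) := by
          simp only [lintegral_const_mul' _ _ ENNReal.ofReal_ne_top]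
      _ ≤ ENNReal.ofReal ((2 * R) ^ 2) * (2 ^ n * volume (ball b₀ R) * ∫⁻ y, Gs y) := by
          gcongr
          exact lintegral_segments_le (measure_mono hDR) (measure_mono (hBD.trans hDR)) Gs hGm
      _ ≤ M := by
          rw [hM, mul_assoc (ENNReal.ofReal _)]
          gcongr
  have hBm : volume.restrict B ≤ volume.restrict D := Measure.restrict_mono hBD le_rfl
  have hmeas : AEMeasurable (fun p : E n × E n => ‖w p.1 - w p.2‖ₑ ^ 2) μ2 := by
    have h1 : AEStronglyMeasurable (fun p : E n × E n => w p.1) μ2 :=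
      hw.1.comp_quasiMeasurePreserving Measure.quasiMeasurePreserving_fst
    have h2 : AEStronglyMeasurable (fun p : E n × E n => w p.2) μ2 :=
      (hw.1.mono_measure hBm).comp_quasiMeasurePreserving Measure.quasiMeasurePreserving_snd
    exact (h1.sub h2).enorm.pow_const 2
  calc ∫⁻ x in D, ∫⁻ b in B, ‖w x - w b‖ₑ ^ 2
      = ∫⁻ p, ‖w p.1 - w p.2‖ₑ ^ 2 ∂μ2 := (lintegral_prod _ hmeas).symm
    _ ≤ ∫⁻ p, Filter.liminf (fun k => f k p) Filter.atTop ∂μ2 := by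
        refine lintegral_mono_ae ?_
        have a1 : ∀ᵐ p ∂μ2, p.1 ∈ D ∧
            Filter.Tendsto (fun k => W k p.1) Filter.atTop (nhds (D.indicator w p.1)) := by
          refine Measure.quasiMeasurePreserving_fst.ae
            (p := fun x => x ∈ D ∧ Filter.Tendsto (fun k => W k x) Filter.atTop
              (nhds (D.indicator w x))) ?_
          exact (ae_restrict_mem hD.measurableSet).and (ae_restrict_of_ae hlim)
        have a2 : ∀ᵐ p ∂μ2, p.2 ∈ B ∧
            Filter.Tendsto (fun k => W k p.2) Filter.atTop (nhds (D.indicator w p.2)) := by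
          refine Measure.quasiMeasurePreserving_snd.ae
            (p := fun x => x ∈ B ∧ Filter.Tendsto (fun k => W k x) Filter.atTop
              (nhds (D.indicator w x))) ?_
          exact (ae_restrict_mem (isClosed_closedBall (x := b₀) (ε := ρ)).measurableSet).and
            (ae_restrict_of_ae hlim)
        filter_upwards [a1, a2] with p hp1 hp2
        refine le_of_eq ?_
        have ht : Filter.Tendsto (fun k => f k p) Filter.atTop (nhds (‖w p.1 - w p.2‖ₑ ^ 2)) := by
          have h1 := hp1.2.sub hp2.2
          rw [indicator_of_mem hp1.1, indicator_of_mem (hBD hp2.1)] at h1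
          have h2 : Filter.Tendsto (fun k => ‖W k p.1 - W k p.2‖ₑ ^ 2) Filter.atTop
              (nhds (‖w p.1 - w p.2‖ₑ ^ 2)) := ENNReal.Tendsto.pow h1.enorm
          refine h2.congr' ?_
          filter_upwards [hSev p.1 hp1.1] with k hk
          simp [f, hk]
        exact ht.liminf_eq.symm
    _ ≤ Filter.liminf (fun k => ∫⁻ p, f k p ∂μ2) Filter.atTop :=
        lintegral_liminf_le' fun k => (hfm k).aemeasurable
    _ ≤ M := Filter.liminf_le_of_le (by isBoundedDefault) fun b hb => by
        obtain ⟨k, hk⟩ := hb.exists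
        exact hk.trans (hfk k)

/-! ### Polynomial calculus -/

lemma contDiff_eval {n : ℕ} (p : MvPolynomial (Fin n) ℝ) {k : WithTop ℕ∞} :
    ContDiff ℝ k (fun x : E n => MvPolynomial.eval x p) := by
  induction p using MvPolynomial.induction_on with
  | C a => simpa using contDiff_const
  | add p q hp hq => simpa using hp.add hq
  | mul_X p i hp =>
    simp only [map_mul, MvPolynomial.eval_X]
    exact hp.mul (EuclideanSpace.proj i : E n →L[ℝ] ℝ).contDiff

lemma fderiv_eval {n : ℕ} (p : MvPolynomial (Fin n) ℝ) (x : E n) (j : Fin n) :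
    fderiv ℝ (fun x : E n => MvPolynomial.eval x p) x (EuclideanSpace.single j (1 : ℝ))
      = MvPolynomial.eval x (MvPolynomial.pderiv j p) := by
  have hd : ∀ p : MvPolynomial (Fin n) ℝ,
      DifferentiableAt ℝ (fun x : E n => MvPolynomial.eval x p) x := fun p =>
    ((contDiff_eval p (k := 1)).differentiable (by simp)) x
  induction p using MvPolynomial.induction_on with
  | C a => simp
  | add p q hp hq =>
    simp only [map_add]
    rw [← hp, ← hq, fderiv_fun_add (hd p) (hd q)]
    rfl
  | mul_X p i hp =>
    have hi : HasFDerivAt (fun x : E n => x i) (EuclideanSpace.proj i : E n →L[ℝ] ℝ) x :=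
      (EuclideanSpace.proj i : E n →L[ℝ] ℝ).hasFDerivAt
    simp only [map_mul, MvPolynomial.eval_X, Derivation.leibniz, map_add, smul_eq_mul]
    rw [fderiv_fun_mul (hd p) hi.differentiableAt, hi.fderiv, ← hp]
    classical
    simp [MvPolynomial.pderiv_X, Pi.single_apply, eq_comm, apply_ite]

/-- The partial derivative `∂^β` of polynomials. -/
def polyDeriv {n : ℕ} (β : Fin n →₀ ℕ) :
    MvPolynomial (Fin n) ℝ →ₗ[ℝ] MvPolynomial (Fin n) ℝ :=
  (MvPolynomial.basisMonomials (Fin n) ℝ).constr ℝ fun γ =>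
    MvPolynomial.monomial (γ - β) (∏ i, ((γ i).descFactorial (β i) : ℝ))

lemma polyDeriv_monomial {n : ℕ} (β γ : Fin n →₀ ℕ) (a : ℝ) :
    polyDeriv β (MvPolynomial.monomial γ a)
      = MvPolynomial.monomial (γ - β) (a * ∏ i, ((γ i).descFactorial (β i) : ℝ)) := by
  have h1 : MvPolynomial.monomial γ a = a • MvPolynomial.basisMonomials (Fin n) ℝ γ := by
    simp [MvPolynomial.smul_monomial]
  rw [h1, map_smul, polyDeriv, Module.Basis.constr_basis, MvPolynomial.smul_monomial, smul_eq_mul]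

lemma polyDeriv_zero {n : ℕ} (p : MvPolynomial (Fin n) ℝ) : polyDeriv 0 p = p := by
  induction p using MvPolynomial.induction_on' with
  | monomial γ a => rw [polyDeriv_monomial]; simp
  | add p q hp hq => rw [map_add, hp, hq]

lemma pderiv_polyDeriv {n : ℕ} (β : Fin n →₀ ℕ) (j : Fin n) (p : MvPolynomial (Fin n) ℝ) :
    MvPolynomial.pderiv j (polyDeriv β p) = polyDeriv (β + Finsupp.single j 1) p := by
  classical
  induction p using MvPolynomial.induction_on' with
  | monomial γ a =>
    rw [polyDeriv_monomial, polyDeriv_monomial, MvPolynomial.pderiv_monomial, tsub_tsub]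
    congr 1
    rw [mul_assoc]
    congr 1
    rw [← Finset.mul_prod_erase Finset.univ (fun i => ((γ i).descFactorial (β i) : ℝ))
        (Finset.mem_univ j),
      ← Finset.mul_prod_erase Finset.univ (fun i => ((γ i).descFactorial
        ((β + (Finsupp.single j 1 : Fin n →₀ ℕ)) i) : ℝ)) (Finset.mem_univ j)]
    have h1 : ((γ j).descFactorial ((β + (Finsupp.single j 1 : Fin n →₀ ℕ)) j) : ℝ)
        = ((γ - β) j : ℕ) * (γ j).descFactorial (β j) := by
      simp [Nat.descFactorial_succ]
    have h2 : ∏ i ∈ Finset.univ.erase j,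
        ((γ i).descFactorial ((β + (Finsupp.single j 1 : Fin n →₀ ℕ)) i) : ℝ)
        = ∏ i ∈ Finset.univ.erase j, ((γ i).descFactorial (β i) : ℝ) := by
      refine Finset.prod_congr rfl fun i hi => ?_
      have : j ≠ i := (Finset.ne_of_mem_erase hi).symm
      simp [this]
    rw [h1, h2]
    ring
  | add p q hp hq => simp only [map_add, hp, hq]

/-- The multi-indices of order `k`. -/
def multiIndices (n k : ℕ) : Finset (Fin n →₀ ℕ) := Finset.univ.finsuppAntidiag k

lemma mem_multiIndices {n k : ℕ} {β : Fin n →₀ ℕ} : β ∈ multiIndices n k ↔ β.degree = k := by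
  simp [multiIndices, Finset.mem_finsuppAntidiag, Finsupp.degree_eq_sum]

/-- A homogeneous polynomial is determined by prescribing its derivatives of top order. -/
lemma polyDeriv_sum_monomial {n k : ℕ} (d : (Fin n →₀ ℕ) → ℝ) (β : Fin n →₀ ℕ)
    (hβ : k ≤ β.degree) :
    polyDeriv β (∑ γ ∈ multiIndices n k,
        MvPolynomial.monomial γ (d γ / ∏ i, ((γ i).factorial : ℝ)))
      = MvPolynomial.C (if β.degree = k then d β else 0) := by
  rw [map_sum]
  have hzero : ∀ γ ∈ multiIndices n k, γ ≠ β → ∏ i, ((γ i).descFactorial (β i) : ℝ) = 0 := by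
    intro γ hγ hne
    rw [mem_multiIndices] at hγ
    have : ∃ i, γ i < β i := by
      by_contra! h
      refine hne (Finsupp.ext fun i => ?_)
      have hs : ∑ i, β i = ∑ i, γ i := by
        have h1 : ∑ i, β i ≤ ∑ i, γ i := Finset.sum_le_sum fun i _ => h i
        rw [← Finsupp.degree_eq_sum, ← Finsupp.degree_eq_sum] at h1 ⊢
        omega
      exact ((Finset.sum_eq_sum_iff_of_le (fun i _ => h i)).1 hs i (Finset.mem_univ i)).symm
    obtain ⟨i, hi⟩ := this
    exact Finset.prod_eq_zero (Finset.mem_univ i)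
      (by exact_mod_cast Nat.descFactorial_eq_zero_iff_lt.2 hi)
  split_ifs with h
  · rw [Finset.sum_eq_single β]
    · rw [polyDeriv_monomial]
      have : ∏ i, ((β i).factorial : ℝ) ≠ 0 :=
        Finset.prod_ne_zero_iff.2 fun i _ => by exact_mod_cast (Nat.factorial_ne_zero _)
      simp only [tsub_self, Nat.descFactorial_self]
      rw [div_mul_cancel₀ _ this]
      rfl
    · intro γ hγ hne
      rw [polyDeriv_monomial, hzero γ hγ hne]
      simp
    · intro h'
      exact absurd (mem_multiIndices.2 h) h'
  · rw [map_zero]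
    refine Finset.sum_eq_zero fun γ hγ => ?_
    rw [polyDeriv_monomial, hzero γ hγ]
    · simp
    · rintro rfl
      exact h (mem_multiIndices.1 hγ)

lemma continuous_eval {n : ℕ} (p : MvPolynomial (Fin n) ℝ) :
    Continuous (fun x : E n => MvPolynomial.eval x p) :=
  (contDiff_eval p (k := 0)).continuous

/-- There is a polynomial of degree at most `M` with prescribed means of all derivatives of order
at most `M` over a ball. Its coefficients are determined by descending induction on the degree. -/
lemma exists_poly_average {n : ℕ} (b₀ : E n) {ρ : ℝ} (hρ : 0 < ρ) (M : ℕ)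
    (c : (Fin n →₀ ℕ) → ℝ) : ∃ p : MvPolynomial (Fin n) ℝ, p.totalDegree ≤ M ∧
      (∀ β : Fin n →₀ ℕ, M < β.degree → polyDeriv β p = 0) ∧
      (∀ β : Fin n →₀ ℕ, β.degree = M → ∃ a, polyDeriv β p = MvPolynomial.C a) ∧
      ∀ β : Fin n →₀ ℕ, β.degree ≤ M →
        ⨍ x in closedBall b₀ ρ, MvPolynomial.eval x (polyDeriv β p) = c β := by
  have hint : ∀ q : MvPolynomial (Fin n) ℝ,
      IntegrableOn (fun x : E n => MvPolynomial.eval x q) (closedBall b₀ ρ) := fun q =>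
    (continuous_eval q).continuousOn.integrableOn_compact (isCompact_closedBall b₀ ρ)
  have hvol : volume (closedBall b₀ ρ) ≠ 0 := (measure_closedBall_pos volume b₀ hρ).ne'
  have hvol' : volume (closedBall b₀ ρ) ≠ ⊤ := measure_closedBall_lt_top.ne
  have key : ∀ k ≤ M + 1, ∃ p : MvPolynomial (Fin n) ℝ, p.totalDegree ≤ M ∧
      (∀ β : Fin n →₀ ℕ, M < β.degree → polyDeriv β p = 0) ∧
      (∀ β : Fin n →₀ ℕ, β.degree = M → ∃ a, polyDeriv β p = MvPolynomial.C a) ∧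
      ∀ β : Fin n →₀ ℕ, M + 1 - k ≤ β.degree → β.degree ≤ M →
        ⨍ x in closedBall b₀ ρ, MvPolynomial.eval x (polyDeriv β p) = c β := by
    intro k
    induction k with
    | zero =>
      intro _
      refine ⟨0, by simp, fun _ _ => map_zero _, fun _ _ => ⟨0, by simp⟩, ?_⟩
      intro β h1 h2
      omega
    | succ k ih =>
      intro hk
      obtain ⟨p, hp, hp0, hpc, hpa⟩ := ih (by omega)
      set l := M - k with hl
      let d : (Fin n →₀ ℕ) → ℝ := fun β =>
        c β - ⨍ x in closedBall b₀ ρ, MvPolynomial.eval x (polyDeriv β p)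
      let q : MvPolynomial (Fin n) ℝ := ∑ γ ∈ multiIndices n l,
        MvPolynomial.monomial γ (d γ / ∏ i, ((γ i).factorial : ℝ))
      have hq : ∀ β : Fin n →₀ ℕ, l ≤ β.degree →
          polyDeriv β q = MvPolynomial.C (if β.degree = l then d β else 0) :=
        fun β hβ => polyDeriv_sum_monomial d β hβ
      refine ⟨p + q, ?_, ?_, ?_, ?_⟩
      · refine (MvPolynomial.totalDegree_add _ _).trans (max_le hp ?_)
        refine MvPolynomial.totalDegree_finsetSum_le fun γ hγ => ?_
        refine (MvPolynomial.totalDegree_monomial_le _ _).trans ?_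
        have h1 := mem_multiIndices.1 hγ
        have h2 : (γ.sum fun _ => id) = γ.degree := rfl
        rw [h2, h1]
        omega
      · intro β hβ
        rw [map_add, hp0 β hβ, hq β (by omega), if_neg (by omega)]
        simp
      · intro β hβ
        obtain ⟨a, ha⟩ := hpc β hβ
        exact ⟨a + _, by rw [map_add, ha, hq β (by omega), MvPolynomial.C_add]⟩
      · intro β h1 h2
        have h3 := hq β (by omega)
        have h4 : ⨍ x in closedBall b₀ ρ, MvPolynomial.eval x (polyDeriv β (p + q))
            = (⨍ x in closedBall b₀ ρ, MvPolynomial.eval x (polyDeriv β p))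
              + (if β.degree = l then d β else 0) := by
          rw [map_add, h3]
          simp only [map_add, MvPolynomial.eval_C]
          rw [setAverage_eq, integral_add (hint _) (integrable_const_iff.2
            (Or.inr ⟨by simpa using hvol'.lt_top⟩)), smul_add, ← setAverage_eq]
          congr 1
          rw [integral_const, measureReal_restrict_apply_univ, smul_smul, inv_mul_cancel₀, one_smul]
          exact (ENNReal.toReal_pos hvol hvol').ne'
        rw [h4]
        split_ifs with h
        · simp [d]
        · rw [add_zero]
          exact hpa β (by omega) h2
  obtain ⟨p, h1, h2, h3, h4⟩ := key (M + 1) le_rfl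
  exact ⟨p, h1, h2, h3, fun β hβ => h4 β (by omega) hβ⟩

/-! ### Weak gradients -/

lemma setIntegral_eq_of_support {n : ℕ} {D Ω : Set (E n)}
    (hΩ : MeasurableSet Ω) (hDΩ : D ⊆ Ω) {f : E n → ℝ} (hf : ∀ x, x ∉ D → f x = 0) :
    ∫ x in D, f x = ∫ x in Ω, f x :=
  (setIntegral_eq_of_subset_of_forall_sdiff_eq_zero hΩ hDΩ fun x hx => hf x hx.2).symm

lemma IsTest.mono {n : ℕ} {D Ω : Set (E n)} (hDΩ : D ⊆ Ω) {φ : E n → ℝ} (h : IsTest D φ) :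
    IsTest Ω φ := ⟨h.1, h.2.1, h.2.2.trans hDΩ⟩

lemma IsTest.eq_zero {n : ℕ} {D : Set (E n)} {φ : E n → ℝ} (h : IsTest D φ) {x : E n}
    (hx : x ∉ D) : φ x = 0 := image_eq_zero_of_notMem_tsupport fun h' => hx (h.2.2 h')

lemma IsTest.fderiv_eq_zero {n : ℕ} {D : Set (E n)} {φ : E n → ℝ} (h : IsTest D φ) {x : E n}
    (hx : x ∉ D) : fderiv ℝ φ x = 0 :=
  image_eq_zero_of_notMem_tsupport fun h' => hx (h.2.2 (tsupport_fderiv_subset ℝ h'))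

lemma IsTest.deriv {n : ℕ} {D : Set (E n)} {φ : E n → ℝ} (h : IsTest D φ) (v : E n) :
    IsTest D (fun x => fderiv ℝ φ x v) := by
  refine ⟨(h.1.fderiv_right (m := ∞) (by simp)).clm_apply contDiff_const, ?_, ?_⟩
  · exact h.2.1.fderiv_apply ℝ v
  · exact (tsupport_fderiv_apply_subset ℝ v).trans h.2.2

lemma IsTest.memLp_fderiv {n : ℕ} {D : Set (E n)} {φ : E n → ℝ} (h : IsTest D φ) (v : E n)
    (Ω : Set (E n)) : MemLp (fun x => fderiv ℝ φ x v) 2 (volume.restrict Ω) :=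
  test_memLp (h.deriv v |>.mono (subset_univ D)) |>.mono_measure
    (by rw [Measure.restrict_univ]; exact Measure.restrict_le_self)

lemma IsTest.memLp {n : ℕ} {D : Set (E n)} {φ : E n → ℝ} (h : IsTest D φ)
    (Ω : Set (E n)) : MemLp φ 2 (volume.restrict Ω) :=
  test_memLp (h.mono (subset_univ D)) |>.mono_measure
    (by rw [Measure.restrict_univ]; exact Measure.restrict_le_self)

lemma IsWeakGrad.mono {n : ℕ} {D Ω : Set (E n)} (hΩ : MeasurableSet Ω) (hDΩ : D ⊆ Ω)
    {w : E n → ℝ} {g : Fin n → E n → ℝ} (h : IsWeakGrad Ω w g) : IsWeakGrad D w g := by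
  intro j φ hφ
  rw [setIntegral_eq_of_support hΩ hDΩ fun x hx => by rw [hφ.fderiv_eq_zero hx]; simp,
    setIntegral_eq_of_support hΩ hDΩ fun x hx => by rw [hφ.eq_zero hx, mul_zero]]
  exact h j φ (hφ.mono hDΩ)

lemma IsWeakGrad.sub {n : ℕ} {D : Set (E n)} {w w' : E n → ℝ} {g g' : Fin n → E n → ℝ}
    (h : IsWeakGrad D w g) (h' : IsWeakGrad D w' g') (hw : MemLp w 2 (volume.restrict D))
    (hw' : MemLp w' 2 (volume.restrict D)) (hg : ∀ j, MemLp (g j) 2 (volume.restrict D))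
    (hg' : ∀ j, MemLp (g' j) 2 (volume.restrict D)) :
    IsWeakGrad D (fun x => w x - w' x) (fun j x => g j x - g' j x) := by
  intro j φ hφ
  have p := hφ.memLp_fderiv (EuclideanSpace.single j (1 : ℝ)) D
  have q := hφ.memLp D
  simp only [sub_mul]
  rw [integral_sub, integral_sub, h j φ hφ, h' j φ hφ]
  · ring
  · exact (hg j).integrable_mul q
  · exact (hg' j).integrable_mul q
  · exact hw.integrable_mul p
  · exact hw'.integrable_mul p

/-- Classical derivatives of smooth functions are weak derivatives. -/
lemma isWeakGrad_of_contDiff {n : ℕ} {D : Set (E n)} {w : E n → ℝ}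
    (hw : ContDiff ℝ 1 w) :
    IsWeakGrad D w (fun j x => fderiv ℝ w x (EuclideanSpace.single j (1 : ℝ))) := by
  intro j φ hφ
  have hc : Continuous fun x => fderiv ℝ w x (EuclideanSpace.single j (1 : ℝ)) :=
    (hw.continuous_fderiv (by simp)).clm_apply continuous_const
  have hφd := hφ.deriv (EuclideanSpace.single j (1 : ℝ))
  rw [setIntegral_eq_of_support MeasurableSet.univ (subset_univ D) fun x hx => by
      rw [hφ.fderiv_eq_zero hx]; simp,
    setIntegral_eq_of_support MeasurableSet.univ (subset_univ D) fun x hx => by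
      rw [hφ.eq_zero hx, mul_zero], Measure.restrict_univ]
  refine integral_mul_fderiv_eq_neg_fderiv_mul_of_integrable ?_ ?_ ?_
    (fun x _ => hw.differentiable (by simp) x) (fun x _ => hφ.1.differentiable (by simp) x)
  · exact (hc.mul hφ.1.continuous).integrable_of_hasCompactSupport hφ.2.1.mul_left
  · exact (hw.continuous.mul hφd.1.continuous).integrable_of_hasCompactSupport hφd.2.1.mul_left
  · exact (hw.continuous.mul hφ.1.continuous).integrable_of_hasCompactSupport hφ.2.1.mul_left

/-! ### Iterated partial derivatives and multi-indices -/

/-- The iterated partial derivative along a list of directions. -/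
def listDeriv {n : ℕ} : List (Fin n) → (E n → ℝ) → E n → ℝ
  | [], φ => φ
  | a :: l, φ => fun x => fderiv ℝ (listDeriv l φ) x (EuclideanSpace.single a (1 : ℝ))

lemma contDiff_listDeriv {n : ℕ} (l : List (Fin n)) {φ : E n → ℝ} (hφ : ContDiff ℝ ∞ φ) :
    ContDiff ℝ ∞ (listDeriv l φ) := by
  induction l with
  | nil => exact hφ
  | cons a l ih => exact (ih.fderiv_right (m := ∞) (by simp)).clm_apply contDiff_const

lemma listDeriv_append {n : ℕ} (l l' : List (Fin n)) (φ : E n → ℝ) :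
    listDeriv (l ++ l') φ = listDeriv l (listDeriv l' φ) := by
  induction l with
  | nil => rfl
  | cons a l ih => simp only [List.cons_append, listDeriv, ih]

lemma listDeriv_perm {n : ℕ} {l l' : List (Fin n)} (h : l.Perm l') {φ : E n → ℝ}
    (hφ : ContDiff ℝ ∞ φ) : listDeriv l φ = listDeriv l' φ := by
  induction h with
  | nil => rfl
  | cons a _ ih => simp only [listDeriv, ih]
  | swap a b l =>
    have hs := contDiff_listDeriv l hφ
    have hd : Differentiable ℝ (fderiv ℝ (listDeriv l φ)) :=
      (hs.fderiv_right (m := ∞) (by simp)).differentiable (by simp)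
    have e : ∀ x v w, fderiv ℝ (fun y => fderiv ℝ (listDeriv l φ) y v) x w
        = fderiv ℝ (fderiv ℝ (listDeriv l φ)) x w v := by
      intro x v w
      have h := ((hd x).hasFDerivAt.clm_apply (hasFDerivAt_const v x)).fderiv
      rw [h]
      simp
    funext x
    simp only [listDeriv]
    rw [e, e]
    exact ((contDiff_infty.1 hs 2).contDiffAt.isSymmSndFDerivAt (by simp)) _ _
  | trans _ _ ih1 ih2 => exact ih1.trans ih2

lemma partialDeriv_eq_listDeriv {n k : ℕ} (i : Fin k → Fin n) {φ : E n → ℝ}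
    (hφ : ContDiff ℝ ∞ φ) : partialDeriv i φ = listDeriv (List.ofFn i) φ := by
  induction k with
  | zero =>
    funext x
    simp [partialDeriv, listDeriv]
  | succ k ih =>
    rw [List.ofFn_succ]
    funext x
    simp only [listDeriv]
    rw [← ih (fun j => i j.succ)]
    unfold partialDeriv
    rw [iteratedFDeriv_succ_apply_left]
    have hd : DifferentiableAt ℝ (iteratedFDeriv ℝ k φ) x :=
      (hφ.differentiable_iteratedFDeriv (by exact_mod_cast ENat.natCast_lt_top k)) x
    rw [show (fun x => (iteratedFDeriv ℝ k φ x) fun j => EuclideanSpace.single (i j.succ) (1 : ℝ))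
      = (ContinuousMultilinearMap.apply ℝ (fun _ : Fin k => E n) ℝ
          (fun j => EuclideanSpace.single (i j.succ) (1 : ℝ))) ∘ (iteratedFDeriv ℝ k φ) from rfl,
      fderiv_comp x (ContinuousLinearMap.differentiableAt _) hd, ContinuousLinearMap.fderiv]
    rfl

/-- A list of directions representing the multi-index `β`. -/
def multiList {n : ℕ} (β : Fin n →₀ ℕ) : List (Fin n) := (Finsupp.toMultiset β).toList

lemma multiList_length {n : ℕ} (β : Fin n →₀ ℕ) : (multiList β).length = β.degree := by
  rw [multiList, Multiset.length_toList, Finsupp.card_toMultiset]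
  rfl

/-- The multi-index derivative of a family of derivatives indexed by tuples of directions. -/
def multiFam {n : ℕ} {Ω : Set (E n)} (D : (k : ℕ) → (Fin k → Fin n) → L2 Ω)
    (β : Fin n →₀ ℕ) : L2 Ω := D (multiList β).length (multiList β).get

lemma multiFam_weak {n : ℕ} {Ω : Set (E n)} {u : L2 Ω}
    {D : (k : ℕ) → (Fin k → Fin n) → L2 Ω} {m : ℕ}
    (hD : ∀ k ≤ m, ∀ i : Fin k → Fin n, IsWeakPartial Ω i u (D k i))
    {β : Fin n →₀ ℕ} (hβ : β.degree ≤ m) {φ : E n → ℝ} (hφ : IsTest Ω φ) :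
    ∫ x in Ω, u x * listDeriv (multiList β) φ x
      = (-1) ^ β.degree * ∫ x in Ω, multiFam D β x * φ x := by
  have h := hD _ (by rw [multiList_length]; exact hβ) (multiList β).get φ hφ
  rw [partialDeriv_eq_listDeriv _ hφ.1, List.ofFn_get] at h
  rw [h]
  change (-1) ^ (multiList β).length * ∫ x in Ω, multiFam D β x * φ x = _
  rw [multiList_length]

/-- The multi-index derivatives are weak derivatives of each other. -/
lemma multiFam_isWeakGrad {n : ℕ} {Ω : Set (E n)} {u : L2 Ω}
    {D : (k : ℕ) → (Fin k → Fin n) → L2 Ω} {m : ℕ}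
    (hD : ∀ k ≤ m, ∀ i : Fin k → Fin n, IsWeakPartial Ω i u (D k i))
    {β : Fin n →₀ ℕ} (hβ : β.degree < m) :
    IsWeakGrad Ω (multiFam D β) (fun j => multiFam D (β + Finsupp.single j 1)) := by
  intro j φ hφ
  have h1 := multiFam_weak hD hβ.le (hφ.deriv (EuclideanSpace.single j (1 : ℝ)))
  have hdeg : (β + Finsupp.single j 1).degree = β.degree + 1 := by
    rw [map_add, Finsupp.degree_single]
  have h2 := multiFam_weak hD (β := β + Finsupp.single j 1) (by omega) hφ
  have hperm : (multiList β ++ [j]).Perm (multiList (β + Finsupp.single j 1)) := by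
    rw [← Multiset.coe_eq_coe, ← Multiset.coe_add]
    simp [multiList, Finsupp.toMultiset_single]
  have h3 : listDeriv (multiList β) (fun x => fderiv ℝ φ x (EuclideanSpace.single j (1 : ℝ)))
      = listDeriv (multiList (β + Finsupp.single j 1)) φ := by
    rw [← listDeriv_perm hperm hφ.1, listDeriv_append]
    rfl
  rw [h3, h2, hdeg, pow_succ] at h1
  have h4 : ((-1 : ℝ) ^ β.degree) * (-1) ^ β.degree = 1 := by
    rw [← mul_pow]; norm_num
  have h5 := congrArg (fun y => (-1 : ℝ) ^ β.degree * y) h1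
  simp only [← mul_assoc, h4, one_mul] at h5
  rw [← h5]
  ring

/-- Square-integrable functions with the same integrals against test functions agree. -/
lemma ae_eq_of_forall_test {n : ℕ} {Ω : Set (E n)} (hΩ : IsOpen Ω) {f g : E n → ℝ}
    (hf : MemLp f 2 (volume.restrict Ω)) (hg : MemLp g 2 (volume.restrict Ω))
    (h : ∀ φ : E n → ℝ, IsTest Ω φ → ∫ x in Ω, f x * φ x = ∫ x in Ω, g x * φ x) :
    f =ᵐ[volume.restrict Ω] g := by
  have hloc : LocallyIntegrableOn (fun x => f x - g x) Ω volume :=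
    locallyIntegrableOn_of_locallyIntegrable_restrict
      ((hf.sub hg).locallyIntegrable (by norm_num))
  have h := hΩ.ae_eq_zero_of_integral_contDiff_smul_eq_zero hloc fun φ h1 h2 h3 => by
    have hφ : IsTest Ω φ := ⟨h1, h2, h3⟩
    have h4 : ∫ x in Ω, (f x - g x) * φ x = 0 := by
      have i1 : Integrable (fun x => f x * φ x) (volume.restrict Ω) :=
        hf.integrable_mul (hφ.memLp Ω)
      have i2 : Integrable (fun x => g x * φ x) (volume.restrict Ω) :=
        hg.integrable_mul (hφ.memLp Ω)
      simp only [sub_mul]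
      rw [integral_sub i1 i2, h φ hφ, sub_self]
    rw [← h4, setIntegral_eq_integral_of_forall_compl_eq_zero]
    · refine integral_congr_ae (Filter.Eventually.of_forall fun x => ?_)
      simp [mul_comm]
    · intro x hx
      rw [image_eq_zero_of_notMem_tsupport fun h' => hx (h3 h'), mul_zero]
  rw [Filter.EventuallyEq, ae_restrict_iff' hΩ.measurableSet]
  filter_upwards [h] with x hx hxΩ
  linarith [hx hxΩ]

/-- The multi-index derivative of order zero is the function itself. -/
lemma multiFam_zero {n : ℕ} {Ω : Set (E n)} (hΩ : IsOpen Ω) {u : L2 Ω}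
    {D : (k : ℕ) → (Fin k → Fin n) → L2 Ω} {m : ℕ}
    (hD : ∀ k ≤ m, ∀ i : Fin k → Fin n, IsWeakPartial Ω i u (D k i)) :
    multiFam D 0 =ᵐ[volume.restrict Ω] u := by
  refine ae_eq_of_forall_test hΩ (Lp.memLp _) (Lp.memLp _) fun φ hφ => ?_
  have h := multiFam_weak hD (β := 0) (by simp) hφ
  have hl : multiList (0 : Fin n →₀ ℕ) = [] := by simp [multiList]
  rw [hl] at h
  simp only [listDeriv, map_zero, pow_zero, one_mul] at h
  exact h.symm

/-! ### The Bramble–Hilbert lemma -/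

lemma memLp_of_continuous_bounded {n : ℕ} {D : Set (E n)} {b₀ : E n} {R : ℝ}
    (hDR : D ⊆ ball b₀ R) {f : E n → ℝ} (hf : Continuous f) :
    MemLp f 2 (volume.restrict D) := by
  obtain ⟨C, hC⟩ := (isCompact_closedBall b₀ R).exists_bound_of_continuousOn hf.continuousOn
  have h1 : MemLp f 2 (volume.restrict (closedBall b₀ R)) := by
    have : IsFiniteMeasure (volume.restrict (closedBall b₀ R)) :=
      ⟨by simpa using measure_closedBall_lt_top⟩
    exact MemLp.of_bound hf.aestronglyMeasurable C
      ((ae_restrict_mem isClosed_closedBall.measurableSet).mono hC)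
  exact h1.mono_measure (Measure.restrict_mono (hDR.trans ball_subset_closedBall) le_rfl)

/-- The squared Sobolev seminorm of order `τ` over `D ⊆ Ω` of a function with multi-index
derivatives `U`. If `τ` is not an integer, only the outer integral of the Gagliardo seminorm is
restricted to `D`, which makes the seminorm countably subadditive in `D`. -/
def sobSeminormSq {n : ℕ} (Ω D : Set (E n)) (τ : ℝ) (U : (Fin n →₀ ℕ) → E n → ℝ) : ℝ≥0∞ :=
  if τ = ⌊τ⌋₊ then ∑ β ∈ multiIndices n ⌊τ⌋₊, ∫⁻ x in D, ‖U β x‖ₑ ^ 2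
  else ∑ β ∈ multiIndices n ⌊τ⌋₊, ∫⁻ x in D, ∫⁻ y in Ω,
    ‖U β x - U β y‖ₑ ^ 2 / edist x y ^ ((n : ℝ) + 2 * (τ - ⌊τ⌋₊))

/-- Bramble–Hilbert: on a set `D` which is star-shaped with respect to a ball of radius `h` and of
diameter comparable to `h`, a function with weak derivatives up to order `τ` differs from a
polynomial of degree less than `τ` by the seminorm of order `τ`, with the natural powers of `h`.
The polynomial is chosen such that all derivatives of the difference have mean zero over the
ball, so that the Poincaré inequality can be iterated. -/
theorem bramble_hilbert (n r : ℕ) {τ : ℝ} (hτ : 1 ≤ τ) (hτr : τ ≤ r + 1) {Λ : ℝ} (hΛ : 0 < Λ) :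
    ∃ C : ℝ≥0∞, C ≠ ⊤ ∧ ∀ (Ω D : Set (E n)), IsOpen Ω → IsOpen D → D ⊆ Ω → ∀ (b₀ : E n) (h : ℝ),
      0 < h → (∀ x ∈ D, ∀ b ∈ closedBall b₀ h, segment ℝ b x ⊆ D) → D ⊆ ball b₀ (Λ * h) →
      ∀ U : (Fin n →₀ ℕ) → E n → ℝ, (∀ β, MemLp (U β) 2 (volume.restrict Ω)) →
      (∀ β : Fin n →₀ ℕ, β.degree < ⌊τ⌋₊ →
        IsWeakGrad Ω (U β) (fun j => U (β + Finsupp.single j 1))) →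
      ∃ p : MvPolynomial (Fin n) ℝ, p.totalDegree ≤ r ∧
        ∫⁻ x in D, ‖U 0 x - MvPolynomial.eval x p‖ₑ ^ 2
          ≤ C * ENNReal.ofReal (h ^ (2 * τ)) * sobSeminormSq Ω D τ U ∧
        ∀ j, ∫⁻ x in D, ‖U (Finsupp.single j 1) x
            - MvPolynomial.eval x (MvPolynomial.pderiv j p)‖ₑ ^ 2
          ≤ C * ENNReal.ofReal (h ^ (2 * (τ - 1))) * sobSeminormSq Ω D τ U := by
  set m := ⌊τ⌋₊ with hm
  have hm1 : 1 ≤ m := Nat.le_floor (by simpa using hτ)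
  have hmτ : (m : ℝ) ≤ τ := Nat.floor_le (by linarith)
  set θ := τ - m with hθ
  have hθ0 : 0 ≤ θ := by linarith
  set K₀ : ℝ≥0∞ := ENNReal.ofReal ((2 * Λ) ^ 2) * 2 ^ n * ENNReal.ofReal (Λ ^ n) with hK₀
  have hK₀t : K₀ ≠ ⊤ := by
    refine ENNReal.mul_ne_top (ENNReal.mul_ne_top ENNReal.ofReal_ne_top ?_) ENNReal.ofReal_ne_top
    exact ENNReal.pow_ne_top (by norm_num)
  set v : ℝ≥0∞ := volume (ball (0 : E n) 1) with hv
  have hv0 : v ≠ 0 := (measure_ball_pos volume _ one_pos).ne'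
  have hvt : v ≠ ⊤ := measure_ball_lt_top.ne
  set Cθ : ℝ≥0∞ := 1 + ENNReal.ofReal ((2 * Λ) ^ ((n : ℝ) + 2 * θ)) * v⁻¹ with hCθ
  have hCθt : Cθ ≠ ⊤ := by
    refine ENNReal.add_ne_top.2 ⟨by norm_num, ENNReal.mul_ne_top ENNReal.ofReal_ne_top ?_⟩
    exact ENNReal.inv_ne_top.2 hv0
  have hnK : (n : ℝ≥0∞) * K₀ ≠ ⊤ := ENNReal.mul_ne_top (ENNReal.natCast_ne_top n) hK₀t
  refine ⟨((n * K₀) ^ m + (n * K₀) ^ (m - 1)) * Cθ, ENNReal.mul_ne_top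
    (ENNReal.add_ne_top.2 ⟨ENNReal.pow_ne_top hnK, ENNReal.pow_ne_top hnK⟩) hCθt, ?_⟩
  intro Ω D hΩ hD hDΩ b₀ h hh hstar hDR U hU hgrad
  rcases D.eq_empty_or_nonempty with rfl | ⟨x₀, hx₀⟩
  · exact ⟨0, by simp, by simp, by simp⟩
  set B := closedBall b₀ h with hB
  have hBD : B ⊆ D := fun b hb => hstar x₀ hx₀ b hb (left_mem_segment ℝ b x₀)
  have hvolB : volume B = ENNReal.ofReal (h ^ n) * v := by
    rw [hB, Measure.addHaar_closedBall _ _ hh.le]; simp [hv]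
  have hΛh : 0 < Λ * h := mul_pos hΛ hh
  have hvolD : volume (ball b₀ (Λ * h)) = ENNReal.ofReal (Λ ^ n) * volume B := by
    rw [Measure.addHaar_ball_of_pos _ _ hΛh, hvolB, ← mul_assoc,
      ← ENNReal.ofReal_mul (by positivity),
      mul_pow]
    simp [hv]
  have hB0 : volume B ≠ 0 := (measure_closedBall_pos volume b₀ hh).ne'
  have hBt : volume B ≠ ⊤ := measure_closedBall_lt_top.ne
  have hBfin : IsFiniteMeasure (volume.restrict B) := ⟨by simpa using hBt.lt_top⟩
  set M : ℕ := if τ = m then m - 1 else m with hM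
  have hMr : M ≤ r := by
    rw [hM]
    split_ifs with h
    · have : (m : ℝ) ≤ r + 1 := by linarith
      have : m ≤ r + 1 := by exact_mod_cast this
      omega
    · have h1 : (m : ℝ) < r + 1 := lt_of_lt_of_le (lt_of_le_of_ne hmτ (Ne.symm h)) hτr
      have : m < r + 1 := by exact_mod_cast h1
      omega
  have hMm : m ≤ M + 1 := by rw [hM]; split_ifs <;> omega
  have hUD : ∀ β, MemLp (U β) 2 (volume.restrict D) := fun β =>
    (hU β).mono_measure (Measure.restrict_mono hDΩ le_rfl)
  have hUB : ∀ β, MemLp (U β) 2 (volume.restrict B) := fun β =>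
    (hUD β).mono_measure (Measure.restrict_mono hBD le_rfl)
  obtain ⟨p, hpd, hp0, hpc, hpa⟩ := exists_poly_average b₀ hh M (fun β => ⨍ x in B, U β x)
  let P : (Fin n →₀ ℕ) → E n → ℝ := fun β x => MvPolynomial.eval x (polyDeriv β p)
  let e : (Fin n →₀ ℕ) → E n → ℝ := fun β x => U β x - P β x
  have hPD : ∀ β, MemLp (P β) 2 (volume.restrict D) := fun β =>
    memLp_of_continuous_bounded hDR (continuous_eval _)
  have heD : ∀ β, MemLp (e β) 2 (volume.restrict D) := fun β => (hUD β).sub (hPD β)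
  have heB : ∀ β, MemLp (e β) 2 (volume.restrict B) := fun β =>
    (heD β).mono_measure (Measure.restrict_mono hBD le_rfl)
  have hegrad : ∀ β : Fin n →₀ ℕ, β.degree < m →
      IsWeakGrad D (e β) (fun j => e (β + Finsupp.single j 1)) := by
    intro β hβ
    have h1 := (hgrad β hβ).mono hΩ.measurableSet hDΩ
    have h2 := isWeakGrad_of_contDiff (D := D) (contDiff_eval (polyDeriv β p) (k := 1))
    simp only [fderiv_eval, pderiv_polyDeriv] at h2
    exact h1.sub h2 (hUD β) (hPD β) (fun j => hUD _) (fun j => hPD _)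
  have heavg : ∀ β : Fin n →₀ ℕ, β.degree ≤ M → ⨍ x in B, e β x = 0 := by
    intro β hβ
    have h1 := hpa β hβ
    rw [setAverage_eq] at h1 ⊢
    rw [integral_sub ((hUB β).integrable (by norm_num))
      (((hPD β).mono_measure (Measure.restrict_mono hBD le_rfl)).integrable (by norm_num)),
      smul_sub, h1, ← setAverage_eq, sub_self]
  let a : (Fin n →₀ ℕ) → ℝ≥0∞ := fun β => ∫⁻ x in D, ‖e β x‖ₑ ^ 2
  have hmean : ∀ β : Fin n →₀ ℕ, β.degree ≤ M →
      volume B * a β ≤ ∫⁻ x in D, ∫⁻ b in B, ‖e β x - e β b‖ₑ ^ 2 := by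
    intro β hβ
    rw [← lintegral_const_mul' _ _ hBt]
    refine lintegral_mono fun x => ?_
    have := sub_average_sq_le hB0 hBt (heB β) (e β x)
    rwa [heavg β hβ, sub_zero] at this
  -- one application of the Poincaré inequality
  have hstep : ∀ β : Fin n →₀ ℕ, β.degree < m →
      a β ≤ K₀ * ENNReal.ofReal (h ^ 2) * ∑ j, a (β + Finsupp.single j 1) := by
    intro β hβ
    have h1 := (hmean β (by omega)).trans (poincare_double hD hstar hDR (heD β)
      (fun j => heD _) (hegrad β hβ))
    rw [hvolD] at h1
    refine (ENNReal.mul_le_mul_iff_right hB0 hBt).1 (h1.trans (le_of_eq ?_))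
    have h2 : ENNReal.ofReal ((2 * (Λ * h)) ^ 2)
        = ENNReal.ofReal ((2 * Λ) ^ 2) * ENNReal.ofReal (h ^ 2) := by
      rw [← ENNReal.ofReal_mul (by positivity)]
      congr 1
      ring
    rw [h2, hK₀]
    ring
  set T := ∑ β ∈ multiIndices n m, a β with hT
  have hiter : ∀ k, ∀ β : Fin n →₀ ℕ, β.degree + k = m →
      a β ≤ (n * (K₀ * ENNReal.ofReal (h ^ 2))) ^ k * T := by
    intro k
    induction k with
    | zero =>
      intro β hβ
      rw [pow_zero, one_mul]
      exact Finset.single_le_sum (f := a) (fun _ _ => zero_le) (mem_multiIndices.2 (by omega))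
    | succ k ih =>
      intro β hβ
      have h1 : ∀ j : Fin n, a (β + Finsupp.single j 1)
          ≤ (n * (K₀ * ENNReal.ofReal (h ^ 2))) ^ k * T := by
        intro j
        refine ih _ ?_
        rw [map_add, Finsupp.degree_single]
        omega
      calc a β ≤ K₀ * ENNReal.ofReal (h ^ 2) * ∑ j, a (β + Finsupp.single j 1) :=
            hstep β (by omega)
        _ ≤ K₀ * ENNReal.ofReal (h ^ 2) *
            ∑ _j : Fin n, (n * (K₀ * ENNReal.ofReal (h ^ 2))) ^ k * T := by
            gcongr with j
            exact h1 j
        _ = _ := by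
            rw [Finset.sum_const, Finset.card_univ, Fintype.card_fin, nsmul_eq_mul]
            ring
  -- the derivatives of top order
  set Q := sobSeminormSq Ω D τ U with hQ
  have htop : T ≤ Cθ * ENNReal.ofReal (h ^ (2 * θ)) * Q := by
    by_cases hint : τ = m
    · have hM' : M = m - 1 := by rw [hM, if_pos hint]
      have hθz : θ = 0 := by rw [hθ, ← hint]; ring
      have h1 : T ≤ Q := by
        refine le_of_eq ?_
        calc T = ∑ β ∈ multiIndices n m, ∫⁻ x in D, ‖U β x‖ₑ ^ 2 := by
              refine Finset.sum_congr rfl fun β hβ => ?_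
              have : β.degree = m := mem_multiIndices.1 hβ
              have h0 : polyDeriv β p = 0 := hp0 β (by omega)
              simp [a, e, P, h0]
          _ = Q := by rw [hQ, sobSeminormSq, ← hm, if_pos hint]
      calc T ≤ 1 * 1 * Q := by simpa using h1
        _ ≤ _ := by
          rw [hθz]
          simp only [mul_zero, Real.rpow_zero, ENNReal.ofReal_one]
          gcongr
          rw [hCθ]
          exact le_self_add
    · have hM' : M = m := by rw [hM, if_neg hint]
      set q : ℝ := (n : ℝ) + 2 * θ with hq
      have hθpos : 0 < θ := lt_of_le_of_ne hθ0 (fun h => hint (by rw [hθ] at h; linarith))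
      have hqpos : 0 < q := by positivity
      have h1 : ∀ β ∈ multiIndices n m, a β ≤ Cθ * ENNReal.ofReal (h ^ (2 * θ)) *
          ∫⁻ x in D, ∫⁻ y in Ω, ‖U β x - U β y‖ₑ ^ 2 / edist x y ^ q := by
        intro β hβ
        have hβm : β.degree = m := mem_multiIndices.1 hβ
        obtain ⟨c, hc⟩ := hpc β (by omega)
        have h2 := hmean β (by omega)
        have h3 : ∀ x b, e β x - e β b = U β x - U β b := by
          intro x b
          simp [e, P, hc]
        simp only [h3] at h2
        have h4 : ∫⁻ x in D, ∫⁻ b in B, ‖U β x - U β b‖ₑ ^ 2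
            ≤ ENNReal.ofReal ((2 * (Λ * h)) ^ q) *
              ∫⁻ x in D, ∫⁻ y in Ω, ‖U β x - U β y‖ₑ ^ 2 / edist x y ^ q := by
          rw [← lintegral_const_mul' _ _ ENNReal.ofReal_ne_top]
          refine setLIntegral_mono' hD.measurableSet fun x hx => ?_
          rw [← lintegral_const_mul' _ _ ENNReal.ofReal_ne_top]
          refine le_trans ?_ (lintegral_mono_set (hBD.trans hDΩ))
          refine setLIntegral_mono' (s := B) isClosed_closedBall.measurableSet fun b hb => ?_
          by_cases hxb : x = b
          · simp [hxb]
          have hed : edist x b ≠ 0 := by simpa using hxb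
          have hle : edist x b ^ q ≤ ENNReal.ofReal ((2 * (Λ * h)) ^ q) := by
            rw [← ENNReal.ofReal_rpow_of_nonneg (by positivity) hqpos.le]
            refine ENNReal.rpow_le_rpow ?_ hqpos.le
            rw [edist_dist]
            refine ENNReal.ofReal_le_ofReal ?_
            have h1 := mem_ball.1 (hDR hx)
            have h2 := mem_ball.1 (hDR (hBD hb))
            linarith [dist_triangle_right x b b₀]
          have hne0 : edist x b ^ q ≠ 0 := by
            rw [Ne, ENNReal.rpow_eq_zero_iff_of_pos hqpos]
            exact hed
          have hnet : edist x b ^ q ≠ ⊤ := ENNReal.rpow_ne_top_of_nonneg hqpos.le (edist_ne_top x b)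
          calc ‖U β x - U β b‖ₑ ^ 2
              = edist x b ^ q * (‖U β x - U β b‖ₑ ^ 2 / edist x b ^ q) :=
                (ENNReal.mul_div_cancel hne0 hnet).symm
            _ ≤ _ := by gcongr
        have h5 := h2.trans h4
        have h6 : ENNReal.ofReal ((2 * (Λ * h)) ^ q)
            = volume B * (ENNReal.ofReal ((2 * Λ) ^ q) * v⁻¹ * ENNReal.ofReal (h ^ (2 * θ))) := by
          have : volume B * (ENNReal.ofReal ((2 * Λ) ^ q) * v⁻¹ * ENNReal.ofReal (h ^ (2 * θ)))
              = (v * v⁻¹) * (ENNReal.ofReal ((2 * Λ) ^ q) *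
                (ENNReal.ofReal (h ^ n) * ENNReal.ofReal (h ^ (2 * θ)))) := by
            rw [hvolB]; ring
          rw [this, ENNReal.mul_inv_cancel hv0 hvt, one_mul,
            ← ENNReal.ofReal_mul (by positivity), ← ENNReal.ofReal_mul (by positivity),
            ← Real.rpow_natCast h n, ← Real.rpow_add hh, ← mul_assoc,
            Real.mul_rpow (by positivity) hh.le]
        rw [h6, mul_assoc] at h5
        refine ((ENNReal.mul_le_mul_iff_right hB0 hBt).1 h5).trans ?_
        gcongr
        rw [hCθ]
        exact le_add_self
      calc T ≤ ∑ β ∈ multiIndices n m, Cθ * ENNReal.ofReal (h ^ (2 * θ)) *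
          ∫⁻ x in D, ∫⁻ y in Ω, ‖U β x - U β y‖ₑ ^ 2 / edist x y ^ q := Finset.sum_le_sum h1
        _ = Cθ * ENNReal.ofReal (h ^ (2 * θ)) * ∑ β ∈ multiIndices n m,
          ∫⁻ x in D, ∫⁻ y in Ω, ‖U β x - U β y‖ₑ ^ 2 / edist x y ^ q := by
            rw [Finset.mul_sum]
        _ ≤ Cθ * ENNReal.ofReal (h ^ (2 * θ)) * Q := by
            rw [hQ, sobSeminormSq, ← hm, if_neg hint]
  have hpow : ∀ k : ℕ, ENNReal.ofReal (h ^ 2) ^ k * ENNReal.ofReal (h ^ (2 * θ))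
      = ENNReal.ofReal (h ^ (2 * (k + θ))) := by
    intro k
    rw [← ENNReal.ofReal_pow (by positivity), ← ENNReal.ofReal_mul (by positivity), ← pow_mul,
      ← Real.rpow_natCast, ← Real.rpow_add hh]
    congr 2
    push_cast
    ring
  have hfin : ∀ k : ℕ, ∀ β : Fin n →₀ ℕ, β.degree + k = m →
      a β ≤ (n * K₀) ^ k * Cθ * ENNReal.ofReal (h ^ (2 * (k + θ))) * Q := by
    intro k β hβ
    calc a β ≤ (n * (K₀ * ENNReal.ofReal (h ^ 2))) ^ k * T := hiter k β hβ
      _ ≤ (n * (K₀ * ENNReal.ofReal (h ^ 2))) ^ k * (Cθ * ENNReal.ofReal (h ^ (2 * θ)) * Q) := by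
          gcongr
      _ = (n * K₀) ^ k * Cθ * (ENNReal.ofReal (h ^ 2) ^ k * ENNReal.ofReal (h ^ (2 * θ))) * Q := by
          rw [← mul_assoc (n : ℝ≥0∞), mul_pow]; ring
      _ = _ := by rw [hpow]
  refine ⟨p, hpd.trans hMr, ?_, fun j => ?_⟩
  · have h1 := hfin m 0 (by simp)
    have h2 : (m : ℝ) + θ = τ := by rw [hθ]; ring
    simp only [a, e, P, polyDeriv_zero, h2] at h1
    refine h1.trans ?_
    gcongr
    exact le_self_add
  · have h1 := hfin (m - 1) (Finsupp.single j 1) (by rw [Finsupp.degree_single]; omega)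
    have h2 : ((m - 1 : ℕ) : ℝ) + θ = τ - 1 := by rw [hθ, Nat.cast_sub hm1]; push_cast; ring
    have h3 : MvPolynomial.pderiv j p = polyDeriv (Finsupp.single j 1) p := by
      conv_lhs => rw [← polyDeriv_zero p]
      rw [pderiv_polyDeriv, zero_add]
    simp only [a, e, P, h2] at h1
    rw [h3]
    refine h1.trans ?_
    gcongr
    exact le_add_self

/-! ### Star-shaped patches in Lipschitz domains -/

/-- The points of `O` which see the ball `B` inside `O` form an open set star-shaped with respect
to `B`. -/
lemma isOpen_convexJoin_subset {n : ℕ} {O B : Set (E n)} (hO : IsOpen O) (hB : IsCompact B) :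
    IsOpen {y | convexJoin ℝ {y} B ⊆ O} := by
  have h1 : {y | convexJoin ℝ {y} B ⊆ O}
      = {y | ∀ q ∈ (Icc (0 : ℝ) 1) ×ˢ B, (1 - q.1) • y + q.1 • q.2 ∈ O} := by
    ext y
    simp only [mem_ofPred_eq, convexJoin_singleton_left, segment_eq_image, iUnion_subset_iff]
    constructor
    · intro h q hq
      exact h q.2 hq.2 ⟨q.1, hq.1, rfl⟩
    · rintro h b hb _ ⟨t, ht, rfl⟩
      exact h (t, b) ⟨ht, hb⟩
  rw [h1, isOpen_iff_eventually]
  intro y hy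
  refine (isCompact_Icc.prod hB).eventually_forall_of_forall_eventually fun q hq => ?_
  have hc : Continuous fun z : E n × (ℝ × E n) => (1 - z.2.1) • z.1 + z.2.1 • z.2.2 := by fun_prop
  exact (hO.preimage hc).mem_nhds (hy q hq)

/-- The patch of the points of `O` within distance `R` of `b₀` which see the ball of radius `h`. -/
lemma exists_starshaped {n : ℕ} {O : Set (E n)} (hO : IsOpen O) (b₀ : E n) {h R : ℝ}
    (hR : h < R) (hh : 0 < h) :
    ∃ D : Set (E n), IsOpen D ∧ D ⊆ O ∧ D ⊆ ball b₀ R ∧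
      (∀ x ∈ D, ∀ b ∈ closedBall b₀ h, segment ℝ b x ⊆ D) ∧
      ∀ y ∈ ball b₀ R, (∀ b ∈ closedBall b₀ h, segment ℝ b y ⊆ O) → y ∈ D := by
  refine ⟨{y | convexJoin ℝ {y} (closedBall b₀ h) ⊆ O} ∩ ball b₀ R,
    (isOpen_convexJoin_subset hO (isCompact_closedBall _ _)).inter isOpen_ball, ?_,
    inter_subset_right, ?_, ?_⟩
  · rintro y ⟨hy, -⟩
    exact hy (mem_convexJoin.2 ⟨y, rfl, b₀, mem_closedBall_self hh.le, left_mem_segment _ _ _⟩)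
  · rintro x ⟨hx, hxR⟩ b hb z hz
    have hxJ : ∀ c ∈ closedBall b₀ h, c ∈ convexJoin ℝ {x} (closedBall b₀ h) := fun c hc =>
      mem_convexJoin.2 ⟨x, rfl, c, hc, right_mem_segment _ _ _⟩
    have hJ : Convex ℝ (convexJoin ℝ {x} (closedBall b₀ h)) :=
      (convex_singleton x).convexJoin (convex_closedBall b₀ h)
    have hzJ : z ∈ convexJoin ℝ {x} (closedBall b₀ h) :=
      mem_convexJoin.2 ⟨x, rfl, b, hb, by rwa [segment_symm]⟩
    refine ⟨?_, (convex_ball b₀ R).segment_subset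
      (closedBall_subset_ball hR hb) hxR hz⟩
    intro w hw
    obtain ⟨z', rfl, c, hc, hw⟩ := mem_convexJoin.1 hw
    exact hx (hJ.segment_subset hzJ (hxJ c hc) hw)
  · intro y hyR hy
    refine ⟨?_, hyR⟩
    intro w hw
    obtain ⟨z', rfl, c, hc, hw⟩ := mem_convexJoin.1 hw
    exact hy c hc (by rwa [segment_symm])

/-- The height of a point over the graph of `ψ`, in the chart with vertical direction `e`. -/
def graphHeight {n : ℕ} (e : E n) (ψ : E n → ℝ) (y : E n) : ℝ :=
  ⟪e, y⟫_ℝ - ψ (y - ⟪e, y⟫_ℝ • e)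

lemma norm_horizontal_le {n : ℕ} {e : E n} (he : ‖e‖ = 1) (y : E n) :
    ‖y - ⟪e, y⟫_ℝ • e‖ ≤ ‖y‖ := by
  have h1 : ‖y - ⟪e, y⟫_ℝ • e‖ ^ 2 = ‖y‖ ^ 2 - ⟪e, y⟫_ℝ ^ 2 := by
    rw [norm_sub_sq_real, inner_smul_right, norm_smul, he, real_inner_comm, Real.norm_eq_abs,
      mul_one, sq_abs, real_inner_comm]
    ring
  refine abs_le_of_sq_le_sq' ?_ (norm_nonneg _) |>.2
  rw [h1]
  nlinarith [sq_nonneg (⟪e, y⟫_ℝ)]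

lemma abs_inner_le {n : ℕ} {e : E n} (he : ‖e‖ = 1) (y : E n) : |⟪e, y⟫_ℝ| ≤ ‖y‖ := by
  simpa [he] using abs_real_inner_le_norm e y

/-- Along a segment, the height decreases at most linearly. -/
lemma graphHeight_segment {n : ℕ} {e : E n} (he : ‖e‖ = 1) {K : NNReal} {ψ : E n → ℝ}
    (hψ : LipschitzWith K ψ) (y v : E n) {t τ : ℝ} (ht : 0 ≤ t) :
    graphHeight e ψ y + t * (τ - (1 + K) * ‖v‖) ≤ graphHeight e ψ (y + t • (v + τ • e)) := by
  have hee : ⟪e, e⟫_ℝ = 1 := by rw [real_inner_self_eq_norm_sq, he]; norm_num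
  have h1 : ⟪e, y + t • (v + τ • e)⟫_ℝ = ⟪e, y⟫_ℝ + t * (⟪e, v⟫_ℝ + τ) := by
    rw [inner_add_right, inner_smul_right, inner_add_right, inner_smul_right, hee, mul_one]
  have h2 : y + t • (v + τ • e) - (⟪e, y⟫_ℝ + t * (⟪e, v⟫_ℝ + τ)) • e
      = (y - ⟪e, y⟫_ℝ • e) + t • (v - ⟪e, v⟫_ℝ • e) := by
    module
  have h3 : ψ ((y - ⟪e, y⟫_ℝ • e) + t • (v - ⟪e, v⟫_ℝ • e))
      ≤ ψ (y - ⟪e, y⟫_ℝ • e) + K * (t * ‖v‖) := by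
    have h4 := hψ.dist_le_mul ((y - ⟪e, y⟫_ℝ • e) + t • (v - ⟪e, v⟫_ℝ • e)) (y - ⟪e, y⟫_ℝ • e)
    rw [Real.dist_eq, dist_eq_norm, add_sub_cancel_left, norm_smul, Real.norm_eq_abs,
      abs_of_nonneg ht] at h4
    have h5 : (K : ℝ) * (t * ‖v - ⟪e, v⟫_ℝ • e‖) ≤ K * (t * ‖v‖) := by
      gcongr
      exact norm_horizontal_le he v
    linarith [le_abs_self (ψ ((y - ⟪e, y⟫_ℝ • e) + t • (v - ⟪e, v⟫_ℝ • e)) - ψ (y - ⟪e, y⟫_ℝ • e))]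
  rw [graphHeight, graphHeight, h1, h2]
  have h6 := neg_le_of_abs_le (abs_inner_le he v)
  nlinarith [mul_le_mul_of_nonneg_left h6 ht]

lemma continuous_graphHeight {n : ℕ} (e : E n) {K : NNReal} {ψ : E n → ℝ}
    (hψ : LipschitzWith K ψ) : Continuous (graphHeight e ψ) := by
  have := hψ.continuous
  unfold graphHeight
  fun_prop

/-- A bounded Lipschitz domain is the interior of its closure. -/
lemma IsBoundedLipschitzDomain.interior_closure {n : ℕ} {Ω : Set (E n)}
    (hΩ : IsBoundedLipschitzDomain Ω) : interior (closure Ω) = Ω := by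
  refine subset_antisymm (fun x hx => ?_) (hΩ.isOpen.subset_interior_closure)
  by_contra hxΩ
  have hxf : x ∈ frontier Ω := ⟨interior_subset hx, fun h => hxΩ (interior_subset h)⟩
  obtain ⟨e, he, K, ψ, hψ, ρ, hρ, hg⟩ := hΩ.lipschitz_boundary x hxf
  have hg' : ∀ y ∈ ball x ρ, y ∈ Ω ↔ 0 < graphHeight e ψ y := fun y hy => by
    rw [hg y hy, graphHeight, sub_pos]
  have hx0 : graphHeight e ψ x ≤ 0 := not_lt.1 fun h => hxΩ ((hg' x (mem_ball_self hρ)).2 h)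
  have hev : ∀ᶠ t : ℝ in nhds 0, x - t • e ∈ interior (closure Ω) ∩ ball x ρ := by
    have hc : Continuous fun t : ℝ => x - t • e := by fun_prop
    refine hc.continuousAt.eventually_mem ((isOpen_interior.inter isOpen_ball).mem_nhds ?_)
    simpa using ⟨hx, hρ⟩
  obtain ⟨δ, hδ, hδ'⟩ := Metric.eventually_nhds_iff.1 hev
  obtain ⟨h1, h2⟩ := hδ' (y := δ / 2) (by
    rw [Real.dist_eq, sub_zero, abs_of_pos (by linarith)]
    linarith)
  -- points strictly below the graph cannot lie in the closure
  have h3 : graphHeight e ψ (x - (δ / 2) • e) < 0 := by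
    have := graphHeight_segment he hψ (x - (δ / 2) • e) 0 (t := δ / 2) (τ := 1) (by linarith)
    rw [zero_add, one_smul, sub_add_cancel, norm_zero] at this
    linarith
  obtain ⟨z, ⟨hz1, hz2⟩, hz3⟩ := mem_closure_iff.1 (interior_subset h1)
    ({y | graphHeight e ψ y < 0} ∩ ball x ρ)
    ((isOpen_lt (continuous_graphHeight e hψ) continuous_const).inter isOpen_ball) ⟨h3, h2⟩
  exact absurd ((hg' z hz2).1 hz3) (not_lt.2 (le_of_lt hz1))

/-- Close to each point of `s` and at each scale `h ≤ h₀` there is a ball of radius `h` which is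
visible in `Ω` from all points of `Ω` near the given one. -/
def HasVisibleBalls {n : ℕ} (Ω s : Set (E n)) : Prop :=
  ∃ h₀ > (0 : ℝ), ∃ M ≥ (0 : ℝ), ∀ x ∈ s, ∀ h : ℝ, 0 < h → h ≤ h₀ → ∃ b₀, dist b₀ x ≤ M * h ∧
    ∀ y ∈ Ω, dist y x < 4 * h → ∀ b ∈ closedBall b₀ h, segment ℝ b y ⊆ Ω

lemma hasVisibleBalls_of_mem {n : ℕ} {Ω : Set (E n)} {x₀ : E n} {ε : ℝ} (hε : 0 < ε)
    (h : ball x₀ ε ⊆ Ω) : HasVisibleBalls Ω (ball x₀ (ε / 2)) := by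
  refine ⟨ε / 8, by linarith, 0, le_rfl, fun x hx h' hh' hh0 =>
    ⟨x, by simp, fun y hy hyx b hb => ?_⟩⟩
  have hsub : ball x (ε / 2) ⊆ Ω := fun z hz => h <| by
    rw [mem_ball] at hx hz ⊢
    linarith [dist_triangle z x x₀]
  refine ((convex_ball x (ε / 2)).segment_subset ?_ ?_).trans hsub
  · rw [mem_closedBall] at hb
    rw [mem_ball]
    linarith
  · rw [mem_ball]
    linarith

lemma hasVisibleBalls_of_frontier {n : ℕ} {Ω : Set (E n)} {x₀ : E n} {e : E n} (he : ‖e‖ = 1)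
    {K : NNReal} {ψ : E n → ℝ} (hψ : LipschitzWith K ψ) {ρ : ℝ} (hρ : 0 < ρ)
    (hg : ∀ y ∈ ball x₀ ρ, y ∈ Ω ↔ ψ (y - ⟪e, y⟫_ℝ • e) < ⟪e, y⟫_ℝ) :
    HasVisibleBalls Ω (ball x₀ (ρ / 2)) := by
  -- the centre lies at height `M h` above `x`, where `M` exceeds `1 + K` times the size of
  -- the horizontal displacements
  set M : ℝ := 5 * (1 + K) with hM
  have hK : (0 : ℝ) ≤ K := K.2
  have hMpos : 0 < M := by positivity
  refine ⟨ρ / 2 / (M + 4), by positivity, M, hMpos.le, fun x hx h hh hh0 =>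
    ⟨x + (M * h) • e, ?_, fun y hy hyx b hb => ?_⟩⟩
  · rw [dist_eq_norm, add_sub_cancel_left, norm_smul, he, mul_one, Real.norm_eq_abs,
      abs_of_pos (by positivity)]
  have hhρ : (M + 4) * h ≤ ρ / 2 := by
    rw [le_div_iff₀ (by positivity)] at hh0
    linarith
  have hbx : dist b x < ρ / 2 := by
    have h1 : dist (x + (M * h) • e) x = M * h := by
      rw [dist_eq_norm, add_sub_cancel_left, norm_smul, he, mul_one, Real.norm_eq_abs,
        abs_of_pos (by positivity)]
    have h2 := mem_closedBall.1 hb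
    linarith [dist_triangle b (x + (M * h) • e) x]
  have hyx' : dist y x < ρ / 2 := by nlinarith
  have hball : ball x (ρ / 2) ⊆ ball x₀ ρ := fun z hz => by
    rw [mem_ball] at hx hz ⊢
    linarith [dist_triangle z x x₀]
  intro z hz
  have hzball : z ∈ ball x₀ ρ :=
    hball ((convex_ball x (ρ / 2)).segment_subset (mem_ball.2 hbx) (mem_ball.2 hyx') hz)
  rw [segment_symm, segment_eq_image'] at hz
  obtain ⟨t, ht, rfl⟩ := hz
  have hy0 : 0 < graphHeight e ψ y := by
    rw [graphHeight, sub_pos]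
    exact (hg y (hball (mem_ball.2 hyx'))).1 hy
  rw [hg _ hzball, ← sub_pos]
  change 0 < graphHeight e ψ (y + t • (b - y))
  set v := b - y - (M * h) • e with hv
  have hvn : ‖v‖ ≤ 5 * h := by
    have h1 : v = (b - (x + (M * h) • e)) + (x - y) := by rw [hv]; abel
    rw [h1]
    have h2 := mem_closedBall.1 hb
    rw [dist_eq_norm] at h2
    rw [dist_comm, dist_eq_norm] at hyx
    linarith [norm_add_le (b - (x + (M * h) • e)) (x - y)]
  have h2 := graphHeight_segment he hψ y v (t := t) (τ := M * h) ht.1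
  have h3 : v + (M * h) • e = b - y := by rw [hv]; abel
  rw [h3] at h2
  have h4 : 0 ≤ M * h - (1 + K) * ‖v‖ := by
    rw [hM]
    nlinarith
  nlinarith [mul_nonneg ht.1 h4]

/-- The interior cone property of bounded Lipschitz domains, in the form needed for
approximation: at each sufficiently small scale `h`, every neighbourhood of size `4h` in `Ω` is
contained in a patch inside `Ω` of size comparable to `h` which is star-shaped with respect to a
ball of radius `h`. -/
theorem IsBoundedLipschitzDomain.exists_patch {n : ℕ} {Ω : Set (E n)}
    (hΩ : IsBoundedLipschitzDomain Ω) :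
    ∃ h₀ > (0 : ℝ), ∃ Λ > (0 : ℝ), ∀ x ∈ closure Ω, ∀ h : ℝ, 0 < h → h ≤ h₀ →
      ∃ (b₀ : E n) (D : Set (E n)), IsOpen D ∧ D ⊆ Ω ∧ D ⊆ ball b₀ (Λ * h) ∧ D ⊆ ball x (Λ * h) ∧
        (∀ y ∈ D, ∀ b ∈ closedBall b₀ h, segment ℝ b y ⊆ D) ∧ Ω ∩ ball x (4 * h) ⊆ D := by
  have hcomp : IsCompact (closure Ω) := hΩ.isBounded.isCompact_closure
  have hvis : HasVisibleBalls Ω (closure Ω) := by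
    refine hcomp.induction_on (p := HasVisibleBalls Ω) ?_ ?_ ?_ ?_
    · exact ⟨1, one_pos, 0, le_rfl, fun x hx => hx.elim⟩
    · rintro s t hst ⟨h₀, hh₀, M, hM, H⟩
      exact ⟨h₀, hh₀, M, hM, fun x hx => H x (hst hx)⟩
    · rintro s t ⟨h₁, hh₁, M₁, hM₁, H₁⟩ ⟨h₂, hh₂, M₂, hM₂, H₂⟩
      refine ⟨min h₁ h₂, lt_min hh₁ hh₂, max M₁ M₂, le_max_of_le_left hM₁, ?_⟩
      rintro x (hx | hx) h hh hle
      · obtain ⟨b₀, hb, H⟩ := H₁ x hx h hh (hle.trans (min_le_left _ _))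
        exact ⟨b₀, hb.trans (by gcongr; exact le_max_left _ _), H⟩
      · obtain ⟨b₀, hb, H⟩ := H₂ x hx h hh (hle.trans (min_le_right _ _))
        exact ⟨b₀, hb.trans (by gcongr; exact le_max_right _ _), H⟩
    · intro x hx
      by_cases hxΩ : x ∈ Ω
      · obtain ⟨ε, hε, h⟩ := Metric.isOpen_iff.1 hΩ.isOpen x hxΩ
        exact ⟨ball x (ε / 2), mem_nhdsWithin_of_mem_nhds (ball_mem_nhds x (by linarith)),
          hasVisibleBalls_of_mem hε h⟩
      · obtain ⟨e, he, K, ψ, hψ, ρ, hρ, hg⟩ :=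
          hΩ.lipschitz_boundary x ⟨hx, fun h => hxΩ (interior_subset h)⟩
        exact ⟨ball x (ρ / 2), mem_nhdsWithin_of_mem_nhds (ball_mem_nhds x (by linarith)),
          hasVisibleBalls_of_frontier he hψ hρ hg⟩
  obtain ⟨h₀, hh₀, M, hM, H⟩ := hvis
  refine ⟨h₀, hh₀, 2 * M + 5, by linarith, fun x hx h hh hle => ?_⟩
  obtain ⟨b₀, hb, hseg⟩ := H x hx h hh hle
  obtain ⟨D, hD, hDΩ, hDR, hstar, hmem⟩ := exists_starshaped hΩ.isOpen b₀ (h := h)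
    (R := (M + 5) * h) (by nlinarith) hh
  refine ⟨b₀, D, hD, hDΩ, hDR.trans (ball_subset_ball (by nlinarith)), fun y hy => ?_, hstar, ?_⟩
  · have := mem_ball.1 (hDR hy)
    rw [mem_ball]
    nlinarith [dist_triangle y b₀ x]
  · rintro y ⟨hyΩ, hy⟩
    rw [mem_ball] at hy
    refine hmem y ?_ (hseg y hyΩ hy)
    rw [mem_ball]
    rw [dist_comm] at hb
    nlinarith [dist_triangle y x b₀]

/-! ### Reference cells and affine cells -/

/-- An open box contained in both reference cells. -/
lemma refBox_subset {n : ℕ} (kind : CellKind) :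
    {x : E n | ∀ i, x i ∈ Ioo (0 : ℝ) (1 / (n + 1))} ⊆ refCell n kind := by
  intro x hx
  have h1 : (1 : ℝ) / (n + 1) ≤ 1 := by
    rw [div_le_one (by positivity)]
    linarith [Nat.cast_nonneg (α := ℝ) n]
  cases kind with
  | simplex =>
    refine ⟨fun i => (hx i).1.le, ?_⟩
    calc ∑ i, x i ≤ ∑ _i : Fin n, (1 : ℝ) / (n + 1) := Finset.sum_le_sum fun i _ => (hx i).2.le
      _ ≤ 1 := by
        rw [Finset.sum_const, Finset.card_univ, Fintype.card_fin, nsmul_eq_mul, mul_one_div,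
          div_le_one (by positivity)]
        linarith
  | box => exact fun i => ⟨(hx i).1.le, (hx i).2.le.trans h1⟩

lemma isOpen_refBox (n : ℕ) : IsOpen {x : E n | ∀ i, x i ∈ Ioo (0 : ℝ) (1 / (n + 1))} := by
  have h1 : {x : E n | ∀ i, x i ∈ Ioo (0 : ℝ) (1 / (n + 1))}
      = ⋂ i, {x : E n | x i ∈ Ioo (0 : ℝ) (1 / (n + 1))} := by
    ext x
    simp
  rw [h1]
  refine isOpen_iInter_of_finite fun i => isOpen_Ioo.preimage ?_
  fun_prop

lemma refBox_nonempty (n : ℕ) : {x : E n | ∀ i, x i ∈ Ioo (0 : ℝ) (1 / (n + 1))}.Nonempty := by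
  refine ⟨WithLp.toLp 2 fun _ => 1 / (n + 1) / 2, fun i => ?_⟩
  have : (0 : ℝ) < 1 / (n + 1) := by positivity
  exact ⟨by simpa using by positivity, by simpa using by linarith⟩

lemma refCell_convex (n : ℕ) (kind : CellKind) : Convex ℝ (refCell n kind) := by
  intro x hx y hy a b ha hb hab
  cases kind with
  | simplex =>
    refine ⟨fun i => ?_, ?_⟩
    · have h1 := mul_nonneg ha (hx.1 i)
      have h2 := mul_nonneg hb (hy.1 i)
      simpa using add_nonneg h1 h2
    · have : ∑ i, (a • x + b • y) i = a * ∑ i, x i + b * ∑ i, y i := by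
        simp [Finset.sum_add_distrib, Finset.mul_sum]
      rw [this]
      nlinarith [hx.2, hy.2]
  | box =>
    intro i
    have : (a • x + b • y) i = a * x i + b * y i := by simp
    rw [this]
    have := hx i
    have := hy i
    constructor <;> nlinarith

lemma refCell_subset_box (n : ℕ) (kind : CellKind) :
    refCell n kind ⊆ {x : E n | ∀ i, x i ∈ Icc (0 : ℝ) 1} := by
  intro x hx
  cases kind with
  | simplex =>
    intro i
    refine ⟨hx.1 i, le_trans ?_ hx.2⟩
    exact Finset.single_le_sum (f := fun i => x i) (fun i _ => hx.1 i) (Finset.mem_univ i)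
  | box => exact hx

lemma refCell_isClosed (n : ℕ) (kind : CellKind) : IsClosed (refCell n kind) := by
  cases kind with
  | simplex =>
    have h1 : refCell n .simplex = (⋂ i, {x : E n | 0 ≤ x i}) ∩ {x | ∑ i, x i ≤ 1} := by
      ext x
      simp [refCell]
    rw [h1]
    refine (isClosed_iInter fun i => isClosed_le continuous_const (by fun_prop)).inter
      (isClosed_le (by fun_prop) continuous_const)
  | box =>
    have h1 : refCell n .box = ⋂ i, {x : E n | x i ∈ Icc (0 : ℝ) 1} := by
      ext x
      simp [refCell]
    rw [h1]
    refine isClosed_iInter fun i => isClosed_Icc.preimage ?_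
    fun_prop

lemma refCell_isCompact (n : ℕ) (kind : CellKind) : IsCompact (refCell n kind) := by
  refine IsCompact.of_isClosed_subset ?_ (refCell_isClosed n kind) (refCell_subset_box n kind)
  have h1 : {x : E n | ∀ i, x i ∈ Icc (0 : ℝ) 1}
      = (EuclideanSpace.equiv (Fin n) ℝ).toHomeomorph ⁻¹' (Set.pi univ fun _ => Icc (0 : ℝ) 1) := by
    ext x
    simp only [mem_preimage, Set.mem_pi, mem_univ, forall_const]
    rfl
  rw [h1, Homeomorph.isCompact_preimage]
  exact isCompact_univ_pi fun _ => isCompact_Icc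

lemma refCell_interior_nonempty (n : ℕ) (kind : CellKind) :
    (interior (refCell n kind)).Nonempty :=
  (refBox_nonempty n).mono (interior_maximal (refBox_subset kind) (isOpen_refBox n))

/-- A polynomial vanishing on the interior of the reference cell is zero. -/
lemma poly_eq_zero_of_interior {n : ℕ} {kind : CellKind} {p : MvPolynomial (Fin n) ℝ}
    (h : ∀ x ∈ interior (refCell n kind), MvPolynomial.eval x p = 0) : p = 0 := by
  have hpos : (0 : ℝ) < 1 / (n + 1) := by positivity
  refine MvPolynomial.funext_set (fun _ => Ioo (0 : ℝ) (1 / (n + 1)))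
    (fun _ => Ioo_infinite hpos) fun x hx => ?_
  rw [map_zero]
  refine h (WithLp.toLp 2 x) (interior_maximal (refBox_subset kind) (isOpen_refBox n) ?_)
  exact fun i => hx i (mem_univ i)

lemma refCell_volume_ne_zero (n : ℕ) (kind : CellKind) : volume (refCell n kind) ≠ 0 :=
  (Measure.measure_pos_of_nonempty_interior volume (refCell_interior_nonempty n kind)).ne'

lemma refCell_volume_ne_top (n : ℕ) (kind : CellKind) : volume (refCell n kind) ≠ ⊤ :=
  (refCell_isCompact n kind).measure_lt_top.ne

section

variable {n : ℕ} {kind : CellKind}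

lemma affineEquiv_continuous (F : E n ≃ᵃ[ℝ] E n) : Continuous F :=
  AffineMap.continuous_of_finiteDimensional (F : E n →ᵃ[ℝ] E n)

/-- An affine bijection of Euclidean space as a homeomorphism. -/
def affineHomeomorph (F : E n ≃ᵃ[ℝ] E n) : E n ≃ₜ E n where
  toEquiv := F.toEquiv
  continuous_toFun := affineEquiv_continuous F
  continuous_invFun := affineEquiv_continuous F.symm

/-- The Jacobian of an affine bijection. -/
def jac (F : E n ≃ᵃ[ℝ] E n) : ℝ := |LinearMap.det (F.linear : E n →ₗ[ℝ] E n)|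

lemma jac_pos (F : E n ≃ᵃ[ℝ] E n) : 0 < jac F :=
  abs_pos.2 (LinearEquiv.isUnit_det' F.linear).ne_zero

lemma affine_hasFDerivAt (F : E n ≃ᵃ[ℝ] E n) (x : E n) :
    HasFDerivAt F (LinearMap.toContinuousLinearMap (F.linear : E n →ₗ[ℝ] E n)) x := by
  have h1 : (F : E n → E n) = fun y => F.linear y + F 0 := by
    funext y
    have := F.map_vadd 0 y
    simpa using this
  rw [h1]
  exact (LinearMap.toContinuousLinearMap (F.linear : E n →ₗ[ℝ] E n)).hasFDerivAt.add_const _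

lemma cell_convex (F : E n ≃ᵃ[ℝ] E n) : Convex ℝ (cell kind F) :=
  (refCell_convex n kind).affine_image (F : E n →ᵃ[ℝ] E n)

lemma cell_isCompact (F : E n ≃ᵃ[ℝ] E n) : IsCompact (cell kind F) :=
  (refCell_isCompact n kind).image (affineEquiv_continuous F)

lemma interior_cell (F : E n ≃ᵃ[ℝ] E n) :
    interior (cell kind F) = F '' interior (refCell n kind) :=
  ((affineHomeomorph F).image_interior _).symm

lemma interior_cell_nonempty (F : E n ≃ᵃ[ℝ] E n) : (interior (cell kind F)).Nonempty := by
  rw [interior_cell]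
  exact (refCell_interior_nonempty n kind).image _

lemma cell_measurableSet (F : E n ≃ᵃ[ℝ] E n) : MeasurableSet (cell kind F) :=
  (cell_isCompact F).isClosed.measurableSet

lemma symm_mem_refCell {F : E n ≃ᵃ[ℝ] E n} {x : E n} (hx : x ∈ cell kind F) :
    F.symm x ∈ refCell n kind := by
  obtain ⟨y, hy, rfl⟩ := hx
  simpa using hy

lemma lintegral_cell (F : E n ≃ᵃ[ℝ] E n) (g : E n → ℝ≥0∞) :
    ∫⁻ x in cell kind F, g x = ENNReal.ofReal (jac F) * ∫⁻ y in refCell n kind, g (F y) := by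
  rw [cell, lintegral_image_eq_lintegral_abs_det_fderiv_mul volume
    (refCell_isClosed n kind).measurableSet (fun x _ => (affine_hasFDerivAt F x).hasFDerivWithinAt)
    F.injective.injOn]
  rw [lintegral_const_mul' _ _ ENNReal.ofReal_ne_top]
  rfl

lemma volume_cell (F : E n ≃ᵃ[ℝ] E n) :
    volume (cell kind F) = ENNReal.ofReal (jac F) * volume (refCell n kind) := by
  simpa using lintegral_cell (kind := kind) F (fun _ => 1)

lemma lintegral_refCell (F : E n ≃ᵃ[ℝ] E n) (g : E n → ℝ≥0∞) :
    ∫⁻ y in refCell n kind, g (F y) = ENNReal.ofReal (jac F)⁻¹ * ∫⁻ x in cell kind F, g x := by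
  rw [lintegral_cell, ← mul_assoc, ← ENNReal.ofReal_mul (inv_nonneg.2 (jac_pos F).le),
    inv_mul_cancel₀ (jac_pos F).ne', ENNReal.ofReal_one, one_mul]

lemma quasiMeasurePreserving_cell (F : E n ≃ᵃ[ℝ] E n) :
    Measure.QuasiMeasurePreserving F (volume.restrict (refCell n kind))
      (volume.restrict (cell kind F)) := by
  refine ⟨(affineEquiv_continuous F).measurable, Measure.AbsolutelyContinuous.mk fun s hs h0 => ?_⟩
  rw [Measure.map_apply (affineEquiv_continuous F).measurable hs]
  have h1 := lintegral_refCell (kind := kind) F (s.indicator fun _ => 1)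
  rw [lintegral_indicator_const hs, h0] at h1
  have h2 : (fun y => s.indicator (fun _ => (1 : ℝ≥0∞)) (F y))
      = (F ⁻¹' s).indicator fun _ => 1 := rfl
  rw [h2, lintegral_indicator_const ((affineEquiv_continuous F).measurable hs)] at h1
  simpa using h1

lemma memLp_two_iff {α : Type*} [MeasurableSpace α] {μ : Measure α} {F : Type*}
    [NormedAddCommGroup F] {f : α → F} :
    MemLp f 2 μ ↔ AEStronglyMeasurable f μ ∧ ∫⁻ x, ‖f x‖ₑ ^ 2 ∂μ < ⊤ := by
  rw [MemLp, eLpNorm_lt_top_iff_lintegral_rpow_enorm_lt_top (by norm_num) (by norm_num)]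
  simp

lemma enorm_sq_eq_lintegral {α : Type*} [MeasurableSpace α] {μ : Measure α} {F : Type*}
    [NormedAddCommGroup F] (f : Lp F 2 μ) : ‖f‖ₑ ^ 2 = ∫⁻ x, ‖f x‖ₑ ^ 2 ∂μ := by
  rw [Lp.enorm_def, eLpNorm_eq_lintegral_rpow_enorm_toReal (by norm_num) (by norm_num),
    ← ENNReal.rpow_natCast, ← ENNReal.rpow_mul]
  norm_num

lemma memLp_comp_cell (F : E n ≃ᵃ[ℝ] E n) {w : E n → ℝ}
    (hw : MemLp w 2 (volume.restrict (cell kind F))) :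
    MemLp (fun y => w (F y)) 2 (volume.restrict (refCell n kind)) := by
  rw [memLp_two_iff] at hw ⊢
  refine ⟨hw.1.comp_quasiMeasurePreserving (quasiMeasurePreserving_cell F), ?_⟩
  rw [lintegral_refCell F (fun x => ‖w x‖ₑ ^ 2)]
  exact ENNReal.mul_lt_top ENNReal.ofReal_lt_top hw.2

/-! ### Geometry of triangulations -/

namespace Triangulation

variable {Ω : Set (E n)} (𝒯 : Triangulation Ω kind)

lemma diam_le_h {F : E n ≃ᵃ[ℝ] E n} (hF : F ∈ 𝒯.maps) : diam (cell kind F) ≤ 𝒯.h :=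
  le_csSup ((𝒯.maps.finite_toSet.image _).bddAbove) ⟨F, hF, rfl⟩

lemma cell_subset_closure {F : E n ≃ᵃ[ℝ] E n} (hF : F ∈ 𝒯.maps) : cell kind F ⊆ closure Ω := by
  rw [← 𝒯.cover]
  exact subset_biUnion_of_mem (u := fun F => cell kind F) hF

lemma exists_mem_cell {x : E n} (hx : x ∈ closure Ω) : ∃ F ∈ 𝒯.maps, x ∈ cell kind F := by
  rw [← 𝒯.cover] at hx
  simpa using hx

lemma diam_pos (hn : 0 < n) (F : E n ≃ᵃ[ℝ] E n) : 0 < diam (cell kind F) := by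
  have : Nonempty (Fin n) := ⟨⟨0, hn⟩⟩
  refine Metric.diam_pos ?_ (cell_isCompact F).isBounded
  by_contra h
  rw [not_nontrivial_iff] at h
  have h1 := h.measure_zero (volume : Measure (E n))
  exact (Measure.measure_pos_of_nonempty_interior volume (interior_cell_nonempty F)).ne' h1

lemma h_pos (hn : 0 < n) (hne : Ω.Nonempty) : 0 < 𝒯.h := by
  obtain ⟨x, hx⟩ := hne
  obtain ⟨F, hF, -⟩ := 𝒯.exists_mem_cell (subset_closure hx)
  exact (diam_pos hn F).trans_le (𝒯.diam_le_h hF)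

lemma h_le_diam (hne : Ω.Nonempty) (hb : Bornology.IsBounded Ω) : 𝒯.h ≤ diam (closure Ω) := by
  obtain ⟨x, hx⟩ := hne
  obtain ⟨F, hF, -⟩ := 𝒯.exists_mem_cell (subset_closure hx)
  refine csSup_le ⟨_, F, hF, rfl⟩ ?_
  rintro _ ⟨G, hG, rfl⟩
  exact diam_mono (𝒯.cell_subset_closure hG) hb.closure

lemma ball_subset_cell {κ : ℝ} (hq : 𝒯.Quality κ) {F : E n ≃ᵃ[ℝ] E n} (hF : F ∈ 𝒯.maps) :
    ∃ c, closedBall c (𝒯.h / κ ^ 2) ⊆ cell kind F := by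
  obtain ⟨c, hc⟩ := hq.shape_regular F hF
  refine ⟨c, (closedBall_subset_closedBall ?_).trans hc⟩
  have h1 := hq.quasi_uniform F hF
  have hκ := hq.pos
  rw [div_le_div_iff₀ (by positivity) hκ]
  nlinarith [mul_le_mul_of_nonneg_right h1 hκ.le]

/-- In a shape-regular and quasi-uniform triangulation all cells are comparable to a ball of
radius `h`. -/
lemma exists_geometry (hn : 0 < n) (kind : CellKind) (κ : ℝ) :
    ∃ C > (0 : ℝ), ∀ (Ω : Set (E n)) (𝒯 : Triangulation Ω kind), 𝒯.Quality κ → Ω.Nonempty →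
      ∀ F ∈ 𝒯.maps, jac F ≤ C * 𝒯.h ^ n ∧ 𝒯.h ^ n ≤ C * jac F ∧
        ENNReal.ofReal (𝒯.h ^ n) ≤ ENNReal.ofReal C * volume (cell kind F) ∧
        ∀ v, ‖F.symm.linear v‖ ≤ C / 𝒯.h * ‖v‖ := by
  set Vr := volume.real (refCell n kind) with hVr
  have hVr0 : 0 < Vr :=
    ENNReal.toReal_pos (refCell_volume_ne_zero n kind) (refCell_volume_ne_top n kind)
  set vb := volume.real (ball (0 : E n) 1) with hvb
  have hvb0 : 0 < vb := ENNReal.toReal_pos (measure_ball_pos volume _ one_pos).ne'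
    measure_ball_lt_top.ne
  set d := diam (refCell n kind) with hd
  have hd0 : 0 ≤ d := diam_nonneg
  refine ⟨vb / Vr + κ ^ (2 * n) * (Vr / vb) + κ ^ (2 * n) * vb⁻¹ + d * κ ^ 2, ?_, ?_⟩
  · have : 0 ≤ κ ^ (2 * n) := by rw [pow_mul]; positivity
    positivity
  intro Ω 𝒯 hq hne F hF
  have hκ := hq.pos
  have hh := 𝒯.h_pos hn hne
  have hvol : volume.real (cell kind F) = jac F * Vr := by
    rw [measureReal_def, volume_cell, ENNReal.toReal_mul, ENNReal.toReal_ofReal (jac_pos F).le]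
    rfl
  have hball : ∀ (x : E n) (ρ : ℝ), 0 ≤ ρ → volume.real (closedBall x ρ) = ρ ^ n * vb := by
    intro x ρ hρ
    rw [measureReal_def, Measure.addHaar_closedBall _ _ hρ, ENNReal.toReal_mul,
      ENNReal.toReal_ofReal (by positivity)]
    simp [hvb, measureReal_def]
  obtain ⟨c, hc⟩ := 𝒯.ball_subset_cell hq hF
  obtain ⟨x, hx⟩ := interior_cell_nonempty (kind := kind) F
  have hup : volume.real (cell kind F) ≤ 𝒯.h ^ n * vb := by
    rw [← hball x _ hh.le]
    refine measureReal_mono (fun y hy => ?_) measure_closedBall_lt_top.ne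
    exact (dist_le_diam_of_mem (cell_isCompact F).isBounded hy (interior_subset hx)).trans
      (𝒯.diam_le_h hF)
  have hlow : (𝒯.h / κ ^ 2) ^ n * vb ≤ volume.real (cell kind F) := by
    rw [← hball c _ (by positivity)]
    exact measureReal_mono hc (cell_isCompact F).measure_lt_top.ne
  have hlow' : 𝒯.h ^ n ≤ κ ^ (2 * n) * vb⁻¹ * volume.real (cell kind F) := by
    rw [div_pow, ← pow_mul] at hlow
    calc 𝒯.h ^ n = κ ^ (2 * n) * vb⁻¹ * (𝒯.h ^ n / κ ^ (2 * n) * vb) := by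
          field_simp
      _ ≤ _ := by gcongr
  have h1 : 0 ≤ vb / Vr := by positivity
  have h2 : 0 ≤ κ ^ (2 * n) * (Vr / vb) := by positivity
  have h3 : 0 ≤ κ ^ (2 * n) * vb⁻¹ := by positivity
  have h4 : 0 ≤ d * κ ^ 2 := by positivity
  have hhn : 0 < 𝒯.h ^ n := by positivity
  have hj := jac_pos F
  refine ⟨?_, ?_, ?_, ?_⟩
  · calc jac F = volume.real (cell kind F) / Vr := by rw [hvol]; field_simp
      _ ≤ 𝒯.h ^ n * vb / Vr := by gcongr
      _ = vb / Vr * 𝒯.h ^ n := by ring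
      _ ≤ _ := by gcongr; linarith
  · calc 𝒯.h ^ n ≤ κ ^ (2 * n) * vb⁻¹ * (jac F * Vr) := by rwa [hvol] at hlow'
      _ = κ ^ (2 * n) * (Vr / vb) * jac F := by ring
      _ ≤ _ := by gcongr; linarith
  · rw [← ENNReal.ofReal_toReal (cell_isCompact F).measure_lt_top.ne,
      ← ENNReal.ofReal_mul (by linarith)]
    refine ENNReal.ofReal_le_ofReal (hlow'.trans ?_)
    change _ ≤ _ * volume.real (cell kind F)
    gcongr
    linarith
  · intro v
    rcases eq_or_ne v 0 with rfl | hv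
    · simp
    have hv0 : 0 < ‖v‖ := norm_pos_iff.2 hv
    set ρ := 𝒯.h / κ ^ 2 with hρ
    have hρ0 : 0 < ρ := by positivity
    -- the image of a diameter of the inscribed ball lies in the reference cell
    have e1 : F.symm (c + (ρ / ‖v‖) • v) ∈ refCell n kind := by
      refine symm_mem_refCell (hc ?_)
      rw [mem_closedBall, dist_eq_norm, add_sub_cancel_left, norm_smul, Real.norm_eq_abs,
        abs_of_pos (by positivity), div_mul_cancel₀ _ hv0.ne']
    have e2 : F.symm c ∈ refCell n kind :=
      symm_mem_refCell (hc (mem_closedBall_self hρ0.le))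
    have e3 := dist_le_diam_of_mem (refCell_isCompact n kind).isBounded e1 e2
    have e4 : F.symm (c + (ρ / ‖v‖) • v) = (ρ / ‖v‖) • F.symm.linear v + F.symm c := by
      have := F.symm.map_vadd c ((ρ / ‖v‖) • v)
      simpa [add_comm] using this
    rw [e4, dist_eq_norm, add_sub_cancel_right, norm_smul, Real.norm_eq_abs,
      abs_of_pos (by positivity), ← hd] at e3
    calc ‖F.symm.linear v‖ = ρ / ‖v‖ * ‖F.symm.linear v‖ * (‖v‖ / ρ) := by field_simp
      _ ≤ d * (‖v‖ / ρ) := by gcongr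
      _ = d * κ ^ 2 / 𝒯.h * ‖v‖ := by rw [hρ]; field_simp
      _ ≤ _ := by gcongr; linarith

/-- Two cells coincide or have an intersection without interior points. -/
lemma cell_eq_or_interior {F G : E n ≃ᵃ[ℝ] E n} (hF : F ∈ 𝒯.maps) (hG : G ∈ 𝒯.maps) :
    cell kind F = cell kind G ∨ interior (cell kind F ∩ cell kind G) = ∅ := by
  have key : ∀ F ∈ 𝒯.maps, ∀ G ∈ 𝒯.maps, (interior (cell kind F ∩ cell kind G)).Nonempty →
      cell kind F ⊆ cell kind G := by
    rintro F hF G hG ⟨x, hx⟩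
    obtain ⟨l, hl⟩ := 𝒯.conforming F hF G hG ⟨x, interior_subset hx⟩
    have hmax : IsLocalMax l x := by
      filter_upwards [isOpen_interior.mem_nhds hx] with y hy
      have h1 := (interior_subset hx : x ∈ cell kind F ∩ cell kind G)
      rw [hl] at h1
      exact h1.2 y (interior_subset hy : y ∈ cell kind F ∩ cell kind G).1
    -- an affine function with an interior maximum is constant
    have hl0 : l = 0 := hmax.hasFDerivAt_eq_zero l.hasFDerivAt
    intro y hy
    have h2 : y ∈ cell kind F ∩ cell kind G := by
      rw [hl]
      exact ⟨hy, fun z _ => by simp [hl0]⟩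
    exact h2.2
  rcases (interior (cell kind F ∩ cell kind G)).eq_empty_or_nonempty with h | h
  · exact Or.inr h
  · exact Or.inl (subset_antisymm (key F hF G hG h) (key G hG F hF (by rwa [inter_comm])))

/-- A choice of one map for each cell. -/
lemma exists_reps : ∃ R ⊆ 𝒯.maps, (∀ F ∈ 𝒯.maps, ∃ G ∈ R, cell kind G = cell kind F) ∧
    (R : Set (E n ≃ᵃ[ℝ] E n)).PairwiseDisjoint (fun F => interior (cell kind F)) := by
  classical
  obtain ⟨R, hR, hinj, him⟩ := Finset.exists_subset_injOn_image_eq_of_surjOn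
    (f := fun F : E n ≃ᵃ[ℝ] E n => cell kind F) (𝒯.maps : Set (E n ≃ᵃ[ℝ] E n))
    (𝒯.maps.image fun F => cell kind F) (by
      rw [Finset.coe_image]
      exact surjOn_image _ _)
  refine ⟨R, by exact_mod_cast hR, fun F hF => ?_, fun F hF G hG hFG => ?_⟩
  · have h1 : cell kind F ∈ R.image fun F => cell kind F := by
      rw [him]
      exact Finset.mem_image_of_mem _ hF
    simpa using h1
  · rcases 𝒯.cell_eq_or_interior (hR hF) (hR hG) with h | h
    · exact absurd (hinj hF hG h) hFG
    · rw [Function.onFun, disjoint_iff_inter_eq_empty, ← interior_inter, h]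

end Triangulation

end

/-! ### Integrals over a triangulated domain -/

lemma sum_lintegral_le {α ι : Type*} [MeasurableSpace α] (μ : Measure α) (s : Finset ι)
    (f : ι → α → ℝ≥0∞) : ∑ i ∈ s, ∫⁻ a, f i a ∂μ ≤ ∫⁻ a, ∑ i ∈ s, f i a ∂μ := by
  classical
  induction s using Finset.induction_on with
  | empty => simp
  | insert i s hi ih =>
    simp only [Finset.sum_insert hi]
    exact (add_le_add_right ih _).trans (le_lintegral_add _ _)

namespace Triangulation

variable {n : ℕ} {kind : CellKind} {Ω : Set (E n)} (𝒯 : Triangulation Ω kind)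

lemma interior_cell_subset (hΩ : IsBoundedLipschitzDomain Ω) {F : E n ≃ᵃ[ℝ] E n}
    (hF : F ∈ 𝒯.maps) : interior (cell kind F) ⊆ Ω := by
  rw [← hΩ.interior_closure]
  exact interior_mono (𝒯.cell_subset_closure hF)

lemma restrict_cell_eq (F : E n ≃ᵃ[ℝ] E n) :
    volume.restrict (cell kind F) = volume.restrict (interior (cell kind F)) := by
  refine Measure.restrict_congr_set (Filter.EventuallyLE.antisymm ?_
    (Filter.Eventually.of_forall interior_subset))
  have h1 : volume (frontier (cell kind F)) = 0 := (cell_convex F).addHaar_frontier volume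
  have h2 : ∀ᵐ x, x ∉ frontier (cell kind F) := measure_eq_zero_iff_ae_notMem.1 h1
  filter_upwards [h2] with x hx hxF
  by_contra h
  exact hx ⟨subset_closure hxF, h⟩

lemma restrict_cell_le (hΩ : IsBoundedLipschitzDomain Ω) {F : E n ≃ᵃ[ℝ] E n}
    (hF : F ∈ 𝒯.maps) : volume.restrict (cell kind F) ≤ volume.restrict Ω := by
  rw [restrict_cell_eq]
  exact Measure.restrict_mono (𝒯.interior_cell_subset hΩ hF) le_rfl

lemma lintegral_le_sum {R : Finset (E n ≃ᵃ[ℝ] E n)}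
    (hR : ∀ F ∈ 𝒯.maps, ∃ G ∈ R, cell kind G = cell kind F) (f : E n → ℝ≥0∞) :
    ∫⁻ x in Ω, f x ≤ ∑ F ∈ R, ∫⁻ x in cell kind F, f x := by
  refine (lintegral_mono_set (t := ⋃ F : R, cell kind F.1) fun x hx => ?_).trans ?_
  · obtain ⟨F, hF, hxF⟩ := 𝒯.exists_mem_cell (subset_closure hx)
    obtain ⟨G, hG, hGF⟩ := hR F hF
    exact mem_iUnion.2 ⟨⟨G, hG⟩, hGF ▸ hxF⟩
  · refine (lintegral_iUnion_le _ _).trans (le_of_eq ?_)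
    rw [tsum_fintype]
    exact Finset.sum_coe_sort R fun F => ∫⁻ x in cell kind F, f x

/-- Sums of integrals over patches of size comparable to `h` around distinct cells are bounded by
the integral over the domain: by comparing volumes, each point lies in boundedly many patches. -/
lemma exists_overlap (hn : 0 < n) (kind : CellKind) (κ Λ : ℝ) (hΛ : 0 < Λ) :
    ∃ C : ℝ≥0∞, C ≠ ⊤ ∧ ∀ (Ω : Set (E n)) (𝒯 : Triangulation Ω kind), 𝒯.Quality κ → Ω.Nonempty →
      ∀ R ⊆ 𝒯.maps, (R : Set (E n ≃ᵃ[ℝ] E n)).PairwiseDisjoint (fun F => interior (cell kind F)) →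
      ∀ D : (E n ≃ᵃ[ℝ] E n) → Set (E n), (∀ F ∈ R, MeasurableSet (D F) ∧ D F ⊆ Ω ∧
        ∃ x ∈ cell kind F, D F ⊆ ball x (Λ * 𝒯.h)) →
      ∀ f : E n → ℝ≥0∞, ∑ F ∈ R, ∫⁻ x in D F, f x ≤ C * ∫⁻ x in Ω, f x := by
  obtain ⟨C, hC, hgeo⟩ := exists_geometry hn kind κ
  set K : ℝ≥0∞ := ENNReal.ofReal C * (ENNReal.ofReal ((Λ + 1) ^ n) * volume (ball (0 : E n) 1))
  have hK : K ≠ ⊤ := ENNReal.mul_ne_top ENNReal.ofReal_ne_top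
    (ENNReal.mul_ne_top ENNReal.ofReal_ne_top measure_ball_lt_top.ne)
  refine ⟨K, hK, fun Ω 𝒯 hq hne R hR hdisj D hD f => ?_⟩
  classical
  have hh := 𝒯.h_pos hn hne
  have hcount : ∀ y, (∑ F ∈ R, (D F).indicator (fun _ => (1 : ℝ≥0∞)) y) ≤ K := by
    intro y
    set S := R.filter fun F => y ∈ D F with hS
    have h1 : (∑ F ∈ R, (D F).indicator (fun _ => (1 : ℝ≥0∞)) y) = (S.card : ℝ≥0∞) := by
      simp [indicator, hS]
    rw [h1]
    have h2 : (S.card : ℝ≥0∞) * ENNReal.ofReal (𝒯.h ^ n) ≤ ENNReal.ofReal C *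
        volume (closedBall y ((Λ + 1) * 𝒯.h)) := by
      calc (S.card : ℝ≥0∞) * ENNReal.ofReal (𝒯.h ^ n)
          = ∑ F ∈ S, ENNReal.ofReal (𝒯.h ^ n) := by simp
        _ ≤ ∑ F ∈ S, ENNReal.ofReal C * volume (interior (cell kind F)) := by
            refine Finset.sum_le_sum fun F hF => ?_
            have h3 := (hgeo Ω 𝒯 hq hne F (hR (Finset.mem_filter.1 hF).1)).2.2.1
            have h4 : volume (cell kind F) = volume (interior (cell kind F)) := by
              simpa using congrArg (fun μ => μ univ) (restrict_cell_eq (kind := kind) F)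
            rwa [h4] at h3
        _ = ENNReal.ofReal C * volume (⋃ F ∈ S, interior (cell kind F)) := by
            rw [measure_biUnion_finset (hdisj.subset (by
              intro F hF
              exact (Finset.mem_filter.1 (Finset.mem_coe.1 hF)).1))
              (fun F _ => isOpen_interior.measurableSet), Finset.mul_sum]
        _ ≤ _ := by
            gcongr
            refine iUnion₂_subset fun F hF z hz => ?_
            obtain ⟨hFR, hyF⟩ := Finset.mem_filter.1 hF
            obtain ⟨-, -, x, hx, hsub⟩ := hD F hFR
            have h5 := mem_ball.1 (hsub hyF)
            have h6 := (dist_le_diam_of_mem (cell_isCompact F).isBounded (interior_subset hz)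
              hx).trans (𝒯.diam_le_h (hR hFR))
            rw [mem_closedBall]
            rw [dist_comm] at h5
            linarith [dist_triangle z x y]
    rw [Measure.addHaar_closedBall _ _ (by positivity), finrank_euclideanSpace, Fintype.card_fin,
      mul_pow, ENNReal.ofReal_mul (by positivity)] at h2
    have h7 : ENNReal.ofReal (𝒯.h ^ n) ≠ 0 := by
      rw [Ne, ENNReal.ofReal_eq_zero, not_le]
      positivity
    refine (ENNReal.mul_le_mul_iff_left h7 ENNReal.ofReal_ne_top).1 (h2.trans (le_of_eq ?_))
    ring
  calc ∑ F ∈ R, ∫⁻ x in D F, f x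
      = ∑ F ∈ R, ∫⁻ x in Ω, (D F).indicator f x := by
        refine Finset.sum_congr rfl fun F hF => ?_
        obtain ⟨hm, hsub, -⟩ := hD F hF
        rw [lintegral_indicator hm, Measure.restrict_restrict hm, inter_eq_left.2 hsub]
    _ ≤ ∫⁻ x in Ω, ∑ F ∈ R, (D F).indicator f x := sum_lintegral_le _ _ _
    _ ≤ ∫⁻ x in Ω, K * f x := by
        refine lintegral_mono fun x => ?_
        have h1 : ∑ F ∈ R, (D F).indicator f x
            = (∑ F ∈ R, (D F).indicator (fun _ => (1 : ℝ≥0∞)) x) * f x := by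
          rw [Finset.sum_mul]
          refine Finset.sum_congr rfl fun F _ => ?_
          by_cases hx : x ∈ D F <;> simp [hx]
        rw [h1]
        exact mul_le_mul' (hcount x) le_rfl
    _ = K * ∫⁻ x in Ω, f x := lintegral_const_mul' _ _ hK

lemma sum_lintegral_cell_le (hΩ : IsBoundedLipschitzDomain Ω) {R : Finset (E n ≃ᵃ[ℝ] E n)}
    (hR : R ⊆ 𝒯.maps)
    (hdisj : (R : Set (E n ≃ᵃ[ℝ] E n)).PairwiseDisjoint (fun F => interior (cell kind F)))
    (f : E n → ℝ≥0∞) : ∑ F ∈ R, ∫⁻ x in cell kind F, f x ≤ ∫⁻ x in Ω, f x := by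
  simp only [restrict_cell_eq]
  rw [← lintegral_biUnion_finset hdisj (fun F _ => isOpen_interior.measurableSet)]
  exact lintegral_mono_set (iUnion₂_subset fun F hF => 𝒯.interior_cell_subset hΩ (hR hF))

end Triangulation

/-! ### The reference element and its dual functions -/

/-- Affine changes of variables preserve the total degree. -/
lemma exists_poly_comp_affine {n : ℕ} (F : E n ≃ᵃ[ℝ] E n) (p : MvPolynomial (Fin n) ℝ) :
    ∃ q : MvPolynomial (Fin n) ℝ, q.totalDegree ≤ p.totalDegree ∧
      ∀ x : E n, MvPolynomial.eval x q = MvPolynomial.eval (F x) p := by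
  classical
  let a : Fin n → MvPolynomial (Fin n) ℝ := fun i =>
    MvPolynomial.C (F 0 i) + ∑ j, MvPolynomial.C (F.linear (EuclideanSpace.single j 1) i) *
      MvPolynomial.X j
  have ha : ∀ i, (a i).totalDegree ≤ 1 := by
    intro i
    refine (MvPolynomial.totalDegree_add _ _).trans (max_le (by simp) ?_)
    refine MvPolynomial.totalDegree_finsetSum_le fun j _ => ?_
    refine (MvPolynomial.totalDegree_mul _ _).trans ?_
    simp
  have hev : ∀ (x : E n) i, MvPolynomial.eval x (a i) = F x i := by
    intro x i
    have h1 : F x = F.linear x + F 0 := by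
      have := F.map_vadd 0 x
      simpa using this
    have h2 : F.linear x i = ∑ j, F.linear (EuclideanSpace.single j 1) i * x j := by
      have h3 := linear_expand ((EuclideanSpace.proj i : E n →L[ℝ] ℝ).toLinearMap.comp
        (F.linear : E n →ₗ[ℝ] E n)) x
      simpa [mul_comm] using h3
    rw [h1]
    simp [a, h2, add_comm]
  refine ⟨MvPolynomial.bind₁ a p, ?_, fun x => ?_⟩
  · rw [MvPolynomial.bind₁, MvPolynomial.aeval_def, MvPolynomial.eval₂_eq]
    refine MvPolynomial.totalDegree_finsetSum_le fun d hd => ?_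
    refine (MvPolynomial.totalDegree_mul _ _).trans ?_
    rw [MvPolynomial.algebraMap_eq, MvPolynomial.totalDegree_C, zero_add]
    refine (MvPolynomial.totalDegree_finsetProd _ _).trans
      (le_trans (Finset.sum_le_sum fun i _ => ?_) (MvPolynomial.le_totalDegree hd))
    refine (MvPolynomial.totalDegree_pow _ _).trans ?_
    calc d i * (a i).totalDegree ≤ d i * 1 := by gcongr; exact ha i
      _ = d i := mul_one _
  · rw [MvPolynomial.eval, MvPolynomial.eval₂Hom_bind₁]
    congr 2
    funext i
    exact hev x i

/-- A unisolvent conforming Lagrange element, together with functions dual to the evaluations at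
the nodes. -/
structure RefElement (n r : ℕ) (kind : CellKind) where
  /-- the nodes -/
  N : Finset (E n)
  /-- the Lagrange basis -/
  Lag : E n → MvPolynomial (Fin n) ℝ
  /-- the functions representing evaluation at the nodes in `L²` of the reference cell -/
  dual : E n → MvPolynomial (Fin n) ℝ
  node_mem : ∀ z ∈ N, z ∈ refCell n kind
  lag_mem : ∀ z ∈ N, Lag z ∈ refPoly n r kind
  expand : ∀ p ∈ refPoly n r kind, p = ∑ z ∈ N, MvPolynomial.C (MvPolynomial.eval z p) * Lag z
  conforming : ∀ F G : E n ≃ᵃ[ℝ] E n,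
    IsExposed ℝ (cell kind F) (cell kind F ∩ cell kind G) →
    IsExposed ℝ (cell kind G) (cell kind F ∩ cell kind G) →
    ∀ c : E n → ℝ, ∀ x ∈ cell kind F ∩ cell kind G,
      ∑ z ∈ N, c (F z) * MvPolynomial.eval (F.symm x) (Lag z)
        = ∑ z ∈ N, c (G z) * MvPolynomial.eval (G.symm x) (Lag z)
  dual_spec : ∀ z ∈ N, ∀ p ∈ refPoly n r kind,
    ∫ x in refCell n kind, MvPolynomial.eval x p * MvPolynomial.eval x (dual z)
      = MvPolynomial.eval z p

lemma integrable_refCell {n : ℕ} {kind : CellKind} {f : E n → ℝ} (hf : Continuous f) :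
    Integrable f (volume.restrict (refCell n kind)) :=
  hf.continuousOn.integrableOn_compact (refCell_isCompact n kind)

lemma integrable_eval_mul {n : ℕ} {kind : CellKind} (p q : MvPolynomial (Fin n) ℝ) :
    Integrable (fun x : E n => MvPolynomial.eval x p * MvPolynomial.eval x q)
      (volume.restrict (refCell n kind)) :=
  integrable_refCell ((continuous_eval p).mul (continuous_eval q))

/-- The `L²` pairing of polynomials on the reference cell. -/
def polyPairing (n : ℕ) (kind : CellKind) (V : Submodule ℝ (MvPolynomial (Fin n) ℝ)) :
    V →ₗ[ℝ] V →ₗ[ℝ] ℝ :=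
  LinearMap.mk₂ ℝ (fun q p => ∫ x in refCell n kind,
      MvPolynomial.eval x (p : MvPolynomial (Fin n) ℝ) *
        MvPolynomial.eval x (q : MvPolynomial (Fin n) ℝ))
    (fun q q' p => by
      rw [← integral_add (integrable_eval_mul _ _) (integrable_eval_mul _ _)]
      simp [mul_add])
    (fun c q p => by
      rw [smul_eq_mul, ← integral_const_mul]
      simp [mul_left_comm])
    (fun q p p' => by
      rw [← integral_add (integrable_eval_mul _ _) (integrable_eval_mul _ _)]
      simp [add_mul])
    (fun c q p => by
      rw [smul_eq_mul, ← integral_const_mul]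
      simp [mul_assoc])

lemma eq_zero_of_integral_sq {n : ℕ} {kind : CellKind} {p : MvPolynomial (Fin n) ℝ}
    (h : ∫ x in refCell n kind, MvPolynomial.eval x p * MvPolynomial.eval x p = 0) : p = 0 := by
  rw [integral_eq_zero_iff_of_nonneg (fun x => mul_self_nonneg _)
    (integrable_eval_mul _ _)] at h
  have h1 : (fun x : E n => MvPolynomial.eval x p)
      =ᵐ[volume.restrict (interior (refCell n kind))] fun _ => 0 := by
    have h2 := ae_restrict_of_ae_restrict_of_subset (interior_subset (s := refCell n kind)) h
    filter_upwards [h2] with x hx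
    simpa using hx
  refine poly_eq_zero_of_interior (kind := kind) fun x hx => ?_
  exact Measure.eqOn_open_of_ae_eq h1 isOpen_interior (continuous_eval p).continuousOn
    continuousOn_const hx

/-- The dual functions exist since the `L²` pairing of reference polynomials is nondegenerate. -/
lemma exists_refElement (n : ℕ) (kind : CellKind) {r : ℕ} (hr : 1 ≤ r) :
    Nonempty (RefElement n r kind) := by
  obtain ⟨N, Lag, hN, hLag, hexp, hconf⟩ := exists_lagrange n kind hr
  have hfin : FiniteDimensional ℝ (refPoly n r kind) := by
    have := FiniteDimensional.span_of_finite ℝ (N.finite_toSet.image Lag)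
    refine Submodule.finiteDimensional_of_le (S₂ := Submodule.span ℝ (Lag '' N)) fun p hp => ?_
    rw [hexp p hp]
    refine Submodule.sum_mem _ fun z hz => ?_
    rw [← MvPolynomial.smul_eq_C_mul]
    exact Submodule.smul_mem _ _ (Submodule.subset_span (mem_image_of_mem _ hz))
  have hinj : Function.Injective (polyPairing n kind (refPoly n r kind)) := by
    rw [← LinearMap.ker_eq_bot, LinearMap.ker_eq_bot']
    intro q hq
    have h1 : polyPairing n kind (refPoly n r kind) q q = 0 := by rw [hq]; rfl
    exact Subtype.ext (eq_zero_of_integral_sq h1)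
  have hsurj : Function.Surjective (polyPairing n kind (refPoly n r kind)) :=
    (LinearMap.injective_iff_surjective_of_finrank_eq_finrank
      Subspace.dual_finrank_eq.symm).1 hinj
  have hdual : ∀ z : E n, ∃ ψ : MvPolynomial (Fin n) ℝ, ∀ p ∈ refPoly n r kind,
      ∫ x in refCell n kind, MvPolynomial.eval x p * MvPolynomial.eval x ψ
        = MvPolynomial.eval z p := by
    intro z
    obtain ⟨ψ, hψ⟩ := hsurj ((MvPolynomial.aeval (R := ℝ) (fun i => z i)).toLinearMap.comp
      (refPoly n r kind).subtype)
    refine ⟨ψ, fun p hp => ?_⟩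
    have h1 := congrArg (fun l => l ⟨p, hp⟩) hψ
    simpa [polyPairing, MvPolynomial.aeval_eq_eval] using h1
  choose dual hdual using hdual
  exact ⟨⟨N, Lag, dual, hN, hLag, hexp, hconf, fun z _ p hp => hdual z p hp⟩⟩

/-! ### Local finite element functions -/

lemma enorm_sq_eq (x : ℝ) : ‖x‖ₑ ^ 2 = ENNReal.ofReal (x ^ 2) := by
  rw [← ofReal_norm, ← ENNReal.ofReal_pow (norm_nonneg _), Real.norm_eq_abs, sq_abs]

namespace RefElement

variable {n r : ℕ} {kind : CellKind} (S : RefElement n r kind)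

/-- The mean of `w` on a cell against the dual function of a node. It reproduces the nodal value
of finite element functions. -/
def coef (F : E n ≃ᵃ[ℝ] E n) (z : E n) (w : E n → ℝ) : ℝ :=
  ∫ y in refCell n kind, w (F y) * MvPolynomial.eval y (S.dual z)

/-- The finite element function with nodal values `a` on the cell `F(K̂)`. -/
def loc (F : E n ≃ᵃ[ℝ] E n) (a : E n → ℝ) (x : E n) : ℝ :=
  ∑ z ∈ S.N, a z * MvPolynomial.eval (F.symm x) (S.Lag z)

lemma exists_bound : ∃ B : ℝ, 0 < B ∧ ∀ z ∈ S.N, ∀ y ∈ refCell n kind,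
    |MvPolynomial.eval y (S.dual z)| ≤ B ∧ |MvPolynomial.eval y (S.Lag z)| ≤ B ∧
      ‖fderiv ℝ (fun y : E n => MvPolynomial.eval y (S.Lag z)) y‖ ≤ B := by
  have h1 : ∀ z, ∃ B : ℝ, ∀ y ∈ refCell n kind,
      |MvPolynomial.eval y (S.dual z)| + |MvPolynomial.eval y (S.Lag z)| +
        ‖fderiv ℝ (fun y : E n => MvPolynomial.eval y (S.Lag z)) y‖ ≤ B := by
    intro z
    have hc : Continuous fun y : E n => |MvPolynomial.eval y (S.dual z)| +
        |MvPolynomial.eval y (S.Lag z)| +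
        ‖fderiv ℝ (fun y : E n => MvPolynomial.eval y (S.Lag z)) y‖ :=
      ((continuous_eval _).abs.add (continuous_eval _).abs).add
        ((contDiff_eval (S.Lag z) (k := 1)).continuous_fderiv one_ne_zero).norm
    obtain ⟨B, hB⟩ := (refCell_isCompact n kind).exists_bound_of_continuousOn hc.continuousOn
    exact ⟨B, fun y hy => (le_abs_self _).trans (hB y hy)⟩
  choose B hB using h1
  refine ⟨1 + ∑ z ∈ S.N, |B z|, by positivity, fun z hz y hy => ?_⟩
  have h2 := hB z y hy
  have h3 : |B z| ≤ ∑ z ∈ S.N, |B z| :=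
    Finset.single_le_sum (f := fun z => |B z|) (fun _ _ => abs_nonneg _) hz
  have h4 := le_abs_self (B z)
  have h5 := abs_nonneg (MvPolynomial.eval y (S.dual z))
  have h6 := abs_nonneg (MvPolynomial.eval y (S.Lag z))
  have h7 := norm_nonneg (fderiv ℝ (fun y : E n => MvPolynomial.eval y (S.Lag z)) y)
  refine ⟨?_, ?_, ?_⟩ <;> linarith

lemma integrable_coef {F : E n ≃ᵃ[ℝ] E n} (z : E n) {w : E n → ℝ}
    (hw : MemLp w 2 (volume.restrict (cell kind F))) :
    Integrable (fun y => w (F y) * MvPolynomial.eval y (S.dual z))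
      (volume.restrict (refCell n kind)) := by
  have hfin : IsFiniteMeasure (volume.restrict (refCell n kind)) :=
    ⟨by simpa using (refCell_isCompact n kind).measure_lt_top⟩
  obtain ⟨C, hC⟩ := (refCell_isCompact n kind).exists_bound_of_continuousOn
    (continuous_eval (S.dual z)).continuousOn
  have hdual : MemLp (fun y : E n => MvPolynomial.eval y (S.dual z)) 2
      (volume.restrict (refCell n kind)) :=
    MemLp.of_bound (continuous_eval _).aestronglyMeasurable C
      ((ae_restrict_mem (refCell_isClosed n kind).measurableSet).mono hC)
  exact (memLp_comp_cell F hw).integrable_mul hdual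

lemma coef_sub {F : E n ≃ᵃ[ℝ] E n} (z : E n) {w w' : E n → ℝ}
    (hw : MemLp w 2 (volume.restrict (cell kind F)))
    (hw' : MemLp w' 2 (volume.restrict (cell kind F))) :
    S.coef F z (fun x => w x - w' x) = S.coef F z w - S.coef F z w' := by
  rw [coef, coef, coef, ← integral_sub (S.integrable_coef z hw) (S.integrable_coef z hw')]
  simp only [sub_mul]

lemma coef_congr {F : E n ≃ᵃ[ℝ] E n} (z : E n) {w w' : E n → ℝ}
    (h : w =ᵐ[volume.restrict (cell kind F)] w') : S.coef F z w = S.coef F z w' := by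
  refine integral_congr_ae ?_
  filter_upwards [(quasiMeasurePreserving_cell (kind := kind) F).ae_eq_comp h] with y hy
  simp only [Function.comp_apply] at hy
  rw [hy]

lemma coef_poly (F : E n ≃ᵃ[ℝ] E n) {z : E n} (hz : z ∈ S.N) {p : MvPolynomial (Fin n) ℝ}
    (hp : p ∈ refPoly n r kind) :
    S.coef F z (fun x => MvPolynomial.eval (F.symm x) p) = MvPolynomial.eval z p := by
  rw [← S.dual_spec z hz p hp, coef]
  simp

lemma exists_ref (F : E n ≃ᵃ[ℝ] E n) {q : MvPolynomial (Fin n) ℝ} (hq : q.totalDegree ≤ r) :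
    ∃ p ∈ refPoly n r kind, ∀ y : E n, MvPolynomial.eval y p = MvPolynomial.eval (F y) q := by
  obtain ⟨p, hp, hpe⟩ := exists_poly_comp_affine F q
  exact ⟨p, restrictTotalDegree_le_refPoly n r kind
    ((MvPolynomial.mem_restrictTotalDegree _ _ _).2 (hp.trans hq)), hpe⟩

lemma coef_global (F : E n ≃ᵃ[ℝ] E n) {z : E n} (hz : z ∈ S.N) {q : MvPolynomial (Fin n) ℝ}
    (hq : q.totalDegree ≤ r) :
    S.coef F z (fun x => MvPolynomial.eval x q) = MvPolynomial.eval (F z) q := by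
  obtain ⟨p, hp, hpe⟩ := exists_ref (kind := kind) F hq
  rw [← hpe, ← S.coef_poly F hz hp]
  simp [hpe]

lemma loc_poly (F : E n ≃ᵃ[ℝ] E n) {p : MvPolynomial (Fin n) ℝ} (hp : p ∈ refPoly n r kind)
    (x : E n) :
    S.loc F (fun z => MvPolynomial.eval z p) x = MvPolynomial.eval (F.symm x) p := by
  conv_rhs => rw [S.expand p hp]
  simp [loc]

lemma loc_global (F : E n ≃ᵃ[ℝ] E n) {q : MvPolynomial (Fin n) ℝ} (hq : q.totalDegree ≤ r)
    (x : E n) :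
    S.loc F (fun z => MvPolynomial.eval (F z) q) x = MvPolynomial.eval x q := by
  obtain ⟨p, hp, hpe⟩ := exists_ref (kind := kind) F hq
  have h1 := S.loc_poly F hp x
  simpa [hpe] using h1

lemma loc_sub (F : E n ≃ᵃ[ℝ] E n) (a b : E n → ℝ) (x : E n) :
    S.loc F (fun z => a z - b z) x = S.loc F a x - S.loc F b x := by
  simp [loc, sub_mul]

lemma loc_mem (F : E n ≃ᵃ[ℝ] E n) (a : E n → ℝ) :
    ∃ p ∈ refPoly n r kind, ∀ x, S.loc F a x = MvPolynomial.eval (F.symm x) p := by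
  refine ⟨∑ z ∈ S.N, a z • S.Lag z, Submodule.sum_mem _ fun z hz =>
    Submodule.smul_mem _ _ (S.lag_mem z hz), fun x => ?_⟩
  simp [loc, MvPolynomial.smul_eval]

lemma contDiff_symm (F : E n ≃ᵃ[ℝ] E n) {k : WithTop ℕ∞} : ContDiff ℝ k F.symm := by
  have h1 : (F.symm : E n → E n) = fun y =>
      (LinearMap.toContinuousLinearMap (F.symm.linear : E n →ₗ[ℝ] E n)) y + F.symm 0 := by
    funext y
    have := F.symm.map_vadd 0 y
    simpa using this
  rw [h1]
  exact (ContinuousLinearMap.contDiff _).add contDiff_const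

lemma contDiff_loc (F : E n ≃ᵃ[ℝ] E n) (a : E n → ℝ) {k : WithTop ℕ∞} :
    ContDiff ℝ k (S.loc F a) :=
  ContDiff.sum fun _ _ => contDiff_const.mul ((contDiff_eval _).comp (contDiff_symm F))

lemma fderiv_loc (F : E n ≃ᵃ[ℝ] E n) (a : E n → ℝ) (x v : E n) :
    fderiv ℝ (S.loc F a) x v = ∑ z ∈ S.N, a z *
      fderiv ℝ (fun y : E n => MvPolynomial.eval y (S.Lag z)) (F.symm x) (F.symm.linear v) := by
  have h1 : HasFDerivAt (S.loc F a) (∑ z ∈ S.N, a z •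
      (fderiv ℝ (fun y : E n => MvPolynomial.eval y (S.Lag z)) (F.symm x)).comp
        (LinearMap.toContinuousLinearMap (F.symm.linear : E n →ₗ[ℝ] E n))) x := by
    refine HasFDerivAt.fun_sum fun z _ => ?_
    refine HasFDerivAt.const_mul ?_ _
    exact ((contDiff_eval (S.Lag z) (k := 1)).differentiable one_ne_zero
      (F.symm x)).hasFDerivAt.comp x (affine_hasFDerivAt F.symm x)
  rw [h1.fderiv]
  simp

lemma sq_sum_le {B : ℝ} (a b : E n → ℝ) (hb : ∀ z ∈ S.N, |b z| ≤ B) :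
    (∑ z ∈ S.N, a z * b z) ^ 2 ≤ B ^ 2 * S.N.card * ∑ z ∈ S.N, a z ^ 2 := by
  calc (∑ z ∈ S.N, a z * b z) ^ 2 ≤ S.N.card * ∑ z ∈ S.N, (a z * b z) ^ 2 :=
        sq_sum_le_card_mul_sum_sq
    _ ≤ S.N.card * ∑ z ∈ S.N, a z ^ 2 * B ^ 2 := by
        gcongr with z hz
        rw [mul_pow]
        refine mul_le_mul_of_nonneg_left ?_ (sq_nonneg _)
        exact sq_le_sq' (abs_le.1 (hb z hz)).1 (abs_le.1 (hb z hz)).2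
    _ = _ := by rw [← Finset.sum_mul]; ring

/-- Scaling estimates for the dual means, and for local finite element functions and their
derivatives in terms of the nodal values. -/
lemma exists_estimates : ∃ K : ℝ≥0∞, K ≠ ⊤ ∧
    (∀ F : E n ≃ᵃ[ℝ] E n, ∀ z ∈ S.N, ∀ w : E n → ℝ, MemLp w 2 (volume.restrict (cell kind F)) →
      ‖S.coef F z w‖ₑ ^ 2 ≤ K * ENNReal.ofReal (jac F)⁻¹ * ∫⁻ x in cell kind F, ‖w x‖ₑ ^ 2) ∧
    (∀ (F : E n ≃ᵃ[ℝ] E n) (a : E n → ℝ), ∫⁻ x in cell kind F, ‖S.loc F a x‖ₑ ^ 2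
      ≤ K * ENNReal.ofReal (jac F) * ∑ z ∈ S.N, ‖a z‖ₑ ^ 2) ∧
    ∀ (F : E n ≃ᵃ[ℝ] E n) (a : E n → ℝ) (v : E n) (c : ℝ), ‖F.symm.linear v‖ ≤ c →
      ∫⁻ x in cell kind F, ‖fderiv ℝ (S.loc F a) x v‖ₑ ^ 2
        ≤ K * ENNReal.ofReal (c ^ 2) * ENNReal.ofReal (jac F) * ∑ z ∈ S.N, ‖a z‖ₑ ^ 2 := by
  obtain ⟨B, hB, hbd⟩ := S.exists_bound
  set V := volume (refCell n kind) with hV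
  have hVt : V ≠ ⊤ := refCell_volume_ne_top n kind
  set K₁ : ℝ≥0∞ := ENNReal.ofReal (B ^ 2) * V with hK₁
  set K₂ : ℝ≥0∞ := ENNReal.ofReal (B ^ 2 * S.N.card) * V with hK₂
  have hsum : ∀ a : E n → ℝ, ∑ z ∈ S.N, ‖a z‖ₑ ^ 2 = ENNReal.ofReal (∑ z ∈ S.N, a z ^ 2) := by
    intro a
    rw [ENNReal.ofReal_sum_of_nonneg fun _ _ => sq_nonneg _]
    simp only [enorm_sq_eq]
  have hint : ∀ (F : E n ≃ᵃ[ℝ] E n) (f : E n → ℝ) (c : ℝ), (∀ x ∈ cell kind F, f x ^ 2 ≤ c) →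
      ∫⁻ x in cell kind F, ‖f x‖ₑ ^ 2 ≤ ENNReal.ofReal c * (ENNReal.ofReal (jac F) * V) := by
    intro F f c hf
    rw [← volume_cell, ← setLIntegral_const]
    refine setLIntegral_mono' (s := cell kind F) (cell_measurableSet F) fun x hx => ?_
    rw [enorm_sq_eq]
    exact ENNReal.ofReal_le_ofReal (hf x hx)
  refine ⟨K₁ + K₂, ENNReal.add_ne_top.2 ⟨ENNReal.mul_ne_top ENNReal.ofReal_ne_top hVt,
    ENNReal.mul_ne_top ENNReal.ofReal_ne_top hVt⟩, ?_, ?_, ?_⟩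
  · intro F z hz w hw
    have h1 : ‖S.coef F z w‖ₑ ≤ ENNReal.ofReal B * ∫⁻ y in refCell n kind, ‖w (F y)‖ₑ := by
      refine (enorm_integral_le_lintegral_enorm _).trans ?_
      rw [← lintegral_const_mul' _ _ ENNReal.ofReal_ne_top]
      refine setLIntegral_mono' (s := refCell n kind) (refCell_isClosed n kind).measurableSet
        fun y hy => ?_
      rw [enorm_mul, mul_comm]
      refine mul_le_mul' ?_ le_rfl
      rw [← ofReal_norm]
      exact ENNReal.ofReal_le_ofReal (hbd z hz y hy).1
    have h2 := lintegral_sq_le (volume.restrict (refCell n kind))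
      (memLp_comp_cell F hw).1.enorm
    rw [Measure.restrict_apply_univ, lintegral_refCell F (fun x => ‖w x‖ₑ ^ 2)] at h2
    calc ‖S.coef F z w‖ₑ ^ 2
        ≤ (ENNReal.ofReal B * ∫⁻ y in refCell n kind, ‖w (F y)‖ₑ) ^ 2 := by gcongr
      _ = ENNReal.ofReal (B ^ 2) * (∫⁻ y in refCell n kind, ‖w (F y)‖ₑ) ^ 2 := by
          rw [mul_pow, ENNReal.ofReal_pow hB.le]
      _ ≤ ENNReal.ofReal (B ^ 2) * (V * (ENNReal.ofReal (jac F)⁻¹ *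
          ∫⁻ x in cell kind F, ‖w x‖ₑ ^ 2)) := by gcongr
      _ = K₁ * ENNReal.ofReal (jac F)⁻¹ * ∫⁻ x in cell kind F, ‖w x‖ₑ ^ 2 := by rw [hK₁]; ring
      _ ≤ _ := by gcongr; exact le_self_add
  · intro F a
    have h1 := hint F (S.loc F a) (B ^ 2 * S.N.card * ∑ z ∈ S.N, a z ^ 2) fun x hx =>
      S.sq_sum_le a _ fun z hz => (hbd z hz _ (symm_mem_refCell hx)).2.1
    refine h1.trans ?_
    rw [ENNReal.ofReal_mul (by positivity), ← hsum]
    calc _ = K₂ * ENNReal.ofReal (jac F) * ∑ z ∈ S.N, ‖a z‖ₑ ^ 2 := by rw [hK₂]; ring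
      _ ≤ _ := by gcongr; exact le_add_self
  · intro F a v c hc
    have hc0 : 0 ≤ c := (norm_nonneg _).trans hc
    have h1 := hint F (fun x => fderiv ℝ (S.loc F a) x v)
      ((B * c) ^ 2 * S.N.card * ∑ z ∈ S.N, a z ^ 2) fun x hx => by
        rw [fderiv_loc]
        refine S.sq_sum_le a _ fun z hz => ?_
        rw [← Real.norm_eq_abs]
        refine (ContinuousLinearMap.le_opNorm _ _).trans ?_
        exact mul_le_mul (hbd z hz _ (symm_mem_refCell hx)).2.2 hc (norm_nonneg _) hB.le
    refine h1.trans ?_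
    have h2 : (B * c) ^ 2 * S.N.card * ∑ z ∈ S.N, a z ^ 2
        = (B ^ 2 * S.N.card) * (c ^ 2 * ∑ z ∈ S.N, a z ^ 2) := by ring
    rw [h2, ENNReal.ofReal_mul (by positivity), ENNReal.ofReal_mul (p := c ^ 2) (by positivity),
      ← hsum]
    calc _ = K₂ * ENNReal.ofReal (c ^ 2) * ENNReal.ofReal (jac F) * ∑ z ∈ S.N, ‖a z‖ₑ ^ 2 := by
          rw [hK₂]; ring
      _ ≤ _ := by gcongr; exact le_add_self

end RefElement

/-! ### Continuous piecewise smooth functions belong to `H¹` -/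

/-- A function which is Lipschitz at each point of a segment, with a common constant, is Lipschitz
along the segment. -/
lemma abs_sub_le_of_segment {n : ℕ} {f : E n → ℝ} {L : ℝ} {a b : E n}
    (h : ∀ x ∈ segment ℝ a b, ∃ ε > (0 : ℝ), ∀ y ∈ segment ℝ a b, dist y x < ε →
      |f y - f x| ≤ L * dist y x) : |f b - f a| ≤ L * dist b a := by
  set γ : ℝ → E n := fun t => a + t • (b - a) with hγ
  have hγseg : ∀ t ∈ Icc (0 : ℝ) 1, γ t ∈ segment ℝ a b := fun t ht => by
    rw [segment_eq_image']
    exact ⟨t, ht, rfl⟩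
  have hγd : ∀ t t' : ℝ, dist (γ t) (γ t') = |t - t'| * dist b a := by
    intro t t'
    rw [dist_eq_norm, hγ]
    have : a + t • (b - a) - (a + t' • (b - a)) = (t - t') • (b - a) := by module
    simp only [this, norm_smul, Real.norm_eq_abs, dist_eq_norm]
  have hγc : Continuous γ := by fun_prop
  have hcont : ContinuousOn (fun t => f (γ t)) (Icc 0 1) := by
    intro t ht
    obtain ⟨ε, hε, hf⟩ := h (γ t) (hγseg t ht)
    rw [ContinuousWithinAt, tendsto_iff_dist_tendsto_zero]
    have h0 : Filter.Tendsto (fun t' => L * dist (γ t') (γ t)) (nhdsWithin t (Icc 0 1))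
        (nhds 0) := by
      have h1 : Continuous fun t' => L * dist (γ t') (γ t) := by fun_prop
      have h2 := h1.tendsto t
      simp only [dist_self, mul_zero] at h2
      exact h2.mono_left nhdsWithin_le_nhds
    refine squeeze_zero' (Filter.Eventually.of_forall fun _ => dist_nonneg) ?_ h0
    have h3 : ∀ᶠ t' in nhdsWithin t (Icc 0 1), dist (γ t') (γ t) < ε :=
      nhdsWithin_le_nhds (hγc.continuousAt.eventually (ball_mem_nhds (γ t) hε))
    filter_upwards [h3, self_mem_nhdsWithin] with t' h4 h5
    exact hf _ (hγseg t' h5) h4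
  set s : Set ℝ := {t | t ∈ Icc (0 : ℝ) 1 ∧ |f (γ t) - f (γ 0)| ≤ L * (t * dist b a)} with hs
  have hclosed : IsClosed s := by
    refine isClosed_Icc.isClosed_le ?_ ?_
    · exact (hcont.sub continuousOn_const).abs
    · exact Continuous.continuousOn (by fun_prop)
  have hsub : Icc (0 : ℝ) 1 ⊆ s := by
    refine IsClosed.Icc_subset_of_forall_exists_gt (hclosed.inter isClosed_Icc) ?_ ?_
    · exact ⟨⟨le_rfl, zero_le_one⟩, by simp⟩
    · rintro t ⟨⟨ht, hft⟩, ht'⟩ y hy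
      obtain ⟨ε, hε, hf⟩ := h (γ t) (hγseg t ht)
      have hev : ∀ᶠ t' in nhdsWithin t (Ioi t), dist (γ t') (γ t) < ε :=
        nhdsWithin_le_nhds (hγc.continuousAt.eventually (ball_mem_nhds (γ t) hε))
      have hev2 : ∀ᶠ t' in nhdsWithin t (Ioi t), t' ∈ Ioc t (min y 1) :=
        Ioc_mem_nhdsGT (lt_min hy ht'.2)
      obtain ⟨t', h1, h2⟩ := (hev.and hev2).exists
      have ht1 : t' ∈ Icc (0 : ℝ) 1 := ⟨ht.1.trans h2.1.le, h2.2.trans (min_le_right _ _)⟩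
      refine ⟨t', ⟨ht1, ?_⟩, h2.1, h2.2.trans (min_le_left _ _)⟩
      have h3 := hf _ (hγseg t' ht1) h1
      rw [hγd, abs_of_pos (a := t' - t) (by linarith [h2.1])] at h3
      have h4 := abs_sub_le (f (γ t')) (f (γ t)) (f (γ 0))
      nlinarith
  have h1 := (hsub (right_mem_Icc.2 zero_le_one)).2
  simpa [hγ] using h1

namespace Triangulation

variable {n : ℕ} {kind : CellKind} {Ω : Set (E n)} (𝒯 : Triangulation Ω kind)

lemma ae_exists_interior {R : Finset (E n ≃ᵃ[ℝ] E n)}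
    (hR : ∀ F ∈ 𝒯.maps, ∃ G ∈ R, cell kind G = cell kind F) :
    ∀ᵐ x : E n, x ∈ Ω → ∃ F ∈ R, x ∈ interior (cell kind F) := by
  have h1 : ∀ᵐ x : E n, ∀ F ∈ R, x ∉ frontier (cell kind F) := by
    rw [Filter.eventually_all_finset]
    exact fun F _ => measure_eq_zero_iff_ae_notMem.1 ((cell_convex F).addHaar_frontier volume)
  filter_upwards [h1] with x hx hxΩ
  obtain ⟨F, hF, hxF⟩ := 𝒯.exists_mem_cell (subset_closure hxΩ)
  obtain ⟨G, hG, hGF⟩ := hR F hF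
  rw [← hGF] at hxF
  refine ⟨G, hG, ?_⟩
  by_contra h
  exact hx G hG ⟨subset_closure hxF, h⟩

/-- Close to a given point, a compatible family of smooth functions on the cells is Lipschitz at
that point: only cells containing the point matter. -/
lemma exists_calm {g : (E n ≃ᵃ[ℝ] E n) → E n → ℝ} {G : E n → ℝ} {L : ℝ}
    (hG : ∀ F ∈ 𝒯.maps, ∀ x ∈ cell kind F, G x = g F x)
    (hL : ∀ F ∈ 𝒯.maps, ∀ x ∈ closure Ω, ∀ y ∈ closure Ω, |g F y - g F x| ≤ L * dist y x)
    {x : E n} (hx : x ∈ closure Ω) :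
    ∃ ε > (0 : ℝ), ∀ y ∈ closure Ω, dist y x < ε → |G y - G x| ≤ L * dist y x := by
  have h1 : ∀ᶠ y in nhds x, ∀ F ∈ 𝒯.maps, x ∉ cell kind F → y ∉ cell kind F := by
    rw [Filter.eventually_all_finset]
    intro F _
    by_cases hxF : x ∈ cell kind F
    · exact Filter.Eventually.of_forall fun y h => absurd hxF h
    · filter_upwards [(cell_isCompact F).isClosed.isOpen_compl.mem_nhds hxF] with y hy _
      exact hy
  obtain ⟨ε, hε, H⟩ := Metric.eventually_nhds_iff.1 h1
  refine ⟨ε, hε, fun y hy hyx => ?_⟩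
  obtain ⟨F, hF, hyF⟩ := 𝒯.exists_mem_cell hy
  have hxF : x ∈ cell kind F := by
    by_contra h
    exact H hyx F hF h hyF
  rw [hG F hF y hyF, hG F hF x hxF]
  exact hL F hF x hx y hy

/-- A family of `C¹` functions on the cells which agree on common faces is the restriction of a
function in `H¹(Ω)`, whose weak gradient is the piecewise gradient. Multiplying by a test
function yields a Lipschitz function, and the integral of a partial derivative of a compactly
supported Lipschitz function vanishes. -/
theorem exists_H1 (hΩ : IsBoundedLipschitzDomain Ω) (g : (E n ≃ᵃ[ℝ] E n) → E n → ℝ)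
    (hg : ∀ F ∈ 𝒯.maps, ContDiff ℝ 1 (g F))
    (hcompat : ∀ F ∈ 𝒯.maps, ∀ G ∈ 𝒯.maps, ∀ x ∈ cell kind F ∩ cell kind G, g F x = g G x) :
    ∃ v : H1 Ω, ∀ F ∈ 𝒯.maps, toL2 v =ᵐ[volume.restrict (cell kind F)] g F ∧
      ∀ j, (fun x => grad v x j) =ᵐ[volume.restrict (cell kind F)]
        fun x => fderiv ℝ (g F) x (EuclideanSpace.single j 1) := by
  classical
  obtain ⟨R, hRsub, hR, hdisj⟩ := 𝒯.exists_reps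
  obtain ⟨ρ₀, hρ₀⟩ := hΩ.isBounded.closure.subset_closedBall (0 : E n)
  set ρ : ℝ := |ρ₀| + 1 with hρ
  have hρpos : 0 < ρ := by positivity
  have hΩρ : closure Ω ⊆ ball 0 ρ := hρ₀.trans (closedBall_subset_ball (by
    rw [hρ]; linarith [le_abs_self ρ₀]))
  -- the global function
  let G : E n → ℝ := fun x => if h : ∃ F ∈ 𝒯.maps, x ∈ cell kind F then g h.choose x else 0
  have hG : ∀ F ∈ 𝒯.maps, ∀ x ∈ cell kind F, G x = g F x := by
    intro F hF x hx
    have h : ∃ F ∈ 𝒯.maps, x ∈ cell kind F := ⟨F, hF, hx⟩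
    simp only [G, dif_pos h]
    exact hcompat _ h.choose_spec.1 F hF x ⟨h.choose_spec.2, hx⟩
  have hlip : ∀ F : E n ≃ᵃ[ℝ] E n, ∃ L : ℝ, 0 ≤ L ∧ (F ∈ 𝒯.maps → (∀ x ∈ closure Ω, ∀ y ∈ closure Ω,
      |g F y - g F x| ≤ L * dist y x) ∧ ∀ x ∈ closure Ω, |g F x| ≤ L) := by
    intro F
    by_cases hF : F ∈ 𝒯.maps
    · obtain ⟨K, hK⟩ := (hg F hF).contDiffOn.exists_lipschitzOnWith one_ne_zero
        (convex_closedBall (0 : E n) ρ) (isCompact_closedBall _ _)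
      obtain ⟨M, hM⟩ := (isCompact_closedBall (0 : E n) ρ).exists_bound_of_continuousOn
        (hg F hF).continuous.continuousOn
      refine ⟨max K |M|, le_max_of_le_left K.2, fun _ => ⟨fun x hx y hy => ?_, fun x hx => ?_⟩⟩
      · have h1 := hK.dist_le_mul y (ball_subset_closedBall (hΩρ hy)) x
          (ball_subset_closedBall (hΩρ hx))
        rw [Real.dist_eq] at h1
        refine h1.trans ?_
        gcongr
        exact le_max_left _ _
      · exact (hM x (ball_subset_closedBall (hΩρ hx))).trans
          ((le_abs_self M).trans (le_max_right _ _))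
    · exact ⟨0, le_rfl, fun h => absurd h hF⟩
  choose Lf hLf0 hLf using hlip
  set L : ℝ := ∑ F ∈ 𝒯.maps, Lf F with hL
  have hL0 : 0 ≤ L := Finset.sum_nonneg fun F _ => hLf0 F
  have hLle : ∀ F ∈ 𝒯.maps, Lf F ≤ L := fun F hF =>
    Finset.single_le_sum (f := Lf) (fun F _ => hLf0 F) hF
  have hcalm : ∀ x ∈ closure Ω, ∃ ε > (0 : ℝ), ∀ y ∈ closure Ω, dist y x < ε →
      |G y - G x| ≤ L * dist y x := fun x hx =>
    𝒯.exists_calm hG (fun F hF x hx y hy => ((hLf F hF).1 x hx y hy).trans (by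
      gcongr; exact hLle F hF)) hx
  have hGbd : ∀ x ∈ closure Ω, |G x| ≤ L := by
    intro x hx
    obtain ⟨F, hF, hxF⟩ := 𝒯.exists_mem_cell hx
    rw [hG F hF x hxF]
    exact ((hLf F hF).2 x hx).trans (hLle F hF)
  -- the piecewise gradient
  let d : Fin n → E n → ℝ := fun j x => ∑ F ∈ R, (interior (cell kind F)).indicator
    (fun x => fderiv ℝ (g F) x (EuclideanSpace.single j 1)) x
  let G' : E n → ℝ := fun x => ∑ F ∈ R, (interior (cell kind F)).indicator (g F) x
  have hsum : ∀ (k : (E n ≃ᵃ[ℝ] E n) → E n → ℝ), ∀ F ∈ R, ∀ x ∈ interior (cell kind F),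
      ∑ F ∈ R, (interior (cell kind F)).indicator (k F) x = k F x := by
    intro k F hF x hx
    rw [Finset.sum_eq_single F]
    · exact indicator_of_mem hx _
    · intro F' hF' hne
      refine indicator_of_notMem (fun hx' => ?_) _
      exact disjoint_left.1 (hdisj hF' hF hne) hx' hx
    · exact fun h => absurd hF h
  have hd : ∀ F ∈ R, ∀ x ∈ interior (cell kind F), ∀ j,
      d j x = fderiv ℝ (g F) x (EuclideanSpace.single j 1) := fun F hF x hx j =>
    hsum (fun F x => fderiv ℝ (g F) x (EuclideanSpace.single j 1)) F hF x hx
  have hG' : ∀ F ∈ R, ∀ x ∈ interior (cell kind F), G' x = G x := fun F hF x hx => by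
    rw [hG F (hRsub hF) x (interior_subset hx)]
    exact hsum g F hF x hx
  have hae := 𝒯.ae_exists_interior hR
  have hGG' : G' =ᵐ[volume.restrict Ω] G := by
    filter_upwards [ae_restrict_of_ae hae, ae_restrict_mem hΩ.isOpen.measurableSet] with x hx hxΩ
    obtain ⟨F, hF, hxF⟩ := hx hxΩ
    exact hG' F hF x hxF
  have hbddΩ : Ω ⊆ ball 0 ρ := subset_closure.trans hΩρ
  have hG'mem : MemLp G' 2 (volume.restrict Ω) :=
    memLp_finsetSum _ fun F hF => (memLp_of_continuous_bounded hbddΩ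
      (hg F (hRsub hF)).continuous).indicator isOpen_interior.measurableSet
  have hGmem : MemLp G 2 (volume.restrict Ω) := hG'mem.ae_eq hGG'
  have hdmem : ∀ j, MemLp (d j) 2 (volume.restrict Ω) := fun j =>
    memLp_finsetSum _ fun F hF => (memLp_of_continuous_bounded hbddΩ
      (((hg F (hRsub hF)).continuous_fderiv one_ne_zero).clm_apply
        continuous_const)).indicator isOpen_interior.measurableSet
  -- the weak gradient
  have hweak : IsWeakGrad Ω G d := by
    intro j φ hφ
    set e : E n := EuclideanSpace.single j 1 with he
    obtain ⟨Kφ, hKφ⟩ := hφ.1.lipschitzWith_of_hasCompactSupport hφ.2.1 (by simp)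
    obtain ⟨Mφ, hMφ⟩ := hφ.2.1.exists_bound_of_continuous hφ.1.continuous
    have hMφ0 : 0 ≤ Mφ := (norm_nonneg _).trans (hMφ 0)
    let f : E n → ℝ := fun x => φ x * G x
    have hf0 : ∀ x ∉ tsupport φ, f =ᶠ[nhds x] fun _ => 0 := by
      intro x hx
      filter_upwards [(isClosed_tsupport φ).isOpen_compl.mem_nhds hx] with y hy
      simp [f, image_eq_zero_of_notMem_tsupport hy]
    have hflip : LipschitzWith (Real.toNNReal (Mφ * L + L * Kφ)) f := by
      refine LipschitzWith.of_dist_le_mul fun b a => ?_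
      rw [Real.coe_toNNReal _ (by positivity), Real.dist_eq]
      refine abs_sub_le_of_segment fun x _ => ?_
      by_cases hx : x ∈ tsupport φ
      · have hxΩ := hφ.2.2 hx
        obtain ⟨ε, hε, hcalmx⟩ := hcalm x (subset_closure hxΩ)
        obtain ⟨ε', hε', hball⟩ := Metric.isOpen_iff.1 hΩ.isOpen x hxΩ
        refine ⟨min ε ε', lt_min hε hε', fun y _ hyx => ?_⟩
        have hyΩ : y ∈ Ω := hball (hyx.trans_le (min_le_right _ _))
        have h1 := hcalmx y (subset_closure hyΩ) (hyx.trans_le (min_le_left _ _))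
        have h2 := hKφ.dist_le_mul y x
        rw [Real.dist_eq] at h2
        have h3 : f y - f x = φ y * (G y - G x) + G x * (φ y - φ x) := by simp only [f]; ring
        rw [h3]
        refine (abs_add_le _ _).trans ?_
        rw [abs_mul, abs_mul]
        have h4 := hMφ y
        rw [Real.norm_eq_abs] at h4
        have h5 := hGbd x (subset_closure hxΩ)
        calc |φ y| * |G y - G x| + |G x| * |φ y - φ x|
            ≤ Mφ * (L * dist y x) + L * (Kφ * dist y x) := by gcongr
          _ = _ := by ring
      · obtain ⟨ε, hε, H⟩ := Metric.eventually_nhds_iff.1 (hf0 x hx)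
        refine ⟨ε, hε, fun y _ hyx => ?_⟩
        rw [H hyx, H (y := x) (by simpa using hε)]
        simp only [sub_self, abs_zero]
        positivity
    let ψ : ContDiffBump (0 : E n) := ⟨ρ, ρ + 1, hρpos, by linarith⟩
    obtain ⟨Kψ, hKψ⟩ := (ψ.contDiff (n := 1)).lipschitzWith_of_hasCompactSupport
      ψ.hasCompactSupport one_ne_zero
    have hibp := hflip.integral_lineDeriv_mul_eq (μ := volume) hKψ ψ.hasCompactSupport e
    have hconst : ∀ (c : ℝ) (x v : E n), lineDeriv ℝ (fun _ : E n => c) x v = 0 := fun c x v => by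
      simp [lineDeriv]
    have hzero : ∀ x, lineDeriv ℝ ψ x (-e) * f x = 0 := by
      intro x
      by_cases hx : x ∈ tsupport φ
      · have h1 : ψ =ᶠ[nhds x] fun _ => (1 : ℝ) := by
          filter_upwards [isOpen_ball.mem_nhds (hbddΩ (hφ.2.2 hx))] with y hy
          exact ψ.one_of_mem_closedBall (ball_subset_closedBall hy)
        rw [h1.lineDeriv_eq, hconst, zero_mul]
      · rw [(hf0 x hx).eq_of_nhds, mul_zero]
    rw [integral_congr_ae (Filter.Eventually.of_forall hzero), integral_zero] at hibp
    have hout : ∀ x ∉ Ω, lineDeriv ℝ f x e * ψ x = 0 := by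
      intro x hx
      rw [(hf0 x fun h => hx (hφ.2.2 h)).lineDeriv_eq, hconst, zero_mul]
    rw [← setIntegral_eq_integral_of_forall_compl_eq_zero hout] at hibp
    have hin : ∀ᵐ x ∂(volume.restrict Ω), lineDeriv ℝ f x e * ψ x
        = G x * fderiv ℝ φ x e + d j x * φ x := by
      filter_upwards [ae_restrict_of_ae hae, ae_restrict_mem hΩ.isOpen.measurableSet] with x hx hxΩ
      obtain ⟨F, hF, hxF⟩ := hx hxΩ
      have h1 : f =ᶠ[nhds x] fun y => φ y * g F y := by
        filter_upwards [isOpen_interior.mem_nhds hxF] with y hy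
        simp only [f, hG F (hRsub hF) y (interior_subset hy)]
      have h2 : HasFDerivAt (fun y => φ y * g F y)
          (φ x • fderiv ℝ (g F) x + g F x • fderiv ℝ φ x) x :=
        ((hφ.1.differentiable (by simp)) x).hasFDerivAt.mul
          (((hg F (hRsub hF)).differentiable one_ne_zero) x).hasFDerivAt
      have h3 : ψ x = 1 := ψ.one_of_mem_closedBall (ball_subset_closedBall (hbddΩ hxΩ))
      rw [h1.lineDeriv_eq, (h2.hasLineDerivAt e).lineDeriv, h3, hd F hF x hxF,
        hG F (hRsub hF) x (interior_subset hxF)]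
      simp only [add_apply, smul_apply, smul_eq_mul]
      ring
    have i1 : Integrable (fun x => G x * fderiv ℝ φ x e) (volume.restrict Ω) :=
      hGmem.integrable_mul (hφ.memLp_fderiv e Ω)
    have i2 : Integrable (fun x => d j x * φ x) (volume.restrict Ω) :=
      (hdmem j).integrable_mul (hφ.memLp Ω)
    rw [integral_congr_ae hin, integral_add i1 i2] at hibp
    linarith
  -- the element of `H¹`
  have hvec : MemLp (fun x => ∑ j, d j x • EuclideanSpace.single j (1 : ℝ)) 2 (volume.restrict Ω) :=
    memLp_finsetSum _ fun j _ => (hdmem j).continuousLinearMap_comp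
      (ContinuousLinearMap.toSpanSingleton ℝ (EuclideanSpace.single j (1 : ℝ)))
  have hvecj : ∀ x j, (∑ j, d j x • EuclideanSpace.single j (1 : ℝ) : E n) j = d j x := by
    intro x j
    simp [Finset.sum_apply, Pi.single_apply]
  let w : WithLp 2 (L2 Ω × L2Vec Ω) := WithLp.toLp 2 (hGmem.toLp G, hvec.toLp _)
  have hw1 : (w.fst : E n → ℝ) =ᵐ[volume.restrict Ω] G := hGmem.coeFn_toLp
  have hw2 : ∀ j, (fun x => w.snd x j) =ᵐ[volume.restrict Ω] d j := by
    intro j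
    filter_upwards [hvec.coeFn_toLp] with x hx
    change (hvec.toLp _ : E n → E n) x j = _
    rw [hx, hvecj]
  have hwH : w ∈ H1 Ω := fun j =>
    (isWeakPartial_one_iff.2 (hweak j)).congr hw1 (hw2 j)
  refine ⟨⟨w, hwH⟩, fun F hF => ?_⟩
  obtain ⟨F', hF', hFF'⟩ := hR F hF
  have hac : (volume.restrict (cell kind F)) ≪ volume.restrict Ω :=
    (𝒯.restrict_cell_le hΩ hF).absolutelyContinuous
  refine ⟨?_, fun j => ?_⟩
  · filter_upwards [hac.ae_le hw1, ae_restrict_mem (cell_measurableSet F)] with x hx hxF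
    rw [← hG F hF x hxF]
    exact hx
  · rw [restrict_cell_eq] at hac ⊢
    filter_upwards [hac.ae_le (hw2 j), ae_restrict_mem isOpen_interior.measurableSet] with x hx hxF
    have hxF' : x ∈ interior (cell kind F') := by rwa [hFF']
    refine hx.trans ?_
    rw [hd F' hF' x hxF']
    have h1 : g F' =ᶠ[nhds x] g F := by
      filter_upwards [isOpen_interior.mem_nhds hxF] with y hy
      have hy' := interior_subset hy
      exact hcompat F' (hRsub hF') F hF y ⟨by rwa [hFF'], hy'⟩
    rw [h1.fderiv_eq]

end Triangulation

/-! ### Quasi-interpolation -/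

lemma enorm_sub_sq_le (a b c : ℝ) :
    ‖a - b‖ₑ ^ 2 ≤ 2 * ‖b - c‖ₑ ^ 2 + 2 * ‖a - c‖ₑ ^ 2 := by
  rw [enorm_sq_eq, enorm_sq_eq, enorm_sq_eq, ← ENNReal.ofReal_ofNat 2,
    ← ENNReal.ofReal_mul (by norm_num), ← ENNReal.ofReal_mul (by norm_num),
    ← ENNReal.ofReal_add (by positivity) (by positivity)]
  refine ENNReal.ofReal_le_ofReal ?_
  nlinarith [sq_nonneg (a - c + (b - c))]

lemma lintegral_enorm_sub_sq_le {α : Type*} [MeasurableSpace α] (μ : Measure α) {a b c : α → ℝ}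
    (hbc : Measurable fun x => b x - c x) :
    ∫⁻ x, ‖a x - b x‖ₑ ^ 2 ∂μ ≤ 2 * ∫⁻ x, ‖b x - c x‖ₑ ^ 2 ∂μ + 2 * ∫⁻ x, ‖a x - c x‖ₑ ^ 2 ∂μ := by
  rw [← lintegral_const_mul' _ _ (by norm_num), ← lintegral_const_mul' _ _ (by norm_num),
    ← lintegral_add_left ((hbc.enorm.pow_const 2).const_mul 2)]
  exact lintegral_mono fun x => enorm_sub_sq_le _ _ _

lemma sum_sobSeminormSq_le {n : ℕ} {Ω : Set (E n)} {τ : ℝ} {U : (Fin n →₀ ℕ) → E n → ℝ}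
    {ι : Type*} (R : Finset ι) (D : ι → Set (E n)) {C : ℝ≥0∞}
    (h : ∀ f : E n → ℝ≥0∞, ∑ F ∈ R, ∫⁻ x in D F, f x ≤ C * ∫⁻ x in Ω, f x) :
    ∑ F ∈ R, sobSeminormSq Ω (D F) τ U ≤ C * sobSeminormSq Ω Ω τ U := by
  unfold sobSeminormSq
  split_ifs
  · rw [Finset.sum_comm, Finset.mul_sum]
    exact Finset.sum_le_sum fun β _ => h _
  · rw [Finset.sum_comm, Finset.mul_sum]
    exact Finset.sum_le_sum fun β _ => h _

namespace RefElement

variable {n r : ℕ} {kind : CellKind} (S : RefElement n r kind)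

/-- Finite element functions on a cell: if the nodal values differ from those of a polynomial of
degree at most `r` by averages over nearby cells, the finite element function differs from the
polynomial by the size of these averages. -/
lemma loc_sub_global (F : E n ≃ᵃ[ℝ] E n) {q : MvPolynomial (Fin n) ℝ} (hq : q.totalDegree ≤ r)
    (c : E n → ℝ) (x : E n) :
    S.loc F (fun z => c z - MvPolynomial.eval (F z) q) x
      = S.loc F c x - MvPolynomial.eval x q := by
  rw [S.loc_sub F c (fun z => MvPolynomial.eval (F z) q), S.loc_global F hq]

end RefElement

/-- On domains with star-shaped patches, the finite element space contains approximations of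
optimal order of functions in `H^τ`, `1 ≤ τ ≤ r + 1`. The approximation is a quasi-interpolant:
each nodal value is the mean against a dual function over one cell containing the node. It
reproduces polynomials locally, and is bounded by the `L²` norm on a neighbourhood of the cell, so
that the Bramble–Hilbert lemma on the patch around the cell gives the estimate. -/
theorem exists_interpolant {n : ℕ} (hn : 0 < n) {Ω : Set (E n)} (hΩ : IsBoundedLipschitzDomain Ω)
    (kind : CellKind) {r : ℕ} (hr : 1 ≤ r) {τ : ℝ} (hτ : 1 ≤ τ) (hτr : τ ≤ r + 1) (κ : ℝ) :
    ∃ h₀ > (0 : ℝ), ∃ C : ℝ≥0∞, C ≠ ⊤ ∧ ∀ 𝒯 : Triangulation Ω kind, 𝒯.Quality κ → 𝒯.h ≤ h₀ →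
      ∀ U : (Fin n →₀ ℕ) → E n → ℝ, (∀ β, MemLp (U β) 2 (volume.restrict Ω)) →
      (∀ β : Fin n →₀ ℕ, β.degree < ⌊τ⌋₊ →
        IsWeakGrad Ω (U β) (fun j => U (β + Finsupp.single j 1))) →
      ∃ v ∈ feSpace 𝒯 r,
        ∫⁻ x in Ω, ‖U 0 x - toL2 v x‖ₑ ^ 2
          ≤ C * ENNReal.ofReal (𝒯.h ^ (2 * τ)) * sobSeminormSq Ω Ω τ U ∧
        ∀ j, ∫⁻ x in Ω, ‖U (Finsupp.single j 1) x - grad v x j‖ₑ ^ 2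
          ≤ C * ENNReal.ofReal (𝒯.h ^ (2 * (τ - 1))) * sobSeminormSq Ω Ω τ U := by
  classical
  obtain ⟨S⟩ := exists_refElement n kind hr
  obtain ⟨K, hK, hcoef, hloc, hdloc⟩ := S.exists_estimates
  obtain ⟨Cg, hCg, hgeo⟩ := Triangulation.exists_geometry hn kind κ
  obtain ⟨h₀, hh₀, Λ, hΛ, hpatch⟩ := hΩ.exists_patch
  obtain ⟨CB, hCB, hBH⟩ := bramble_hilbert n r hτ hτr hΛ
  obtain ⟨CO, hCO, hover⟩ := Triangulation.exists_overlap hn kind κ Λ hΛ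
  set M : ℝ≥0∞ := K * K * ENNReal.ofReal (Cg * Cg) * S.N.card with hM
  have hMt : M ≠ ⊤ := ENNReal.mul_ne_top (ENNReal.mul_ne_top (ENNReal.mul_ne_top hK hK)
    ENNReal.ofReal_ne_top) (ENNReal.natCast_ne_top _)
  set C₁ : ℝ≥0∞ := (2 * (M * (1 + ENNReal.ofReal (Cg ^ 2))) + 2) * CB with hC₁
  have hC₁t : C₁ ≠ ⊤ := by
    refine ENNReal.mul_ne_top (ENNReal.add_ne_top.2 ⟨ENNReal.mul_ne_top (by norm_num)
      (ENNReal.mul_ne_top hMt (ENNReal.add_ne_top.2 ⟨by norm_num, ENNReal.ofReal_ne_top⟩)),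
      by norm_num⟩) hCB
  refine ⟨h₀, hh₀, C₁ * CO, ENNReal.mul_ne_top hC₁t hCO, fun 𝒯 hq hle U hU hgrad => ?_⟩
  have hne := hΩ.isConnected.nonempty
  have hh := 𝒯.h_pos hn hne
  obtain ⟨R, hRsub, hR, hdisj⟩ := 𝒯.exists_reps
  have hUcell : ∀ β, ∀ F ∈ 𝒯.maps, MemLp (U β) 2 (volume.restrict (cell kind F)) :=
    fun β F hF => (hU β).mono_measure (𝒯.restrict_cell_le hΩ hF)
  -- the choice of a cell for each node, and the quasi-interpolant
  have hσ : ∀ y : E n, ∃ σ : (E n ≃ᵃ[ℝ] E n) × E n, (∃ F ∈ 𝒯.maps, ∃ z ∈ S.N, F z = y) →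
      σ.1 ∈ 𝒯.maps ∧ σ.2 ∈ S.N ∧ σ.1 σ.2 = y := by
    intro y
    by_cases h : ∃ F ∈ 𝒯.maps, ∃ z ∈ S.N, F z = y
    · obtain ⟨F, hF, z, hz, hy⟩ := h
      exact ⟨(F, z), fun _ => ⟨hF, hz, hy⟩⟩
    · exact ⟨(AffineEquiv.refl ℝ (E n), 0), fun h' => absurd h' h⟩
  choose σ hσ using hσ
  let c : E n → ℝ := fun y => S.coef (σ y).1 (σ y).2 (U 0)
  let g : (E n ≃ᵃ[ℝ] E n) → E n → ℝ := fun F => S.loc F fun z => c (F z)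
  obtain ⟨v, hv⟩ := 𝒯.exists_H1 hΩ g (fun F _ => S.contDiff_loc F _) fun F hF G hG x hx =>
    S.conforming F G (𝒯.conforming F hF G hG)
      (by rw [inter_comm]; exact 𝒯.conforming G hG F hF) c x hx
  -- the estimates on one cell
  have hlocal : ∀ F ∈ 𝒯.maps, ∃ D : Set (E n), (MeasurableSet D ∧ D ⊆ Ω ∧
      ∃ x ∈ cell kind F, D ⊆ ball x (Λ * 𝒯.h)) ∧
      ∫⁻ x in cell kind F, ‖U 0 x - toL2 v x‖ₑ ^ 2
        ≤ C₁ * ENNReal.ofReal (𝒯.h ^ (2 * τ)) * sobSeminormSq Ω D τ U ∧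
      ∀ j, ∫⁻ x in cell kind F, ‖U (Finsupp.single j 1) x - grad v x j‖ₑ ^ 2
        ≤ C₁ * ENNReal.ofReal (𝒯.h ^ (2 * (τ - 1))) * sobSeminormSq Ω D τ U := by
    intro F hF
    obtain ⟨x₀, hx₀⟩ := interior_cell_nonempty (kind := kind) F
    have hx₀F := interior_subset hx₀
    obtain ⟨b₀, D, hD, hDΩ, hDb, hDx, hstar, hnear⟩ :=
      hpatch x₀ (𝒯.cell_subset_closure hF hx₀F) 𝒯.h hh hle
    obtain ⟨p, hp, hp0, hp1⟩ := hBH Ω D hΩ.isOpen hD hDΩ b₀ 𝒯.h hh hstar hDb U hU hgrad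
    refine ⟨D, ⟨hD.measurableSet, hDΩ, x₀, hx₀F, hDx⟩, ?_⟩
    have hgF := hgeo Ω 𝒯 hq hne F hF
    set I := ∫⁻ x in D, ‖U 0 x - MvPolynomial.eval x p‖ₑ ^ 2 with hI
    -- cells meeting `F` lie in the patch
    have hcellD : ∀ G ∈ 𝒯.maps, (cell kind F ∩ cell kind G).Nonempty → ∀ f : E n → ℝ≥0∞,
        ∫⁻ x in cell kind G, f x ≤ ∫⁻ x in D, f x := by
      rintro G hG ⟨y, hyF, hyG⟩ f
      rw [Triangulation.restrict_cell_eq]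
      refine lintegral_mono_set fun x hx => hnear ⟨𝒯.interior_cell_subset hΩ hG hx, ?_⟩
      have h1 := (dist_le_diam_of_mem (cell_isCompact F).isBounded hyF hx₀F).trans (𝒯.diam_le_h hF)
      have h2 := (dist_le_diam_of_mem (cell_isCompact G).isBounded (interior_subset hx)
        hyG).trans (𝒯.diam_le_h hG)
      rw [mem_ball]
      linarith [dist_triangle x y x₀]
    have hFD := hcellD F hF ⟨x₀, hx₀F, hx₀F⟩
    let a : E n → ℝ := fun z => c (F z) - MvPolynomial.eval (F z) p
    have ha : ∀ z ∈ S.N, ‖a z‖ₑ ^ 2 ≤ K * (ENNReal.ofReal (Cg / 𝒯.h ^ n) * I) := by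
      intro z hz
      obtain ⟨hG, hz', hFz⟩ := hσ (F z) ⟨F, hF, z, hz, rfl⟩
      set G := (σ (F z)).1 with hGdef
      have hpG : MemLp (fun x : E n => MvPolynomial.eval x p) 2
          (volume.restrict (cell kind G)) := by
        obtain ⟨R', hR'⟩ := (cell_isCompact (kind := kind) G).isBounded.subset_ball (0 : E n)
        exact memLp_of_continuous_bounded hR' (continuous_eval p)
      have h1 : a z = S.coef G (σ (F z)).2 (fun x => U 0 x - MvPolynomial.eval x p) := by
        rw [S.coef_sub _ (hUcell 0 G hG) hpG, S.coef_global G hz' hp, hFz]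
      have hmem : MemLp (fun x => U 0 x - MvPolynomial.eval x p) 2
          (volume.restrict (cell kind G)) := (hUcell 0 G hG).sub hpG
      rw [h1]
      refine (hcoef G _ hz' _ hmem).trans ?_
      rw [mul_assoc]
      gcongr
      · rw [inv_eq_one_div, div_le_div_iff₀ (jac_pos G) (by positivity), one_mul]
        exact (hgeo Ω 𝒯 hq hne G hG).2.1
      · exact hcellD G hG ⟨F z, mem_image_of_mem F (S.node_mem z hz), by
          rw [← hFz]; exact mem_image_of_mem G (S.node_mem _ hz')⟩ _
    have hjac : ENNReal.ofReal (jac F) * ∑ z ∈ S.N, ‖a z‖ₑ ^ 2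
        ≤ K * ENNReal.ofReal (Cg * Cg) * S.N.card * I := by
      calc ENNReal.ofReal (jac F) * ∑ z ∈ S.N, ‖a z‖ₑ ^ 2
          ≤ ENNReal.ofReal (Cg * 𝒯.h ^ n) *
            ∑ z ∈ S.N, K * (ENNReal.ofReal (Cg / 𝒯.h ^ n) * I) := by
            gcongr with z hz
            · exact hgF.1
            · exact ha z hz
        _ = K * (ENNReal.ofReal (Cg * 𝒯.h ^ n) * ENNReal.ofReal (Cg / 𝒯.h ^ n)) * S.N.card * I := by
            rw [Finset.sum_const, nsmul_eq_mul]; ring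
        _ = _ := by
            rw [← ENNReal.ofReal_mul (by positivity)]
            congr 4
            field_simp
    have hfun : S.loc F a = fun x => g F x - MvPolynomial.eval x p :=
      funext fun x => S.loc_sub_global F hp (fun z => c (F z)) x
    have hga : ∫⁻ x in cell kind F, ‖g F x - MvPolynomial.eval x p‖ₑ ^ 2 ≤ M * I := by
      have h1 := hloc F a
      rw [hfun] at h1
      refine h1.trans ?_
      rw [mul_assoc, hM]
      calc K * (ENNReal.ofReal (jac F) * ∑ z ∈ S.N, ‖a z‖ₑ ^ 2)
          ≤ K * (K * ENNReal.ofReal (Cg * Cg) * S.N.card * I) := by gcongr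
        _ = _ := by ring
    have hdga : ∀ j, ∫⁻ x in cell kind F, ‖fderiv ℝ (g F) x (EuclideanSpace.single j 1)
        - MvPolynomial.eval x (MvPolynomial.pderiv j p)‖ₑ ^ 2
          ≤ M * ENNReal.ofReal (Cg ^ 2) * (ENNReal.ofReal ((𝒯.h ^ 2)⁻¹) * I) := by
      intro j
      have h1 := hdloc F a (EuclideanSpace.single j 1) (Cg / 𝒯.h) (by
        have := hgF.2.2.2 (EuclideanSpace.single j (1 : ℝ))
        simpa using this)
      have h2 : ∀ x, fderiv ℝ (S.loc F a) x (EuclideanSpace.single j 1)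
          = fderiv ℝ (g F) x (EuclideanSpace.single j 1)
            - MvPolynomial.eval x (MvPolynomial.pderiv j p) := by
        intro x
        rw [hfun, fderiv_fun_sub ((S.contDiff_loc F _ (k := 1)).differentiable one_ne_zero x)
          ((contDiff_eval p (k := 1)).differentiable one_ne_zero x), sub_apply, fderiv_eval]
      simp only [h2] at h1
      refine h1.trans ?_
      have h3 : ENNReal.ofReal ((Cg / 𝒯.h) ^ 2)
          = ENNReal.ofReal (Cg ^ 2) * ENNReal.ofReal ((𝒯.h ^ 2)⁻¹) := by
        rw [← ENNReal.ofReal_mul (by positivity), div_pow, div_eq_mul_inv]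
      rw [mul_assoc, hM, h3]
      calc K * (ENNReal.ofReal (Cg ^ 2) * ENNReal.ofReal ((𝒯.h ^ 2)⁻¹)) *
            (ENNReal.ofReal (jac F) * ∑ z ∈ S.N, ‖a z‖ₑ ^ 2)
          ≤ K * (ENNReal.ofReal (Cg ^ 2) * ENNReal.ofReal ((𝒯.h ^ 2)⁻¹)) *
            (K * ENNReal.ofReal (Cg * Cg) * S.N.card * I) := by gcongr
        _ = _ := by ring
    obtain ⟨hv0, hv1⟩ := hv F hF
    constructor
    · have h1 : ∫⁻ x in cell kind F, ‖U 0 x - toL2 v x‖ₑ ^ 2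
          = ∫⁻ x in cell kind F, ‖U 0 x - g F x‖ₑ ^ 2 := by
        refine lintegral_congr_ae ?_
        filter_upwards [hv0] with x hx
        rw [hx]
      rw [h1]
      refine (lintegral_enorm_sub_sq_le (c := fun x : E n => MvPolynomial.eval x p) _ ?_).trans ?_
      · exact ((S.contDiff_loc F _ (k := 0)).continuous.sub (continuous_eval p)).measurable
      calc 2 * (∫⁻ x in cell kind F, ‖g F x - MvPolynomial.eval x p‖ₑ ^ 2)
            + 2 * ∫⁻ x in cell kind F, ‖U 0 x - MvPolynomial.eval x p‖ₑ ^ 2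
          ≤ 2 * (M * I) + 2 * I := by
            gcongr
            exact hFD _
        _ = (2 * (M * 1) + 2) * I := by ring
        _ ≤ (2 * (M * (1 + ENNReal.ofReal (Cg ^ 2))) + 2) *
            (CB * ENNReal.ofReal (𝒯.h ^ (2 * τ)) * sobSeminormSq Ω D τ U) := by
            gcongr
            exact le_self_add
        _ = _ := by rw [hC₁]; ring
    · intro j
      have h1 : ∫⁻ x in cell kind F, ‖U (Finsupp.single j 1) x - grad v x j‖ₑ ^ 2
          = ∫⁻ x in cell kind F, ‖U (Finsupp.single j 1) x
            - fderiv ℝ (g F) x (EuclideanSpace.single j 1)‖ₑ ^ 2 := by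
        refine lintegral_congr_ae ?_
        filter_upwards [hv1 j] with x hx
        rw [hx]
      rw [h1]
      refine (lintegral_enorm_sub_sq_le
        (c := fun x : E n => MvPolynomial.eval x (MvPolynomial.pderiv j p)) _ ?_).trans ?_
      · exact ((((S.contDiff_loc F _ (k := 1)).continuous_fderiv one_ne_zero).clm_apply
          continuous_const).sub (continuous_eval _)).measurable
      have h2 : ENNReal.ofReal ((𝒯.h ^ 2)⁻¹) * ENNReal.ofReal (𝒯.h ^ (2 * τ))
          = ENNReal.ofReal (𝒯.h ^ (2 * (τ - 1))) := by
        rw [← ENNReal.ofReal_mul (by positivity)]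
        congr 1
        rw [← Real.rpow_natCast 𝒯.h 2, ← Real.rpow_neg hh.le, ← Real.rpow_add hh]
        congr 1
        push_cast
        ring
      calc 2 * (∫⁻ x in cell kind F, ‖fderiv ℝ (g F) x (EuclideanSpace.single j 1)
              - MvPolynomial.eval x (MvPolynomial.pderiv j p)‖ₑ ^ 2)
            + 2 * ∫⁻ x in cell kind F, ‖U (Finsupp.single j 1) x
              - MvPolynomial.eval x (MvPolynomial.pderiv j p)‖ₑ ^ 2
          ≤ 2 * (M * ENNReal.ofReal (Cg ^ 2) * (ENNReal.ofReal ((𝒯.h ^ 2)⁻¹) *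
              (CB * ENNReal.ofReal (𝒯.h ^ (2 * τ)) * sobSeminormSq Ω D τ U)))
            + 2 * (CB * ENNReal.ofReal (𝒯.h ^ (2 * (τ - 1))) * sobSeminormSq Ω D τ U) := by
            refine add_le_add ?_ ?_
            · refine mul_le_mul' le_rfl ((hdga j).trans ?_)
              gcongr
            · exact mul_le_mul' le_rfl ((hFD _).trans (hp1 j))
        _ = 2 * (M * ENNReal.ofReal (Cg ^ 2) * (CB *
              (ENNReal.ofReal ((𝒯.h ^ 2)⁻¹) * ENNReal.ofReal (𝒯.h ^ (2 * τ))) *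
                sobSeminormSq Ω D τ U))
            + 2 * (CB * ENNReal.ofReal (𝒯.h ^ (2 * (τ - 1))) * sobSeminormSq Ω D τ U) := by ring
        _ = (2 * (M * ENNReal.ofReal (Cg ^ 2)) + 2) *
            (CB * ENNReal.ofReal (𝒯.h ^ (2 * (τ - 1))) * sobSeminormSq Ω D τ U) := by
            rw [h2]; ring
        _ ≤ (2 * (M * (1 + ENNReal.ofReal (Cg ^ 2))) + 2) *
            (CB * ENNReal.ofReal (𝒯.h ^ (2 * (τ - 1))) * sobSeminormSq Ω D τ U) := by
            gcongr
            exact le_add_self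
        _ = _ := by rw [hC₁]; ring
  choose! D hD hD0 hD1 using hlocal
  have hsum : ∑ F ∈ R, sobSeminormSq Ω (D F) τ U ≤ CO * sobSeminormSq Ω Ω τ U :=
    sum_sobSeminormSq_le R D (hover Ω 𝒯 hq hne R hRsub hdisj D fun F hF => hD F (hRsub hF))
  have hglobal : ∀ (f : E n → ℝ≥0∞) (t : ℝ≥0∞), (∀ F ∈ 𝒯.maps, ∫⁻ x in cell kind F, f x
      ≤ C₁ * t * sobSeminormSq Ω (D F) τ U) →
      ∫⁻ x in Ω, f x ≤ C₁ * CO * t * sobSeminormSq Ω Ω τ U := by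
    intro f t hf
    calc ∫⁻ x in Ω, f x ≤ ∑ F ∈ R, ∫⁻ x in cell kind F, f x := 𝒯.lintegral_le_sum hR f
      _ ≤ ∑ F ∈ R, C₁ * t * sobSeminormSq Ω (D F) τ U :=
          Finset.sum_le_sum fun F hF => hf F (hRsub hF)
      _ ≤ C₁ * t * (CO * sobSeminormSq Ω Ω τ U) := by
          rw [← Finset.mul_sum]
          gcongr
      _ = _ := by ring
  refine ⟨v, ?_, hglobal _ _ hD0, fun j => hglobal _ _ fun F hF => hD1 F hF j⟩
  intro F hF
  obtain ⟨p, hp, hpe⟩ := S.loc_mem F fun z => c (F z)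
  refine ⟨p, hp, ?_⟩
  rw [Measure.restrict_restrict (cell_measurableSet F)]
  have h1 := ae_restrict_of_ae_restrict_of_subset (inter_subset_left (t := Ω)) (hv F hF).1
  filter_upwards [h1] with x hx
  rw [hx]
  exact hpe x

/-! ### Structure of the finite element space -/

section

variable {n : ℕ} {Ω : Set (E n)}

lemma toL2_add (v w : H1 Ω) : toL2 (v + w) = toL2 v + toL2 w := map_add _ _ _

lemma grad_add (v w : H1 Ω) : grad (v + w) = grad v + grad w := rfl

lemma grad_sub (v w : H1 Ω) : grad (v - w) = grad v - grad w := rfl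

lemma isWeakGrad_grad (v : H1 Ω) : IsWeakGrad Ω (toL2 v) (fun j x => grad v x j) :=
  fun j => isWeakPartial_one_iff.1 (v.2 j)

lemma isWeakGrad_unique (hΩ : IsOpen Ω) {u u' : E n → ℝ} {g g' : Fin n → E n → ℝ}
    (hu : u =ᵐ[volume.restrict Ω] u') (h : IsWeakGrad Ω u g) (h' : IsWeakGrad Ω u' g')
    (hg : ∀ j, MemLp (g j) 2 (volume.restrict Ω)) (hg' : ∀ j, MemLp (g' j) 2 (volume.restrict Ω))
    (j : Fin n) : g j =ᵐ[volume.restrict Ω] g' j := by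
  refine ae_eq_of_forall_test hΩ (hg j) (hg' j) fun φ hφ => ?_
  have h1 := h j φ hφ
  have h2 := h' j φ hφ
  have h3 : ∫ x in Ω, u x * fderiv ℝ φ x (EuclideanSpace.single j 1)
      = ∫ x in Ω, u' x * fderiv ℝ φ x (EuclideanSpace.single j 1) :=
    integral_congr_ae (by filter_upwards [hu] with x hx; rw [hx])
  linarith

lemma grad_coord_congr (hΩ : IsOpen Ω) {v w : H1 Ω} (h : toL2 v = toL2 w) (j : Fin n) :
    (fun x => grad v x j) =ᵐ[volume.restrict Ω] fun x => grad w x j :=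
  isWeakGrad_unique hΩ (by rw [h]) (isWeakGrad_grad v) (isWeakGrad_grad w)
    (fun j => memLp_coord _ j) (fun j => memLp_coord _ j) j

/-- A function in `H¹` is determined by its values. -/
lemma toL2_injective (hΩ : IsOpen Ω) : Function.Injective (toL2 (Ω := Ω)) := by
  intro v w h
  refine Subtype.ext (WithLp.ofLp_injective 2 (Prod.ext h (Lp.ext ?_)))
  have h1 : ∀ᵐ x ∂(volume.restrict Ω), ∀ j, grad v x j = grad w x j :=
    ae_all_iff.2 fun j => grad_coord_congr hΩ h j
  filter_upwards [h1] with x hx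
  exact PiLp.ext hx

lemma lintegral_grad_eq (w : L2Vec Ω) :
    ‖w‖ₑ ^ 2 = ∑ j, ∫⁻ x in Ω, ‖w x j‖ₑ ^ 2 := by
  rw [enorm_sq_eq_lintegral, ← lintegral_finsetSum' _ fun j _ =>
    ((memLp_coord w j).1.enorm.pow_const 2)]
  refine lintegral_congr fun x => ?_
  simp only [enorm_sq_eq]
  rw [← ENNReal.ofReal_sum_of_nonneg fun _ _ => sq_nonneg _, ← ofReal_norm,
    ← ENNReal.ofReal_pow (norm_nonneg _), EuclideanSpace.real_norm_sq_eq]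

lemma measurable_grad_coord (v : H1 Ω) (j : Fin n) : Measurable fun x => grad v x j := by
  have h1 := (Lp.stronglyMeasurable (grad v)).measurable
  have h2 : Measurable fun y : E n => y j := by fun_prop
  exact h2.comp h1

end

section

variable {n r : ℕ} {kind : CellKind} {Ω : Set (E n)} (S : RefElement n r kind)

/-- On each cell, a finite element function is the Lagrange interpolant of its dual means, and its
weak gradient is the gradient of this polynomial. -/
lemma fe_local (hΩ : IsBoundedLipschitzDomain Ω) {𝒯 : Triangulation Ω kind} {v : H1 Ω}
    (hv : v ∈ feSpace 𝒯 r) {F : E n ≃ᵃ[ℝ] E n} (hF : F ∈ 𝒯.maps) :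
    toL2 v =ᵐ[volume.restrict (cell kind F)] S.loc F (fun z => S.coef F z (toL2 v)) ∧
    ∀ j, (fun x => grad v x j) =ᵐ[volume.restrict (cell kind F)]
      fun x => fderiv ℝ (S.loc F fun z => S.coef F z (toL2 v)) x (EuclideanSpace.single j 1) := by
  obtain ⟨p, hp, hvp⟩ := hv F hF
  rw [Measure.restrict_restrict (cell_measurableSet F)] at hvp
  have hint : interior (cell kind F) ⊆ cell kind F ∩ Ω :=
    subset_inter interior_subset (𝒯.interior_cell_subset hΩ hF)
  have hvp' : toL2 v =ᵐ[volume.restrict (cell kind F)] fun x => MvPolynomial.eval (F.symm x) p := by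
    rw [Triangulation.restrict_cell_eq]
    exact ae_restrict_of_ae_restrict_of_subset hint hvp
  have hloc : S.loc F (fun z => S.coef F z (toL2 v)) = fun x => MvPolynomial.eval (F.symm x) p := by
    funext x
    rw [← S.loc_poly F hp x]
    refine Finset.sum_congr rfl fun z hz => ?_
    beta_reduce
    rw [S.coef_congr z hvp', S.coef_poly F hz hp]
  rw [hloc]
  refine ⟨hvp', fun j => ?_⟩
  rw [Triangulation.restrict_cell_eq] at hvp' ⊢
  have hsm : ContDiff ℝ 1 fun x => MvPolynomial.eval (F.symm x) p :=
    (contDiff_eval p).comp (RefElement.contDiff_symm F)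
  obtain ⟨ρ, hρ⟩ := ((cell_isCompact (kind := kind) F).isBounded.subset
    (interior_subset (s := cell kind F))).subset_ball (0 : E n)
  have hle : volume.restrict (interior (cell kind F)) ≤ volume.restrict Ω :=
    Measure.restrict_mono (𝒯.interior_cell_subset hΩ hF) le_rfl
  exact isWeakGrad_unique isOpen_interior hvp'
    ((isWeakGrad_grad v).mono hΩ.isOpen.measurableSet (𝒯.interior_cell_subset hΩ hF))
    (isWeakGrad_of_contDiff hsm) (fun j => (memLp_coord _ j).mono_measure hle)
    (fun j => memLp_of_continuous_bounded hρ
      ((hsm.continuous_fderiv one_ne_zero).clm_apply continuous_const)) j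

/-- Finite element functions are determined by their dual means. -/
lemma finiteDimensional_feSpace (hr : 1 ≤ r) (hΩ : IsBoundedLipschitzDomain Ω)
    (𝒯 : Triangulation Ω kind) : FiniteDimensional ℝ (feSpace 𝒯 r) := by
  obtain ⟨S⟩ := exists_refElement n kind hr
  have hmem : ∀ (v : H1 Ω) (F : 𝒯.maps), MemLp (toL2 v) 2 (volume.restrict (cell kind F.1)) :=
    fun v F => (Lp.memLp _).mono_measure (𝒯.restrict_cell_le hΩ F.2)
  have hac : ∀ F : 𝒯.maps, volume.restrict (cell kind F.1) ≪ volume.restrict Ω := fun F =>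
    (𝒯.restrict_cell_le hΩ F.2).absolutelyContinuous
  let Φ : feSpace 𝒯 r →ₗ[ℝ] (𝒯.maps × S.N → ℝ) :=
    { toFun := fun v q => S.coef q.1.1 q.2.1 (toL2 v.1)
      map_add' := by
        intro v w
        funext q
        have h1 : toL2 (v.1 + w.1) =ᵐ[volume.restrict (cell kind q.1.1)]
            fun x => toL2 v.1 x + toL2 w.1 x := by
          rw [toL2_add]
          exact (hac q.1).ae_le (Lp.coeFn_add _ _)
        change S.coef q.1.1 q.2.1 (toL2 (v.1 + w.1)) = _
        rw [S.coef_congr _ h1, Pi.add_apply, RefElement.coef, RefElement.coef, RefElement.coef,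
          ← integral_add (S.integrable_coef _ (hmem _ _)) (S.integrable_coef _ (hmem _ _))]
        simp only [add_mul]
      map_smul' := by
        intro c v
        funext q
        have h1 : toL2 (c • v.1) =ᵐ[volume.restrict (cell kind q.1.1)]
            fun x => c * toL2 v.1 x := by
          rw [map_smul]
          exact (hac q.1).ae_le (Lp.coeFn_smul _ _)
        change S.coef q.1.1 q.2.1 (toL2 (c • v.1)) = _
        rw [S.coef_congr _ h1, Pi.smul_apply, RingHom.id_apply, RefElement.coef, RefElement.coef,
          smul_eq_mul, ← integral_const_mul]
        simp only [mul_assoc] }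
  refine Module.Finite.of_injective Φ ?_
  rw [← LinearMap.ker_eq_bot, LinearMap.ker_eq_bot']
  intro v hv
  have hzero : ∀ F ∈ 𝒯.maps, toL2 v.1 =ᵐ[volume.restrict (cell kind F)] fun _ => 0 := by
    intro F hF
    refine (fe_local S hΩ v.2 hF).1.trans (Filter.Eventually.of_forall fun x => ?_)
    refine Finset.sum_eq_zero fun z hz => ?_
    have h1 : S.coef F z (toL2 v.1) = 0 := congrFun hv (⟨F, hF⟩, ⟨z, hz⟩)
    beta_reduce
    rw [h1, zero_mul]
  have h1 : ‖toL2 v.1‖ₑ ^ 2 = 0 := by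
    rw [enorm_sq_eq_lintegral, ← nonpos_iff_eq_zero]
    refine (𝒯.lintegral_le_sum (R := 𝒯.maps) (fun F hF => ⟨F, hF, rfl⟩) _).trans
      (le_of_eq (Finset.sum_eq_zero fun F hF => ?_))
    rw [lintegral_congr_ae (g := fun _ => 0)]
    · simp
    · filter_upwards [hzero F hF] with x hx
      simp [hx]
  have h2 : toL2 v.1 = toL2 0 := by
    rw [map_zero]
    simpa using h1
  exact Subtype.ext (toL2_injective hΩ.isOpen h2)

/-- The inverse inequality `‖∇v‖ ≤ C h⁻¹ ‖v‖` for finite element functions. -/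
theorem exists_inverse_inequality (hn : 0 < n) (hΩ : IsBoundedLipschitzDomain Ω)
    (kind : CellKind) (hr : 1 ≤ r) (κ : ℝ) :
    ∃ C : ℝ≥0∞, C ≠ ⊤ ∧ ∀ 𝒯 : Triangulation Ω kind, 𝒯.Quality κ → ∀ v ∈ feSpace 𝒯 r, ∀ j,
      ∫⁻ x in Ω, ‖grad v x j‖ₑ ^ 2
        ≤ C * ENNReal.ofReal ((𝒯.h ^ 2)⁻¹) * ∫⁻ x in Ω, ‖toL2 v x‖ₑ ^ 2 := by
  obtain ⟨S⟩ := exists_refElement n kind hr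
  obtain ⟨K, hK, hcoef, -, hdloc⟩ := S.exists_estimates
  obtain ⟨Cg, hCg, hgeo⟩ := Triangulation.exists_geometry hn kind κ
  refine ⟨K * K * ENNReal.ofReal (Cg ^ 2) * S.N.card, ENNReal.mul_ne_top (ENNReal.mul_ne_top
    (ENNReal.mul_ne_top hK hK) ENNReal.ofReal_ne_top) (ENNReal.natCast_ne_top _), ?_⟩
  intro 𝒯 hq v hv j
  have hne := hΩ.isConnected.nonempty
  have hh := 𝒯.h_pos hn hne
  obtain ⟨R, hRsub, hR, hdisj⟩ := 𝒯.exists_reps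
  set t := K * K * ENNReal.ofReal (Cg ^ 2) * S.N.card * ENNReal.ofReal ((𝒯.h ^ 2)⁻¹) with ht
  have hcell : ∀ F ∈ R, ∫⁻ x in cell kind F, ‖grad v x j‖ₑ ^ 2
      ≤ t * ∫⁻ x in cell kind F, ‖toL2 v x‖ₑ ^ 2 := by
    intro F hFR
    have hF := hRsub hFR
    set I := ∫⁻ x in cell kind F, ‖toL2 v x‖ₑ ^ 2 with hI
    have h1 : ∫⁻ x in cell kind F, ‖grad v x j‖ₑ ^ 2 = ∫⁻ x in cell kind F,
        ‖fderiv ℝ (S.loc F fun z => S.coef F z (toL2 v)) x (EuclideanSpace.single j 1)‖ₑ ^ 2 := by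
      refine lintegral_congr_ae ?_
      filter_upwards [(fe_local S hΩ hv hF).2 j] with x hx
      rw [hx]
    have h2 := hdloc F (fun z => S.coef F z (toL2 v)) (EuclideanSpace.single j 1) (Cg / 𝒯.h) (by
      have := (hgeo Ω 𝒯 hq hne F hF).2.2.2 (EuclideanSpace.single j (1 : ℝ))
      simpa using this)
    have h3 : ENNReal.ofReal ((Cg / 𝒯.h) ^ 2)
        = ENNReal.ofReal (Cg ^ 2) * ENNReal.ofReal ((𝒯.h ^ 2)⁻¹) := by
      rw [← ENNReal.ofReal_mul (by positivity), div_pow, div_eq_mul_inv]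
    rw [h1]
    refine h2.trans ?_
    calc K * ENNReal.ofReal ((Cg / 𝒯.h) ^ 2) * ENNReal.ofReal (jac F) *
          ∑ z ∈ S.N, ‖S.coef F z (toL2 v)‖ₑ ^ 2
        ≤ K * ENNReal.ofReal ((Cg / 𝒯.h) ^ 2) * ENNReal.ofReal (jac F) *
          ∑ _z ∈ S.N, K * ENNReal.ofReal (jac F)⁻¹ * I := by
          gcongr with z hz
          exact hcoef F z hz _ ((Lp.memLp _).mono_measure (𝒯.restrict_cell_le hΩ hF))
      _ = t * (ENNReal.ofReal (jac F) * ENNReal.ofReal (jac F)⁻¹) * I := by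
          rw [Finset.sum_const, nsmul_eq_mul, h3, ht]; ring
      _ = t * I := by
          rw [← ENNReal.ofReal_mul (jac_pos F).le, mul_inv_cancel₀ (jac_pos F).ne',
            ENNReal.ofReal_one, mul_one]
  calc ∫⁻ x in Ω, ‖grad v x j‖ₑ ^ 2
      ≤ ∑ F ∈ R, ∫⁻ x in cell kind F, ‖grad v x j‖ₑ ^ 2 := 𝒯.lintegral_le_sum hR _
    _ ≤ ∑ F ∈ R, t * ∫⁻ x in cell kind F, ‖toL2 v x‖ₑ ^ 2 := Finset.sum_le_sum hcell
    _ = t * ∑ F ∈ R, ∫⁻ x in cell kind F, ‖toL2 v x‖ₑ ^ 2 := by rw [Finset.mul_sum]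
    _ ≤ t * ∫⁻ x in Ω, ‖toL2 v x‖ₑ ^ 2 := by
        gcongr
        exact 𝒯.sum_lintegral_cell_le hΩ hRsub hdisj _

end

/-! ### Approximation by the `L²` projection -/

section

variable {n : ℕ} {Ω : Set (E n)}

/-- The square of the Sobolev norm of order `p`, in terms of a family of weak derivatives. -/
def sobSum (Ω : Set (E n)) (p : ℝ) (D : (k : ℕ) → (Fin k → Fin n) → L2 Ω) : ℝ≥0∞ :=
  (∑ k ∈ Finset.range (⌊p⌋₊ + 1), ∑ i : Fin k → Fin n, ‖D k i‖ₑ ^ 2) +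
    (if p = ⌊p⌋₊ then 0
      else ∑ i : Fin ⌊p⌋₊ → Fin n, gagliardoSq Ω (p - ⌊p⌋₊) (D ⌊p⌋₊ i))

lemma sobolevNorm_eq (p : ℝ) (u : L2 Ω) : sobolevNorm Ω p u =
    ⨅ (D : (k : ℕ) → (Fin k → Fin n) → L2 Ω)
      (_ : ∀ k ≤ ⌊p⌋₊, ∀ i : Fin k → Fin n, IsWeakPartial Ω i u (D k i)),
      sobSum Ω p D ^ (1 / 2 : ℝ) := rfl

lemma enorm_multiFam_sq_le (p : ℝ) (D : (k : ℕ) → (Fin k → Fin n) → L2 Ω) {β : Fin n →₀ ℕ}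
    (hβ : β.degree ≤ ⌊p⌋₊) : ‖multiFam D β‖ₑ ^ 2 ≤ sobSum Ω p D := by
  refine le_trans ?_ le_self_add
  refine le_trans ?_ (Finset.single_le_sum
    (f := fun k => ∑ i : Fin k → Fin n, ‖D k i‖ₑ ^ 2) (fun _ _ => zero_le)
    (Finset.mem_range.2 (Nat.lt_succ_of_le (by rw [multiList_length]; exact hβ) :
      (multiList β).length < ⌊p⌋₊ + 1)))
  exact Finset.single_le_sum (f := fun i => ‖D (multiList β).length i‖ₑ ^ 2)
    (fun _ _ => zero_le) (Finset.mem_univ (multiList β).get)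

lemma le_sum_tuples {M : Type*} (D : (k : ℕ) → (Fin k → Fin n) → M) (f : M → ℝ≥0∞) {k m : ℕ}
    (hk : k = m) (i : Fin k → Fin n) : f (D k i) ≤ ∑ i : Fin m → Fin n, f (D m i) := by
  subst hk
  exact Finset.single_le_sum (f := fun i => f (D k i)) (fun _ _ => zero_le) (Finset.mem_univ i)

lemma sobSeminormSq_multiFam_le (p : ℝ) (D : (k : ℕ) → (Fin k → Fin n) → L2 Ω) :
    sobSeminormSq Ω Ω p (fun β => multiFam D β) ≤ (multiIndices n ⌊p⌋₊).card * sobSum Ω p D := by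
  rw [sobSeminormSq, ← nsmul_eq_mul]
  split_ifs with h
  · refine Finset.sum_le_card_nsmul _ _ _ fun β hβ => ?_
    rw [← enorm_sq_eq_lintegral]
    exact enorm_multiFam_sq_le p D (mem_multiIndices.1 hβ).le
  · refine Finset.sum_le_card_nsmul _ _ _ fun β hβ => ?_
    refine le_trans ?_ (le_add_self : _ ≤ sobSum Ω p D)
    rw [if_neg h]
    exact le_sum_tuples D (fun g : L2 Ω => gagliardoSq Ω (p - ⌊p⌋₊) g)
      (by rw [multiList_length]; exact mem_multiIndices.1 hβ) (multiList β).get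

/-- Best approximation in the finite element space, at all mesh sizes: above the threshold of
`exists_interpolant` zero is an approximation of the required quality. -/
lemma exists_approximation (hn : 0 < n) (hΩ : IsBoundedLipschitzDomain Ω)
    (kind : CellKind) {r : ℕ} (hr : 1 ≤ r) {τ : ℝ} (hτ : 1 ≤ τ) (hτr : τ ≤ r + 1) (κ : ℝ) :
    ∃ C : ℝ≥0∞, C ≠ ⊤ ∧ ∀ 𝒯 : Triangulation Ω kind, 𝒯.Quality κ →
      ∀ (u : L2 Ω) (D : (k : ℕ) → (Fin k → Fin n) → L2 Ω),
      (∀ k ≤ ⌊τ⌋₊, ∀ i : Fin k → Fin n, IsWeakPartial Ω i u (D k i)) →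
      ∃ v ∈ feSpace 𝒯 r,
        ∫⁻ x in Ω, ‖u x - toL2 v x‖ₑ ^ 2 ≤ C * ENNReal.ofReal (𝒯.h ^ (2 * τ)) * sobSum Ω τ D ∧
        ∀ j, ∫⁻ x in Ω, ‖multiFam D (Finsupp.single j 1) x - grad v x j‖ₑ ^ 2
          ≤ C * ENNReal.ofReal (𝒯.h ^ (2 * (τ - 1))) * sobSum Ω τ D := by
  obtain ⟨h₀, hh₀, C, hC, H⟩ := exists_interpolant hn hΩ kind hr hτ hτr κ
  set M : ℝ≥0∞ := (((multiIndices n ⌊τ⌋₊).card : ℕ) : ℝ≥0∞) with hM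
  have hMt : M ≠ ⊤ := ENNReal.natCast_ne_top _
  refine ⟨C * M + ENNReal.ofReal (h₀ ^ (2 * τ))⁻¹ + ENNReal.ofReal (h₀ ^ (2 * (τ - 1)))⁻¹,
    ENNReal.add_ne_top.2 ⟨ENNReal.add_ne_top.2 ⟨ENNReal.mul_ne_top hC hMt, ENNReal.ofReal_ne_top⟩,
      ENNReal.ofReal_ne_top⟩, fun 𝒯 hq u D hD => ?_⟩
  have hh := 𝒯.h_pos hn hΩ.isConnected.nonempty
  have hfl : 1 ≤ ⌊τ⌋₊ := Nat.le_floor (by simpa using hτ)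
  have hzero := multiFam_zero hΩ.isOpen hD
  rcases le_or_gt 𝒯.h h₀ with hle | hgt
  · obtain ⟨v, hv, h1, h2⟩ := H 𝒯 hq hle (fun β => multiFam D β) (fun β => Lp.memLp _)
      (fun β hβ => multiFam_isWeakGrad hD hβ)
    have hsem := sobSeminormSq_multiFam_le τ D
    refine ⟨v, hv, ?_, fun j => ?_⟩
    · have h3 : ∫⁻ x in Ω, ‖u x - toL2 v x‖ₑ ^ 2 = ∫⁻ x in Ω, ‖multiFam D 0 x - toL2 v x‖ₑ ^ 2 := by
        refine lintegral_congr_ae ?_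
        filter_upwards [hzero] with x hx
        rw [hx]
      rw [h3]
      calc _ ≤ C * ENNReal.ofReal (𝒯.h ^ (2 * τ)) * (M * sobSum Ω τ D) :=
            h1.trans (mul_le_mul' le_rfl hsem)
        _ = C * M * ENNReal.ofReal (𝒯.h ^ (2 * τ)) * sobSum Ω τ D := by ring
        _ ≤ _ := by
            gcongr
            rw [add_assoc]
            exact le_self_add
    · calc _ ≤ C * ENNReal.ofReal (𝒯.h ^ (2 * (τ - 1))) * (M * sobSum Ω τ D) :=
            (h2 j).trans (mul_le_mul' le_rfl hsem)
        _ = C * M * ENNReal.ofReal (𝒯.h ^ (2 * (τ - 1))) * sobSum Ω τ D := by ring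
        _ ≤ _ := by
            gcongr
            rw [add_assoc]
            exact le_self_add
  · have hpow : ∀ e : ℝ, 0 ≤ e →
        1 ≤ ENNReal.ofReal (h₀ ^ e)⁻¹ * ENNReal.ofReal (𝒯.h ^ e) := by
      intro e he
      have hpos : 0 < h₀ ^ e := Real.rpow_pos_of_pos hh₀ e
      rw [← ENNReal.ofReal_mul (by positivity), ← ENNReal.ofReal_one]
      refine ENNReal.ofReal_le_ofReal ?_
      rw [inv_mul_eq_div, le_div_iff₀ hpos, one_mul]
      exact Real.rpow_le_rpow hh₀.le hgt.le he
    have hbound : ∀ (e : ℝ) (c : ℝ≥0∞), 0 ≤ e → ENNReal.ofReal (h₀ ^ e)⁻¹ ≤ c →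
        sobSum Ω τ D ≤ c * ENNReal.ofReal (𝒯.h ^ e) * sobSum Ω τ D := by
      intro e c he hc
      calc sobSum Ω τ D = 1 * sobSum Ω τ D := (one_mul _).symm
        _ ≤ ENNReal.ofReal (h₀ ^ e)⁻¹ * ENNReal.ofReal (𝒯.h ^ e) * sobSum Ω τ D := by
            gcongr
            exact hpow e he
        _ ≤ _ := by gcongr
    refine ⟨0, zero_mem _, ?_, fun j => ?_⟩
    · have h3 : ∫⁻ x in Ω, ‖u x - toL2 (0 : H1 Ω) x‖ₑ ^ 2 = ‖multiFam D 0‖ₑ ^ 2 := by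
        rw [enorm_sq_eq_lintegral]
        refine lintegral_congr_ae ?_
        rw [map_zero]
        filter_upwards [hzero, Lp.coeFn_zero ℝ 2 (volume.restrict Ω)] with x hx h0
        rw [hx, h0]
        simp
      rw [h3]
      refine (enorm_multiFam_sq_le τ D (by simp)).trans (hbound _ _ (by linarith) ?_)
      rw [add_assoc, add_left_comm]
      exact le_self_add
    · have h3 : ∫⁻ x in Ω, ‖multiFam D (Finsupp.single j 1) x - grad (0 : H1 Ω) x j‖ₑ ^ 2
          = ‖multiFam D (Finsupp.single j 1)‖ₑ ^ 2 := by
        rw [enorm_sq_eq_lintegral]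
        refine lintegral_congr_ae ?_
        filter_upwards [Lp.coeFn_zero (E n) 2 (volume.restrict Ω)] with x h0
        have h4 : grad (0 : H1 Ω) x = 0 := h0
        rw [h4]
        simp
      rw [h3]
      refine (enorm_multiFam_sq_le τ D (by rw [Finsupp.degree_single]; exact hfl)).trans
        (hbound _ _ (by linarith) le_add_self)

lemma enorm_sub_sq_eq (u v : L2 Ω) : ‖u - v‖ₑ ^ 2 = ∫⁻ x in Ω, ‖u x - v x‖ₑ ^ 2 := by
  rw [enorm_sq_eq_lintegral]
  refine lintegral_congr_ae ?_
  filter_upwards [Lp.coeFn_sub u v] with x hx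
  rw [hx, Pi.sub_apply]

lemma grad_sub_coord (v w : H1 Ω) (j : Fin n) :
    (fun x => grad (v - w) x j) =ᵐ[volume.restrict Ω] fun x => grad v x j - grad w x j := by
  filter_upwards [Lp.coeFn_sub (grad v) (grad w)] with x hx
  rw [grad_sub, hx]
  rfl

/-- The image of the finite element space in `L²(Ω)`. -/
def feL2 {kind : CellKind} (𝒯 : Triangulation Ω kind) (r : ℕ) : Submodule ℝ (L2 Ω) :=
  (feSpace 𝒯 r).map (toL2 (Ω := Ω) : H1 Ω →ₗ[ℝ] L2 Ω)

lemma mem_feL2 {kind : CellKind} {𝒯 : Triangulation Ω kind} {r : ℕ} {u : L2 Ω} :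
    u ∈ feL2 𝒯 r ↔ ∃ v ∈ feSpace 𝒯 r, toL2 v = u := Iff.rfl

/-- The error of the `L²` projection `q` of `u` onto the finite element space. The bound in `L²` is
best approximation; for the gradient, `q` is compared with the quasi-interpolant `v` and the inverse
inequality is applied to `q - v`. -/
theorem exists_projection_error (hn : 0 < n) (hΩ : IsBoundedLipschitzDomain Ω)
    (kind : CellKind) {r : ℕ} (hr : 1 ≤ r) {τ : ℝ} (hτ : 1 ≤ τ) (hτr : τ ≤ r + 1) (κ : ℝ) :
    ∃ C : ℝ, 0 < C ∧ ∀ 𝒯 : Triangulation Ω kind, 𝒯.Quality κ →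
      ∀ (u : L2 Ω), ∀ q ∈ feSpace 𝒯 r, u - toL2 q ∈ (feL2 𝒯 r)ᗮ →
        ‖u - toL2 q‖ₑ ≤ ENNReal.ofReal (C * 𝒯.h ^ τ) * sobolevNorm Ω τ u ∧
        ∀ w : H1 Ω, toL2 w = u →
          ‖grad (w - q)‖ₑ ≤ ENNReal.ofReal (C * 𝒯.h ^ (τ - 1)) * sobolevNorm Ω τ u := by
  obtain ⟨C, hC, happrox⟩ := exists_approximation hn hΩ kind hr hτ hτr κ
  obtain ⟨Ci, hCi, hinv⟩ := exists_inverse_inequality hn hΩ kind hr κ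
  set A : ℝ≥0∞ := n * (2 * (Ci * C) + 2 * C) + C + 1 with hA
  have hAt : A ≠ ⊤ := ENNReal.add_ne_top.2 ⟨ENNReal.add_ne_top.2 ⟨ENNReal.mul_ne_top
    (ENNReal.natCast_ne_top n) (ENNReal.add_ne_top.2 ⟨ENNReal.mul_ne_top (by norm_num)
    (ENNReal.mul_ne_top hCi hC), ENNReal.mul_ne_top (by norm_num) hC⟩), hC⟩, by norm_num⟩
  have hA1 : 1 ≤ A := le_add_self
  have hAr : 1 ≤ A.toReal := by
    rw [← ENNReal.toReal_one]
    exact ENNReal.toReal_mono hAt hA1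
  refine ⟨√A.toReal, by positivity, fun 𝒯 hq u q hqV horth => ?_⟩
  have hh := 𝒯.h_pos hn hΩ.isConnected.nonempty
  -- it suffices to bound the squares for each family of weak derivatives
  have hred : ∀ (X : ℝ≥0∞) (e : ℝ), (∀ D : (k : ℕ) → (Fin k → Fin n) → L2 Ω,
      (∀ k ≤ ⌊τ⌋₊, ∀ i : Fin k → Fin n, IsWeakPartial Ω i u (D k i)) →
        X ^ 2 ≤ A * ENNReal.ofReal (𝒯.h ^ (2 * e)) * sobSum Ω τ D) →
      X ≤ ENNReal.ofReal (√A.toReal * 𝒯.h ^ e) * sobolevNorm Ω τ u := by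
    intro X e hX
    have hpos : 0 < √A.toReal * 𝒯.h ^ e := by positivity
    have h0 : ENNReal.ofReal (√A.toReal * 𝒯.h ^ e) ≠ 0 := by
      rw [Ne, ENNReal.ofReal_eq_zero, not_le]
      exact hpos
    rw [sobolevNorm_eq, ENNReal.mul_iInf_of_ne h0 ENNReal.ofReal_ne_top]
    refine le_iInf fun D => ?_
    rw [ENNReal.mul_iInf_of_ne h0 ENNReal.ofReal_ne_top]
    refine le_iInf fun hD => ?_
    rw [← ENNReal.pow_le_pow_left_iff (n := 2) two_ne_zero]
    refine (hX D hD).trans (le_of_eq ?_)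
    rw [mul_pow, ← ENNReal.rpow_natCast (_ ^ (1 / 2 : ℝ)), ← ENNReal.rpow_mul,
      ← ENNReal.ofReal_pow hpos.le, mul_pow, Real.sq_sqrt (by positivity), ENNReal.ofReal_mul
      (by positivity), ENNReal.ofReal_toReal hAt, ← Real.rpow_natCast (𝒯.h ^ e),
      ← Real.rpow_mul hh.le]
    norm_num
    rw [mul_comm e 2]
  -- Pythagoras for the projection `q` and an arbitrary finite element function `v`
  have hmin : ∀ v ∈ feSpace 𝒯 r, ‖u - toL2 q‖ₑ ^ 2 ≤ ‖u - toL2 v‖ₑ ^ 2 ∧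
      ‖toL2 (q - v)‖ₑ ^ 2 ≤ ‖u - toL2 v‖ₑ ^ 2 := by
    intro v hv
    have h1 : ⟪u - toL2 q, toL2 (q - v)⟫_ℝ = 0 := by
      rw [real_inner_comm]
      exact horth _ (mem_feL2.2 ⟨q - v, sub_mem hqV hv, rfl⟩)
    have h2 : u - toL2 v = (u - toL2 q) + toL2 (q - v) := by rw [map_sub]; abel
    have h3 : ‖u - toL2 v‖ ^ 2 = ‖u - toL2 q‖ ^ 2 + ‖toL2 (q - v)‖ ^ 2 := by
      rw [h2, norm_add_sq_real, h1]
      ring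
    have h4 : ∀ x : L2 Ω, ‖x‖ₑ ^ 2 = ENNReal.ofReal (‖x‖ ^ 2) := fun x => by
      rw [← ofReal_norm, ENNReal.ofReal_pow (norm_nonneg _)]
    rw [h4, h4, h4]
    constructor <;> refine ENNReal.ofReal_le_ofReal ?_ <;> nlinarith [sq_nonneg ‖u - toL2 q‖,
      sq_nonneg ‖toL2 (q - v)‖]
  constructor
  · refine hred _ τ fun D hD => ?_
    obtain ⟨v, hv, h1, -⟩ := happrox 𝒯 hq u D hD
    refine (hmin v hv).1.trans ?_
    rw [enorm_sub_sq_eq]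
    refine h1.trans ?_
    gcongr
    rw [hA, add_assoc, add_left_comm]
    exact le_self_add
  · intro w hw
    refine hred _ (τ - 1) fun D hD => ?_
    obtain ⟨v, hv, h1, h2⟩ := happrox 𝒯 hq u D hD
    set N := sobSum Ω τ D with hN
    have hfl : 1 ≤ ⌊τ⌋₊ := Nat.le_floor (by simpa using hτ)
    have hgw : ∀ j, (fun x => grad w x j)
        =ᵐ[volume.restrict Ω] multiFam D (Finsupp.single j 1) := by
      intro j
      have h3 : toL2 w =ᵐ[volume.restrict Ω] multiFam D 0 := by
        rw [hw]
        exact (multiFam_zero hΩ.isOpen hD).symm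
      have h4 := isWeakGrad_unique hΩ.isOpen h3 (isWeakGrad_grad w)
        (multiFam_isWeakGrad hD (β := 0) (by rw [map_zero]; omega))
        (fun j => memLp_coord _ j) (fun j => Lp.memLp _) j
      simpa only [zero_add] using h4
    rw [lintegral_grad_eq]
    have hj : ∀ j, ∫⁻ x in Ω, ‖grad (w - q) x j‖ₑ ^ 2
        ≤ (2 * (Ci * C) + 2 * C) * (ENNReal.ofReal (𝒯.h ^ (2 * (τ - 1))) * N) := by
      intro j
      have e1 : ∫⁻ x in Ω, ‖grad (w - q) x j‖ₑ ^ 2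
          = ∫⁻ x in Ω, ‖multiFam D (Finsupp.single j 1) x - grad q x j‖ₑ ^ 2 := by
        refine lintegral_congr_ae ?_
        filter_upwards [grad_sub_coord w q j, hgw j] with x hx hx'
        rw [hx, hx']
      have e2 : ∫⁻ x in Ω, ‖grad q x j - grad v x j‖ₑ ^ 2
          = ∫⁻ x in Ω, ‖grad (q - v) x j‖ₑ ^ 2 := by
        refine lintegral_congr_ae ?_
        filter_upwards [grad_sub_coord q v j] with x hx
        rw [hx]
      have e3 := hinv 𝒯 hq (q - v) (sub_mem hqV hv) j
      rw [← enorm_sq_eq_lintegral] at e3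
      have e4 : ENNReal.ofReal ((𝒯.h ^ 2)⁻¹) * ENNReal.ofReal (𝒯.h ^ (2 * τ))
          = ENNReal.ofReal (𝒯.h ^ (2 * (τ - 1))) := by
        rw [← ENNReal.ofReal_mul (by positivity)]
        congr 1
        rw [← Real.rpow_natCast 𝒯.h 2, ← Real.rpow_neg hh.le, ← Real.rpow_add hh]
        congr 1
        push_cast
        ring
      have e5 := (hmin v hv).2
      rw [enorm_sub_sq_eq u] at e5
      rw [e1]
      refine (lintegral_enorm_sub_sq_le (c := fun x => grad v x j) _
        ((measurable_grad_coord q j).sub (measurable_grad_coord v j))).trans ?_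
      rw [e2]
      calc 2 * (∫⁻ x in Ω, ‖grad (q - v) x j‖ₑ ^ 2)
            + 2 * ∫⁻ x in Ω, ‖multiFam D (Finsupp.single j 1) x - grad v x j‖ₑ ^ 2
          ≤ 2 * (Ci * ENNReal.ofReal ((𝒯.h ^ 2)⁻¹) *
              (C * ENNReal.ofReal (𝒯.h ^ (2 * τ)) * N))
            + 2 * (C * ENNReal.ofReal (𝒯.h ^ (2 * (τ - 1))) * N) :=
            add_le_add (mul_le_mul' le_rfl (e3.trans (mul_le_mul' le_rfl (e5.trans h1))))
              (mul_le_mul' le_rfl (h2 j))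
        _ = 2 * (Ci * C * (ENNReal.ofReal ((𝒯.h ^ 2)⁻¹) * ENNReal.ofReal (𝒯.h ^ (2 * τ))) * N)
            + 2 * (C * ENNReal.ofReal (𝒯.h ^ (2 * (τ - 1))) * N) := by ring
        _ = _ := by rw [e4]; ring
    calc ∑ j, ∫⁻ x in Ω, ‖grad (w - q) x j‖ₑ ^ 2
        ≤ ∑ _j : Fin n, (2 * (Ci * C) + 2 * C) * (ENNReal.ofReal (𝒯.h ^ (2 * (τ - 1))) * N) :=
          Finset.sum_le_sum fun j _ => hj j
      _ = n * (2 * (Ci * C) + 2 * C) * ENNReal.ofReal (𝒯.h ^ (2 * (τ - 1))) * N := by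
          rw [Finset.sum_const, Finset.card_univ, Fintype.card_fin, nsmul_eq_mul]
          ring
      _ ≤ _ := by
          gcongr
          rw [hA, add_assoc]
          exact le_self_add

end

/-! ### The bilinear form -/

section

variable {n : ℕ} {Ω : Set (E n)} {α β : ℝ} {A : E n → Matrix (Fin n) (Fin n) ℝ}

lemma sum_single_mul (f : Fin n → ℝ) (i : Fin n) :
    ∑ k, f k * (EuclideanSpace.single i (1 : ℝ) : E n) k = f i := by
  simp

/-- The entries of a symmetric positive semidefinite matrix are controlled by its quadratic form,
by polarisation on the vectors `e_i ± e_j`. -/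
lemma abs_entry_le {M : Matrix (Fin n) (Fin n) ℝ} (hM : M.IsSymm)
    (hl : ∀ ξ : E n, 0 ≤ ∑ i, ∑ j, M i j * ξ j * ξ i)
    (hu : ∀ ξ : E n, ∑ i, ∑ j, M i j * ξ j * ξ i ≤ β * ‖ξ‖ ^ 2) (i j : Fin n) :
    |M i j| ≤ β := by
  have hq : ∀ (a b : Fin n) (c : ℝ), ∑ i, ∑ j, M i j *
      (EuclideanSpace.single a (1 : ℝ) + c • EuclideanSpace.single b (1 : ℝ) : E n) j *
      (EuclideanSpace.single a (1 : ℝ) + c • EuclideanSpace.single b (1 : ℝ) : E n) i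
      = M a a + c * M a b + c * M b a + c ^ 2 * M b b := by
    intro a b c
    simp only [PiLp.add_apply, PiLp.smul_apply, smul_eq_mul, mul_add, ← Finset.sum_mul,
      Finset.sum_add_distrib, sum_single_mul, add_mul, ← mul_assoc, mul_comm _ c]
    ring
  have hd : ∀ a, M a a ≤ β := by
    intro a
    have h1 := hu (EuclideanSpace.single a 1 + (0 : ℝ) • EuclideanSpace.single a 1)
    rw [hq] at h1
    simpa using h1
  have h1 := hl (EuclideanSpace.single i 1 + (1 : ℝ) • EuclideanSpace.single j 1)
  have h2 := hl (EuclideanSpace.single i 1 + (-1 : ℝ) • EuclideanSpace.single j 1)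
  rw [hq] at h1 h2
  have h3 : M j i = M i j := hM.apply i j
  rw [h3] at h1 h2
  rw [abs_le]
  constructor <;> linarith [hd i, hd j]

lemma IsConductivity.nonneg (hA : IsConductivity Ω α β A) :
    ∀ᵐ x ∂(volume.restrict Ω), ∀ ξ : E n, 0 ≤ ∑ i, ∑ j, A x i j * ξ j * ξ i := by
  filter_upwards [hA.lower] with x hx ξ
  have := hA.pos
  exact le_trans (by positivity) (hx ξ)

lemma IsConductivity.integrable (hA : IsConductivity Ω α β A) (u v : H1 Ω) :
    Integrable (fun x => ∑ i, ∑ j, A x i j * grad u x j * grad v x i) (volume.restrict Ω) := by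
  refine integrable_finsetSum _ fun i _ => integrable_finsetSum _ fun j _ => ?_
  have h1 : Integrable (fun x => grad u x j * grad v x i) (volume.restrict Ω) :=
    (memLp_coord _ j).integrable_mul (memLp_coord _ i)
  have h2 : Integrable (fun x => A x i j * (grad u x j * grad v x i)) (volume.restrict Ω) := by
    refine h1.bdd_mul (c := β) (hA.measurable i j).aestronglyMeasurable ?_
    filter_upwards [hA.symm, hA.nonneg, hA.upper] with x h3 h4 h5
    exact abs_entry_le h3 h4 h5 i j
  simpa only [mul_assoc] using h2

lemma aForm_add_left (hA : IsConductivity Ω α β A) (u w v : H1 Ω) :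
    aForm A (u + w) v = aForm A u v + aForm A w v := by
  rw [aForm, aForm, aForm, ← integral_add (hA.integrable u v) (hA.integrable w v)]
  refine integral_congr_ae ?_
  filter_upwards [Lp.coeFn_add (grad u) (grad w)] with x hx
  rw [grad_add, hx]
  simp only [Pi.add_apply, PiLp.add_apply, mul_add, add_mul, Finset.sum_add_distrib]

lemma aForm_self_nonneg (hA : IsConductivity Ω α β A) (u : H1 Ω) : 0 ≤ aForm A u u := by
  refine integral_nonneg_of_ae ?_
  filter_upwards [hA.nonneg] with x hx
  exact hx _

lemma aForm_self_le (hA : IsConductivity Ω α β A) (u : H1 Ω) :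
    aForm A u u ≤ β * ‖grad u‖ ^ 2 := by
  have h1 : ‖grad u‖ ^ 2 = ∫ x in Ω, ‖grad u x‖ ^ 2 := by
    rw [← real_inner_self_eq_norm_sq, L2.inner_def]
    simp only [real_inner_self_eq_norm_sq]
  have h2 : Integrable (fun x => ‖grad u x‖ ^ 2) (volume.restrict Ω) :=
    (Lp.memLp (grad u)).integrable_norm_pow two_ne_zero
  rw [h1, ← integral_const_mul]
  refine integral_mono_ae (hA.integrable u u) (h2.const_mul β) ?_
  filter_upwards [hA.upper] with x hx
  exact hx _

lemma two_mul_aForm_le (hA : IsConductivity Ω α β A) (u v : H1 Ω) :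
    2 * aForm A u v ≤ aForm A u u + aForm A v v := by
  rw [aForm, aForm, aForm, ← integral_const_mul,
    ← integral_add (hA.integrable u u) (hA.integrable v v)]
  refine integral_mono_ae ((hA.integrable u v).const_mul 2)
    ((hA.integrable u u).add (hA.integrable v v)) ?_
  filter_upwards [hA.symm, hA.nonneg] with x h1 h2
  have h3 := h2 (grad u x - grad v x)
  have h4 : ∑ i, ∑ j, A x i j * grad v x j * grad u x i
      = ∑ i, ∑ j, A x i j * grad u x j * grad v x i := by
    rw [Finset.sum_comm]
    refine Finset.sum_congr rfl fun i _ => Finset.sum_congr rfl fun j _ => ?_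
    rw [h1.apply]
    ring
  simp only [PiLp.sub_apply, mul_sub, sub_mul, Finset.sum_sub_distrib] at h3
  change 2 * ∑ i, ∑ j, A x i j * grad u x j * grad v x i
    ≤ (∑ i, ∑ j, A x i j * grad u x j * grad u x i) + ∑ i, ∑ j, A x i j * grad v x j * grad v x i
  linarith

end

/-! ### Weak time derivatives and the Gronwall inequality -/

section

lemma IsL2Time.integrable {X : Type*} [NormedAddCommGroup X] {T : ℝ} {w : ℝ → X}
    (hw : IsL2Time T w) : Integrable w (volume.restrict (Ioo 0 T)) :=
  memLp_one_iff_integrable.1 (MemLp.mono_exponent hw one_le_two)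

lemma IsL2Time.integrable_smul {X : Type*} [NormedAddCommGroup X] [NormedSpace ℝ X] {T : ℝ}
    {w : ℝ → X} (hw : IsL2Time T w) {φ : ℝ → ℝ} (hφ : Continuous φ) (hc : HasCompactSupport φ) :
    Integrable (fun t => φ t • w t) (volume.restrict (Ioo 0 T)) := by
  obtain ⟨K, hK⟩ := hc.exists_bound_of_continuous hφ
  exact hw.integrable.bdd_smul K hφ.aestronglyMeasurable (Filter.Eventually.of_forall hK)

/-- A continuous functional may be applied to a weak time derivative. -/
lemma IsH1Time.comp_clm {X : Type*} [NormedAddCommGroup X] [NormedSpace ℝ X] [CompleteSpace X]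
    {T : ℝ} {w w' : ℝ → X} (h : IsH1Time T w w') (l : X →L[ℝ] ℝ) :
    IsH1Time T (fun t => l (w t)) (fun t => l (w' t)) where
  memLp := l.comp_memLp' h.memLp
  memLp_deriv := l.comp_memLp' h.memLp_deriv
  weak_deriv := by
    intro φ hφ hc hs
    have h1 := congrArg l (h.weak_deriv φ hφ hc hs)
    have hd : Continuous (deriv φ) := hφ.continuous_deriv (by norm_num)
    rw [map_neg, ← l.integral_comp_comm (h.memLp.integrable_smul hd hc.deriv),
      ← l.integral_comp_comm (h.memLp_deriv.integrable_smul hφ.continuous hc)] at h1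
    simpa only [map_smul] using h1

lemma IsH1Time.sub {X : Type*} [NormedAddCommGroup X] [NormedSpace ℝ X]
    {T : ℝ} {w w' v v' : ℝ → X} (h : IsH1Time T w w') (g : IsH1Time T v v') :
    IsH1Time T (fun t => w t - v t) (fun t => w' t - v' t) where
  memLp := MemLp.sub h.memLp g.memLp
  memLp_deriv := MemLp.sub h.memLp_deriv g.memLp_deriv
  weak_deriv := by
    intro φ hφ hc hs
    have hd : Continuous (deriv φ) := hφ.continuous_deriv (by norm_num)
    simp only [smul_sub]
    rw [integral_sub (h.memLp.integrable_smul hd hc.deriv)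
      (g.memLp.integrable_smul hd hc.deriv), integral_sub
      (h.memLp_deriv.integrable_smul hφ.continuous hc)
      (g.memLp_deriv.integrable_smul hφ.continuous hc), h.weak_deriv φ hφ hc hs,
      g.weak_deriv φ hφ hc hs]
    abel

/-- A smooth function of zero mean with compact support in an interval is the derivative of one. -/
lemma exists_test_antideriv {T : ℝ} {ψ : ℝ → ℝ} (hψ : ContDiff ℝ ∞ ψ)
    (hc : HasCompactSupport ψ) (hs : tsupport ψ ⊆ Ioo 0 T) (h0 : ∫ t, ψ t = 0) :
    ∃ Φ : ℝ → ℝ, ContDiff ℝ ∞ Φ ∧ HasCompactSupport Φ ∧ tsupport Φ ⊆ Ioo 0 T ∧ deriv Φ = ψ := by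
  rcases (tsupport ψ).eq_empty_or_nonempty with he | hne
  · refine ⟨0, contDiff_const, HasCompactSupport.zero, by simp, ?_⟩
    rw [tsupport_eq_empty_iff] at he
    rw [he]
    exact deriv_zero
  obtain ⟨a, ha, hamin⟩ := hc.exists_isLeast hne
  obtain ⟨b, hb, hbmax⟩ := hc.exists_isGreatest hne
  have hcont := hψ.continuous
  have hder : ∀ t, HasDerivAt (fun t => ∫ x in (0 : ℝ)..t, ψ x) (ψ t) t := fun t =>
    hcont.integral_hasStrictDerivAt 0 t |>.hasDerivAt
  have hd : deriv (fun t => ∫ x in (0 : ℝ)..t, ψ x) = ψ := funext fun t => (hder t).deriv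
  have hz : ∀ t, t < a ∨ b < t → ψ t = 0 := by
    intro t ht
    refine image_eq_zero_of_notMem_tsupport fun h => ?_
    rcases ht with h1 | h1
    · exact absurd (hamin h) (not_le.2 h1)
    · exact absurd (hbmax h) (not_le.2 h1)
  have hl : ∀ t, t < a → ∫ x in (0 : ℝ)..t, ψ x = 0 := by
    intro t ht
    refine intervalIntegral.integral_zero_ae (Filter.Eventually.of_forall fun x hx => hz x ?_)
    have h1 := (hs ha).1
    rw [mem_uIoc] at hx
    rcases hx with h2 | h2 <;> left <;> linarith [h2.1, h2.2]
  have hr : ∀ t, b < t → ∫ x in (0 : ℝ)..t, ψ x = 0 := by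
    intro t ht
    rw [intervalIntegral.integral_of_le (by linarith [(hs hb).1]),
      setIntegral_eq_integral_of_forall_compl_eq_zero, h0]
    intro x hx
    refine hz x ?_
    by_contra hcon
    push Not at hcon
    exact hx ⟨by linarith [(hs ha).1, hcon.1], by linarith [hcon.2]⟩
  have hsub : Function.support (fun t => ∫ x in (0 : ℝ)..t, ψ x) ⊆ Icc a b := by
    intro t ht
    by_contra hcon
    rw [mem_Icc, not_and_or, not_le, not_le] at hcon
    exact ht (hcon.elim (hl t) (hr t))
  have hsub' : tsupport (fun t => ∫ x in (0 : ℝ)..t, ψ x) ⊆ Icc a b :=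
    closure_minimal hsub isClosed_Icc
  refine ⟨_, contDiff_infty_iff_deriv.2 ⟨fun t => (hder t).differentiableAt, ?_⟩,
    HasCompactSupport.of_support_subset_isCompact isCompact_Icc hsub,
    hsub'.trans fun t ht => ⟨(hs ha).1.trans_le ht.1, ht.2.trans_lt (hs hb).2⟩, hd⟩
  rw [hd]
  exact hψ

/-- The lemma of du Bois-Reymond. -/
lemma exists_ae_eq_const {T : ℝ} (hT : 0 < T) {w : ℝ → ℝ}
    (hw : Integrable w (volume.restrict (Ioo 0 T)))
    (h : ∀ φ : ℝ → ℝ, ContDiff ℝ ∞ φ → HasCompactSupport φ → tsupport φ ⊆ Ioo 0 T →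
      ∫ t in Ioo 0 T, deriv φ t * w t = 0) :
    ∃ c : ℝ, w =ᵐ[volume.restrict (Ioo 0 T)] fun _ => c := by
  obtain ⟨ρ, hρs, hρc, hρ, hρr, hρ1⟩ := exists_contDiff_tsupport_subset (n := ⊤)
    (Ioo_mem_nhds (half_pos hT) (half_lt_self hT))
  have hρi : Integrable ρ := hρ.continuous.integrable_of_hasCompactSupport hρc
  have hm : 0 < ∫ t, ρ t := by
    refine hρ.continuous.integral_pos_of_hasCompactSupport_nonneg_nonzero hρc
      (fun x => (hρr (mem_range_self x)).1) (x := T / 2) (by rw [hρ1]; exact one_ne_zero)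
  set m := ∫ t, ρ t with hmdef
  set c := (∫ t in Ioo 0 T, ρ t * w t) / m with hcdef
  refine ⟨c, ?_⟩
  -- subtracting a multiple of `ρ` from a test function makes it the derivative of another one
  have hmul : ∀ φ : ℝ → ℝ, ContDiff ℝ ∞ φ → HasCompactSupport φ →
      Integrable (fun t => φ t * w t) (volume.restrict (Ioo 0 T)) := by
    intro φ hφ hc
    obtain ⟨K, hK⟩ := hc.exists_bound_of_continuous hφ.continuous
    exact hw.bdd_mul hφ.continuous.aestronglyMeasurable (Filter.Eventually.of_forall hK)
  have hset : ∀ φ : ℝ → ℝ, tsupport φ ⊆ Ioo 0 T → ∫ t in Ioo 0 T, φ t = ∫ t, φ t := by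
    intro φ hs
    refine setIntegral_eq_integral_of_forall_compl_eq_zero fun x hx => ?_
    exact image_eq_zero_of_notMem_tsupport fun h => hx (hs h)
  have key := isOpen_Ioo.ae_eq_zero_of_integral_contDiff_smul_eq_zero (U := Ioo 0 T)
    (μ := volume.restrict (Ioo 0 T)) (f := fun t => w t - c)
    ((hw.sub (integrable_const c)).locallyIntegrable.locallyIntegrableOn _) ?_
  · rw [Filter.EventuallyEq]
    filter_upwards [key, ae_restrict_mem measurableSet_Ioo] with t h1 h2
    exact sub_eq_zero.1 (h1 h2)
  intro φ hφ hc hs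
  have hφi : Integrable φ := hφ.continuous.integrable_of_hasCompactSupport hc
  set k := (∫ t, φ t) / m with hk
  have hψs : tsupport (fun t => φ t - k * ρ t) ⊆ Ioo 0 T := by
    refine (tsupport_sub (f := φ) (g := fun t => k * ρ t)).trans (union_subset hs ?_)
    exact (tsupport_mul_subset_right (f := fun _ => k) (g := ρ)).trans hρs
  obtain ⟨Φ, hΦ, hΦc, hΦs, hΦd⟩ := exists_test_antideriv (T := T)
    (ψ := fun t => φ t - k * ρ t) (hφ.sub (contDiff_const.mul hρ))
    (hc.sub hρc.mul_left) hψs (by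
      rw [integral_sub hφi (hρi.const_mul k), integral_const_mul, ← hmdef, hk]
      field_simp
      ring)
  have h1 := h Φ hΦ hΦc hΦs
  rw [hΦd] at h1
  have h2 : ∫ t in Ioo 0 T, φ t * w t = k * ∫ t in Ioo 0 T, ρ t * w t := by
    have i1 := hmul φ hφ hc
    have i2 : Integrable (fun t => k * (ρ t * w t)) (volume.restrict (Ioo 0 T)) :=
      (hmul ρ hρ hρc).const_mul k
    have h3 : ∫ t in Ioo 0 T, (φ t * w t - k * (ρ t * w t)) = 0 := by
      refine Eq.trans (integral_congr_ae (Filter.Eventually.of_forall fun t => ?_)) h1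
      simp only []
      ring
    rw [integral_sub i1 i2, integral_const_mul] at h3
    linarith
  have i1 := hmul φ hφ hc
  have i2 : Integrable (fun t => φ t * c) (volume.restrict (Ioo 0 T)) :=
    (hφi.restrict).mul_const c
  simp only [smul_eq_mul, mul_sub]
  rw [integral_sub i1 i2, h2, integral_mul_const, hset φ hs, hk, hcdef]
  field_simp
  ring

lemma intervalIntegrable_of_mem {T : ℝ} {G : ℝ → ℝ}
    (hG : Integrable G (volume.restrict (Ioo 0 T))) {t : ℝ} (ht : t ∈ Icc 0 T) :
    IntervalIntegrable G volume 0 t := by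
  rw [intervalIntegrable_iff_integrableOn_Ioo_of_le ht.1]
  exact hG.mono_measure (Measure.restrict_mono (Ioo_subset_Ioo le_rfl ht.2) le_rfl)

/-- A continuous function with an integrable weak derivative is the integral of the latter. -/
lemma eq_add_integral_of_weak_deriv {T : ℝ} (hT : 0 < T) {z G : ℝ → ℝ}
    (hz : ContinuousOn z (Icc 0 T)) (hG : IsH1Time T z G) {t : ℝ} (ht : t ∈ Icc 0 T) :
    z t = z 0 + ∫ x in (0 : ℝ)..t, G x := by
  have hGi := hG.memLp_deriv.integrable
  have hI : IntervalIntegrable G volume 0 T := intervalIntegrable_of_mem hGi ⟨hT.le, le_rfl⟩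
  set H : ℝ → ℝ := fun t => ∫ x in (0 : ℝ)..t, G x with hH
  have hHac : AbsolutelyContinuousOnInterval H 0 T :=
    hI.absolutelyContinuousOnInterval_intervalIntegral left_mem_uIcc
  have hHc : ContinuousOn H (Icc 0 T) := by
    rw [← uIcc_of_le hT.le]
    exact hHac.continuousOn
  have hHi : Integrable H (volume.restrict (Ioo 0 T)) :=
    (hHc.integrableOn_Icc).mono_set Ioo_subset_Icc_self
  have hparts : ∀ φ : ℝ → ℝ, ContDiff ℝ ∞ φ → tsupport φ ⊆ Ioo 0 T →
      ∫ t in Ioo 0 T, deriv φ t * H t = -∫ t in Ioo 0 T, φ t * G t := by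
    intro φ hφ hs
    have h0 : φ 0 = 0 := image_eq_zero_of_notMem_tsupport fun h => lt_irrefl _ (hs h).1
    have h1 : φ T = 0 := image_eq_zero_of_notMem_tsupport fun h => lt_irrefl _ (hs h).2
    have h2 := ((hφ.of_le (by norm_num)).contDiffOn (s := uIcc 0 T) (n := 1))
      |>.absolutelyContinuousOnInterval.integral_mul_deriv_eq_deriv_mul hHac
    have h3 : ∫ x in (0 : ℝ)..T, φ x * deriv H x = ∫ x in (0 : ℝ)..T, φ x * G x := by
      refine intervalIntegral.integral_congr_ae ?_
      filter_upwards [hI.ae_hasDerivAt_integral] with x hx hx'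
      rw [(hx (uIoc_subset_uIcc hx') 0 left_mem_uIcc).deriv]
    rw [h3, h0, h1] at h2
    simp only [zero_mul, sub_self, zero_sub] at h2
    rw [intervalIntegral.integral_of_le hT.le, intervalIntegral.integral_of_le hT.le,
      integral_Ioc_eq_integral_Ioo, integral_Ioc_eq_integral_Ioo] at h2
    rw [h2, neg_neg]
  -- `z - H` has vanishing weak derivative
  obtain ⟨c, hc⟩ := exists_ae_eq_const hT (w := fun t => z t - H t)
    (hG.memLp.integrable.sub hHi) (by
      intro φ hφ hφc hs
      have hd : Continuous (deriv φ) := hφ.continuous_deriv (by norm_num)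
      obtain ⟨K, hK⟩ := hφc.deriv.exists_bound_of_continuous hd
      have i1 : Integrable (fun t => deriv φ t * z t) (volume.restrict (Ioo 0 T)) :=
        hG.memLp.integrable_smul hd hφc.deriv
      have i2 : Integrable (fun t => deriv φ t * H t) (volume.restrict (Ioo 0 T)) :=
        hHi.bdd_mul hd.aestronglyMeasurable (Filter.Eventually.of_forall hK)
      simp only [mul_sub]
      rw [integral_sub i1 i2, hparts φ hφ hs, sub_neg_eq_add]
      have h1 := hG.weak_deriv φ hφ hφc hs
      simp only [smul_eq_mul] at h1
      rw [h1, neg_add_cancel])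
  rw [restrict_Ioo_eq_restrict_Icc] at hc
  have heq := Measure.eqOn_Icc_of_ae_eq volume hT.ne hc (hz.sub hHc) continuousOn_const
  have h0 := heq (left_mem_Icc.2 hT.le)
  have h1 := heq ht
  have h2 : H 0 = 0 := intervalIntegral.integral_same
  simp only [h2] at h0 h1
  change z t = z 0 + H t
  linarith

/-- No integrability is needed, as the integral of a nonintegrable function is zero. -/
lemma ofReal_integral_le {X : Type*} [MeasurableSpace X] {μ : Measure X} {f : X → ℝ} :
    ENNReal.ofReal (∫ x, f x ∂μ) ≤ ∫⁻ x, ENNReal.ofReal (f x) ∂μ := by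
  by_cases hf : Integrable f μ
  · have h1 : ∫ x, f x ∂μ ≤ ∫ x, max (f x) 0 ∂μ :=
      integral_mono hf hf.pos_part fun x => le_max_left _ _
    refine (ENNReal.ofReal_le_ofReal h1).trans ?_
    rw [ofReal_integral_eq_lintegral_ofReal hf.pos_part
      (Filter.Eventually.of_forall fun x => le_max_right _ _)]
    refine lintegral_mono fun x => ?_
    rw [ENNReal.ofReal_max]
    simp
  · rw [integral_undef hf]
    simp

/-- The Gronwall inequality for the squared norm of a vector of functions with weak derivatives,
in differential form. The right-hand side `R` need not be measurable. -/
lemma gronwall {ι : Type*} [Fintype ι] {T : ℝ} (hT : 0 < T) {z G : ι → ℝ → ℝ}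
    (hz : ∀ i, ContinuousOn (z i) (Icc 0 T)) (hG : ∀ i, IsH1Time T (z i) (G i)) {γ : ℝ}
    (hγ : 0 ≤ γ) {R : ℝ → ℝ≥0∞} (h : ∀ᵐ t ∂(volume.restrict (Ioo 0 T)),
      ENNReal.ofReal (2 * ∑ i, z i t * G i t + 2 * γ * ∑ i, z i t ^ 2) ≤ R t)
    {t : ℝ} (ht : t ∈ Icc 0 T) :
    ENNReal.ofReal (∑ i, z i t ^ 2) ≤ ENNReal.ofReal (Real.exp (-2 * γ * t) * ∑ i, z i 0 ^ 2)
      + ∫⁻ t in Ioo 0 T, R t := by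
  -- absolutely continuous functions on the whole line which agree with `z` on `[0, T]`
  set ζ : ι → ℝ → ℝ := fun i t => z i 0 + ∫ x in (0 : ℝ)..t, G i x with hζ
  have hzζ : ∀ i, ∀ x ∈ Icc 0 T, z i x = ζ i x := fun i x hx =>
    eq_add_integral_of_weak_deriv hT (hz i) (hG i) hx
  have hGi : ∀ i, IntervalIntegrable (G i) volume 0 t := fun i =>
    intervalIntegrable_of_mem (hG i).memLp_deriv.integrable ht
  have hac : ∀ i, AbsolutelyContinuousOnInterval (ζ i) 0 t := by
    intro i
    have h1 := (hGi i).absolutelyContinuousOnInterval_intervalIntegral (c := 0) left_mem_uIcc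
    have h2 : AbsolutelyContinuousOnInterval (fun _ : ℝ => z i 0) 0 t :=
      (contDiff_const.contDiffOn (n := 1)).absolutelyContinuousOnInterval
    exact h2.fun_add h1
  have hexp : AbsolutelyContinuousOnInterval (fun x => Real.exp (2 * γ * x)) 0 t := by
    refine ContDiffOn.absolutelyContinuousOnInterval (ContDiff.contDiffOn ?_)
    fun_prop
  set y : ℝ → ℝ := fun x => Real.exp (2 * γ * x) * ∑ i, ζ i x ^ 2 with hy
  have hsum : AbsolutelyContinuousOnInterval (fun x => ∑ i, ζ i x ^ 2) 0 t := by
    have : ∀ s : Finset ι, AbsolutelyContinuousOnInterval (fun x => ∑ i ∈ s, ζ i x ^ 2) 0 t := by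
      intro s
      classical
      induction s using Finset.induction_on with
      | empty =>
        simp only [Finset.sum_empty]
        exact (contDiff_const.contDiffOn (n := 1)).absolutelyContinuousOnInterval
      | insert i s hi ih =>
        simp only [Finset.sum_insert hi, pow_two] at ih ⊢
        exact ((hac i).fun_mul (hac i)).fun_add ih
    exact this _
  have hyac : AbsolutelyContinuousOnInterval y 0 t := hexp.fun_mul hsum
  have hyint := hyac.integral_deriv_eq_sub
  have hyder : ∀ᵐ x ∂(volume.restrict (Ioo 0 t)), deriv y x
      = Real.exp (2 * γ * x) * (2 * ∑ i, z i x * G i x + 2 * γ * ∑ i, z i x ^ 2) := by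
    have h1 : ∀ᵐ x : ℝ, ∀ i, x ∈ uIcc 0 t → HasDerivAt (ζ i) (G i x) x := by
      rw [ae_all_iff]
      intro i
      filter_upwards [(hGi i).ae_hasDerivAt_integral] with x hx hx'
      exact (hx hx' 0 left_mem_uIcc).const_add _
    rw [ae_restrict_iff' measurableSet_Ioo]
    filter_upwards [h1] with x hx hxt
    have hxI : x ∈ uIcc 0 t := by
      rw [uIcc_of_le ht.1]
      exact Ioo_subset_Icc_self hxt
    have hxT : x ∈ Icc 0 T := ⟨hxt.1.le, hxt.2.le.trans ht.2⟩
    have h2 : HasDerivAt (fun x => Real.exp (2 * γ * x)) (Real.exp (2 * γ * x) * (2 * γ)) x := by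
      have h3 : HasDerivAt (fun x : ℝ => 2 * γ * x) (2 * γ) x := by
        simpa using (hasDerivAt_id x).const_mul (2 * γ)
      exact h3.exp
    have h3 : HasDerivAt (fun x => ∑ i, ζ i x ^ 2) (∑ i, 2 * (ζ i x * G i x)) x := by
      refine HasDerivAt.fun_sum fun i _ => ?_
      refine ((hx i hxI).pow 2).congr_deriv ?_
      norm_num
      ring
    have h4 : HasDerivAt y _ x := h2.mul h3
    rw [h4.deriv]
    simp only [hzζ _ x hxT, ← Finset.mul_sum]
    ring
  have hRt : ∀ᵐ x ∂(volume.restrict (Ioo 0 t)),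
      ENNReal.ofReal (deriv y x) ≤ ENNReal.ofReal (Real.exp (2 * γ * t)) * R x := by
    have h1 := ae_mono (Measure.restrict_mono (Ioo_subset_Ioo_right ht.2) le_rfl) h
    filter_upwards [hyder, h1, ae_restrict_mem measurableSet_Ioo] with x h2 h3 h4
    rw [h2, ENNReal.ofReal_mul (Real.exp_pos _).le]
    gcongr
    exact h4.2.le
  have hle : ENNReal.ofReal (y t - y 0)
      ≤ ENNReal.ofReal (Real.exp (2 * γ * t)) * ∫⁻ x in Ioo 0 T, R x := by
    rw [← hyint, intervalIntegral.integral_of_le ht.1, integral_Ioc_eq_integral_Ioo]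
    refine ofReal_integral_le.trans ((lintegral_mono_ae hRt).trans ?_)
    rw [lintegral_const_mul' _ _ ENNReal.ofReal_ne_top]
    gcongr
    exact ht.2
  have hy0 : y 0 = ∑ i, z i 0 ^ 2 := by
    simp [hy, hzζ _ 0 (left_mem_Icc.2 hT.le)]
  have hyt : ∑ i, z i t ^ 2
      = Real.exp (-2 * γ * t) * y 0 + Real.exp (-2 * γ * t) * (y t - y 0) := by
    simp only [hy, hzζ _ t ht]
    rw [← mul_add, add_sub_cancel, ← mul_assoc, ← Real.exp_add]
    ring_nf
    simp
  rw [hyt, ← hy0]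
  refine ENNReal.ofReal_add_le.trans (add_le_add le_rfl ?_)
  rw [ENNReal.ofReal_mul (Real.exp_pos _).le]
  refine (mul_le_mul' le_rfl hle).trans (le_of_eq ?_)
  rw [← mul_assoc, ← ENNReal.ofReal_mul (Real.exp_pos _).le, ← Real.exp_add]
  ring_nf
  simp

end

/-! ### The energy estimate -/

section

variable {n : ℕ} {Ω : Set (E n)} {α β : ℝ} {A : E n → Matrix (Fin n) (Fin n) ℝ}
  {Y : Type*} [NormedAddCommGroup Y] [InnerProductSpace ℝ Y] {L : H1 Ω →ₗ[ℝ] Y} {μ Ca : ℝ}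

lemma decayRate_nonneg (hμ : 0 < μ) (hCa : 0 ≤ Ca) : 0 ≤ decayRate μ Ca := by
  unfold decayRate
  split_ifs
  · positivity
  · have := le_min hμ.le (one_div_nonneg.2 hCa)
    positivity

/-- Observability makes the nudged form coercive in `L²(Ω)`. -/
lemma decayRate_mul_le (hA : IsConductivity Ω α β A) (hL : IsObservable A L Ca) (hμ : 0 < μ)
    (u : H1 Ω) : 2 * decayRate μ Ca * ‖toL2 u‖ ^ 2 ≤ μ * ‖L u‖ ^ 2 + aForm A u u := by
  have h1 := hL.2 u
  have ha := aForm_self_nonneg hA u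
  have hLn := sq_nonneg ‖L u‖
  have hγ := decayRate_nonneg hμ hL.1
  have h2 : 2 * decayRate μ Ca ≤ μ ∧ 2 * decayRate μ Ca * Ca ≤ 1 := by
    unfold decayRate
    split_ifs with h0
    · rw [h0]
      constructor <;> linarith
    · have hpos : 0 < Ca := lt_of_le_of_ne hL.1 (Ne.symm h0)
      have h3 := min_le_left μ (1 / Ca)
      have h4 := min_le_right μ (1 / Ca)
      refine ⟨by linarith, ?_⟩
      rw [mul_div_cancel₀ _ two_ne_zero]
      rwa [le_div_iff₀ hpos] at h4
  calc 2 * decayRate μ Ca * ‖toL2 u‖ ^ 2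
      ≤ 2 * decayRate μ Ca * (‖L u‖ ^ 2 + Ca * aForm A u u) := by gcongr
    _ = 2 * decayRate μ Ca * ‖L u‖ ^ 2 + (2 * decayRate μ Ca * Ca) * aForm A u u := by ring
    _ ≤ μ * ‖L u‖ ^ 2 + 1 * aForm A u u := by
        gcongr
        · exact h2.1
        · exact h2.2
    _ = _ := by rw [one_mul]

/-- The nudged form of the error `u - v`, tested with `θ = u - q`, is coercive up to the residual of
`w = v - q`: split `u - v = θ - w` and apply Young's inequality. -/
lemma nudged_form_le (hA : IsConductivity Ω α β A) (hL : IsObservable A L Ca) (hμ : 0 < μ)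
    {u v q : H1 Ω} : 2 * (aForm A v (u - q) - aForm A u (u - q) - μ * ⟪L u - L v, L (u - q)⟫_ℝ)
      + 2 * decayRate μ Ca * ‖toL2 (u - q)‖ ^ 2
      ≤ aForm A (v - q) (v - q) + μ * ‖L (v - q)‖ ^ 2 := by
  have h1 := decayRate_mul_le hA hL hμ (u - q)
  have h2 := two_mul_aForm_le hA (v - q) (u - q)
  have h3 : aForm A v (u - q) = aForm A (v - q) (u - q) + aForm A q (u - q) := by
    rw [← aForm_add_left hA, sub_add_cancel]
  have h4 : aForm A u (u - q) = aForm A (u - q) (u - q) + aForm A q (u - q) := by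
    rw [← aForm_add_left hA, sub_add_cancel]
  have h5 : L u - L v = L (u - q) - L (v - q) := by
    rw [← map_sub, ← map_sub, sub_sub_sub_cancel_right]
  rw [h3, h4, h5, inner_sub_left, real_inner_self_eq_norm_sq]
  have h6 : 2 * ⟪L (v - q), L (u - q)⟫_ℝ ≤ ‖L (v - q)‖ ^ 2 + ‖L (u - q)‖ ^ 2 := by
    have := norm_sub_sq_real (L (v - q)) (L (u - q))
    nlinarith [sq_nonneg ‖L (v - q) - L (u - q)‖]
  have h7 := mul_le_mul_of_nonneg_left h6 hμ.le
  linarith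

lemma toHNegOne_apply (u : L2 Ω) (v : H1 Ω) : toHNegOne u v = ⟪u, toL2 v⟫_ℝ := rfl

/-- Coordinates in a finite-dimensional subspace which are orthonormal for the inner product pulled
back along an injective map. -/
lemma exists_orthonormal_coordinates {X H : Type*} [AddCommGroup X] [Module ℝ X]
    [NormedAddCommGroup H] [InnerProductSpace ℝ H] {J : X →ₗ[ℝ] H} (hJ : Function.Injective J)
    (V : Submodule ℝ X) [FiniteDimensional ℝ V] : ∃ (m : ℕ) (e : Fin m → X), (∀ k, e k ∈ V) ∧
      ∀ v ∈ V, v = ∑ k, ⟪J (e k), J v⟫_ℝ • e k ∧ ∑ k, ⟪J (e k), J v⟫_ℝ ^ 2 = ‖J v‖ ^ 2 := by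
  set b := stdOrthonormalBasis ℝ (V.map J)
  have hb : ∀ k, ∃ v ∈ V, J v = (b k : H) := fun k => (b k).2
  choose e he heb using hb
  refine ⟨_, e, he, fun v hv => ⟨hJ ?_, ?_⟩⟩
  · have h1 := congrArg Subtype.val (b.sum_repr' ⟨J v, v, hv, rfl⟩)
    rw [map_sum]
    simp only [map_smul, heb]
    rw [Submodule.coe_sum] at h1
    exact h1.symm
  · have h1 := b.sum_sq_norm_inner_right ⟨J v, v, hv, rfl⟩
    simp only [Submodule.coe_inner, Submodule.coe_norm, Real.norm_eq_abs, sq_abs] at h1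
    simp only [heb, h1]

set_option maxHeartbeats 400000 in
/-- The discrete error `θ = u_h - P ν`, where `P` is the `L²` projection onto the finite element
space, is controlled by the projection error of the exact solution. The time derivative of
`ν - P ν` does not enter, since it is orthogonal to the finite element space. -/
theorem energy_estimate (hΩ : IsOpen Ω) (hA : IsConductivity Ω α β A)
    (hL : IsObservable A L Ca) (hμ : 0 < μ) {T : ℝ} (hT : 0 < T) {f : ℝ → HNegOne Ω}
    {g : ℝ → HNegHalf Ω} {ν₀ : L2 Ω} {ν : ℝ → L2 Ω} {νs : ℝ → H1 Ω}
    (hν : IsExactSolution A T f g ν₀ ν νs) {Vh : Submodule ℝ (H1 Ω)} [FiniteDimensional ℝ Vh]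
    {uh : ℝ → Vh} (hu : IsNudgedSolution A T f g L μ (fun t => L (νs t)) Vh uh)
    {P : L2 Ω → H1 Ω} (hPV : ∀ u, P u ∈ Vh)
    (hP : ∀ u, ∀ v ∈ Vh, ⟪u - toL2 (P u), toL2 v⟫_ℝ = 0) {t : ℝ} (ht : t ∈ Icc 0 T) :
    ENNReal.ofReal (‖toL2 ((uh t : H1 Ω) - P (ν t))‖ ^ 2)
      ≤ ENNReal.ofReal (Real.exp (-2 * decayRate μ Ca * t) * ‖ν₀‖ ^ 2)
        + ∫⁻ t in Ioo 0 T, ENNReal.ofReal (aForm A (νs t - P (ν t)) (νs t - P (ν t))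
          + μ * ‖L (νs t - P (ν t))‖ ^ 2) := by
  obtain ⟨uh', huH, hueq⟩ := hu.equation
  obtain ⟨ν', hνH, hνeq⟩ := hν.equation
  have : CompleteSpace Vh := FiniteDimensional.complete ℝ Vh
  obtain ⟨m, e, he, hcoord⟩ := exists_orthonormal_coordinates
    (J := (toL2 (Ω := Ω) : H1 Ω →ₗ[ℝ] L2 Ω)) (toL2_injective hΩ) Vh
  set z : Fin m → ℝ → ℝ :=
    fun k t => toHNegOne (toL2 (e k)) (uh t : H1 Ω) - toHNegOne (ν t) (e k) with hz
  set θ : ℝ → H1 Ω := fun t => (uh t : H1 Ω) - P (ν t) with hθ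
  have hθV : ∀ t, θ t ∈ Vh := fun t => sub_mem (uh t).2 (hPV _)
  -- `z` is the vector of coordinates of `θ`
  have hzθ : ∀ k t, z k t = ⟪toL2 (e k), toL2 (θ t)⟫_ℝ := by
    intro k t
    have h1 := hP (ν t) (e k) (he k)
    rw [inner_sub_left] at h1
    have h2 : toL2 (θ t) = toL2 (uh t : H1 Ω) - toL2 (P (ν t)) := map_sub _ _ _
    rw [h2, inner_sub_right, real_inner_comm (toL2 (P (ν t)))]
    change ⟪toL2 (e k), toL2 (uh t : H1 Ω)⟫_ℝ - ⟪ν t, toL2 (e k)⟫_ℝ = _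
    linarith
  have hsum : ∀ t, θ t = ∑ k, z k t • e k := by
    intro t
    simp only [hzθ]
    exact (hcoord _ (hθV t)).1
  have hnorm : ∀ t, ∑ k, z k t ^ 2 = ‖toL2 (θ t)‖ ^ 2 := by
    intro t
    simp only [hzθ]
    exact (hcoord _ (hθV t)).2
  have hzc : ∀ k, ContinuousOn (z k) (Icc 0 T) := by
    intro k
    have h1 : ContinuousOn (fun t => (uh t : H1 Ω)) (Icc 0 T) :=
      continuous_subtype_val.comp_continuousOn hu.continuousOn
    refine ((toHNegOne (toL2 (e k))).continuous.comp_continuousOn h1).sub ?_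
    exact hν.continuousOn.inner continuousOn_const
  have hzd : ∀ k, IsH1Time T (z k)
      (fun t => toHNegOne (toL2 (e k)) (uh' t : H1 Ω) - ν' t (e k)) := fun k =>
    (huH.comp_clm ((toHNegOne (toL2 (e k))).comp Vh.subtypeL)).sub
      (hνH.comp_clm (ContinuousLinearMap.apply ℝ ℝ (e k)))
  have hae : ∀ᵐ t ∂(volume.restrict (Ioo 0 T)), ENNReal.ofReal (2 * ∑ k, z k t *
      (toHNegOne (toL2 (e k)) (uh' t : H1 Ω) - ν' t (e k))
      + 2 * decayRate μ Ca * ∑ k, z k t ^ 2)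
      ≤ ENNReal.ofReal (aForm A (νs t - P (ν t)) (νs t - P (ν t))
          + μ * ‖L (νs t - P (ν t))‖ ^ 2) := by
    filter_upwards [hueq, hνeq] with t h1 h2
    refine ENNReal.ofReal_le_ofReal (le_trans (le_of_eq ?_) (nudged_form_le hA hL hμ (u := uh t)))
    rw [hnorm]
    congr 2
    have h3 : ∑ k, z k t * (toHNegOne (toL2 (e k)) (uh' t : H1 Ω) - ν' t (e k))
        = ⟪toL2 (uh' t : H1 Ω), toL2 (θ t)⟫_ℝ - ν' t (θ t) := by
      rw [hsum t, map_sum, map_sum, inner_sum, ← Finset.sum_sub_distrib]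
      refine Finset.sum_congr rfl fun k _ => ?_
      rw [map_smul, map_smul, inner_smul_right, toHNegOne_apply, real_inner_comm,
        smul_eq_mul, mul_sub]
    -- both equations are tested with `θ t`, where `f` and `g` cancel
    have h4 := h1 ⟨θ t, hθV t⟩
    have h5 := h2 (θ t)
    rw [h3]
    simp only at h4
    change _ = aForm A (νs t) (θ t) - aForm A (uh t) (θ t) - μ * ⟪L (uh t) - L (νs t), L (θ t)⟫_ℝ
    linarith
  have key := gronwall hT hzc hzd (decayRate_nonneg hμ hL.1) hae ht
  rw [hnorm, hnorm] at key
  refine key.trans (add_le_add (ENNReal.ofReal_le_ofReal ?_) le_rfl)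
  have h0 : toL2 (θ 0) = -toL2 (P ν₀) := by
    simp only [hθ, hu.initial, hν.initial, map_sub]
    simp
  have h1 : ‖toL2 (P ν₀)‖ ^ 2 ≤ ‖ν₀‖ ^ 2 := by
    have h2 := norm_add_sq_real (ν₀ - toL2 (P ν₀)) (toL2 (P ν₀))
    rw [sub_add_cancel, hP ν₀ _ (hPV ν₀)] at h2
    nlinarith [sq_nonneg ‖ν₀ - toL2 (P ν₀)‖]
  rw [h0, norm_neg]
  gcongr

end

/-! ### The error estimate -/

section

variable {n : ℕ} {Ω : Set (E n)}

lemma exists_l2_projection {r : ℕ} (hr : 1 ≤ r) (hΩ : IsBoundedLipschitzDomain Ω)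
    {kind : CellKind} (𝒯 : Triangulation Ω kind) (u : L2 Ω) :
    ∃ q ∈ feSpace 𝒯 r, u - toL2 q ∈ (feL2 𝒯 r)ᗮ := by
  have := finiteDimensional_feSpace hr hΩ 𝒯
  have : FiniteDimensional ℝ (feL2 𝒯 r) := by
    unfold feL2
    infer_instance
  obtain ⟨q, hq, hqu⟩ := mem_feL2.1 (Submodule.starProjection_apply_mem (feL2 𝒯 r) u)
  refine ⟨q, hq, ?_⟩
  rw [hqu]
  exact Submodule.sub_starProjection_mem_orthogonal u

lemma ofReal_add_mul_sq_le {X Y a b c d : ℝ} {N : ℝ≥0∞} {M : ℝ} (hX : 0 ≤ X) (hY : 0 ≤ Y)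
    (ha : 0 ≤ a) (hb : 0 ≤ b) (hc : 0 ≤ c) (hd : 0 ≤ d)
    (hac : ENNReal.ofReal a ≤ ENNReal.ofReal c * N)
    (hbd : ENNReal.ofReal b ≤ ENNReal.ofReal d * N) (hM : X * c ^ 2 + Y * d ^ 2 ≤ M) :
    ENNReal.ofReal (X * a ^ 2 + Y * b ^ 2) ≤ ENNReal.ofReal M * N ^ 2 := by
  have h1 : ∀ {x c : ℝ}, 0 ≤ x → 0 ≤ c → ENNReal.ofReal x ≤ ENNReal.ofReal c * N →
      ENNReal.ofReal (x ^ 2) ≤ ENNReal.ofReal (c ^ 2) * N ^ 2 := by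
    intro x c hx hc h
    rw [ENNReal.ofReal_pow hx, ENNReal.ofReal_pow hc, ← mul_pow]
    gcongr
  calc ENNReal.ofReal (X * a ^ 2 + Y * b ^ 2)
      = ENNReal.ofReal X * ENNReal.ofReal (a ^ 2) + ENNReal.ofReal Y * ENNReal.ofReal (b ^ 2) := by
        rw [ENNReal.ofReal_add (by positivity) (by positivity), ENNReal.ofReal_mul hX,
          ENNReal.ofReal_mul hY]
    _ ≤ ENNReal.ofReal X * (ENNReal.ofReal (c ^ 2) * N ^ 2)
        + ENNReal.ofReal Y * (ENNReal.ofReal (d ^ 2) * N ^ 2) := by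
        gcongr
        · exact h1 ha hc hac
        · exact h1 hb hd hbd
    _ = ENNReal.ofReal (X * c ^ 2 + Y * d ^ 2) * N ^ 2 := by
        rw [ENNReal.ofReal_add (by positivity) (by positivity), ENNReal.ofReal_mul hX,
          ENNReal.ofReal_mul hY]
        ring
    _ ≤ _ := by gcongr

/-- From the energy estimate for `θ` and a bound of its right-hand side to the error estimate. -/
lemma errorEstimate_of_energy {C K D Cμ h s μ γ T t : ℝ} {ν₀ θ p : L2 Ω} {ν : ℝ → L2 Ω}
    {R : ℝ → ℝ≥0∞} (hK : 0 ≤ K) (hD : 0 ≤ D) (hC : 1 + K + D ≤ C)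
    (hθ : ENNReal.ofReal (‖θ‖ ^ 2) ≤ ENNReal.ofReal (Real.exp (-2 * γ * t) * ‖ν₀‖ ^ 2)
      + ∫⁻ t in Ioo 0 T, R t)
    (hR : ∀ᵐ t ∂(volume.restrict (Ioo 0 T)), R t
      ≤ ENNReal.ofReal ((K * (h ^ s * √(1 + μ * Cμ))) ^ 2) * sobolevNorm Ω (1 + s) (ν t) ^ 2)
    (hh : 0 < h)
    (hp : ‖ν t - p‖ₑ ≤ ENNReal.ofReal (D * h ^ (1 + s)) * sobolevNorm Ω (1 + s) (ν t)) :
    ErrorEstimate C Cμ h s μ γ T ν₀ ν (θ + p) t := by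
  set a : ℝ≥0∞ := ENNReal.ofReal (Real.exp (-γ * t) * ‖ν₀‖) with ha
  set q : ℝ := h ^ s * √(1 + μ * Cμ) with hq
  have hq0 : 0 ≤ q := by positivity
  set N := l2SobolevNorm T (1 + s) ν with hN
  have hNsq : N ^ 2 = ∫⁻ t in Ioo 0 T, sobolevNorm Ω (1 + s) (ν t) ^ 2 := by
    rw [hN, l2SobolevNorm, ← ENNReal.rpow_natCast, ← ENNReal.rpow_mul]
    norm_num
  have h1 : ‖θ‖ₑ ≤ a + ENNReal.ofReal (K * q) * N := by
    rw [← ENNReal.pow_le_pow_left_iff (n := 2) two_ne_zero, ← ofReal_norm,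
      ← ENNReal.ofReal_pow (norm_nonneg _)]
    have h2 : ENNReal.ofReal (Real.exp (-2 * γ * t) * ‖ν₀‖ ^ 2) = a ^ 2 := by
      rw [ha, ← ENNReal.ofReal_pow (by positivity), mul_pow, ← Real.exp_nat_mul]
      congr 3
      push_cast
      ring
    have h3 : ∫⁻ t in Ioo 0 T, R t ≤ (ENNReal.ofReal (K * q) * N) ^ 2 := by
      refine (lintegral_mono_ae hR).trans ?_
      rw [lintegral_const_mul' _ _ ENNReal.ofReal_ne_top, mul_pow (ENNReal.ofReal _), hNsq,
        ENNReal.ofReal_pow (by positivity)]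
    calc _ ≤ a ^ 2 + (ENNReal.ofReal (K * q) * N) ^ 2 := by
          rw [← h2]
          exact hθ.trans (add_le_add le_rfl h3)
      _ ≤ (a + ENNReal.ofReal (K * q) * N) ^ 2 := by
          rw [add_sq]
          gcongr
          exact le_self_add
  have h2 : ‖θ + p - ν t‖ₑ ≤ ‖θ‖ₑ + ‖ν t - p‖ₑ := by
    have h3 : θ + p - ν t = θ - (ν t - p) := by abel
    rw [h3]
    exact enorm_sub_le
  unfold ErrorEstimate
  calc ‖θ + p - ν t‖ₑ ≤ (a + ENNReal.ofReal (K * q) * N)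
        + ENNReal.ofReal (D * h ^ (1 + s)) * sobolevNorm Ω (1 + s) (ν t) :=
        h2.trans (add_le_add h1 hp)
    _ = ENNReal.ofReal 1 * a + ENNReal.ofReal K * (ENNReal.ofReal q * N) + ENNReal.ofReal D *
        (ENNReal.ofReal (h ^ (1 + s)) * sobolevNorm Ω (1 + s) (ν t)) := by
        rw [ENNReal.ofReal_mul hK, ENNReal.ofReal_mul hD, ENNReal.ofReal_one, one_mul, mul_assoc,
          mul_assoc]
    _ ≤ ENNReal.ofReal C * a + ENNReal.ofReal C * (ENNReal.ofReal q * N) + ENNReal.ofReal C *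
        (ENNReal.ofReal (h ^ (1 + s)) * sobolevNorm Ω (1 + s) (ν t)) := by
        gcongr <;> linarith
    _ = _ := by rw [mul_add, mul_add]

end

end

end Nudging


theorem proposition3p2 {n : ℕ} (hn : 0 < n) (Ω : Set (Nudging.E n))
    (hΩ : Nudging.IsBoundedLipschitzDomain Ω)
    (kind : Nudging.CellKind) (r : ℕ) (hr : 1 ≤ r) (s : ℝ) (hs : 0 ≤ s) (hsr : s ≤ r)
    (κ β CB : ℝ) :
    ∃ C₁ : ℝ, 0 < C₁ ∧ ∀ CS : ℝ, ∃ C₂ : ℝ, 0 < C₂ ∧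
      ∀ (α : ℝ) (A : Nudging.E n → Matrix (Fin n) (Fin n) ℝ),
        Nudging.IsConductivity Ω α β A →
      ∀ (Y : Type*) [NormedAddCommGroup Y] [InnerProductSpace ℝ Y] [CompleteSpace Y]
        (L : Nudging.H1 Ω →ₗ[ℝ] Y) (Ca : ℝ),
        Nudging.IsContinuousObs A L CB → Nudging.IsObservable A L Ca →
      ∀ 𝒯 : Nudging.Triangulation Ω kind, 𝒯.Quality κ →
      ∀ (T : ℝ), 0 < T →
      ∀ (f : ℝ → Nudging.HNegOne Ω) (g : ℝ → Nudging.HNegHalf Ω) (ν₀ : Nudging.L2 Ω)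
        (ν : ℝ → Nudging.L2 Ω) (νs : ℝ → Nudging.H1 Ω),
        Nudging.IsL2Time T f → Nudging.IsL2Time T g →
        Nudging.IsExactSolution A T f g ν₀ ν νs →
        Nudging.IsLinftySobolev T (1 + s) ν →
      ∀ (μ : ℝ), 0 < μ →
      ∀ uh : ℝ → Nudging.feSpace 𝒯 r,
        Nudging.IsNudgedSolution A T f g L μ (fun t => L (νs t)) (Nudging.feSpace 𝒯 r) uh →
      ∀ t ∈ Set.Icc 0 T,
        Nudging.ErrorEstimate C₁ 1 𝒯.h s μ (Nudging.decayRate μ Ca) T ν₀ ν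
          (Nudging.toL2 (uh t : Nudging.H1 Ω)) t ∧
        (Nudging.IsL2Stable L CS →
          Nudging.ErrorEstimate C₂ (𝒯.h ^ 2) 𝒯.h s μ (Nudging.decayRate μ Ca) T ν₀ ν
            (Nudging.toL2 (uh t : Nudging.H1 Ω)) t) := by
  obtain ⟨C₀, hC₀, herr⟩ := Nudging.exists_projection_error hn hΩ kind hr (τ := 1 + s)
    (by linarith) (by linarith) κ
  set d := diam (closure Ω) with hd
  have hd0 : 0 ≤ d := diam_nonneg
  -- `K₁` and `K₂` collect the constants in front of the projection error in the two cases
  set K₁ := √(|β| * (1 + |CB|) + |CB| * d ^ 2) with hK₁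
  have hK₁sq : K₁ ^ 2 = |β| * (1 + |CB|) + |CB| * d ^ 2 := Real.sq_sqrt (by positivity)
  refine ⟨1 + C₀ * K₁ + C₀, by positivity, fun CS => ?_⟩
  set K₂ := √(|β| + |CS|) with hK₂
  have hK₂sq : K₂ ^ 2 = |β| + |CS| := Real.sq_sqrt (by positivity)
  refine ⟨1 + C₀ * K₂ + C₀, by positivity, ?_⟩
  intro α A hA Y _ _ _ L Ca hcont hobs 𝒯 h𝒯 T hT f g ν₀ ν νs _ _ hν _ μ hμ uh hu t ht
  have hh := 𝒯.h_pos hn hΩ.isConnected.nonempty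
  have hhd : 𝒯.h ≤ d := 𝒯.h_le_diam hΩ.isConnected.nonempty hΩ.isBounded
  choose P hPV hPo using fun u => Nudging.exists_l2_projection hr hΩ 𝒯 u
  have hP : ∀ u, ∀ v ∈ Nudging.feSpace 𝒯 r, ⟪u - Nudging.toL2 (P u), Nudging.toL2 v⟫_ℝ = 0 := by
    intro u v hv
    rw [real_inner_comm]
    exact hPo u _ (Nudging.mem_feL2.2 ⟨v, hv, rfl⟩)
  have := Nudging.finiteDimensional_feSpace hr hΩ 𝒯
  have henergy := Nudging.energy_estimate hΩ.isOpen hA hobs hμ hT hν hu hPV hP ht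
  have hsplit : Nudging.toL2 (uh t : Nudging.H1 Ω)
      = Nudging.toL2 ((uh t : Nudging.H1 Ω) - P (ν t)) + Nudging.toL2 (P (ν t)) := by
    rw [map_sub, sub_add_cancel]
  have hp := (herr 𝒯 h𝒯 (ν t) _ (hPV _) (hPo _)).1
  -- it suffices to bound the residual by the two parts of the projection error
  have key : ∀ {K Cμ X Z : ℝ}, 0 ≤ K → 0 ≤ Cμ → 0 ≤ X → 0 ≤ Z →
      X + Z * 𝒯.h ^ 2 ≤ K ^ 2 * (1 + μ * Cμ) →
      (∀ w : Nudging.H1 Ω, Nudging.aForm A w w + μ * ‖L w‖ ^ 2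
        ≤ X * ‖Nudging.grad w‖ ^ 2 + Z * ‖Nudging.toL2 w‖ ^ 2) →
      Nudging.ErrorEstimate (1 + C₀ * K + C₀) Cμ 𝒯.h s μ (Nudging.decayRate μ Ca) T ν₀ ν
        (Nudging.toL2 (uh t : Nudging.H1 Ω)) t := by
    intro K Cμ X Z hK hCμ hX hZ hXZ hres
    rw [hsplit]
    refine Nudging.errorEstimate_of_energy (by positivity) hC₀.le le_rfl henergy ?_ hh hp
    filter_upwards [hν.ae_eq] with x hx
    obtain ⟨h1, h2⟩ := herr 𝒯 h𝒯 (ν x) _ (hPV _) (hPo _)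
    have h3 := h2 _ hx
    rw [← hx, ← map_sub, hx] at h1
    rw [← ofReal_norm] at h1 h3
    refine (ENNReal.ofReal_le_ofReal (hres _)).trans (Nudging.ofReal_add_mul_sq_le hX hZ
      (norm_nonneg _) (norm_nonneg _) (by positivity) (by positivity) h3 h1 ?_)
    rw [add_sub_cancel_left, Real.rpow_add hh, Real.rpow_one]
    calc _ = C₀ ^ 2 * (𝒯.h ^ s) ^ 2 * (X + Z * 𝒯.h ^ 2) := by ring
      _ ≤ C₀ ^ 2 * (𝒯.h ^ s) ^ 2 * (K ^ 2 * (1 + μ * Cμ)) := by gcongr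
      _ = (C₀ * K * (𝒯.h ^ s * √(1 + μ * Cμ))) ^ 2 := by
          rw [mul_pow, mul_pow, mul_pow, Real.sq_sqrt (by positivity)]
          ring
  have ha : ∀ w : Nudging.H1 Ω, Nudging.aForm A w w ≤ |β| * ‖Nudging.grad w‖ ^ 2 := fun w =>
    (Nudging.aForm_self_le hA w).trans (by gcongr; exact le_abs_self β)
  constructor
  · have hCB : |CB| = CB := abs_of_pos hcont.1
    refine key (X := (1 + μ * CB) * |β|) (Z := μ * CB) (by positivity) zero_le_one
      (by have := hcont.1; positivity) (by have := hcont.1; positivity) ?_ fun w => ?_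
    · have hCB0 := hcont.1
      rw [hK₁sq, hCB]
      have h1 : 𝒯.h ^ 2 ≤ d ^ 2 := by gcongr
      have h2 := mul_le_mul_of_nonneg_left h1 (mul_nonneg hμ.le hCB0.le)
      have h3 : 0 ≤ |β| * CB + CB * d ^ 2 + μ * |β| := by positivity
      linarith
    · have h1 := hcont.2 w
      rw [inv_mul_le_iff₀ hcont.1] at h1
      have h2 := mul_le_mul_of_nonneg_left h1 hμ.le
      have h3 := mul_le_mul_of_nonneg_left (ha w)
        (by have := hcont.1; positivity : 0 ≤ 1 + μ * CB)
      linarith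
  · intro hst
    have hCS : |CS| = CS := abs_of_pos hst.1
    have hCS0 := hst.1
    refine key (X := |β|) (Z := μ * CS) (by positivity) (by positivity) (by positivity)
      (by positivity) ?_ fun w => ?_
    · rw [hK₂sq, hCS]
      have h3 : 0 ≤ CS + |β| * (μ * 𝒯.h ^ 2) := by positivity
      linarith
    · have h2 := mul_le_mul_of_nonneg_left (hst.2 w) hμ.le
      linarith [ha w]
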